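/- **Conventions.** $t,x,y$ are real; all other quantities are complex. For a kernel $K$ on $(0,1)^2$ let $D_K(t)=\sum_{n\ge0}\frac{(-1)^n}{n!}\int_{(0,t)^n}\det[K(x_i,x_j)]\,dx$ be the Fredholm determinant of $1-K$ on $L^2(0,t)$, and let $U_K=\{t\in(0,1):D_K(t)\ne0\}$. "$D_K$ is well defined" means: for every $t\in(0,1)$ the integrals exist and the series converges absolutely; $D_K$ is continuous on $(0,1)$ with $D_K(t)\to1$ as $t\to0$; $U_K$ is open and $D_K\in C^3(U_K)$. A function $\tau$ is a *Jimbo–Miwa–Ueno (JMU) Painlevé VI tau function* on an open set $U\subset\mathbb R$ with parameters $\theta=(\theta_0,\theta_1,\theta_t,\theta_\infty)$ if there are traceless $2\times2$ matrix functions $A_0,A_1,A_t$ on $U$ with eigenvalues $\pm\theta_\nu/2$, with $A_0+A_1+A_t=\mathrm{diag}(-\theta_\infty/2,\theta_\infty/2)$ (if $\theta_\infty=0$: $=\begin{pmatrix}0&0\\1&0\end{pmatrix}$), satisfying $A_0'=[A_t,A_0]/t$, $A_1'=[A_t,A_1]/(t-1)$, such that $\tau\neq0$ and $(\ln\tau)'=\frac{\mathrm{tr}A_0A_t}{t}+\frac{\mathrm{tr}A_1A_t}{t-1}$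 on $U$. The *$\sigma$-form* with parameters $\theta$ is $$\sigma'(t(t-1)\sigma'')^2+\Bigl[2\sigma'(t\sigma'-\sigma)-\sigma'^2-\tfrac{(\theta_t^2-\theta_\infty^2)(\theta_0^2-\theta_1^2)}{16}\Bigr]^2=\prod_{\pm}\Bigl(\sigma'+\tfrac{(\theta_t\pm\theta_\infty)^2}4\Bigr)\Bigl(\sigma'+\tfrac{(\theta_0\pm\theta_1)^2}4\Bigr).\qquad(\sigma)$$ "$D_K$ is a PVI tau function with parameters $\theta$" means: $D_K$ is a JMU tau function on $U_K$ with parameters $\theta$, and $\sigma=t(t-1)(\ln D_K)'+\frac{t(\theta_t^2-\theta_\infty^2)}4-\frac{\theta_t^2+\theta_0^2-\theta_1^2-\theta_\infty^2}8$ is a $C^2$ solution of $(\sigma)$ on $U_K$. Below, $\mathcal A_0=\begin{pmatrix}\alpha_0&\beta_0\\-\gamma_0&-\alpha_0\end{pmatrix}$. For constants $\alpha_0,\alpha_1,I_1,I_2$ consider the equation $$(t(1-t)\zeta'')^2+4(\zeta'-\alpha_1^2)(t\zeta'-\zeta)^2-4\zeta'(t\zeta'-\zeta)(\zeta'+2\alpha_0\alpha_1-I_1)=4(I_1+I_2)\zeta'^2.\qquad(\zeta)$$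 Given $k_1,k_2$ with $I_1=-k_1k_2+\alpha_1(2\alpha_0+\alpha_1)$ and $I_2=\frac{(k_1+k_2)^2}4-\alpha_1(2\alpha_0+\alpha_1)$, put $\sigma=\zeta-\alpha_1^2t+\frac{\alpha_1^2+k_1k_2}2$ and $\theta=(k_1-k_2,k_1+k_2,0,2\alpha_1)$. For functions $\varphi,\psi$ on $(0,1)$ solving $x(1-x)\binom{\varphi}{\psi}'=(\mathcal A_0+\mathcal A_1x)\binom{\varphi}{\psi}$ with $\mathcal A_0,\mathcal A_1\in\mathfrak{sl}_2(\mathbb C)$, call $(\varphi,\psi)$ *regular* if $\varphi,\psi\to0$ as $x\to0$; let $K(x,y)=\frac{\varphi(x)\psi(y)-\psi(x)\varphi(y)}{x-y}$ (on the diagonal: $\varphi'\psi-\psi'\varphi$), $D=D_K$, $U=U_K$, and, with the bilinear pairing on $(0,t)$, $q(t)=[(1-K)^{-1}\varphi](t)$, $p(t)=[(1-K)^{-1}\psi](t)$, $u=\langle\varphi|(1-K)^{-1}|\varphi\rangle$, $v=\langle\varphi|(1-K)^{-1}|\psi\rangle$, $w=\langle\psi|(1-K)^{-1}|\psi\rangle$.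 **Theorem.** 1. (Diagonal system.) Let $S\subset\mathbb R\setminus\{0,1\}$ be open and connected, and let $q,p,u,v,w$ satisfy on $S$: $t(1-t)q'=\alpha q+\beta p$, $t(1-t)p'=-\gamma q-\alpha p$, $u'=q^2$, $v'=pq$, $w'=p^2$, with $\alpha=\alpha_0+\alpha_1t+v$, $\beta=\beta_0+(2\alpha_1-1)u$, $\gamma=\gamma_0-(2\alpha_1+1)w$. Then $I_1=2\alpha pq+\beta p^2+\gamma q^2-2\alpha_1v$ and $I_2=(v+\alpha_0)^2-\beta\gamma-2\alpha_1t(1-t)pq+2\alpha_1(1-t)v-I_1t$ are constant; $\zeta=t(t-1)(qp'-pq')$ equals $2\alpha pq+\beta p^2+\gamma q^2=2\alpha_1v+I_1$, and $\zeta'=2\alpha_1pq$, $t(1-t)\zeta''=2\alpha_1(\beta p^2-\gamma q^2)$; $\zeta$ solves $(\zeta)$; and for all $k_1,k_2$ as above $\sigma$ solves $(\sigma)$ with parameters $\theta$. 2. (The two equations.) For every $C^2$ function $\zeta$ on an open subset of $\mathbb R$ and all $k_1,k_2$ as above: at each point, $(\zeta)$ implies $(\sigma)$ for $\sigma$ and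 $\theta$ as above, and conversely $(\sigma)$ implies $(\zeta)$ at each point where $\sigma'\neq0$. 3. (Determinant, diagonal case.) Let $\mathcal A_1=\mathrm{diag}(\alpha_1,-\alpha_1)$ and let $(\varphi,\psi)$ be regular. Then $D$ is well defined; $1-K$ is invertible on $L^2(0,t)$ for $t\in U$; $q,p,u,v,w\to0$ as $t\to0$; $D'/D=qp'-pq'$ on $U$; $q,p,u,v,w$ satisfy the system of part 1 on $U$, with $I_1=0$ and $I_2=\alpha_0^2-\beta_0\gamma_0$; $\zeta=t(t-1)(\ln D)'$ solves $(\zeta)$ on $U$ with these $I_1,I_2$; and for all corresponding $k_1,k_2$ the function $\sigma$ solves $(\sigma)$ on $U$ and $D$ is a PVI tau function with parameters $\theta=(k_1-k_2,k_1+k_2,0,2\alpha_1)$. 4. (Nilpotent system.) The analogue of part 1 holds with $\alpha=\alpha_0+v-w$, $\beta=\beta_0+t-u+2v$, $\gamma=\gamma_0-w$ and the first integrals $I_1=2\alpha pq+\beta p^2+\gamma(q^2+1)$, $I_2=\alpha^2-\beta\gamma-t(1-t)p^2+(2t-1)\gamma-I_1t$: these are constant, $\zeta=t(t-1)(qp'-pq')$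 solves $(\zeta)$ with $\alpha_1=0$, and $\sigma$ (with $\alpha_1=0$) solves $(\sigma)$ with $\theta=(k_1-k_2,k_1+k_2,0,0)$. 5. (Determinant, nilpotent case.) Let $\mathcal A_1=\begin{pmatrix}0&1\\0&0\end{pmatrix}$ and let $(\varphi,\psi)$ be regular. Then $D$ is well defined, $1-K$ is invertible for $t\in U$, $q,p,u,v,w\to0$ as $t\to0$, $D'/D=qp'-pq'$ on $U$, and $q,p,u,v,w$ satisfy the system of part 4 on $U$ with $I_1=\gamma_0$, $I_2=\alpha_0^2-\beta_0\gamma_0-\gamma_0$. 6. (All systems.) Let $\mathcal A_0,\mathcal A_1\in\mathfrak{sl}_2(\mathbb C)$ be arbitrary, let $\mathcal A_0,\ \mathcal A_0+\mathcal A_1,\ \mathcal A_1$ have eigenvalues $\pm\theta_0/2,\ \pm\theta_1/2,\ \pm\theta_\infty/2$, and let $(\varphi,\psi)$ be regular. Then $D$ is well defined and is a PVI tau function with parameters $(\theta_0,\theta_1,0,\theta_\infty)$. 7. (Regular solution.) Let $\mathrm{Re}\,c>0$, $c\ne a+b$, and $\alpha_0=-\frac c2-\frac{ab}{c-a-b}$,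 $\beta_0=-\frac{(c-a)(c-b)}{c-a-b}$, $\gamma_0=-\frac{ab}{c-a-b}$, $\mathcal A_1=\frac{c-a-b}2\,\mathrm{diag}(1,-1)$. With $f=x^{c/2}(1-x)^{-\frac{a+b}2}{}_2F_1(a,b;c;\tfrac x{x-1})$ and $g=x^{1+c/2}(1-x)^{-1-\frac{a+b}2}{}_2F_1(1+a,1+b;2+c;\tfrac x{x-1})$, the pair $\varphi=f+\frac{(c-a)(c-b)}{c(1+c)}g$, $\psi=-f-\frac{ab}{c(1+c)}g$ is a regular solution, and every regular solution is a constant multiple of it. 8. (The ${}_2F_1$ kernel.) Let $z,z',w,w'\in\mathbb C$ with $z+w,z+w',z'+w,z'+w'\notin\mathbb Z_{<0}$ and $\mathrm{Re}(z+z'+w+w')>0$. Put $A(x)=x^{\frac{z+z'+w+w'}2}(1-x)^{-\frac{z+z'+2w'}2}{}_2F_1(z+w',z'+w';z+z'+w+w';\tfrac x{x-1})$, $B(x)=x^{\frac{z+z'+w+w'+2}2}(1-x)^{-\frac{z+z'+2w'+2}2}{}_2F_1(z+w'+1,z'+w'+1;z+z'+w+w'+2;\tfrac x{x-1})$, and $$K(x,y)=\lambda\,\frac{A(x)B(y)-B(x)A(y)}{y-x},\qquad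 \lambda=\frac{\sin\pi z\,\sin\pi z'}{\pi^2}\,\frac{\Gamma(1+z+w)\Gamma(1+z+w')\Gamma(1+z'+w)\Gamma(1+z'+w')}{\Gamma(1+z+z'+w+w')\Gamma(2+z+z'+w+w')}$$ (extended to the diagonal by its limit). If $w\ne w'$, then $K$ is the integrable kernel of a constant multiple of the pair of part 7 with $a=z+w'$, $b=z'+w'$, $c=z+z'+w+w'$. In all cases (including $w=w'$) $D_K$ is well defined and is a PVI tau function with parameters $\theta=(z+z'+w+w',\,z-z',\,0,\,w-w')$. -/

import Mathlib

open Set Filter Topology MeasureTheory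

noncomputable section

/-! ### Painlevé VI: Schlesinger system, Jimbo–Miwa–Ueno tau functions, sigma form -/

/-- The parameters `(θ₀, θ₁, θ_t, θ_∞)` of Painlevé VI. -/
structure PVIParams where
  th0 : ℂ
  th1 : ℂ
  tht : ℂ
  thinf : ℂ

/-- `A ∈ sl₂(ℂ)` has eigenvalues `±θ/2` (with multiplicity). -/
def HasEigenvaluesPM (A : Matrix (Fin 2) (Fin 2) ℂ) (θ : ℂ) : Prop :=
  A.charpoly = (Polynomial.X - Polynomial.C (θ / 2)) * (Polynomial.X + Polynomial.C (θ / 2))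

open Classical in
/-- The normal form of `A₀ + A₁ + A_t`: it is `diag (-θ_∞/2, θ_∞/2)` if `θ_∞ ≠ 0`, and a nonzero
nilpotent Jordan block if `θ_∞ = 0`. -/
def residueSum (θinf : ℂ) : Matrix (Fin 2) (Fin 2) ℂ :=
  if θinf = 0 then !![0, 0; 1, 0] else !![-θinf / 2, 0; 0, θinf / 2]

/-- `(A₀, A₁, A_t)` is a solution, on the set `U` of real times, of the Schlesinger equations
`A₀' = [A_t, A₀] / t`, `A₁' = [A_t, A₁] / (t - 1)` (where `A₀ + A₁ + A_t` is constant), with the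
spectral data prescribed by `θ`. -/
structure IsSchlesinger (θ : PVIParams) (U : Set ℝ)
    (A0 A1 At : ℝ → Matrix (Fin 2) (Fin 2) ℂ) : Prop where
  eig0 : ∀ t ∈ U, HasEigenvaluesPM (A0 t) θ.th0
  eig1 : ∀ t ∈ U, HasEigenvaluesPM (A1 t) θ.th1
  eigt : ∀ t ∈ U, HasEigenvaluesPM (At t) θ.tht
  sum_eq : ∀ t ∈ U, A0 t + A1 t + At t = residueSum θ.thinf
  deriv0 : ∀ t ∈ U, ∀ i j,
    HasDerivAt (fun s => A0 s i j) ((At t * A0 t - A0 t * At t) i j / (t : ℂ)) t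
  deriv1 : ∀ t ∈ U, ∀ i j,
    HasDerivAt (fun s => A1 s i j) ((At t * A1 t - A1 t * At t) i j / ((t : ℂ) - 1)) t

/-- `τ` is, on `U`, a Jimbo–Miwa–Ueno tau function of Painlevé VI with parameters `θ`:
`(ln τ)' = tr (A₀ A_t) / t + tr (A₁ A_t) / (t - 1)` for a solution of the Schlesinger system. -/
def IsJMUTau (θ : PVIParams) (U : Set ℝ) (τ : ℝ → ℂ) : Prop :=
  ∃ A0 A1 At : ℝ → Matrix (Fin 2) (Fin 2) ℂ, IsSchlesinger θ U A0 A1 At ∧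
    ∀ t ∈ U, τ t ≠ 0 ∧
      HasDerivAt τ (τ t * ((A0 t * At t).trace / (t : ℂ) + (A1 t * At t).trace / ((t : ℂ) - 1))) t

/-- The sigma form of Painlevé VI, as an equation for the function `σ` at the point `t`. -/
def SigmaPVIAt (θ : PVIParams) (σ : ℝ → ℂ) (t : ℝ) : Prop :=
  deriv σ t * ((t : ℂ) * (t - 1) * deriv (deriv σ) t) ^ 2
    + (2 * deriv σ t * (t * deriv σ t - σ t) - deriv σ t ^ 2
        - (θ.tht ^ 2 - θ.thinf ^ 2) * (θ.th0 ^ 2 - θ.th1 ^ 2) / 16) ^ 2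
  = (deriv σ t + (θ.tht + θ.thinf) ^ 2 / 4) * (deriv σ t + (θ.tht - θ.thinf) ^ 2 / 4)
    * (deriv σ t + (θ.th0 + θ.th1) ^ 2 / 4) * (deriv σ t + (θ.th0 - θ.th1) ^ 2 / 4)

/-- `σ` is a twice continuously differentiable solution on `U` of the sigma form. -/
def SolvesSigmaPVI (θ : PVIParams) (U : Set ℝ) (σ : ℝ → ℂ) : Prop :=
  ContDiffOn ℝ 2 σ U ∧ ∀ t ∈ U, SigmaPVIAt θ σ t

/-- `t (t - 1) (ln τ)'`. -/
def zetaOf (τ : ℝ → ℂ) (t : ℝ) : ℂ := (t : ℂ) * (t - 1) * logDeriv τ t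

/-- The function `σ` attached to a tau function with parameters `θ`. -/
def sigmaOf (θ : PVIParams) (τ : ℝ → ℂ) (t : ℝ) : ℂ :=
  zetaOf τ t + t * (θ.tht ^ 2 - θ.thinf ^ 2) / 4
    - (θ.tht ^ 2 + θ.th0 ^ 2 - θ.th1 ^ 2 - θ.thinf ^ 2) / 8

/-! ### Integrable kernels and Fredholm determinants on `(0, t)` -/

/-- The kernel `(φ(x) ψ(y) - ψ(x) φ(y)) / (x - y)`, extended to the diagonal by its limit. -/
def integrableKernel (φ ψ : ℝ → ℂ) (x y : ℝ) : ℂ :=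
  if x = y then deriv φ x * ψ x - deriv ψ x * φ x
  else (φ x * ψ y - ψ x * φ y) / ((x : ℂ) - y)

/-- The cube `(0, t)ⁿ`. -/
def cube (n : ℕ) (t : ℝ) : Set (Fin n → ℝ) := Set.pi univ fun _ => Ioo 0 t

/-- The `n × n` determinant of the values `K (x i) (x j)`. -/
def kernelMinor (K : ℝ → ℝ → ℂ) (n : ℕ) (x : Fin n → ℝ) : ℂ :=
  (Matrix.of fun i j => K (x i) (x j)).det

/-- The `n`-th term of the Fredholm series of `det (1 - K)` on `L²(0, t)`. -/
def fredholmTerm (K : ℝ → ℝ → ℂ) (t : ℝ) (n : ℕ) : ℂ :=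
  (-1) ^ n / (n.factorial : ℂ) * ∫ x in cube n t, kernelMinor K n x

/-- The Fredholm determinant of `1 - K` on `L²(0, t)`. -/
def fredholmDet (K : ℝ → ℝ → ℂ) (t : ℝ) : ℂ := ∑' n, fredholmTerm K t n

/-- All integrals in the Fredholm series exist and the series converges (absolutely). -/
def FredholmConverges (K : ℝ → ℝ → ℂ) (t : ℝ) : Prop :=
  (∀ n, IntegrableOn (kernelMinor K n) (cube n t)) ∧ Summable (fredholmTerm K t)

/-- The points of `(0, 1)` where the Fredholm determinant does not vanish. -/
def regularSet (K : ℝ → ℝ → ℂ) : Set ℝ := {t | t ∈ Ioo (0 : ℝ) 1 ∧ fredholmDet K t ≠ 0}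

/-- The determinant on `(0, t)`, `0 < t < 1`, is well defined, continuous in `t`, tends to `1` as
`t → 0`, and is three times continuously differentiable on the open set of its non-zeros. -/
structure FredholmWellDefined (K : ℝ → ℝ → ℂ) : Prop where
  converges : ∀ t ∈ Ioo (0 : ℝ) 1, FredholmConverges K t
  continuousOn : ContinuousOn (fredholmDet K) (Ioo 0 1)
  tendsto_one : Tendsto (fredholmDet K) (𝓝[>] 0) (𝓝 1)
  isOpen : IsOpen (regularSet K)
  contDiffOn : ContDiffOn ℝ 3 (fredholmDet K) (regularSet K)

/-- `f ∈ L²(0, t)` satisfies `(1 - K) f = g` on `(0, t]`; the equation holds at every point, which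
singles out a representative of the `L²` class. -/
def IsResolventSolution (K : ℝ → ℝ → ℂ) (t : ℝ) (g f : ℝ → ℂ) : Prop :=
  MemLp f 2 (volume.restrict (Ioc 0 t)) ∧
    ∀ x ∈ Ioc 0 t, f x - ∫ y in Ioc 0 t, K x y * f y = g x

/-- `1 - K` is invertible on `L²(0, t)`. -/
def ResolventExists (K : ℝ → ℝ → ℂ) (t : ℝ) : Prop :=
  ∀ g : ℝ → ℂ, MemLp g 2 (volume.restrict (Ioc 0 t)) →
    ∃ f, IsResolventSolution K t g f ∧ ∀ f', IsResolventSolution K t g f' → EqOn f' f (Ioc 0 t)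

/-- `(1 - K)⁻¹ g` on `(0, t]` (meaningful when `1 - K` is invertible). -/
def resolventApply (K : ℝ → ℝ → ℂ) (t : ℝ) (g : ℝ → ℂ) : ℝ → ℂ :=
  Classical.epsilon (IsResolventSolution K t g)

/-! ### The Tracy–Widom quantities -/

/-- `q(t) = ((1 - K)⁻¹ φ)(t)`. -/
def twQ (φ ψ : ℝ → ℂ) (t : ℝ) : ℂ := resolventApply (integrableKernel φ ψ) t φ t

/-- `p(t) = ((1 - K)⁻¹ ψ)(t)`. -/
def twP (φ ψ : ℝ → ℂ) (t : ℝ) : ℂ := resolventApply (integrableKernel φ ψ) t ψ t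

/-- `u(t) = ⟨φ, (1 - K)⁻¹ φ⟩` (bilinear pairing on `(0, t)`). -/
def twU (φ ψ : ℝ → ℂ) (t : ℝ) : ℂ :=
  ∫ x in Ioc 0 t, φ x * resolventApply (integrableKernel φ ψ) t φ x

/-- `v(t) = ⟨φ, (1 - K)⁻¹ ψ⟩`. -/
def twV (φ ψ : ℝ → ℂ) (t : ℝ) : ℂ :=
  ∫ x in Ioc 0 t, φ x * resolventApply (integrableKernel φ ψ) t ψ x

/-- `w(t) = ⟨ψ, (1 - K)⁻¹ ψ⟩`. -/
def twW (φ ψ : ℝ → ℂ) (t : ℝ) : ℂ :=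
  ∫ x in Ioc 0 t, ψ x * resolventApply (integrableKernel φ ψ) t ψ x

/-- `x (1 - x) (φ, ψ)' = (A₀ + A₁ x) (φ, ψ)` on `(0, 1)`. -/
def SolvesLinearSystem (A0 A1 : Matrix (Fin 2) (Fin 2) ℂ) (φ ψ : ℝ → ℂ) : Prop :=
  ∀ x ∈ Ioo (0 : ℝ) 1,
    HasDerivAt φ (((A0 + (x : ℂ) • A1).mulVec ![φ x, ψ x]) 0 / ((x : ℂ) * (1 - x))) x ∧
    HasDerivAt ψ (((A0 + (x : ℂ) • A1).mulVec ![φ x, ψ x]) 1 / ((x : ℂ) * (1 - x))) x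

/-- The solution is regular at `0`: both components vanish there. -/
def RegularAtZero (φ ψ : ℝ → ℂ) : Prop :=
  Tendsto φ (𝓝[>] 0) (𝓝 0) ∧ Tendsto ψ (𝓝[>] 0) (𝓝 0)

/-- `t(1-t) q' = α q + β p`, `t(1-t) p' = -γ q - α p`, `u' = q²`, `v' = p q`, `w' = p²` on `S`. -/
structure IsTWSolution (α β γ q p u v w : ℝ → ℂ) (S : Set ℝ) : Prop where
  deriv_q : ∀ t ∈ S, HasDerivAt q ((α t * q t + β t * p t) / ((t : ℂ) * (1 - t))) t
  deriv_p : ∀ t ∈ S, HasDerivAt p ((-γ t * q t - α t * p t) / ((t : ℂ) * (1 - t))) t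
  deriv_u : ∀ t ∈ S, HasDerivAt u (q t ^ 2) t
  deriv_v : ∀ t ∈ S, HasDerivAt v (p t * q t) t
  deriv_w : ∀ t ∈ S, HasDerivAt w (p t ^ 2) t

/-- `t (t - 1) (q p' - p q')`. -/
def twZeta (q p : ℝ → ℂ) (t : ℝ) : ℂ := (t : ℂ) * (t - 1) * (q t * deriv p t - p t * deriv q t)

/-- The second order equation for `ζ`, with constants `α₀, α₁, I₁, I₂`, at the point `t`. -/
def ZetaODEAt (α₀ α₁ I₁ I₂ : ℂ) (ζ : ℝ → ℂ) (t : ℝ) : Prop :=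
  ((t : ℂ) * (1 - t) * deriv (deriv ζ) t) ^ 2
    + 4 * (deriv ζ t - α₁ ^ 2) * (t * deriv ζ t - ζ t) ^ 2
    - 4 * deriv ζ t * (t * deriv ζ t - ζ t) * (deriv ζ t + 2 * α₀ * α₁ - I₁)
  = 4 * (I₁ + I₂) * deriv ζ t ^ 2

/-- `ζ` is a twice continuously differentiable solution on `S` of the second order equation. -/
def SolvesZetaODE (α₀ α₁ I₁ I₂ : ℂ) (S : Set ℝ) (ζ : ℝ → ℂ) : Prop :=
  ContDiffOn ℝ 2 ζ S ∧ ∀ t ∈ S, ZetaODEAt α₀ α₁ I₁ I₂ ζ t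

/-! Diagonal case: `A₀ = (α₀, β₀; -γ₀, -α₀)`, `A₁ = diag (α₁, -α₁)`. -/

def sl2Matrix (α₀ β₀ γ₀ : ℂ) : Matrix (Fin 2) (Fin 2) ℂ := !![α₀, β₀; -γ₀, -α₀]

def diagAlpha (α₀ α₁ : ℂ) (v : ℝ → ℂ) (t : ℝ) : ℂ := α₀ + α₁ * t + v t

def diagBeta (β₀ α₁ : ℂ) (u : ℝ → ℂ) (t : ℝ) : ℂ := β₀ + (2 * α₁ - 1) * u t

def diagGamma (γ₀ α₁ : ℂ) (w : ℝ → ℂ) (t : ℝ) : ℂ := γ₀ - (2 * α₁ + 1) * w t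

/-- The Tracy–Widom equations in the diagonal case. -/
def IsDiagTWSolution (α₀ β₀ γ₀ α₁ : ℂ) (q p u v w : ℝ → ℂ) (S : Set ℝ) : Prop :=
  IsTWSolution (diagAlpha α₀ α₁ v) (diagBeta β₀ α₁ u) (diagGamma γ₀ α₁ w) q p u v w S

/-- First integral `I₁ = 2αpq + βp² + γq² - 2α₁v`. -/
def diagI1 (α₀ β₀ γ₀ α₁ : ℂ) (q p u v w : ℝ → ℂ) (t : ℝ) : ℂ :=
  2 * diagAlpha α₀ α₁ v t * p t * q t + diagBeta β₀ α₁ u t * p t ^ 2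
    + diagGamma γ₀ α₁ w t * q t ^ 2 - 2 * α₁ * v t

/-- First integral `I₂ = (v + α₀)² - βγ - 2α₁t(1-t)pq + 2α₁(1-t)v - I₁t`. -/
def diagI2 (α₀ β₀ γ₀ α₁ : ℂ) (q p u v w : ℝ → ℂ) (t : ℝ) : ℂ :=
  (v t + α₀) ^ 2 - diagBeta β₀ α₁ u t * diagGamma γ₀ α₁ w t
    - 2 * α₁ * t * (1 - t) * p t * q t + 2 * α₁ * (1 - t) * v t
    - diagI1 α₀ β₀ γ₀ α₁ q p u v w t * t

/-- The parametrization of `I₁, I₂` by `k₁, k₂`. -/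
def KParam (α₀ α₁ I₁ I₂ k₁ k₂ : ℂ) : Prop :=
  I₁ = -(k₁ * k₂) + α₁ * (2 * α₀ + α₁) ∧
  I₂ = (k₁ + k₂) ^ 2 / 4 - α₁ * (2 * α₀ + α₁)

/-- `θ = (k₁ - k₂, k₁ + k₂, 0, 2α₁)`. -/
def kTheta (α₁ k₁ k₂ : ℂ) : PVIParams := ⟨k₁ - k₂, k₁ + k₂, 0, 2 * α₁⟩

/-- `σ = ζ - α₁² t + (α₁² + k₁k₂)/2`. -/
def kSigma (α₁ k₁ k₂ : ℂ) (ζ : ℝ → ℂ) (t : ℝ) : ℂ :=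
  ζ t - α₁ ^ 2 * t + (α₁ ^ 2 + k₁ * k₂) / 2

/-! Nilpotent case: `A₀ = (α₀, β₀; -γ₀, -α₀)`, `A₁ = (0, 1; 0, 0)`. -/

def nilAlpha (α₀ : ℂ) (v w : ℝ → ℂ) (t : ℝ) : ℂ := α₀ + v t - w t

def nilBeta (β₀ : ℂ) (u v : ℝ → ℂ) (t : ℝ) : ℂ := β₀ + t - u t + 2 * v t

def nilGamma (γ₀ : ℂ) (w : ℝ → ℂ) (t : ℝ) : ℂ := γ₀ - w t

/-- The Tracy–Widom equations in the nilpotent case. -/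
def IsNilTWSolution (α₀ β₀ γ₀ : ℂ) (q p u v w : ℝ → ℂ) (S : Set ℝ) : Prop :=
  IsTWSolution (nilAlpha α₀ v w) (nilBeta β₀ u v) (nilGamma γ₀ w) q p u v w S

/-- First integral `I₁ = 2αpq + βp² + γ(q² + 1)`. -/
def nilI1 (α₀ β₀ γ₀ : ℂ) (q p u v w : ℝ → ℂ) (t : ℝ) : ℂ :=
  2 * nilAlpha α₀ v w t * p t * q t + nilBeta β₀ u v t * p t ^ 2
    + nilGamma γ₀ w t * (q t ^ 2 + 1)

/-- First integral `I₂ = α² - βγ - t(1-t)p² + (2t-1)γ - I₁t`. -/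
def nilI2 (α₀ β₀ γ₀ : ℂ) (q p u v w : ℝ → ℂ) (t : ℝ) : ℂ :=
  nilAlpha α₀ v w t ^ 2 - nilBeta β₀ u v t * nilGamma γ₀ w t - t * (1 - t) * p t ^ 2
    + (2 * t - 1) * nilGamma γ₀ w t - nilI1 α₀ β₀ γ₀ q p u v w t * t

/-- The Tracy–Widom quantities of `(φ, ψ)` all vanish as `t → 0`. -/
def TWVanishAtZero (φ ψ : ℝ → ℂ) : Prop :=
  Tendsto (twQ φ ψ) (𝓝[>] 0) (𝓝 0) ∧ Tendsto (twP φ ψ) (𝓝[>] 0) (𝓝 0) ∧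
  Tendsto (twU φ ψ) (𝓝[>] 0) (𝓝 0) ∧ Tendsto (twV φ ψ) (𝓝[>] 0) (𝓝 0) ∧
  Tendsto (twW φ ψ) (𝓝[>] 0) (𝓝 0)

/-- The determinant of the kernel built from `(φ, ψ)` and its Tracy–Widom quantities are well
defined, the latter vanish as `t → 0`, and `D'/D = q p' - p q'` where `D ≠ 0`. -/
structure TWWellDefined (φ ψ : ℝ → ℂ) : Prop where
  det : FredholmWellDefined (integrableKernel φ ψ)
  resolvent : ∀ t ∈ regularSet (integrableKernel φ ψ), ResolventExists (integrableKernel φ ψ) t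
  vanish : TWVanishAtZero φ ψ
  logDeriv_eq : ∀ t ∈ regularSet (integrableKernel φ ψ),
    logDeriv (fredholmDet (integrableKernel φ ψ)) t
      = twQ φ ψ t * deriv (twP φ ψ) t - twP φ ψ t * deriv (twQ φ ψ) t

/-- The non-vanishing set of the determinant of the kernel built from `(φ, ψ)`. -/
def twSet (φ ψ : ℝ → ℂ) : Set ℝ := regularSet (integrableKernel φ ψ)

/-- The determinant `D` is a tau function with parameters `θ`, and its `σ` solves the sigma form. -/
def IsPVITauDet (θ : PVIParams) (K : ℝ → ℝ → ℂ) : Prop :=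
  IsJMUTau θ (regularSet K) (fredholmDet K) ∧
    SolvesSigmaPVI θ (regularSet K) (sigmaOf θ (fredholmDet K))

/-! ### The hypergeometric kernel -/

/-- Gauss' hypergeometric function on `{‖s‖ < 1} ∪ {Re s < 1/2}`: the power series in the unit
disc, continued analytically to the half-plane by Pfaff's transformation
`₂F₁(a, b; c; s) = (1 - s)^(-a) ₂F₁(a, c - b; c; s / (s - 1))`. It is used here only for `s < 0`. -/
def gauss2F1 (a b c s : ℂ) : ℂ :=
  if ‖s‖ < 1 then ordinaryHypergeometric a b c s
  else (1 - s) ^ (-a) * ordinaryHypergeometric a (c - b) c (s / (s - 1))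

/-- `x^(c/2) (1-x)^(-(a+b)/2) ₂F₁(a, b; c; x/(x-1))`. -/
def hyperA (a b c : ℂ) (x : ℝ) : ℂ :=
  (x : ℂ) ^ (c / 2) * (1 - (x : ℂ)) ^ (-(a + b) / 2) * gauss2F1 a b c ((x : ℂ) / (x - 1))

/-- `x^(1+c/2) (1-x)^(-1-(a+b)/2) ₂F₁(1+a, 1+b; 2+c; x/(x-1))`. -/
def hyperB (a b c : ℂ) (x : ℝ) : ℂ :=
  (x : ℂ) ^ (1 + c / 2) * (1 - (x : ℂ)) ^ (-1 - (a + b) / 2)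
    * gauss2F1 (1 + a) (1 + b) (2 + c) ((x : ℂ) / (x - 1))

/-- First component of the regular solution. -/
def hyperPhi (a b c : ℂ) (x : ℝ) : ℂ :=
  hyperA a b c x + (c - a) * (c - b) / (c * (1 + c)) * hyperB a b c x

/-- Second component of the regular solution. -/
def hyperPsi (a b c : ℂ) (x : ℝ) : ℂ :=
  -hyperA a b c x - a * b / (c * (1 + c)) * hyperB a b c x

/-- The function `A(x)` of the `₂F₁` kernel. -/
def kernelA (z z' w w' : ℂ) (x : ℝ) : ℂ :=
  (x : ℂ) ^ ((z + z' + w + w') / 2) * (1 - (x : ℂ)) ^ (-(z + z' + 2 * w') / 2)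
    * gauss2F1 (z + w') (z' + w') (z + z' + w + w') ((x : ℂ) / (x - 1))

/-- The function `B(x)` of the `₂F₁` kernel. -/
def kernelB (z z' w w' : ℂ) (x : ℝ) : ℂ :=
  (x : ℂ) ^ ((z + z' + w + w' + 2) / 2) * (1 - (x : ℂ)) ^ (-(z + z' + 2 * w' + 2) / 2)
    * gauss2F1 (z + w' + 1) (z' + w' + 1) (z + z' + w + w' + 2) ((x : ℂ) / (x - 1))

/-- The prefactor `λ` of the `₂F₁` kernel. -/
def kernelLambda (z z' w w' : ℂ) : ℂ :=
  Complex.sin (Real.pi * z) * Complex.sin (Real.pi * z') / (Real.pi : ℂ) ^ 2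
    * (Complex.Gamma (1 + z + w) * Complex.Gamma (1 + z + w')
        * Complex.Gamma (1 + z' + w) * Complex.Gamma (1 + z' + w'))
    / (Complex.Gamma (1 + z + z' + w + w') * Complex.Gamma (2 + z + z' + w + w'))

/-- The `₂F₁` kernel `λ (A(x) B(y) - B(x) A(y)) / (y - x)`, extended to the diagonal by its
limit. -/
def hyperKernel (z z' w w' : ℂ) (x y : ℝ) : ℂ :=
  if x = y then
    kernelLambda z z' w w' * (kernelA z z' w w' x * deriv (kernelB z z' w w') x
      - kernelB z z' w w' x * deriv (kernelA z z' w w') x)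
  else
    kernelLambda z z' w w' * ((kernelA z z' w w' x * kernelB z z' w w' y
      - kernelB z z' w w' x * kernelA z z' w w' y) / ((y : ℂ) - x))

/-- The complex number `s` is not a negative integer. -/
def NotNegInt (s : ℂ) : Prop := ∀ n : ℕ, s ≠ -((n : ℂ) + 1)

/-- Admissible parameters of the `₂F₁` kernel. -/
structure HyperAdmissible (z z' w w' : ℂ) : Prop where
  zw : NotNegInt (z + w)
  zw' : NotNegInt (z + w')
  z'w : NotNegInt (z' + w)
  z'w' : NotNegInt (z' + w')
  re_pos : 0 < (z + z' + w + w').re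

end

/-! The method is that of Tracy and Widom. The kernel K is integrable, so multiplication by x
commutes with K up to rank two. Since 𝒜₀ and 𝒜₁ are traceless and x(1 - x)d/dx acts on (φ, ψ) by 𝒜₀
+ 𝒜₁x, the combination x(1 - x)∂ₓK + y(1 - y)∂_yK + (1 - x - y)K is the symmetric bilinear form of
𝒜₁ in (φ, ψ), in which 𝒜₀ has dropped out. Pushing x(1 - x)d/dx through (1 - K)⁻¹ and letting the
endpoint t move gives a closed system for q, p, u, v, w, for arbitrary 𝒜₁
(`IsTWData.isGenTWSolution`). The resolvent kernel is again integrable, and L'Hôpital on its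
diagonal gives D'/D as a quadratic form in q, p (`IsTWData.resKernel_diag`).

This system is isomonodromic. With A_t the nilpotent matrix built from (q, p), there is a matrix A₀
for which A₀, A_t and A₁ = -𝒜₁ - A₀ - A_t solve the Schlesinger equations, and the Jimbo–Miwa–Ueno
logarithmic derivative is D'/D (`IsGenTWSolution.trace_residueMatrix`). The first integrals are det
A₀ and ζ - (c₁u + 2a₁v + b₁w), where a₁, b₁, -c₁ are the entries of 𝒜₁. Up to constants, ζ, ζ' and
t(1 - t)ζ'' are expressed by the pairings and the triple product of three vectors of sl₂. The square
of a triple product is a Gram determinant, which is the second order equation for ζ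
(`IsGenTWSolution.sigmaPVI_identity`). Multiplied by σ' it becomes the σ-form.

Two analytic points need an idea. The solutions only tend to 0 at x = 0, so continuity of K up to
the boundary of the square is not visible from its definition. An integral representation along the
flow of x(1 - x)d/dx, linear in the coordinate x/(1 - x), contains neither a division by x - y nor a
derivative (`sub_mul_extKernel`). Secondly, D may vanish inside (0, t), so the values of the first
integrals cannot simply be carried over from t = 0. Scaling (φ, ψ) by l turns K into l²K; for small
l the determinant has no zeros on [0, t], and after clearing denominators the identities are entire
in l, hence hold at l = 1 (`IsTWData.first_integrals`).

The Fredholm theory rests on Hadamard's bound: the series for the determinant and the first minor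
converge, D'(t) is minus the minor at (t, t), and the quotient of minor and determinant is the
resolvent kernel.

In the hypergeometric case the functions A and B themselves solve a traceless system with no
denominator c - a - b, so the general result applies to the ₂F₁ kernel also when w = w'. Since
regular solutions are unique up to a factor, the same system yields Pfaff's transformation and the
uniqueness in the description of the regular solution. -/

noncomputable section

/-! ### Hadamard's inequality and bordered minors. -/

open scoped ComplexOrder in
/-- Hadamard's inequality for matrices with uniformly bounded entries. -/
theorem norm_det_le_of_entry_le {n : ℕ} (A : Matrix (Fin n) (Fin n) ℂ) {M : ℝ}
    (hA : ∀ i j, ‖A i j‖ ≤ M) : ‖A.det‖ ≤ (Real.sqrt n * M) ^ n := by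
  rcases Nat.eq_zero_or_pos n with rfl | hn
  · simp
  have hM : 0 ≤ M := (norm_nonneg _).trans (hA ⟨0, hn⟩ ⟨0, hn⟩)
  have hH : (A * A.conjTranspose).PosSemidef := Matrix.posSemidef_self_mul_conjTranspose A
  have hd : ((‖A.det‖ ^ 2 : ℝ) : ℂ) = (A * A.conjTranspose).det := by
    rw [Matrix.det_mul, Matrix.det_conjTranspose]
    simp [Complex.mul_conj, Complex.normSq_eq_norm_sq]
  have hdet := hH.isHermitian.det_eq_prod_eigenvalues
  have htr := hH.isHermitian.trace_eq_sum_eigenvalues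
  have hd' : ‖A.det‖ ^ 2 = ∏ i, hH.isHermitian.eigenvalues i := by
    have h := hd.trans hdet
    have h2 : ((‖A.det‖ ^ 2 : ℝ) : ℂ) = ((∏ i, hH.isHermitian.eigenvalues i : ℝ) : ℂ) := by
      rw [h]; push_cast; rfl
    exact_mod_cast h2
  have htr' : (∑ i, hH.isHermitian.eigenvalues i) = ∑ i, ∑ j, ‖A i j‖ ^ 2 := by
    have h2 : ((∑ i, hH.isHermitian.eigenvalues i : ℝ) : ℂ) = ((∑ i, ∑ j, ‖A i j‖ ^ 2 : ℝ) : ℂ) := by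
      push_cast
      refine Eq.trans htr.symm ?_
      simp [Matrix.trace, Matrix.mul_apply, Complex.mul_conj, Complex.normSq_eq_norm_sq]
    exact_mod_cast h2
  have hn' : (0 : ℝ) < n := by exact_mod_cast hn
  -- The squared modulus of det A is the product of the eigenvalues of AA*. By AM–GM it is at most
  -- the n-th power of their mean, and their sum is the trace of AA*, at most n²M².
  have amgm : ∏ i, hH.isHermitian.eigenvalues i
      ≤ ((∑ i, hH.isHermitian.eigenvalues i) / n) ^ n := by
    have := Real.geom_mean_le_arith_mean (Finset.univ : Finset (Fin n)) (fun _ => (1 : ℝ))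
      hH.isHermitian.eigenvalues (fun _ _ => zero_le_one) (by simpa using hn)
      (fun i _ => hH.eigenvalues_nonneg i)
    simp only [Real.rpow_one, Finset.sum_const, Finset.card_univ, Fintype.card_fin, nsmul_eq_mul,
      mul_one, one_mul] at this
    have hp : 0 ≤ ∏ i, hH.isHermitian.eigenvalues i :=
      Finset.prod_nonneg fun i _ => hH.eigenvalues_nonneg i
    calc _ = ((∏ i, hH.isHermitian.eigenvalues i) ^ ((n : ℝ)⁻¹)) ^ n := by
          rw [Real.rpow_inv_natCast_pow hp hn.ne']
      _ ≤ _ := pow_le_pow_left₀ (Real.rpow_nonneg hp _) this n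
  have hs : (∑ i, hH.isHermitian.eigenvalues i) / n ≤ n * M ^ 2 := by
    rw [htr', div_le_iff₀ hn']
    calc ∑ i, ∑ j, ‖A i j‖ ^ 2 ≤ ∑ i : Fin n, ∑ j : Fin n, M ^ 2 :=
          Finset.sum_le_sum fun i _ => Finset.sum_le_sum fun j _ =>
            pow_le_pow_left₀ (norm_nonneg _) (hA i j) 2
      _ = _ := by simp; ring
  have h0 : 0 ≤ (∑ i, hH.isHermitian.eigenvalues i) / n :=
    div_nonneg (Finset.sum_nonneg fun i _ => hH.eigenvalues_nonneg i) hn'.le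
  have : ‖A.det‖ ^ 2 ≤ ((Real.sqrt n * M) ^ n) ^ 2 := by
    rw [hd', ← pow_mul, mul_comm n 2, pow_mul, mul_pow, Real.sq_sqrt hn'.le]
    exact amgm.trans (pow_le_pow_left₀ h0 hs n)
  exact le_of_sq_le_sq this (by positivity)

/-- The determinant of the values of `K` at `(x, z)` and `(y, z)`. -/
def borderedMinor (K : ℝ → ℝ → ℂ) (n : ℕ) (x y : ℝ) (z : Fin n → ℝ) : ℂ :=
  (Matrix.of fun i j : Fin (n + 1) =>
    K ((Fin.cons x z : Fin (n + 1) → ℝ) i) ((Fin.cons y z : Fin (n + 1) → ℝ) j)).det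

theorem kernelMinor_comp_perm (K : ℝ → ℝ → ℂ) (n : ℕ) (z : Fin n → ℝ) (e : Equiv.Perm (Fin n)) :
    kernelMinor K n (z ∘ e) = kernelMinor K n z :=
  Matrix.det_submatrix_equiv_self e (Matrix.of fun i j => K (z i) (z j))

/-- Rows and columns are permuted simultaneously, so no sign appears and the position of s is
irrelevant. -/
theorem kernelMinor_insertNth (K : ℝ → ℝ → ℂ) (n : ℕ) (k : Fin (n + 1)) (s : ℝ) (z : Fin n → ℝ) :
    kernelMinor K (n + 1) (k.insertNth s z) = borderedMinor K n s s z := by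
  rw [← Fin.cons_comp_cycleRange, kernelMinor_comp_perm]
  rfl

theorem borderedMinor_symm {K : ℝ → ℝ → ℂ} (hK : ∀ x y, K x y = K y x) (n : ℕ) (x y : ℝ)
    (z : Fin n → ℝ) : borderedMinor K n x y z = borderedMinor K n y x z := by
  rw [borderedMinor, ← Matrix.det_transpose]
  congr 1
  ext i j
  simp [hK]

/-- Laplace expansion along the row of x. In the cofactor of the column z k, moving the row z k to
the top costs (-1)^k, which cancels against the Laplace sign (-1)^(k+1) up to a uniform minus. -/
theorem borderedMinor_expand (K : ℝ → ℝ → ℂ) (n : ℕ) (x y : ℝ) (z : Fin (n + 1) → ℝ) :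
    borderedMinor K (n + 1) x y z = K x y * kernelMinor K (n + 1) z
      - ∑ k, K x (z k) * borderedMinor K n (z k) y (k.removeNth z) := by
  rw [borderedMinor, Matrix.det_succ_row_zero, Fin.sum_univ_succ, sub_eq_add_neg,
    ← Finset.sum_neg_distrib]
  congr 1
  · simp [kernelMinor, Matrix.submatrix]
  · refine Finset.sum_congr rfl fun k _ => ?_
    have h : borderedMinor K n (z k) y (k.removeNth z) = (-1) ^ (k : ℕ) *
        ((Matrix.of fun i j : Fin (n + 1 + 1) =>
          K ((Fin.cons x z : Fin (n + 1 + 1) → ℝ) i)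
            ((Fin.cons y z : Fin (n + 1 + 1) → ℝ) j)).submatrix Fin.succ
          (k.succ.succAbove)).det := by
      have hp := Matrix.det_permute k.cycleRange.symm
        ((Matrix.of fun i j : Fin (n + 1 + 1) =>
          K ((Fin.cons x z : Fin (n + 1 + 1) → ℝ) i)
            ((Fin.cons y z : Fin (n + 1 + 1) → ℝ) j)).submatrix Fin.succ (k.succ.succAbove))
      rw [Equiv.Perm.sign_symm, Fin.sign_cycleRange] at hp
      push_cast at hp
      rw [← hp, borderedMinor]
      congr 1
      ext i j
      simp only [Matrix.of_apply, Matrix.submatrix_apply, id]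
      congr 1
      · rw [Fin.cons_removeNth_eq_comp_cycleRange_symm]; simp
      · cases j using Fin.cases <;> simp [Fin.removeNth_apply]
    rw [h]
    simp only [Matrix.of_apply, Fin.cons_zero, Fin.cons_succ, Fin.val_succ, pow_succ]
    have : ((-1 : ℂ) ^ (k : ℕ)) * (-1) ^ (k : ℕ) = 1 := by rw [← mul_pow]; simp
    ring_nf

end

/-! ### Convergence of Fredholm series and integrals over cubes. -/

noncomputable section

/-- Up to sign the term is XY with X = 2^(-m) m^(m/2)/√(m!) and Y = (2|C|)^m/√(m!). Since m^m/m! ≤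
e^m, X² is at most (e/4)^m, while Y² is a term of an exponential series. The factor 2^(-m) is there
to bring the geometric ratio e below 1. -/
theorem summable_sqrt_pow_div_factorial (C : ℝ) :
    Summable fun m : ℕ => (Real.sqrt m * C) ^ m / (m.factorial : ℝ) := by
  have h1 : Summable fun m : ℕ => (Real.exp 1 / 4) ^ m := by
    refine summable_geometric_of_lt_one (by positivity) ?_
    have := Real.exp_one_lt_d9
    linarith
  have h2 : Summable fun m : ℕ => (4 * C ^ 2) ^ m / (m.factorial : ℝ) :=
    Real.summable_pow_div_factorial _
  refine Summable.of_norm_bounded (h1.add h2) fun m => ?_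
  have hf : (0 : ℝ) < m.factorial := by positivity
  have he : (m : ℝ) ^ m / m.factorial ≤ Real.exp 1 ^ m := by
    rw [← Real.exp_nat_mul, mul_one]
    exact Real.pow_div_factorial_le_exp _ (Nat.cast_nonneg m) m
  set s := Real.sqrt m.factorial with hs
  have hs0 : 0 < s := Real.sqrt_pos.2 hf
  have hss : s ^ 2 = m.factorial := Real.sq_sqrt hf.le
  set X := (1 / 2) ^ m * Real.sqrt m ^ m / s with hX
  set Y := (2 * |C|) ^ m / s with hY
  have hXY : ‖(Real.sqrt m * C) ^ m / (m.factorial : ℝ)‖ = X * Y := by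
    rw [norm_div, norm_pow, norm_mul, Real.norm_of_nonneg (Real.sqrt_nonneg _), Real.norm_eq_abs,
      Real.norm_of_nonneg hf.le, ← hss, hX, hY]
    field_simp
    rw [← mul_pow, ← mul_pow]
    congr 1
    ring
  have hX2 : X ^ 2 ≤ (Real.exp 1 / 4) ^ m := by
    have : X ^ 2 = (1 / 4) ^ m * ((m : ℝ) ^ m / m.factorial) := by
      rw [hX, div_pow, hss, mul_pow, ← pow_mul, ← pow_mul, mul_comm m 2, pow_mul, pow_mul,
        Real.sq_sqrt (Nat.cast_nonneg m)]
      norm_num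
      ring
    rw [this]
    calc _ ≤ (1 / 4 : ℝ) ^ m * Real.exp 1 ^ m := by gcongr
      _ = _ := by rw [← mul_pow]; congr 1; ring
  have hY2 : Y ^ 2 = (4 * C ^ 2) ^ m / (m.factorial : ℝ) := by
    rw [hY, div_pow, hss, ← pow_mul, mul_comm m 2, pow_mul, mul_pow, sq_abs]
    norm_num
  rw [hXY]
  nlinarith [sq_nonneg (X - Y), sq_nonneg X, sq_nonneg Y]

/-- Bound of the `n`-th term of the series of first Fredholm minors. -/
def minorBound (M r : ℝ) (n : ℕ) : ℝ :=
  r ^ n * (Real.sqrt (n + 1 : ℕ) * M) ^ (n + 1) / (n.factorial : ℝ)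

/-- Comparison with the preceding series shifted by one: the mismatch between n! and (n + 1)! is
absorbed by n + 1 ≤ 2^(n+1), and that between r^n and an (n + 1)-st power by max r 1. -/
theorem summable_minorBound {M r : ℝ} (hM : 0 ≤ M) (hr : 0 ≤ r) : Summable (minorBound M r) := by
  have h := (summable_nat_add_iff 1).2 (summable_sqrt_pow_div_factorial (2 * max r 1 * M))
  refine Summable.of_nonneg_of_le (fun n => by unfold minorBound; positivity) (fun n => ?_) h
  have h1 : r ^ n ≤ max r 1 ^ (n + 1) :=
    (pow_le_pow_left₀ hr (le_max_left _ _) n).trans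
      (pow_le_pow_right₀ (le_max_right _ _) n.le_succ)
  have h2 : ((n + 1 : ℕ) : ℝ) ≤ 2 ^ (n + 1) := by exact_mod_cast (Nat.lt_two_pow_self).le
  have hf : ((n + 1).factorial : ℝ) = (n + 1 : ℕ) * n.factorial := by
    exact_mod_cast Nat.factorial_succ n
  have hf0 : (0 : ℝ) < n.factorial := by positivity
  unfold minorBound
  rw [hf, div_le_div_iff₀ hf0 (by positivity)]
  set S := Real.sqrt (n + 1 : ℕ)
  have : 0 ≤ S := Real.sqrt_nonneg _
  calc r ^ n * (S * M) ^ (n + 1) * (((n + 1 : ℕ) : ℝ) * n.factorial)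
      ≤ max r 1 ^ (n + 1) * (S * M) ^ (n + 1) * (2 ^ (n + 1) * n.factorial) := by gcongr
    _ = (S * (2 * max r 1 * M)) ^ (n + 1) * n.factorial := by
      simp only [mul_pow]; ring

theorem minorBound_nonneg {M r : ℝ} (hM : 0 ≤ M) (hr : 0 ≤ r) (n : ℕ) : 0 ≤ minorBound M r n := by
  unfold minorBound; positivity

theorem minorBound_mono {M r s : ℝ} (hM : 0 ≤ M) (hr : 0 ≤ r) (hrs : r ≤ s) (n : ℕ) :
    minorBound M r n ≤ minorBound M s n := by
  unfold minorBound; gcongr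

/-! ### Integrals over cubes -/

theorem measurableSet_cube (n : ℕ) (t : ℝ) : MeasurableSet (cube n t) :=
  MeasurableSet.univ_pi fun _ => measurableSet_Ioo

theorem volume_cube (n : ℕ) (t : ℝ) : volume (cube n t) = ENNReal.ofReal t ^ n := by
  rw [cube, Real.volume_pi_Ioo]; simp

theorem volume_cube_lt_top (n : ℕ) (t : ℝ) : volume (cube n t) < ⊤ := by
  rw [volume_cube]; exact ENNReal.pow_lt_top ENNReal.ofReal_lt_top

instance isFiniteMeasure_restrict_cube (n : ℕ) (t : ℝ) :
    IsFiniteMeasure (volume.restrict (cube n t)) :=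
  ⟨by rw [Measure.restrict_apply_univ]; exact volume_cube_lt_top n t⟩

theorem volume_restrict_cube (n : ℕ) (t : ℝ) : (volume : Measure (Fin n → ℝ)).restrict (cube n t)
    = Measure.pi fun _ => (volume : Measure ℝ).restrict (Ioo 0 t) := by
  rw [volume_pi, cube, Measure.restrict_pi_pi]

-- The rescaling moves t from the domain into the integrand, so that continuity in t is a matter of
-- dominated convergence over a fixed cube.
open scoped Pointwise in
theorem integral_cube_smul (n : ℕ) {t : ℝ} (ht : 0 < t) (f : (Fin n → ℝ) → ℂ) :
    ∫ z in cube n t, f z = (t : ℂ) ^ n * ∫ z in cube n 1, f (t • z) := by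
  rw [Measure.setIntegral_comp_smul_of_pos volume f (cube n 1) ht]
  have : t • cube n 1 = cube n t := by
    ext z
    simp only [cube, mem_smul_set_iff_inv_smul_mem₀ ht.ne', Set.mem_pi, mem_univ, true_imp_iff, mem_Ioo,
      Pi.smul_apply, smul_eq_mul]
    refine forall_congr' fun i => ?_
    rw [inv_mul_lt_iff₀ ht, mul_one, mul_pos_iff_of_pos_left (inv_pos.2 ht)]
  rw [this, Module.finrank_fin_fun, Complex.real_smul]
  push_cast
  rw [← mul_assoc, mul_inv_cancel₀ (pow_ne_zero _ (by exact_mod_cast ht.ne')), one_mul]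

theorem integral_cube_succ (n : ℕ) (t : ℝ) (k : Fin (n + 1)) {f : (Fin (n + 1) → ℝ) → ℂ}
    (hf : IntegrableOn f (cube (n + 1) t)) :
    ∫ z in cube (n + 1) t, f z
      = ∫ w in Ioo 0 t, ∫ z in cube n t, f (k.insertNth w z) := by
  have hmp := measurePreserving_piFinSuccAbove
    (fun _ : Fin (n + 1) => (volume : Measure ℝ).restrict (Ioo 0 t)) k
  have he := hmp.symm
  have h1 := he.integral_comp' (g := f)
  have h2 : Integrable (fun p => f ((MeasurableEquiv.piFinSuccAbove (fun _ => ℝ) k).symm p))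
      (((volume : Measure ℝ).restrict (Ioo 0 t)).prod
        (Measure.pi fun _ : Fin n => (volume : Measure ℝ).restrict (Ioo 0 t))) := by
    rw [IntegrableOn, volume_restrict_cube] at hf
    exact (he.integrable_comp_emb (MeasurableEquiv.measurableEmbedding _)).2 hf
  rw [volume_restrict_cube, ← h1, integral_prod _ h2, volume_restrict_cube]
  rfl

end

/-! ### The Fredholm determinant and first minor of a bounded continuous symmetric kernel. -/

noncomputable section

/-- A continuous, bounded, symmetric kernel on the real line. -/
structure IsNiceKernel (K : ℝ → ℝ → ℂ) (M : ℝ) : Prop where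
  cont : Continuous (Function.uncurry K)
  bound : ∀ x y, ‖K x y‖ ≤ M
  symm : ∀ x y, K x y = K y x

/-- The integral over `(0, t)ⁿ` of the bordered minors, rescaled to the unit cube. -/
def minorIntegral (K : ℝ → ℝ → ℂ) (n : ℕ) (t x y : ℝ) : ℂ :=
  (t : ℂ) ^ n * ∫ z in cube n 1, borderedMinor K n x y (t • z)

/-- The integral over `(0, t)ⁿ` of the minors, rescaled to the unit cube. -/
def detIntegral (K : ℝ → ℝ → ℂ) (n : ℕ) (t : ℝ) : ℂ :=
  (t : ℂ) ^ n * ∫ z in cube n 1, kernelMinor K n (t • z)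

/-- Fredholm's first minor on `(0, t)`. -/
def fredMinor (K : ℝ → ℝ → ℂ) (t x y : ℝ) : ℂ :=
  ∑' n : ℕ, (-1) ^ n / (n.factorial : ℂ) * minorIntegral K n t x y

/-- The Fredholm determinant, extended continuously to `t = 0`. -/
def fredDet (K : ℝ → ℝ → ℂ) (t : ℝ) : ℂ :=
  ∑' n : ℕ, (-1) ^ n / (n.factorial : ℂ) * detIntegral K n t

namespace IsNiceKernel

variable {K : ℝ → ℝ → ℂ} {M : ℝ}

theorem nonneg (h : IsNiceKernel K M) : 0 ≤ M := (norm_nonneg _).trans (h.bound 0 0)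

theorem continuous_comp₂ {X : Type*} [TopologicalSpace X] (h : IsNiceKernel K M) {f g : X → ℝ}
    (hf : Continuous f) (hg : Continuous g) : Continuous fun x => K (f x) (g x) :=
  h.cont.comp (hf.prodMk hg)

theorem continuous_kernelMinor (h : IsNiceKernel K M) (n : ℕ) : Continuous (kernelMinor K n) := by
  refine Continuous.matrix_det (continuous_matrix fun i j => ?_)
  exact h.continuous_comp₂ (continuous_apply i) (continuous_apply j)

theorem continuous_borderedMinor (h : IsNiceKernel K M) (n : ℕ) :
    Continuous fun p : ℝ × ℝ × (Fin n → ℝ) => borderedMinor K n p.1 p.2.1 p.2.2 := by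
  refine Continuous.matrix_det (continuous_matrix fun i j => ?_)
  refine h.continuous_comp₂ ?_ ?_
  · cases i using Fin.cases <;> simp only [Fin.cons_zero, Fin.cons_succ] <;> fun_prop
  · cases j using Fin.cases <;> simp only [Fin.cons_zero, Fin.cons_succ] <;> fun_prop

theorem norm_kernelMinor_le (h : IsNiceKernel K M) (n : ℕ) (z : Fin n → ℝ) :
    ‖kernelMinor K n z‖ ≤ (Real.sqrt n * M) ^ n :=
  norm_det_le_of_entry_le _ fun _ _ => h.bound _ _

theorem norm_borderedMinor_le (h : IsNiceKernel K M) (n : ℕ) (x y : ℝ) (z : Fin n → ℝ) :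
    ‖borderedMinor K n x y z‖ ≤ (Real.sqrt (n + 1 : ℕ) * M) ^ (n + 1) :=
  norm_det_le_of_entry_le _ fun _ _ => h.bound _ _

theorem integrableOn_kernelMinor (h : IsNiceKernel K M) (n : ℕ) (t : ℝ) :
    IntegrableOn (kernelMinor K n) (cube n t) :=
  Integrable.of_bound (h.continuous_kernelMinor n).aestronglyMeasurable _
    (Eventually.of_forall (h.norm_kernelMinor_le n))

theorem continuous_minorIntegral (h : IsNiceKernel K M) (n : ℕ) :
    Continuous fun p : ℝ × ℝ × ℝ => minorIntegral K n p.1 p.2.1 p.2.2 := by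
  unfold minorIntegral
  refine Continuous.mul (by fun_prop) ?_
  refine continuous_of_dominated (bound := fun _ => (Real.sqrt (n + 1 : ℕ) * M) ^ (n + 1))
    (fun p => ?_) (fun p => ?_) (integrable_const _) ?_
  · exact ((h.continuous_borderedMinor n).comp (by fun_prop :
      Continuous fun z : Fin n → ℝ => (p.2.1, p.2.2, p.1 • z))).aestronglyMeasurable
  · exact Eventually.of_forall fun z => h.norm_borderedMinor_le n _ _ _
  · exact Eventually.of_forall fun z => (h.continuous_borderedMinor n).comp (by fun_prop :
      Continuous fun p : ℝ × ℝ × ℝ => (p.2.1, p.2.2, p.1 • z))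

theorem norm_minorIntegral_le (h : IsNiceKernel K M) (n : ℕ) (t x y : ℝ) :
    ‖minorIntegral K n t x y‖ ≤ |t| ^ n * (Real.sqrt (n + 1 : ℕ) * M) ^ (n + 1) := by
  rw [minorIntegral, norm_mul, norm_pow, Complex.norm_real, Real.norm_eq_abs]
  refine mul_le_mul_of_nonneg_left ?_ (by positivity)
  have := norm_setIntegral_le_of_norm_le_const (volume_cube_lt_top n 1)
    (fun z _ => h.norm_borderedMinor_le n x y (t • z))
  simpa [Measure.real, volume_cube] using this

theorem norm_minorTerm_le (h : IsNiceKernel K M) (n : ℕ) (t x y : ℝ) :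
    ‖(-1) ^ n / (n.factorial : ℂ) * minorIntegral K n t x y‖ ≤ minorBound M |t| n := by
  have h1 := h.norm_minorIntegral_le n t x y
  rw [norm_mul, norm_div, norm_pow, norm_neg, norm_one, one_pow, Complex.norm_natCast, minorBound,
    one_div_mul_eq_div]
  gcongr

theorem hasSum_fredMinor (h : IsNiceKernel K M) (t x y : ℝ) :
    HasSum (fun n : ℕ => (-1) ^ n / (n.factorial : ℂ) * minorIntegral K n t x y)
      (fredMinor K t x y) :=
  (Summable.of_norm_bounded (summable_minorBound h.nonneg (abs_nonneg t))
    fun n => h.norm_minorTerm_le n t x y).hasSum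

theorem continuous_fredMinor (h : IsNiceKernel K M) :
    Continuous fun p : ℝ × ℝ × ℝ => fredMinor K p.1 p.2.1 p.2.2 := by
  refine continuous_iff_continuousAt.2 fun p₀ => ?_
  have hs : {p : ℝ × ℝ × ℝ | |p.1| < |p₀.1| + 1} ∈ 𝓝 p₀ :=
    (isOpen_lt (by fun_prop) (by fun_prop)).mem_nhds (by simp)
  refine ContinuousOn.continuousAt (continuousOn_tsum (u := minorBound M (|p₀.1| + 1))
    (fun n => (continuous_const.mul (h.continuous_minorIntegral n)).continuousOn)
    (summable_minorBound h.nonneg (by positivity)) fun n p hp => ?_) hs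
  exact (h.norm_minorTerm_le n _ _ _).trans
    (minorBound_mono h.nonneg (abs_nonneg _) (le_of_lt hp) n)

theorem minorIntegral_zero (K : ℝ → ℝ → ℂ) (t x y : ℝ) : minorIntegral K 0 t x y = K x y := by
  have : ∀ z : Fin 0 → ℝ, borderedMinor K 0 x y z = K x y := fun z => by simp [borderedMinor]
  simp [minorIntegral, this, Measure.real, volume_cube]

theorem detIntegral_zero (K : ℝ → ℝ → ℂ) (t : ℝ) : detIntegral K 0 t = 1 := by
  simp [detIntegral, kernelMinor, Measure.real, volume_cube]

theorem minorIntegral_eq (K : ℝ → ℝ → ℂ) (n : ℕ) {t : ℝ} (ht : 0 < t) (x y : ℝ) :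
    minorIntegral K n t x y = ∫ z in cube n t, borderedMinor K n x y z :=
  (integral_cube_smul n ht _).symm

theorem detIntegral_eq (K : ℝ → ℝ → ℂ) (n : ℕ) {t : ℝ} (ht : 0 < t) :
    detIntegral K n t = ∫ z in cube n t, kernelMinor K n z :=
  (integral_cube_smul n ht _).symm

theorem minorIntegral_symm (h : IsNiceKernel K M) (n : ℕ) (t x y : ℝ) :
    minorIntegral K n t x y = minorIntegral K n t y x := by
  simp only [minorIntegral, borderedMinor_symm h.symm n x y]

theorem fredMinor_symm (h : IsNiceKernel K M) (t x y : ℝ) :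
    fredMinor K t x y = fredMinor K t y x := by
  simp only [fredMinor, h.minorIntegral_symm _ t x y]

/-- The Laplace expansion integrated over the cube. Separating the k-th variable by Fubini shows
that the n + 1 cofactor terms all have the same integral. -/
theorem minorIntegral_succ (h : IsNiceKernel K M) (n : ℕ) {t : ℝ} (ht : 0 < t) (x y : ℝ) :
    minorIntegral K (n + 1) t x y = K x y * detIntegral K (n + 1) t
      - (n + 1) * ∫ w in (0)..t, K x w * minorIntegral K n t w y := by
  rw [minorIntegral_eq K _ ht, detIntegral_eq K _ ht]
  simp_rw [borderedMinor_expand]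
  have hi : ∀ k : Fin (n + 1), IntegrableOn
      (fun z : Fin (n + 1) → ℝ => K x (z k) * borderedMinor K n (z k) y (k.removeNth z))
      (cube (n + 1) t) := fun k => by
    refine Integrable.of_bound (C := M * (Real.sqrt (n + 1 : ℕ) * M) ^ (n + 1)) ?_ ?_
    · refine Continuous.aestronglyMeasurable (Continuous.mul ?_ ?_)
      · exact h.continuous_comp₂ continuous_const (continuous_apply k)
      · refine (h.continuous_borderedMinor n).comp
          (f := fun z : Fin (n + 1) → ℝ => (z k, y, k.removeNth z)) ?_
        refine (continuous_apply k).prodMk (continuous_const.prodMk ?_)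
        exact continuous_pi fun j => continuous_apply _
    · refine Eventually.of_forall fun z => ?_
      rw [norm_mul]
      exact mul_le_mul (h.bound _ _) (h.norm_borderedMinor_le _ _ _ _) (norm_nonneg _) h.nonneg
  rw [integral_sub ((h.integrableOn_kernelMinor (n + 1) t).const_mul _)
    (integrable_finsetSum _ fun k _ => hi k), integral_const_mul,
    integral_finsetSum _ fun k _ => hi k]
  congr 1
  have : ∀ k : Fin (n + 1), ∫ z in cube (n + 1) t,
      K x (z k) * borderedMinor K n (z k) y (k.removeNth z)
      = ∫ w in (0)..t, K x w * minorIntegral K n t w y := fun k => by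
    rw [integral_cube_succ n t k (hi k), intervalIntegral.integral_of_le ht.le,
      integral_Ioc_eq_integral_Ioo]
    refine integral_congr_ae (Eventually.of_forall fun w => ?_)
    simp only [Fin.insertNth_apply_same, Fin.removeNth_insertNth]
    rw [integral_const_mul, minorIntegral_eq K n ht]
  simp [this]

end IsNiceKernel

end

/-! ### The derivative of the determinant, and Fredholm's identity. -/

noncomputable section

theorem hasSum_intervalIntegral_of_bound {f : ℕ → ℝ → ℂ} {F : ℝ → ℂ} {b : ℕ → ℝ} {a t : ℝ}
    (hc : ∀ n, Continuous (f n)) (hb : ∀ n, ∀ x ∈ uIoc a t, ‖f n x‖ ≤ b n) (hs : Summable b)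
    (hF : ∀ x, HasSum (fun n => f n x) (F x)) :
    HasSum (fun n => ∫ x in a..t, f n x) (∫ x in a..t, F x) :=
  intervalIntegral.hasSum_integral_of_dominated_convergence (fun n _ => b n)
    (fun n => (hc n).aestronglyMeasurable) (fun n => Eventually.of_forall (hb n))
    (Eventually.of_forall fun _ _ => hs) intervalIntegrable_const
    (Eventually.of_forall fun x _ => hF x)

/-- The part of the cube where the `k`-th coordinate is the largest. -/
def maxRegion (n : ℕ) (k : Fin (n + 1)) : Set (Fin (n + 1) → ℝ) :=
  {z | ∀ j : Fin n, z (k.succAbove j) < z k}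

theorem measurableSet_maxRegion (n : ℕ) (k : Fin (n + 1)) : MeasurableSet (maxRegion n k) := by
  rw [maxRegion, ofPred_forall]
  exact MeasurableSet.iInter fun j =>
    measurableSet_lt (measurable_pi_apply _) (measurable_pi_apply _)

theorem pairwise_disjoint_maxRegion (n : ℕ) : Pairwise (Function.onFun Disjoint (maxRegion n)) := by
  intro k l hkl
  refine Set.disjoint_left.2 fun z hz hz' => ?_
  obtain ⟨j, hj⟩ := Fin.exists_succAbove_eq hkl
  obtain ⟨i, hi⟩ := Fin.exists_succAbove_eq hkl.symm
  have h1 := hz i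
  have h2 := hz' j
  rw [hi] at h1
  rw [hj] at h2
  exact lt_asymm h1 h2

theorem volume_setOf_eq {n : ℕ} {i j : Fin n} (hij : i ≠ j) :
    volume {z : Fin n → ℝ | z i = z j} = 0 := by
  let φ : (Fin n → ℝ) →ₗ[ℝ] ℝ := LinearMap.proj (R := ℝ) (φ := fun _ => ℝ) i - LinearMap.proj (R := ℝ) (φ := fun _ => ℝ) j
  have : {z : Fin n → ℝ | z i = z j} = (LinearMap.ker φ : Set (Fin n → ℝ)) := by
    ext z; simp [φ, sub_eq_zero]
  rw [this]
  refine Measure.addHaar_submodule volume _ fun h => ?_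
  have h1 : (Pi.single i 1 : Fin n → ℝ) ∈ LinearMap.ker φ := h ▸ Submodule.mem_top
  simp [φ, hij.symm] at h1

theorem ae_mem_iUnion_maxRegion (n : ℕ) :
    ∀ᵐ z : Fin (n + 1) → ℝ, z ∈ ⋃ k, maxRegion n k := by
  have h : ∀ᵐ z : Fin (n + 1) → ℝ, ∀ i j : Fin (n + 1), i ≠ j → z i ≠ z j := by
    refine ae_all_iff.2 fun i => ae_all_iff.2 fun j => ?_
    by_cases hij : i = j
    · simp [hij]
    · filter_upwards [(compl_mem_ae_iff.2 (volume_setOf_eq hij))] with z hz _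
      exact hz
  filter_upwards [h] with z hz
  obtain ⟨k, -, hk⟩ := Finset.exists_max_image Finset.univ z ⟨0, Finset.mem_univ _⟩
  exact mem_iUnion.2 ⟨k, fun j =>
    lt_of_le_of_ne (hk _ (Finset.mem_univ _)) (hz _ _ (Fin.succAbove_ne k j))⟩

/-- Almost every point has a unique largest coordinate, since two coordinates agree only on a
hyperplane. If the k-th coordinate is the largest and equals s, the others range over (0, s)ⁿ. This
form makes t appear only as the upper limit of the outer integral. -/
theorem integral_cube_max (n : ℕ) {t : ℝ} {f : (Fin (n + 1) → ℝ) → ℂ}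
    (hf : IntegrableOn f (cube (n + 1) t)) :
    ∫ z in cube (n + 1) t, f z
      = ∑ k : Fin (n + 1), ∫ s in Ioo 0 t, ∫ z in cube n s, f (k.insertNth s z) := by
  have h1 : ∫ z in cube (n + 1) t, f z
      = ∑ k : Fin (n + 1), ∫ z in cube (n + 1) t, (maxRegion n k).indicator f z := by
    have h2 : ∀ k, ∫ z in cube (n + 1) t, (maxRegion n k).indicator f z
        = ∫ z in maxRegion n k, f z ∂(volume.restrict (cube (n + 1) t)) := fun k =>
      integral_indicator (measurableSet_maxRegion n k)
    simp_rw [h2]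
    rw [← integral_iUnion_fintype (measurableSet_maxRegion n) (pairwise_disjoint_maxRegion n)
      (fun k => hf.integrableOn), Measure.restrict_eq_self_of_ae_mem
        (ae_restrict_of_ae (s := cube (n + 1) t) (ae_mem_iUnion_maxRegion n))]
  rw [h1]
  refine Finset.sum_congr rfl fun k _ => ?_
  rw [integral_cube_succ n t k (Integrable.indicator hf (measurableSet_maxRegion n k))]
  refine setIntegral_congr_fun measurableSet_Ioo fun s hs => ?_
  have h3 : ∀ z ∈ cube n t, (maxRegion n k).indicator f (k.insertNth s z)
      = (cube n s).indicator (fun z => f (k.insertNth s z)) z := by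
    intro z hz
    have hz' : ∀ j, 0 < z j := fun j => (hz j (mem_univ j)).1
    by_cases h : z ∈ cube n s
    · rw [indicator_of_mem h, indicator_of_mem]
      intro j
      simpa using (h j (mem_univ j)).2
    · rw [indicator_of_notMem h, indicator_of_notMem]
      intro h'
      refine h fun j _ => ⟨hz' j, ?_⟩
      simpa using h' j
  rw [setIntegral_congr_fun (measurableSet_cube n t) h3,
    setIntegral_indicator (measurableSet_cube n s), inter_eq_self_of_subset_right]
  exact Set.pi_mono fun _ _ => Ioo_subset_Ioo_right hs.2.le

namespace IsNiceKernel

variable {K : ℝ → ℝ → ℂ} {M : ℝ}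

/-- By the symmetry of the minors, each of the n + 1 choices of the largest coordinate contributes
the same amount. -/
theorem detIntegral_succ (h : IsNiceKernel K M) (n : ℕ) {t : ℝ} (ht : 0 < t) :
    detIntegral K (n + 1) t = (n + 1) * ∫ s in (0)..t, minorIntegral K n s s s := by
  rw [detIntegral_eq K _ ht, integral_cube_max n (h.integrableOn_kernelMinor (n + 1) t)]
  simp_rw [kernelMinor_insertNth]
  have : ∫ s in Ioo 0 t, ∫ z in cube n s, borderedMinor K n s s z
      = ∫ s in (0)..t, minorIntegral K n s s s := by
    rw [intervalIntegral.integral_of_le ht.le, integral_Ioc_eq_integral_Ioo]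
    refine setIntegral_congr_fun measurableSet_Ioo fun s hs => ?_
    simp only [minorIntegral_eq K n hs.1]
  simp [this]

theorem norm_detIntegral_succ_le (h : IsNiceKernel K M) (n : ℕ) (t : ℝ) :
    ‖detIntegral K (n + 1) t‖ ≤ |t| ^ (n + 1) * (Real.sqrt (n + 1 : ℕ) * M) ^ (n + 1) := by
  rw [detIntegral, norm_mul, norm_pow, Complex.norm_real, Real.norm_eq_abs]
  refine mul_le_mul_of_nonneg_left ?_ (by positivity)
  have := norm_setIntegral_le_of_norm_le_const (volume_cube_lt_top (n + 1) 1)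
    (fun z _ => h.norm_kernelMinor_le (n + 1) (t • z))
  simpa [Measure.real, volume_cube] using this

theorem norm_detTerm_succ_le (h : IsNiceKernel K M) (n : ℕ) (t : ℝ) :
    ‖(-1) ^ (n + 1) / ((n + 1).factorial : ℂ) * detIntegral K (n + 1) t‖
      ≤ |t| * minorBound M |t| n := by
  have h1 := h.norm_detIntegral_succ_le n t
  have h0 := h.nonneg
  have hf : (n.factorial : ℝ) ≤ ((n + 1).factorial : ℝ) := by
    exact_mod_cast Nat.factorial_le n.le_succ
  rw [norm_mul, norm_div, norm_pow, norm_neg, norm_one, one_pow, Complex.norm_natCast, minorBound,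
    one_div_mul_eq_div, mul_div_assoc']
  refine (div_le_div_of_nonneg_right h1 (by positivity)).trans ?_
  rw [show |t| * (|t| ^ n * (Real.sqrt (n + 1 : ℕ) * M) ^ (n + 1))
    = |t| ^ (n + 1) * (Real.sqrt (n + 1 : ℕ) * M) ^ (n + 1) by ring]
  gcongr

theorem hasSum_fredDet (h : IsNiceKernel K M) (t : ℝ) :
    HasSum (fun n : ℕ => (-1) ^ n / (n.factorial : ℂ) * detIntegral K n t) (fredDet K t) := by
  refine Summable.hasSum ((summable_nat_add_iff 1).1 ?_)
  exact Summable.of_norm_bounded ((summable_minorBound h.nonneg (abs_nonneg t)).mul_left |t|)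
    fun n => h.norm_detTerm_succ_le n t

/-- Summing `detIntegral_succ`: the factor n + 1 turns 1/(n + 1)! into 1/n!, and the shift of the
index gives the minus sign. Differentiated, this says D' = -N(t; t, t), with N the first minor. -/
theorem fredDet_eq_one_sub (h : IsNiceKernel K M) {t : ℝ} (ht : 0 < t) :
    fredDet K t = 1 - ∫ s in (0)..t, fredMinor K s s s := by
  have h1 := h.hasSum_fredDet t
  have h2 := (hasSum_nat_add_iff' 1).2 h1
  have h3 : HasSum (fun n : ℕ => ∫ s in (0)..t, (-1) ^ n / (n.factorial : ℂ)
      * minorIntegral K n s s s) (∫ s in (0)..t, fredMinor K s s s) := by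
    refine hasSum_intervalIntegral_of_bound (b := minorBound M t) (fun n => ?_)
      (fun n x hx => ?_) (summable_minorBound h.nonneg ht.le) fun s => h.hasSum_fredMinor s s s
    · exact continuous_const.mul ((h.continuous_minorIntegral n).comp
        (by fun_prop : Continuous fun s : ℝ => (s, s, s)))
    · rw [uIoc_of_le ht.le] at hx
      exact (h.norm_minorTerm_le n x x x).trans (minorBound_mono h.nonneg (abs_nonneg x)
        (by rw [abs_of_pos hx.1]; exact hx.2) n)
  have h4 := h2.unique (a₂ := -∫ s in (0)..t, fredMinor K s s s) (by
    refine h3.neg.congr_fun fun n => ?_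
    rw [h.detIntegral_succ n ht, intervalIntegral.integral_const_mul, Nat.factorial_succ]
    have : (n.factorial : ℂ) ≠ 0 := by exact_mod_cast n.factorial_ne_zero
    have : (n + 1 : ℂ) ≠ 0 := by exact_mod_cast n.succ_ne_zero
    push_cast
    field_simp
    ring)
  simp only [Finset.sum_range_one, pow_zero, Nat.factorial_zero, Nat.cast_one, div_one, one_mul,
    detIntegral_zero] at h4
  linear_combination h4

theorem fredDet_zero (K : ℝ → ℝ → ℂ) : fredDet K 0 = 1 := by
  rw [fredDet, tsum_eq_single 0]
  · simp [detIntegral_zero]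
  · intro n hn
    simp [detIntegral, hn]

theorem continuous_fredMinor_diag (h : IsNiceKernel K M) :
    Continuous fun s => fredMinor K s s s :=
  h.continuous_fredMinor.comp (by fun_prop : Continuous fun s : ℝ => (s, s, s))

theorem hasDerivAt_fredDet (h : IsNiceKernel K M) {t : ℝ} (ht : 0 < t) :
    HasDerivAt (fredDet K) (-fredMinor K t t t) t := by
  have h1 : HasDerivAt (fun t => 1 - ∫ s in (0)..t, fredMinor K s s s) (-fredMinor K t t t) t := by
    have := (h.continuous_fredMinor_diag.integral_hasStrictDerivAt 0 t).hasDerivAt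
    simpa using this.const_sub 1
  refine h1.congr_of_eventuallyEq ?_
  filter_upwards [lt_mem_nhds ht] with s hs using h.fredDet_eq_one_sub hs

/-- Fredholm's identity N = KD + KN, obtained by summing `minorIntegral_succ` over n. The terms of
index 0 are split off, where both sides have K x y. -/
theorem fredMinor_eq (h : IsNiceKernel K M) {t : ℝ} (ht : 0 ≤ t) (x y : ℝ) :
    fredMinor K t x y = K x y * fredDet K t + ∫ w in (0)..t, K x w * fredMinor K t w y := by
  rcases ht.eq_or_lt with rfl | ht
  · rw [fredDet_zero, fredMinor, tsum_eq_single 0]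
    · simp [minorIntegral_zero]
    · intro n hn
      simp [minorIntegral, hn]
  have h3 : HasSum (fun n : ℕ => ∫ w in (0)..t, K x w * ((-1) ^ n / (n.factorial : ℂ)
      * minorIntegral K n t w y)) (∫ w in (0)..t, K x w * fredMinor K t w y) := by
    refine hasSum_intervalIntegral_of_bound (b := fun n => M * minorBound M |t| n) (fun n => ?_)
      (fun n w _ => ?_) ((summable_minorBound h.nonneg (abs_nonneg t)).mul_left M)
      fun w => (h.hasSum_fredMinor t w y).mul_left _
    · exact (h.continuous_comp₂ continuous_const continuous_id).mul
        (continuous_const.mul ((h.continuous_minorIntegral n).comp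
        (by fun_prop : Continuous fun s : ℝ => (t, s, y))))
    · rw [norm_mul]
      exact mul_le_mul (h.bound _ _) (h.norm_minorTerm_le n _ _ _) (norm_nonneg _) h.nonneg
  have h1 := (hasSum_nat_add_iff' 1).2 (h.hasSum_fredMinor t x y)
  have h2 := ((hasSum_nat_add_iff' 1).2 (h.hasSum_fredDet t)).mul_left (K x y)
  have h4 := h1.unique ((h2.add h3).congr_fun fun n => by
    rw [h.minorIntegral_succ n ht, Nat.factorial_succ]
    have e : ∫ w in (0)..t, K x w * ((-1) ^ n / (n.factorial : ℂ) * minorIntegral K n t w y)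
        = (-1) ^ n / (n.factorial : ℂ) * ∫ w in (0)..t, K x w * minorIntegral K n t w y := by
      rw [← intervalIntegral.integral_const_mul]
      congr 1; ext w; ring
    rw [e]
    have : (n.factorial : ℂ) ≠ 0 := by exact_mod_cast n.factorial_ne_zero
    have : (n + 1 : ℂ) ≠ 0 := by exact_mod_cast n.succ_ne_zero
    push_cast
    field_simp
    ring)
  simp only [Finset.sum_range_one, pow_zero, Nat.factorial_zero, Nat.cast_one, div_one, one_mul,
    detIntegral_zero, minorIntegral_zero] at h4
  linear_combination h4

end IsNiceKernel

end

/-! ### The resolvent kernel inverts 1 - K wherever the determinant is nonzero. -/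

noncomputable section

/-- Fubini's theorem for the composition of two bounded continuous kernels. -/
theorem integral_kernel_comp {μ ν : Measure ℝ} [IsFiniteMeasure μ]
    [IsFiniteMeasure ν] {A : ℝ → ℂ} {B : ℝ → ℝ → ℂ}
    {a b : ℝ} (hA : Continuous A) (hB : Continuous fun p : ℝ × ℝ => B p.1 p.2) (ha : ∀ z, ‖A z‖ ≤ a)
    (hb : ∀ z y, ‖B z y‖ ≤ b) {f : ℝ → ℂ} (hf : Integrable f ν) :
    ∫ z, A z * ∫ y, B z y * f y ∂ν ∂μ = ∫ y, (∫ z, A z * B z y ∂μ) * f y ∂ν := by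
  have hi : Integrable (Function.uncurry fun z y => A z * B z y * f y) (μ.prod ν) := by
    refine Integrable.bdd_mul (c := a * b) (hf.comp_snd μ) ?_ ?_
    · exact (Continuous.mul (hA.comp continuous_fst) hB).aestronglyMeasurable
    · refine Eventually.of_forall fun p => ?_
      rw [norm_mul]
      exact mul_le_mul (ha _) (hb _ _) (norm_nonneg _) ((norm_nonneg _).trans (ha 0))
  have hsw := integral_integral_swap hi
  calc _ = ∫ z, ∫ y, A z * B z y * f y ∂ν ∂μ := by
        refine integral_congr_ae (Eventually.of_forall fun z => ?_)
        simp only [mul_assoc]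
        exact (integral_const_mul _ _).symm
    _ = _ := by
        rw [hsw]
        refine integral_congr_ae (Eventually.of_forall fun y => ?_)
        exact integral_mul_const _ _

/-- The resolvent kernel `K (1 - K)⁻¹` on `(0, t)`. -/
def resKernel (K : ℝ → ℝ → ℂ) (t x y : ℝ) : ℂ := fredMinor K t x y / fredDet K t

namespace IsNiceKernel

variable {K : ℝ → ℝ → ℂ} {M : ℝ}

theorem exists_bound_resKernel (h : IsNiceKernel K M) (t : ℝ) :
    ∃ C, ∀ x y, ‖resKernel K t x y‖ ≤ C := by
  refine ⟨(∑' n, minorBound M |t| n) / ‖fredDet K t‖, fun x y => ?_⟩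
  rw [resKernel, norm_div]
  refine div_le_div_of_nonneg_right ?_ (norm_nonneg _)
  exact tsum_of_norm_bounded (summable_minorBound h.nonneg (abs_nonneg t)).hasSum
    fun n => h.norm_minorTerm_le n t x y

theorem continuous_resKernel (h : IsNiceKernel K M) (t : ℝ) :
    Continuous fun p : ℝ × ℝ => resKernel K t p.1 p.2 :=
  (h.continuous_fredMinor.comp (by fun_prop : Continuous fun p : ℝ × ℝ => (t, p.1, p.2))).div_const _

theorem continuous_resKernel_comp {X : Type*} [TopologicalSpace X] (h : IsNiceKernel K M) (t : ℝ)
    {f g : X → ℝ} (hf : Continuous f) (hg : Continuous g) :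
    Continuous fun x => resKernel K t (f x) (g x) := by
  have h1 : Continuous fun x => (t, f x, g x) := continuous_const.prodMk (hf.prodMk hg)
  exact (h.continuous_fredMinor.comp h1).div_const (fredDet K t)

theorem resKernel_symm (h : IsNiceKernel K M) (t x y : ℝ) :
    resKernel K t x y = resKernel K t y x := by
  rw [resKernel, resKernel, h.fredMinor_symm]

theorem resKernel_eq (h : IsNiceKernel K M) {t : ℝ} (ht : 0 ≤ t) (hD : fredDet K t ≠ 0)
    (x y : ℝ) : resKernel K t x y = K x y + ∫ w in (0)..t, K x w * resKernel K t w y := by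
  have : ∫ w in (0)..t, K x w * resKernel K t w y
      = (∫ w in (0)..t, K x w * fredMinor K t w y) / fredDet K t := by
    rw [← intervalIntegral.integral_div]
    simp only [resKernel, mul_div_assoc]
  rw [this, resKernel, h.fredMinor_eq ht]
  field_simp

theorem resKernel_eq' (h : IsNiceKernel K M) {t : ℝ} (ht : 0 ≤ t) (hD : fredDet K t ≠ 0)
    (x y : ℝ) : resKernel K t x y = K x y + ∫ w in (0)..t, resKernel K t x w * K w y := by
  rw [h.resKernel_symm, h.resKernel_eq ht hD, h.symm]
  congr 1
  refine intervalIntegral.integral_congr fun w _ => ?_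
  simp only [h.symm y w, h.resKernel_symm t w x, mul_comm]

theorem intervalIntegrable_kernel_mul {A : ℝ → ℂ} (hA : Continuous A) {f : ℝ → ℂ} {a b : ℝ}
    (hf : IntervalIntegrable f volume a b) : IntervalIntegrable (fun y => A y * f y) volume a b :=
  hf.continuousOn_mul hA.continuousOn

/-- If `(1 - K) f = g` on `(0, t]` then `f = (1 + R) g` there. -/
theorem eq_of_solution (h : IsNiceKernel K M) {t : ℝ} (ht : 0 ≤ t) (hD : fredDet K t ≠ 0)
    {f g : ℝ → ℂ} (hf : IntervalIntegrable f volume 0 t) (hg : IntervalIntegrable g volume 0 t)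
    (hfg : ∀ x ∈ Ioc 0 t, f x = g x + ∫ y in (0)..t, K x y * f y) :
    ∀ x ∈ Ioc 0 t, f x = g x + ∫ y in (0)..t, resKernel K t x y * g y := by
  intro x hx
  obtain ⟨C, hC⟩ := h.exists_bound_resKernel t
  have hR : Continuous fun z => resKernel K t x z :=
    h.continuous_resKernel_comp t continuous_const continuous_id
  have hKx : Continuous fun z => K x z := h.continuous_comp₂ continuous_const continuous_id
  -- Apply R to f = g + Kf. Because RK = R - K, the term Rf cancels and Kf = Rg remains.
  have h1 : ∫ z in (0)..t, resKernel K t x z * ∫ y in (0)..t, K z y * f y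
      = ∫ y in (0)..t, (∫ z in (0)..t, resKernel K t x z * K z y) * f y := by
    simp only [intervalIntegral.integral_of_le ht]
    exact integral_kernel_comp hR h.cont (hC x) h.bound hf.1
  have h2 : ∀ y, (∫ z in (0)..t, resKernel K t x z * K z y) = resKernel K t x y - K x y :=
    fun y => by rw [h.resKernel_eq' ht hD x y]; ring
  simp only [h2, sub_mul] at h1
  rw [intervalIntegral.integral_sub (intervalIntegrable_kernel_mul hR hf)
    (intervalIntegrable_kernel_mul hKx hf)] at h1
  have h3 : ∫ z in (0)..t, resKernel K t x z * g z = (∫ z in (0)..t, resKernel K t x z * f z)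
      - ∫ z in (0)..t, resKernel K t x z * ∫ y in (0)..t, K z y * f y := by
    have h4 : ∀ z ∈ uIoc 0 t, resKernel K t x z * g z = resKernel K t x z * f z
        - resKernel K t x z * ∫ y in (0)..t, K z y * f y := fun z hz => by
      rw [uIoc_of_le ht] at hz
      rw [hfg z hz]; ring
    rw [← intervalIntegral.integral_sub (intervalIntegrable_kernel_mul hR hf)]
    · exact intervalIntegral.integral_congr_ae (Eventually.of_forall h4)
    · refine ((intervalIntegrable_kernel_mul hR hf).sub
        (intervalIntegrable_kernel_mul hR hg)).congr ?_
      intro z hz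
      simp only [h4 z hz]
      ring
  rw [hfg x hx, h3, h1]
  ring

/-- `f = (1 + R) g` solves `(1 - K) f = g`. -/
theorem solution_of_resKernel (h : IsNiceKernel K M) {t : ℝ} (ht : 0 ≤ t) (hD : fredDet K t ≠ 0)
    {g : ℝ → ℂ} (hg : IntervalIntegrable g volume 0 t) (x : ℝ) :
    ∫ y in (0)..t, K x y * (g y + ∫ z in (0)..t, resKernel K t y z * g z)
      = ∫ y in (0)..t, resKernel K t x y * g y := by
  obtain ⟨C, hC⟩ := h.exists_bound_resKernel t
  have hR : Continuous fun z => resKernel K t x z :=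
    h.continuous_resKernel_comp t continuous_const continuous_id
  have hKx : Continuous fun z => K x z := h.continuous_comp₂ continuous_const continuous_id
  -- The mirror computation, now with KR = R - K: K(g + Rg) = Rg.
  have h1 : ∫ z in (0)..t, K x z * ∫ y in (0)..t, resKernel K t z y * g y
      = ∫ y in (0)..t, (∫ z in (0)..t, K x z * resKernel K t z y) * g y := by
    simp only [intervalIntegral.integral_of_le ht]
    exact integral_kernel_comp hKx (h.continuous_resKernel t) (h.bound x) hC hg.1
  have h2 : ∀ y, (∫ z in (0)..t, K x z * resKernel K t z y) = resKernel K t x y - K x y :=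
    fun y => by rw [h.resKernel_eq ht hD x y]; ring
  simp only [h2, sub_mul] at h1
  rw [intervalIntegral.integral_sub (intervalIntegrable_kernel_mul hR hg)
    (intervalIntegrable_kernel_mul hKx hg)] at h1
  have hRg : Continuous fun z => ∫ y in (0)..t, resKernel K t z y * g y := by
    simp only [intervalIntegral.integral_of_le ht]
    refine continuous_of_dominated (bound := fun y => C * ‖g y‖) (fun z => ?_) (fun z => ?_)
      (hg.1.norm.const_mul C) (Eventually.of_forall fun y => ?_)
    · exact ((h.continuous_resKernel_comp t continuous_const
        continuous_id).aestronglyMeasurable).mul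
          hg.1.aestronglyMeasurable
    · refine Eventually.of_forall fun y => ?_
      rw [norm_mul]
      exact mul_le_mul_of_nonneg_right (hC _ _) (norm_nonneg _)
    · exact (h.continuous_resKernel_comp t continuous_id continuous_const).mul continuous_const
  simp only [mul_add]
  have hi : IntervalIntegrable (fun z => K x z * ∫ y in (0)..t, resKernel K t z y * g y)
      volume 0 t := (hKx.mul hRg).intervalIntegrable 0 t
  rw [intervalIntegral.integral_add (intervalIntegrable_kernel_mul hKx hg) hi, h1]
  ring

end IsNiceKernel

end

/-! ### Dependence of (1 - K)⁻¹ on the endpoint t. -/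

noncomputable section

/-- Derivative at `t` of an integral over `[t, s]` whose integrand also depends on `s`. -/
theorem hasDerivAt_integral_moving {F : ℝ → ℝ → ℂ} {t : ℝ}
    (hF : ContinuousAt (fun p : ℝ × ℝ => F p.1 p.2) (t, t))
    (hi : ∀ᶠ s in 𝓝 t, IntervalIntegrable (F s) volume t s) :
    HasDerivAt (fun s => ∫ z in t..s, F s z) (F t t) t := by
  rw [hasDerivAt_iff_isLittleO, Asymptotics.isLittleO_iff]
  intro ε hε
  have h1 := Metric.continuousAt_iff.1 hF ε hε
  obtain ⟨δ, hδ, h2⟩ := h1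
  filter_upwards [hi, Metric.ball_mem_nhds t hδ] with s hs hsd
  have h3 : (∫ z in t..s, F s z) - (∫ z in t..t, F t z) - (s - t) • F t t
      = ∫ z in t..s, (F s z - F t t) := by
    rw [intervalIntegral.integral_sub hs intervalIntegrable_const]
    simp
  rw [h3, Real.norm_eq_abs]
  refine intervalIntegral.norm_integral_le_of_norm_le_const fun z hz => ?_
  rw [← dist_eq_norm]
  refine (h2 (x := (s, z)) ?_).le
  rw [Metric.mem_ball, Real.dist_eq] at hsd
  rw [Prod.dist_eq, max_lt_iff, Real.dist_eq, Real.dist_eq]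
  refine ⟨hsd, lt_of_le_of_lt ?_ hsd⟩
  exact abs_sub_left_of_mem_uIcc (uIoc_subset_uIcc hz)

/-- `(1 - K)⁻¹ f` on `(0, t)`, continued to the whole line. -/
def resSol (K : ℝ → ℝ → ℂ) (f : ℝ → ℂ) (t x : ℝ) : ℂ :=
  f x + ∫ z in (0)..t, resKernel K t x z * f z

/-- The bilinear pairing `⟨f, (1 - K)⁻¹ g⟩` on `(0, t)`. -/
def resPairing (K : ℝ → ℝ → ℂ) (f g : ℝ → ℂ) (t : ℝ) : ℂ :=
  ∫ x in (0)..t, f x * resSol K g t x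

namespace IsNiceKernel

variable {K : ℝ → ℝ → ℂ} {M : ℝ}

theorem continuous_detIntegral (h : IsNiceKernel K M) (n : ℕ) : Continuous (detIntegral K n) := by
  unfold detIntegral
  refine Continuous.mul (by fun_prop) ?_
  refine continuous_of_dominated (bound := fun _ => (Real.sqrt n * M) ^ n)
    (fun t => ?_) (fun t => ?_) (integrable_const _) ?_
  · exact ((h.continuous_kernelMinor n).comp (continuous_const_smul t)).aestronglyMeasurable
  · exact Eventually.of_forall fun z => h.norm_kernelMinor_le n _
  · exact Eventually.of_forall fun z => (h.continuous_kernelMinor n).comp (by fun_prop :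
      Continuous fun t : ℝ => t • z)

theorem continuous_fredDet (h : IsNiceKernel K M) : Continuous (fredDet K) := by
  have he : fredDet K = fun t => 1 + ∑' n : ℕ, (-1) ^ (n + 1) / ((n + 1).factorial : ℂ)
      * detIntegral K (n + 1) t := by
    ext t
    rw [fredDet, (h.hasSum_fredDet t).summable.tsum_eq_zero_add]
    simp [detIntegral_zero]
  rw [he]
  refine continuous_const.add (continuous_iff_continuousAt.2 fun t₀ => ?_)
  have hs : {t : ℝ | |t| < |t₀| + 1} ∈ 𝓝 t₀ :=
    (isOpen_lt (by fun_prop) (by fun_prop)).mem_nhds (by simp)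
  refine ContinuousOn.continuousAt
    (continuousOn_tsum (u := fun n => (|t₀| + 1) * minorBound M (|t₀| + 1) n)
    (fun n => (continuous_const.mul (h.continuous_detIntegral (n + 1))).continuousOn)
    ((summable_minorBound h.nonneg (by positivity)).mul_left _) fun n t ht => ?_) hs
  have ht' : |t| ≤ |t₀| + 1 := le_of_lt ht
  refine (h.norm_detTerm_succ_le n t).trans ?_
  exact mul_le_mul ht' (minorBound_mono h.nonneg (abs_nonneg _) ht' n)
    (minorBound_nonneg h.nonneg (abs_nonneg _) n) (by positivity)

variable {f g : ℝ → ℂ}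

theorem fredDet_mul_resSol {t : ℝ} (hD : fredDet K t ≠ 0) (x : ℝ) :
    fredDet K t * resSol K f t x
      = fredDet K t * f x + ∫ z in (0)..t, fredMinor K t x z * f z := by
  rw [resSol, mul_add, ← intervalIntegral.integral_const_mul]
  congr 1
  refine intervalIntegral.integral_congr fun z _ => ?_
  simp only [resKernel]
  field_simp

theorem continuous_integral_fredMinor (h : IsNiceKernel K M) (hf : Continuous f) :
    Continuous fun p : ℝ × ℝ => ∫ z in (0)..p.1, fredMinor K p.1 p.2 z * f z := by
  refine intervalIntegral.continuous_parametric_intervalIntegral_of_continuous ?_ continuous_fst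
  have h1 : Continuous fun q : (ℝ × ℝ) × ℝ => (q.1.1, q.1.2, q.2) := by fun_prop
  exact (h.continuous_fredMinor.comp h1).mul (hf.comp continuous_snd)

theorem resSol_eq (K : ℝ → ℝ → ℂ) (f : ℝ → ℂ) (t x : ℝ) : resSol K f t x
    = f x + (∫ z in (0)..t, fredMinor K t x z * f z) / fredDet K t := by
  rw [resSol, ← intervalIntegral.integral_div]
  congr 1
  refine intervalIntegral.integral_congr fun z _ => ?_
  simp only [resKernel]
  ring

theorem continuousAt_resSol (h : IsNiceKernel K M) (hf : Continuous f) {t : ℝ}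
    (hD : fredDet K t ≠ 0) (x : ℝ) :
    ContinuousAt (fun p : ℝ × ℝ => resSol K f p.1 p.2) (t, x) := by
  simp only [resSol_eq]
  refine ContinuousAt.add (hf.comp continuous_snd).continuousAt (ContinuousAt.div ?_ ?_ hD)
  · exact (h.continuous_integral_fredMinor hf).continuousAt
  · exact (h.continuous_fredDet.comp continuous_fst).continuousAt

theorem continuous_resSol (h : IsNiceKernel K M) (hf : Continuous f) (t : ℝ) :
    Continuous (resSol K f t) := by
  have he : resSol K f t
      = fun x => f x + (∫ z in (0)..t, fredMinor K t x z * f z) / fredDet K t :=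
    funext (resSol_eq K f t)
  rw [he]
  exact hf.add (((h.continuous_integral_fredMinor hf).comp
    (by fun_prop : Continuous fun x : ℝ => (t, x))).div_const _)

theorem resSol_solves (h : IsNiceKernel K M) (hf : Continuous f) {t : ℝ} (ht : 0 ≤ t)
    (hD : fredDet K t ≠ 0) (x : ℝ) :
    resSol K f t x = f x + ∫ z in (0)..t, K x z * resSol K f t z := by
  have := h.solution_of_resKernel ht hD (hf.intervalIntegrable 0 t) x
  simp only [resSol] at this ⊢
  rw [this]

theorem eq_resSol (h : IsNiceKernel K M) {t : ℝ} (ht : 0 ≤ t)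
    (hD : fredDet K t ≠ 0) {F : ℝ → ℂ} (hF : Continuous F) (hf : Continuous f)
    (hFf : ∀ x ∈ Ioc 0 t, F x = f x + ∫ y in (0)..t, K x y * F y) :
    ∀ x ∈ Ioc 0 t, F x = resSol K f t x :=
  h.eq_of_solution ht hD (hF.intervalIntegrable 0 t) (hf.intervalIntegrable 0 t) hFf

/-- Write Q_s for `resSol K f s`. Splitting its integral at t, Q_s solves the equation on (0, t)
with source f + ∫_t^s K(·, z)Q_s(z)dz, and 1 + R_t turns K(·, z) into R_t(·, z). As this difference
formula is exact, R_t never has to be differentiated in t. -/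
theorem resSol_sub (h : IsNiceKernel K M) (hf : Continuous f) {t s : ℝ} (ht : 0 ≤ t) (hs : 0 ≤ s)
    (hDt : fredDet K t ≠ 0) (hDs : fredDet K s ≠ 0) (x : ℝ) :
    resSol K f s x - resSol K f t x = ∫ z in t..s, resKernel K t x z * resSol K f s z := by
  obtain ⟨C, hC⟩ := h.exists_bound_resKernel t
  set F := resSol K f s with hFdef
  have hF : Continuous F := h.continuous_resSol hf s
  have hR : Continuous fun z => resKernel K t x z :=
    h.continuous_resKernel_comp t continuous_const continuous_id
  have hKx : Continuous fun z => K x z := h.continuous_comp₂ continuous_const continuous_id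
  have hsol : ∀ z, f z = F z - ∫ w in (0)..s, K z w * F w := fun z => by
    rw [hFdef, h.resSol_solves hf hs hDs z]; ring
  have h1 : ∫ z in (0)..t, resKernel K t x z * ∫ w in (0)..s, K z w * F w
      = ∫ w in (0)..s, (∫ z in (0)..t, resKernel K t x z * K z w) * F w := by
    simp only [intervalIntegral.integral_of_le ht, intervalIntegral.integral_of_le hs]
    exact integral_kernel_comp hR h.cont (hC x) h.bound (hF.intervalIntegrable 0 s).1
  have h2 : ∀ y, (∫ z in (0)..t, resKernel K t x z * K z y) = resKernel K t x y - K x y :=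
    fun y => by rw [h.resKernel_eq' ht hDt x y]; ring
  have iR : ∀ a b, IntervalIntegrable (fun z => resKernel K t x z * F z) volume a b :=
    fun a b => (hR.mul hF).intervalIntegrable a b
  have iK : ∀ a b, IntervalIntegrable (fun z => K x z * F z) volume a b :=
    fun a b => (hKx.mul hF).intervalIntegrable a b
  simp only [h2, sub_mul] at h1
  rw [intervalIntegral.integral_sub (iR 0 s) (iK 0 s)] at h1
  have hKF : Continuous fun z => ∫ w in (0)..s, K z w * F w := by
    have : (fun z => ∫ w in (0)..s, K z w * F w) = fun z => F z - f z := by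
      ext z; rw [hsol z]; ring
    rw [this]; exact hF.sub hf
  have h3 : ∫ z in (0)..t, resKernel K t x z * f z = (∫ z in (0)..t, resKernel K t x z * F z)
      - ∫ z in (0)..t, resKernel K t x z * ∫ w in (0)..s, K z w * F w := by
    have i2 : IntervalIntegrable (fun z => resKernel K t x z * ∫ w in (0)..s, K z w * F w)
      volume 0 t := (hR.mul hKF).intervalIntegrable 0 t
    rw [← intervalIntegral.integral_sub (iR 0 t) i2]
    refine intervalIntegral.integral_congr fun z _ => ?_
    rw [hsol z]; ring
  have h4 := intervalIntegral.integral_add_adjacent_intervals (iR 0 t) (iR t s)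
  have h5 : resSol K f t x = f x + ∫ z in (0)..t, resKernel K t x z * f z := rfl
  rw [h5, h3, h1, hsol x]
  linear_combination -h4

/-- Insert `resSol_sub` under the pairing with f and exchange integrals; by the symmetry of R_t,
integrating against f produces (1 + R_t)f on the interval between t and s. -/
theorem resPairing_sub (h : IsNiceKernel K M) (hf : Continuous f) (hg : Continuous g) {t s : ℝ}
    (ht : 0 ≤ t) (hs : 0 ≤ s) (hDt : fredDet K t ≠ 0) (hDs : fredDet K s ≠ 0) :
    resPairing K f g s - resPairing K f g t
      = ∫ z in t..s, resSol K f t z * resSol K g s z := by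
  obtain ⟨C, hC⟩ := h.exists_bound_resKernel t
  set G := resSol K g s with hGdef
  have hG : Continuous G := h.continuous_resSol hg s
  have hGt := h.continuous_resSol hg t
  have hR2 : Continuous fun p : ℝ × ℝ => resKernel K t p.1 p.2 := h.continuous_resKernel t
  have iG : ∀ a b, IntervalIntegrable (fun z => f z * G z) volume a b :=
    fun a b => (hf.mul hG).intervalIntegrable a b
  have h1 : ∫ x in (0)..t, f x * ∫ z in t..s, resKernel K t x z * G z
      = ∫ z in t..s, (∫ x in (0)..t, resKernel K t z x * f x) * G z := by
    have e : ∀ x, f x * ∫ z in t..s, resKernel K t x z * G z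
        = ∫ z in t..s, f x * (resKernel K t x z * G z) := fun x =>
      (intervalIntegral.integral_const_mul _ _).symm
    simp_rw [e]
    rw [intervalIntegral_intervalIntegral_swap]
    · refine intervalIntegral.integral_congr fun z _ => ?_
      rw [← intervalIntegral.integral_mul_const]
      refine intervalIntegral.integral_congr fun x _ => ?_
      rw [h.resKernel_symm t z x]; ring
    · refine ((Continuous.mul (hf.comp continuous_fst) (hR2.mul (hG.comp
        continuous_snd))).continuousOn.integrableOn_compact
          (isCompact_uIcc.prod isCompact_uIcc)).mono_set
          (prod_mono uIoc_subset_uIcc uIoc_subset_uIcc)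
  have h2 : ∫ x in (0)..t, f x * (G x - resSol K g t x)
      = ∫ x in (0)..t, f x * ∫ z in t..s, resKernel K t x z * G z := by
    refine intervalIntegral.integral_congr fun x _ => ?_
    rw [h.resSol_sub hg ht hs hDt hDs x]
  have h3 : ∫ x in (0)..t, f x * (G x - resSol K g t x)
      = (∫ x in (0)..t, f x * G x) - resPairing K f g t := by
    have i2 : IntervalIntegrable (fun x => f x * resSol K g t x) volume 0 t :=
      (hf.mul hGt).intervalIntegrable 0 t
    rw [resPairing, ← intervalIntegral.integral_sub (iG 0 t) i2]
    simp only [mul_sub]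
  have h4 := intervalIntegral.integral_add_adjacent_intervals (iG 0 t) (iG t s)
  have h5 : Continuous fun z => (∫ x in (0)..t, resKernel K t z x * f x) * G z := by
    have : (fun z => (∫ x in (0)..t, resKernel K t z x * f x) * G z)
        = fun z => (resSol K f t z - f z) * G z := by
      ext z; simp [resSol]
    rw [this]
    exact ((h.continuous_resSol hf t).sub hf).mul hG
  have h6 : ∫ z in t..s, resSol K f t z * G z = (∫ z in t..s, f z * G z)
      + ∫ z in t..s, (∫ x in (0)..t, resKernel K t z x * f x) * G z := by
    rw [← intervalIntegral.integral_add (iG t s) (h5.intervalIntegrable t s)]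
    simp only [resSol, add_mul]
  have h7 : resPairing K f g s = ∫ x in (0)..s, f x * G x := rfl
  rw [h6, ← h1, ← h2, h3, h7]
  linear_combination -h4

theorem eventually_fredDet_ne_zero (h : IsNiceKernel K M) {t : ℝ} (hD : fredDet K t ≠ 0) :
    ∀ᶠ s in 𝓝 t, fredDet K s ≠ 0 :=
  h.continuous_fredDet.continuousAt.eventually_ne hD

theorem hasDerivAt_resPairing (h : IsNiceKernel K M) (hf : Continuous f) (hg : Continuous g)
    {t : ℝ} (ht : 0 < t) (hD : fredDet K t ≠ 0) :
    HasDerivAt (resPairing K f g) (resSol K f t t * resSol K g t t) t := by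
  have h1 : HasDerivAt (fun s => ∫ z in t..s, resSol K f t z * resSol K g s z)
      (resSol K f t t * resSol K g t t) t := by
    refine hasDerivAt_integral_moving (F := fun s z => resSol K f t z * resSol K g s z) ?_ ?_
    · exact ((h.continuous_resSol hf t).comp continuous_snd).continuousAt.mul
        (h.continuousAt_resSol hg hD t)
    · exact Eventually.of_forall fun s => ((h.continuous_resSol hf t).mul
        (h.continuous_resSol hg s)).intervalIntegrable t s
  refine (h1.const_add (resPairing K f g t)).congr_of_eventuallyEq ?_
  filter_upwards [lt_mem_nhds ht, h.eventually_fredDet_ne_zero hD] with s hs hDs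
  rw [← h.resPairing_sub hf hg ht.le hs.le hD hDs]
  ring

/-- By `resSol_sub`, Q_s(s) = Q_t(s) + ∫_t^s R_t(s, z)Q_s(z)dz. The first term contributes the
x-derivative d of Q_t at t, the second its integrand at s = z = t. -/
theorem hasDerivAt_resSol_diag (h : IsNiceKernel K M) (hf : Continuous f)
    {t : ℝ} (ht : 0 < t) (hD : fredDet K t ≠ 0) {d : ℂ} (hd : HasDerivAt (resSol K f t) d t) :
    HasDerivAt (fun s => resSol K f s s) (resKernel K t t t * resSol K f t t + d) t := by
  have h1 : HasDerivAt (fun s => ∫ z in t..s, resKernel K t s z * resSol K f s z)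
      (resKernel K t t t * resSol K f t t) t := by
    refine hasDerivAt_integral_moving (F := fun s z => resKernel K t s z * resSol K f s z) ?_ ?_
    · exact (h.continuous_resKernel t).continuousAt.mul (h.continuousAt_resSol hf hD t)
    · exact Eventually.of_forall fun s => ((h.continuous_resKernel_comp t continuous_const
        continuous_id).mul (h.continuous_resSol hf s)).intervalIntegrable t s
  refine (h1.add hd).congr_of_eventuallyEq ?_
  filter_upwards [lt_mem_nhds ht, h.eventually_fredDet_ne_zero hD] with s hs hDs
  simp only [Pi.add_apply]
  rw [← h.resSol_sub hf ht.le hs.le hD hDs s]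
  ring

end IsNiceKernel

end

/-! ### The action of x(1 - x)d/dx on (1 - K)⁻¹f for an integrable kernel. -/

noncomputable section

theorem hasDerivAt_ofReal (x : ℝ) : HasDerivAt (fun s : ℝ => (s : ℂ)) 1 x := by
  simpa using (hasDerivAt_id x).ofReal_comp

/-- Continuous extensions to the real line of a solution `(f, g)` of
`x (1 - x) (f, g)' = (A₀ + A₁ x) (f, g)` on `(0, T)`, of its integrable kernel `K` and of
`Λ = x (1 - x) ∂K/∂x`. -/
structure IsTWData (a₀ b₀ c₀ a₁ b₁ c₁ : ℂ) (T M : ℝ) (f g : ℝ → ℂ) (K Λ : ℝ → ℝ → ℂ) : Prop where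
  nice : IsNiceKernel K M
  lt_one : T < 1
  cont_f : Continuous f
  cont_g : Continuous g
  cont_Λ : Continuous fun p : ℝ × ℝ => Λ p.1 p.2
  f_zero : f 0 = 0
  g_zero : g 0 = 0
  kernel : ∀ x ∈ Icc 0 T, ∀ y ∈ Icc 0 T, ((x : ℂ) - y) * K x y = f x * g y - g x * f y
  deriv_f : ∀ x ∈ Ioo 0 T, HasDerivAt f
    (((a₀ + a₁ * x) * f x + (b₀ + b₁ * x) * g x) / ((x : ℂ) * (1 - x))) x
  deriv_g : ∀ x ∈ Ioo 0 T, HasDerivAt g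
    ((-(c₀ + c₁ * x) * f x - (a₀ + a₁ * x) * g x) / ((x : ℂ) * (1 - x))) x
  deriv_K : ∀ x ∈ Ioo 0 T, ∀ y ∈ Icc 0 T,
    HasDerivAt (fun s => K s y) (Λ x y / ((x : ℂ) * (1 - x))) x
  Λ_add : ∀ x ∈ Ioo 0 T, ∀ y ∈ Ioo 0 T, Λ x y + Λ y x + (1 - x - y) * K x y
    = c₁ * (f x * f y) + a₁ * (f x * g y + g x * f y) + b₁ * (g x * g y)

theorem hasDerivAt_integral_of_continuous {F G : ℝ → ℝ → ℂ} {T t x : ℝ} (hx : x ∈ Ioo 0 T)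
    (hF : Continuous fun p : ℝ × ℝ => F p.1 p.2) (hG : Continuous fun p : ℝ × ℝ => G p.1 p.2)
    (ht : 0 ≤ t)
    (hd : ∀ s ∈ Ioo 0 T, ∀ z ∈ Ioc 0 t, HasDerivAt (fun s => F s z)
      (G s z / ((s : ℂ) * (1 - s))) s) (hT : T < 1) :
    HasDerivAt (fun s => ∫ z in (0)..t, F s z) ((∫ z in (0)..t, G x z) / ((x : ℂ) * (1 - x))) x := by
  obtain ⟨ε, hε, hball⟩ := Metric.isOpen_iff.1 isOpen_Ioo x hx
  have hcb : Metric.closedBall x (ε / 2) ⊆ Ioo 0 T :=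
    (Metric.closedBall_subset_ball (by linarith)).trans hball
  have hne : ∀ s ∈ Ioo 0 T, ((s : ℂ) * (1 - s)) ≠ 0 := fun s hs => by
    have h1 : (s : ℂ) ≠ 0 := by exact_mod_cast hs.1.ne'
    have h2 : (1 - (s : ℂ)) ≠ 0 := by
      have : (1 - s : ℝ) ≠ 0 := by linarith [hs.2]
      exact_mod_cast this
    exact mul_ne_zero h1 h2
  have hcont : ContinuousOn (fun p : ℝ × ℝ => G p.1 p.2 / ((p.1 : ℂ) * (1 - p.1)))
      (Metric.closedBall x (ε / 2) ×ˢ Icc 0 t) := by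
    refine hG.continuousOn.div (by fun_prop) fun p hp => hne p.1 (hcb hp.1)
  obtain ⟨C, hC⟩ := ((isCompact_closedBall x (ε / 2)).prod
    (isCompact_Icc (a := (0 : ℝ)) (b := t))).exists_bound_of_continuousOn hcont
  have hFc : ∀ s, Continuous (F s) := fun s => hF.comp (by fun_prop : Continuous fun z : ℝ => (s, z))
  have hGc : Continuous (G x) := hG.comp (by fun_prop : Continuous fun z : ℝ => (x, z))
  have := (intervalIntegral.hasDerivAt_integral_of_dominated_loc_of_deriv_le
    (F := F) (F' := fun s z => G s z / ((s : ℂ) * (1 - s))) (x₀ := x) (a := 0) (b := t)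
    (bound := fun _ => C) (s := Metric.ball x (ε / 2)) (μ := volume)
    (Metric.ball_mem_nhds x (by positivity))
    (Eventually.of_forall fun s => (hFc s).aestronglyMeasurable)
    ((hFc x).intervalIntegrable 0 t) (hGc.div_const _).aestronglyMeasurable
    (Eventually.of_forall fun z hz s hs => ?_) intervalIntegrable_const
    (Eventually.of_forall fun z hz s hs => ?_)).2
  · rwa [intervalIntegral.integral_div] at this
  · rw [uIoc_of_le ht] at hz
    exact hC (s, z) ⟨Metric.ball_subset_closedBall hs, hz.1.le, hz.2⟩
  · rw [uIoc_of_le ht] at hz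
    exact hd s (hcb (Metric.ball_subset_closedBall hs)) z hz

theorem integral_mul_combination {k q₁ q₂ r : ℝ → ℂ} (hk : Continuous k) (h₁ : Continuous q₁)
    (h₂ : Continuous q₂) (hr : Continuous r) (α β a b τ : ℂ) (t : ℝ) :
    ∫ z in (0)..t, k z * ((α + a * z) * q₁ z + (β + b * z) * q₂ z - τ * r z)
      = α * (∫ z in (0)..t, k z * q₁ z) + a * (∫ z in (0)..t, k z * (z * q₁ z))
        + β * (∫ z in (0)..t, k z * q₂ z) + b * (∫ z in (0)..t, k z * (z * q₂ z))
        - τ * ∫ z in (0)..t, k z * r z := by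
  have hi : ∀ {F : ℝ → ℂ}, Continuous F → IntervalIntegrable F volume 0 t :=
    fun h => h.intervalIntegrable 0 t
  simp only [← intervalIntegral.integral_const_mul]
  rw [← intervalIntegral.integral_add (hi (by fun_prop)) (hi (by fun_prop)),
    ← intervalIntegral.integral_add (hi (by fun_prop)) (hi (by fun_prop)),
    ← intervalIntegral.integral_add (hi (by fun_prop)) (hi (by fun_prop)),
    ← intervalIntegral.integral_sub (hi (by fun_prop)) (hi (by fun_prop))]
  refine intervalIntegral.integral_congr fun z _ => ?_
  ring

namespace IsNiceKernel

variable {K : ℝ → ℝ → ℂ} {M : ℝ} {f g : ℝ → ℂ}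

theorem resPairing_symm (h : IsNiceKernel K M) (hf : Continuous f) (hg : Continuous g) (t : ℝ) :
    resPairing K f g t = resPairing K g f t := by
  have hR := h.continuous_resKernel t
  have key : ∀ {f g : ℝ → ℂ}, Continuous f → Continuous g → resPairing K f g t
      = (∫ x in (0)..t, f x * g x)
        + ∫ x in (0)..t, ∫ z in (0)..t, f x * (resKernel K t x z * g z) := by
    intro f g hf hg
    have h1 : Continuous fun x => ∫ z in (0)..t, f x * (resKernel K t x z * g z) := by
      refine intervalIntegral.continuous_parametric_intervalIntegral_of_continuous'
        (f := fun x z => f x * (resKernel K t x z * g z)) ?_ 0 t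
      exact (hf.comp continuous_fst).mul (hR.mul (hg.comp continuous_snd))
    have i1 : IntervalIntegrable (fun x => f x * g x) volume 0 t :=
      (hf.mul hg).intervalIntegrable 0 t
    rw [← intervalIntegral.integral_add i1 (h1.intervalIntegrable 0 t)]
    refine intervalIntegral.integral_congr fun x _ => ?_
    simp only [resSol, mul_add, intervalIntegral.integral_const_mul]
  rw [key hf hg, key hg hf]
  congr 1
  · simp only [mul_comm]
  · rw [intervalIntegral_intervalIntegral_swap]
    · refine intervalIntegral.integral_congr fun z _ =>
        intervalIntegral.integral_congr fun x _ => ?_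
      simp only [h.resKernel_symm t x z]
      ring
    · exact ((Continuous.mul (hf.comp continuous_fst) (hR.mul (hg.comp
        continuous_snd))).continuousOn.integrableOn_compact
          (isCompact_uIcc.prod isCompact_uIcc)).mono_set
          (prod_mono uIoc_subset_uIcc uIoc_subset_uIcc)

end IsNiceKernel

namespace IsTWData

variable {a₀ b₀ c₀ a₁ b₁ c₁ : ℂ} {T M : ℝ} {f g : ℝ → ℂ} {K Λ : ℝ → ℝ → ℂ}

/-- The rotation (f, g) ↦ (g, -f) leaves f(x)g(y) - g(x)f(y) unchanged, so every statement proved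
for f yields the one for g. -/
theorem swap (h : IsTWData a₀ b₀ c₀ a₁ b₁ c₁ T M f g K Λ) :
    IsTWData (-a₀) c₀ b₀ (-a₁) c₁ b₁ T M g (fun x => -f x) K Λ where
  nice := h.nice
  lt_one := h.lt_one
  cont_f := h.cont_g
  cont_g := h.cont_f.neg
  cont_Λ := h.cont_Λ
  f_zero := h.g_zero
  g_zero := by simp [h.f_zero]
  kernel x hx y hy := by rw [h.kernel x hx y hy]; ring
  deriv_f x hx := (h.deriv_g x hx).congr_deriv (by ring)
  deriv_g x hx := (h.deriv_f x hx).neg.congr_deriv (by ring)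
  deriv_K := h.deriv_K
  Λ_add x hx y hy := by rw [h.Λ_add x hx y hy]; ring

theorem mul_one_sub_ne_zero (h : IsTWData a₀ b₀ c₀ a₁ b₁ c₁ T M f g K Λ) {x : ℝ}
    (hx : x ∈ Ioo 0 T) : (x : ℂ) * (1 - x) ≠ 0 := by
  have h1 : (x : ℂ) ≠ 0 := by exact_mod_cast hx.1.ne'
  have h2 : (1 - (x : ℂ)) ≠ 0 := by
    have : (1 - x : ℝ) ≠ 0 := by linarith [hx.2, h.lt_one]
    exact_mod_cast this
  exact mul_ne_zero h1 h2

/-- Integrability as a commutator: multiplication by the variable and K commute up to the rank two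
operator f ⊗ g - g ⊗ f. -/
theorem integral_kernel_id_mul (h : IsTWData a₀ b₀ c₀ a₁ b₁ c₁ T M f g K Λ) {t x : ℝ} (ht : 0 ≤ t)
    (htT : t ≤ T) (hx : x ∈ Icc 0 T) {Q : ℝ → ℂ} (hQ : Continuous Q) :
    ∫ z in (0)..t, K x z * (z * Q z) = x * (∫ z in (0)..t, K x z * Q z)
      - (f x * (∫ z in (0)..t, g z * Q z) - g x * ∫ z in (0)..t, f z * Q z) := by
  have hi : ∀ {F : ℝ → ℂ}, Continuous F → IntervalIntegrable F volume 0 t :=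
    fun h => h.intervalIntegrable 0 t
  have hk : Continuous (K x) := h.nice.continuous_comp₂ continuous_const continuous_id
  have hf := h.cont_f
  have hg := h.cont_g
  simp only [← intervalIntegral.integral_const_mul]
  rw [← intervalIntegral.integral_sub (hi (by fun_prop)) (hi (by fun_prop)),
    ← intervalIntegral.integral_sub (hi (by fun_prop)) (hi (by fun_prop))]
  refine intervalIntegral.integral_congr fun z hz => ?_
  rw [uIcc_of_le ht] at hz
  linear_combination (-Q z) * h.kernel x hx z ⟨hz.1, hz.2.trans htT⟩

/-- `x (1 - x) ∂Q/∂x` for `Q = (1 - K)⁻¹ f`. -/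
def flowDeriv (a₀ b₀ a₁ b₁ : ℂ) (f g : ℝ → ℂ) (K Λ : ℝ → ℝ → ℂ) (t x : ℝ) : ℂ :=
  (a₀ + a₁ * x) * f x + (b₀ + b₁ * x) * g x + ∫ z in (0)..t, Λ x z * resSol K f t z

theorem continuous_flowDeriv (h : IsTWData a₀ b₀ c₀ a₁ b₁ c₁ T M f g K Λ) (t : ℝ) :
    Continuous (flowDeriv a₀ b₀ a₁ b₁ f g K Λ t) := by
  have hf := h.cont_f
  have hg := h.cont_g
  unfold flowDeriv
  refine Continuous.add (by fun_prop) ?_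
  refine intervalIntegral.continuous_parametric_intervalIntegral_of_continuous'
    (f := fun x z => Λ x z * resSol K f t z) ?_ 0 t
  exact h.cont_Λ.mul ((h.nice.continuous_resSol hf t).comp continuous_snd)

variable {t : ℝ}

theorem hasDerivAt_resSol (h : IsTWData a₀ b₀ c₀ a₁ b₁ c₁ T M f g K Λ) (ht : t ∈ Ioo 0 T)
    (hD : fredDet K t ≠ 0) {x : ℝ} (hx : x ∈ Ioo 0 T) : HasDerivAt (resSol K f t)
      (flowDeriv a₀ b₀ a₁ b₁ f g K Λ t x / ((x : ℂ) * (1 - x))) x := by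
  have hQ := h.nice.continuous_resSol h.cont_f t
  have h1 := hasDerivAt_integral_of_continuous (F := fun x z => K x z * resSol K f t z)
    (G := fun x z => Λ x z * resSol K f t z) hx
    ((h.nice.continuous_comp₂ continuous_fst continuous_snd).mul (hQ.comp continuous_snd))
    (h.cont_Λ.mul (hQ.comp continuous_snd)) ht.1.le
    (fun s hs z hz => ((h.deriv_K s hs z ⟨hz.1.le, hz.2.trans ht.2.le⟩).mul_const (resSol K f t z)).congr_deriv (by ring))
    h.lt_one
  have h2 := (h.deriv_f x hx).add h1
  refine (h2.congr_deriv ?_).congr_of_eventuallyEq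
    (Eventually.of_forall fun s => h.nice.resSol_solves h.cont_f ht.1.le hD s)
  rw [flowDeriv]
  ring

/-- Let Q = (1 - K)⁻¹f and Z = x(1 - x)Q'. In ∫Λ(x, z)Q(z)dz the identity `Λ_add` trades Λ(x, z) for
-Λ(z, x), a multiple of K and a form of rank two. Integration by parts moves the derivative in Λ(z,
x) onto Q, which produces KZ and a boundary term at t. The remaining factor (1 - 2z) - (1 - x - z) =
x - z in front of K(x, z) is again of rank two by `kernel`. -/
theorem flowDeriv_solves (h : IsTWData a₀ b₀ c₀ a₁ b₁ c₁ T M f g K Λ) (ht : t ∈ Ioo 0 T)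
    (hD : fredDet K t ≠ 0) {x : ℝ} (hx : x ∈ Ioo 0 T) :
    flowDeriv a₀ b₀ a₁ b₁ f g K Λ t x
      = (a₀ + a₁ * x + c₁ * resPairing K f f t + (a₁ + 1) * resPairing K f g t) * f x
        + (b₀ + b₁ * x + (a₁ - 1) * resPairing K f f t + b₁ * resPairing K f g t) * g x
        - t * (1 - t) * resSol K f t t * K x t
        + ∫ z in (0)..t, K x z * flowDeriv a₀ b₀ a₁ b₁ f g K Λ t z := by
  set Q := resSol K f t with hQdef
  set Z := flowDeriv a₀ b₀ a₁ b₁ f g K Λ t with hZdef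
  have hQ : Continuous Q := h.nice.continuous_resSol h.cont_f t
  have hZ : Continuous Z := h.continuous_flowDeriv t
  have hf := h.cont_f
  have hg := h.cont_g
  have hk : Continuous (K x) := h.nice.continuous_comp₂ continuous_const continuous_id
  have hΛ1 : Continuous (Λ x) := h.cont_Λ.comp (by fun_prop : Continuous fun z : ℝ => (x, z))
  have hΛ2 : Continuous fun z => Λ z x := h.cont_Λ.comp (by fun_prop : Continuous fun z : ℝ => (z, x))
  have hi : ∀ {F : ℝ → ℂ}, Continuous F → IntervalIntegrable F volume 0 t :=
    fun h => h.intervalIntegrable 0 t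
  -- The integrand is the derivative of z(1 - z)K(x, z)Q(z); the weight kills the contribution of
  -- the endpoint 0.
  have hparts : ∫ z in (0)..t, (Λ z x * Q z + K x z * Z z + (1 - 2 * z) * (K x z * Q z))
      = t * (1 - t) * K x t * Q t := by
    have := intervalIntegral.integral_eq_sub_of_hasDerivAt_of_le
      (f := fun z : ℝ => (z : ℂ) * (1 - z) * (K x z * Q z))
      (f' := fun z : ℝ => Λ z x * Q z + K x z * Z z + (1 - 2 * z) * (K x z * Q z)) ht.1.le
      (by fun_prop) (fun z hz => ?_) (hi (by fun_prop))
    · rw [this]; push_cast; ring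
    · have hz' : z ∈ Ioo 0 T := ⟨hz.1, hz.2.trans ht.2⟩
      have hne := h.mul_one_sub_ne_zero hz'
      have d1 : HasDerivAt (fun z : ℝ => (z : ℂ) * (1 - z)) (1 - 2 * z) z := by
        exact ((hasDerivAt_ofReal z).mul ((hasDerivAt_ofReal z).const_sub 1)).congr_deriv (by ring)
      have d2 : HasDerivAt (fun z => K x z) (Λ z x / ((z : ℂ) * (1 - z))) z := by
        refine (h.deriv_K z hz' x ⟨hx.1.le, hx.2.le⟩).congr_of_eventuallyEq
          (Eventually.of_forall fun s => h.nice.symm _ _)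
      have d3 := h.hasDerivAt_resSol ht hD hz'
      refine (d1.mul (d2.mul d3)).congr_deriv ?_
      simp only [Pi.mul_apply, ← hQdef, ← hZdef]
      have h0 := left_ne_zero_of_mul hne
      have h1 := right_ne_zero_of_mul hne
      field_simp
      ring
  have hv : ∫ z in (0)..t, g z * Q z = resPairing K f g t :=
    (h.nice.resPairing_symm hf hg t).symm
  have hu : ∫ z in (0)..t, f z * Q z = resPairing K f f t := rfl
  rw [← hv, ← hu]
  have e1 : (∫ z in (0)..t, Λ x z * Q z)
      + (∫ z in (0)..t, (Λ z x * Q z + K x z * Z z + (1 - 2 * z) * (K x z * Q z)))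
      - (∫ z in (0)..t, K x z * Z z)
      = (c₁ * f x + (a₁ - 1) * g x) * (∫ z in (0)..t, f z * Q z)
        + ((a₁ + 1) * f x + b₁ * g x) * (∫ z in (0)..t, g z * Q z) := by
    simp only [← intervalIntegral.integral_const_mul]
    rw [← intervalIntegral.integral_add (hi (by fun_prop)) (hi (by fun_prop)),
      ← intervalIntegral.integral_add (hi (by fun_prop)) (hi (by fun_prop)),
      ← intervalIntegral.integral_sub (hi (by fun_prop)) (hi (by fun_prop))]
    refine intervalIntegral.integral_congr_ae (Eventually.of_forall fun z hz => ?_)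
    rw [uIoc_of_le ht.1.le] at hz
    have hz' : z ∈ Ioo 0 T := ⟨hz.1, hz.2.trans_lt ht.2⟩
    have k1 := h.Λ_add x hx z hz'
    have k2 := h.kernel x ⟨hx.1.le, hx.2.le⟩ z ⟨hz'.1.le, hz'.2.le⟩
    linear_combination Q z * k1 + Q z * k2
  rw [hparts] at e1
  have e2 : Z x = (a₀ + a₁ * x) * f x + (b₀ + b₁ * x) * g x + ∫ z in (0)..t, Λ x z * Q z := rfl
  rw [e2]
  linear_combination e1

/-- Both sides are (1 - K)⁻¹ of the same source H. For the right side one applies 1 - K: on xQ₁ and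
xQ₂ the commutator with multiplication by x produces the extra multiples of u, v, w that account for
the difference between the coefficients here and those in `flowDeriv_solves`. -/
theorem flowDeriv_eq (h : IsTWData a₀ b₀ c₀ a₁ b₁ c₁ T M f g K Λ) (ht : t ∈ Ioo 0 T)
    (hD : fredDet K t ≠ 0) {x : ℝ} (hx : x ∈ Ioc 0 t) :
    flowDeriv a₀ b₀ a₁ b₁ f g K Λ t x
      = (a₀ + resPairing K f g t + c₁ * resPairing K f f t - b₁ * resPairing K g g t + a₁ * x)
          * resSol K f t x
        + (b₀ + (2 * a₁ - 1) * resPairing K f f t + 2 * b₁ * resPairing K f g t + b₁ * x)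
          * resSol K g t x
        - t * (1 - t) * resSol K f t t * resKernel K t x t := by
  set u := resPairing K f f t with hu
  set v := resPairing K f g t with hv
  set w := resPairing K g g t with hw
  have hf := h.cont_f
  have hg := h.cont_g
  have hQ₁ := h.nice.continuous_resSol hf t
  have hQ₂ := h.nice.continuous_resSol hg t
  have hR : Continuous fun z => resKernel K t z t :=
    h.nice.continuous_resKernel_comp t continuous_id continuous_const
  have hKt : Continuous fun z => K z t := h.nice.continuous_comp₂ continuous_id continuous_const
  set H : ℝ → ℂ := fun x => (a₀ + a₁ * x + c₁ * u + (a₁ + 1) * v) * f x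
        + (b₀ + b₁ * x + (a₁ - 1) * u + b₁ * v) * g x
        - t * (1 - t) * resSol K f t t * K x t with hH
  have hHc : Continuous H := by fun_prop
  have s1 := h.nice.eq_resSol ht.1.le hD (h.continuous_flowDeriv t) hHc
    (fun x hx => h.flowDeriv_solves ht hD ⟨hx.1, hx.2.trans_lt ht.2⟩) x hx
  set F : ℝ → ℂ := fun x => (a₀ + v + c₁ * u - b₁ * w + a₁ * x) * resSol K f t x
        + (b₀ + (2 * a₁ - 1) * u + 2 * b₁ * v + b₁ * x) * resSol K g t x
        - t * (1 - t) * resSol K f t t * resKernel K t x t with hF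
  have hFc : Continuous F := by fun_prop
  have s2 := h.nice.eq_resSol ht.1.le hD hFc hHc (fun x hx => ?_) x hx
  · rw [s1, ← s2]
  · have hx' : x ∈ Icc 0 T := ⟨hx.1.le, hx.2.trans ht.2.le⟩
    have hk : Continuous (K x) := h.nice.continuous_comp₂ continuous_const continuous_id
    have q1 := h.nice.resSol_solves hf ht.1.le hD x
    have q2 := h.nice.resSol_solves hg ht.1.le hD x
    have r := h.nice.resKernel_eq ht.1.le hD x t
    have i1 := h.integral_kernel_id_mul ht.1.le ht.2.le hx' hQ₁
    have i2 := h.integral_kernel_id_mul ht.1.le ht.2.le hx' hQ₂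
    have hv' : ∫ z in (0)..t, g z * resSol K f t z = v :=
      (h.nice.resPairing_symm hf hg t).symm
    have hu' : ∫ z in (0)..t, f z * resSol K f t z = u := rfl
    have hw' : ∫ z in (0)..t, g z * resSol K g t z = w := rfl
    have hv'' : ∫ z in (0)..t, f z * resSol K g t z = v := rfl
    rw [hv', hu'] at i1
    rw [hw', hv''] at i2
    have e := integral_mul_combination hk hQ₁ hQ₂ hR (a₀ + v + c₁ * u - b₁ * w)
      (b₀ + (2 * a₁ - 1) * u + 2 * b₁ * v) a₁ b₁ (t * (1 - t) * resSol K f t t) t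
    rw [hF, hH]
    beta_reduce
    rw [e, i1, i2]
    linear_combination (a₀ + v + c₁ * u - b₁ * w + a₁ * x) * q1
      + (b₀ + (2 * a₁ - 1) * u + 2 * b₁ * v + b₁ * x) * q2 - t * (1 - t) * resSol K f t t * r

/-- The resolvent of an integrable kernel is integrable. For fixed y, both sides as functions of x
solve (1 - K)F = f(x)P(y) - g(x)Q(y), where Q, P are (1 - K)⁻¹ applied to f, g, and uniqueness
applies. -/
theorem sub_mul_resKernel (h : IsTWData a₀ b₀ c₀ a₁ b₁ c₁ T M f g K Λ) (ht : t ∈ Ioo 0 T)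
    (hD : fredDet K t ≠ 0) {x y : ℝ} (hx : x ∈ Ioc 0 t) (hy : y ∈ Ioc 0 t) :
    ((x : ℂ) - y) * resKernel K t x y
      = resSol K f t x * resSol K g t y - resSol K g t x * resSol K f t y := by
  have hf := h.cont_f
  have hg := h.cont_g
  have hQ₁ := h.nice.continuous_resSol hf t
  have hQ₂ := h.nice.continuous_resSol hg t
  have hR : Continuous fun z => resKernel K t z y :=
    h.nice.continuous_resKernel_comp t continuous_id continuous_const
  set H : ℝ → ℂ := fun x => f x * resSol K g t y - g x * resSol K f t y with hH
  have hHc : Continuous H := by fun_prop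
  have hi : ∀ {F : ℝ → ℂ}, Continuous F → IntervalIntegrable F volume 0 t :=
    fun h => h.intervalIntegrable 0 t
  have e : ∀ f : ℝ → ℂ, ∫ z in (0)..t, f z * resKernel K t z y = resSol K f t y - f y := fun f => by
    rw [resSol, add_sub_cancel_left]
    refine intervalIntegral.integral_congr fun z _ => ?_
    simp only [h.nice.resKernel_symm t z y, mul_comm]
  have s1 := h.nice.eq_resSol ht.1.le hD (F := fun x => ((x : ℂ) - y) * resKernel K t x y)
    (f := H) (by fun_prop) hHc (fun x hx => ?_) x hx
  have s2 := h.nice.eq_resSol ht.1.le hD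
    (F := fun x => resSol K f t x * resSol K g t y - resSol K g t x * resSol K f t y)
    (f := H) (by fun_prop) hHc (fun x hx => ?_) x hx
  · exact s1.trans s2.symm
  · have q1 := h.nice.resSol_solves hf ht.1.le hD x
    have q2 := h.nice.resSol_solves hg ht.1.le hD x
    have hk : Continuous (K x) := h.nice.continuous_comp₂ continuous_const continuous_id
    have : ∫ z in (0)..t, K x z
        * (resSol K f t z * resSol K g t y - resSol K g t z * resSol K f t y)
        = (∫ z in (0)..t, K x z * resSol K f t z) * resSol K g t y
          - (∫ z in (0)..t, K x z * resSol K g t z) * resSol K f t y := by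
      simp only [← intervalIntegral.integral_mul_const]
      rw [← intervalIntegral.integral_sub (hi (by fun_prop)) (hi (by fun_prop))]
      refine intervalIntegral.integral_congr fun z _ => ?_
      ring
    rw [this, hH]
    linear_combination resSol K g t y * q1 - resSol K f t y * q2
  · have hx' : x ∈ Icc 0 T := ⟨hx.1.le, hx.2.trans ht.2.le⟩
    have hy' : y ∈ Icc 0 T := ⟨hy.1.le, hy.2.trans ht.2.le⟩
    have hk : Continuous (K x) := h.nice.continuous_comp₂ continuous_const continuous_id
    have r := h.nice.resKernel_eq ht.1.le hD x y
    have i := h.integral_kernel_id_mul ht.1.le ht.2.le hx' hR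
    rw [e f, e g] at i
    have : ∫ z in (0)..t, K x z * (((z : ℂ) - y) * resKernel K t z y)
        = (∫ z in (0)..t, K x z * (z * resKernel K t z y))
          - y * ∫ z in (0)..t, K x z * resKernel K t z y := by
      simp only [← intervalIntegral.integral_const_mul]
      rw [← intervalIntegral.integral_sub (hi (by fun_prop)) (hi (by fun_prop))]
      refine intervalIntegral.integral_congr fun z _ => ?_
      ring
    have k := h.kernel x hx' y hy'
    rw [this, i, hH]
    linear_combination (x - y : ℂ) * r + k

end IsTWData

end

/-! ### The Tracy–Widom system for a general 𝒜₁, and the diagonal of the resolvent. -/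

noncomputable section

/-- `α(t)` of the Tracy–Widom system, for `A₁ = (a₁, b₁; -c₁, -a₁)`. -/
def genAlpha (a₀ a₁ b₁ c₁ : ℂ) (u v w : ℝ → ℂ) (t : ℝ) : ℂ :=
  a₀ + a₁ * t + v t + c₁ * u t - b₁ * w t

/-- `β(t)` of the Tracy–Widom system, for `A₁ = (a₁, b₁; -c₁, -a₁)`. -/
def genBeta (b₀ a₁ b₁ : ℂ) (u v : ℝ → ℂ) (t : ℝ) : ℂ :=
  b₀ + b₁ * t + (2 * a₁ - 1) * u t + 2 * b₁ * v t

/-- `γ(t)` of the Tracy–Widom system, for `A₁ = (a₁, b₁; -c₁, -a₁)`. -/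
def genGamma (c₀ a₁ c₁ : ℂ) (v w : ℝ → ℂ) (t : ℝ) : ℂ :=
  c₀ + c₁ * t - 2 * c₁ * v t - (2 * a₁ + 1) * w t

/-- The Tracy–Widom equations for `A₀ = (a₀, b₀; -c₀, -a₀)`, `A₁ = (a₁, b₁; -c₁, -a₁)`. -/
def IsGenTWSolution (a₀ b₀ c₀ a₁ b₁ c₁ : ℂ) (q p u v w : ℝ → ℂ) (S : Set ℝ) : Prop :=
  IsTWSolution (genAlpha a₀ a₁ b₁ c₁ u v w) (genBeta b₀ a₁ b₁ u v) (genGamma c₀ a₁ c₁ v w)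
    q p u v w S

theorem resSol_neg (K : ℝ → ℝ → ℂ) (f : ℝ → ℂ) (t x : ℝ) :
    resSol K (fun x => -f x) t x = -resSol K f t x := by
  simp only [resSol, mul_neg, intervalIntegral.integral_neg]
  ring

theorem resPairing_neg_right (K : ℝ → ℝ → ℂ) (f g : ℝ → ℂ) (t : ℝ) :
    resPairing K f (fun x => -g x) t = -resPairing K f g t := by
  simp only [resPairing, resSol_neg, mul_neg, intervalIntegral.integral_neg]

theorem resPairing_neg_left (K : ℝ → ℝ → ℂ) (f g : ℝ → ℂ) (t : ℝ) :
    resPairing K (fun x => -f x) g t = -resPairing K f g t := by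
  simp only [resPairing, neg_mul, intervalIntegral.integral_neg]

namespace IsTWData

variable {a₀ b₀ c₀ a₁ b₁ c₁ : ℂ} {T M : ℝ} {f g : ℝ → ℂ} {K Λ : ℝ → ℝ → ℂ} {t : ℝ}

theorem hasDerivAt_resSol_right (h : IsTWData a₀ b₀ c₀ a₁ b₁ c₁ T M f g K Λ) (ht : t ∈ Ioo 0 T)
    (hD : fredDet K t ≠ 0) : HasDerivAt (resSol K f t)
      ((genAlpha a₀ a₁ b₁ c₁ (resPairing K f f) (resPairing K f g) (resPairing K g g) t
          * resSol K f t t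
        + genBeta b₀ a₁ b₁ (resPairing K f f) (resPairing K f g) t * resSol K g t t)
        / ((t : ℂ) * (1 - t)) - resKernel K t t t * resSol K f t t) t := by
  refine (h.hasDerivAt_resSol ht hD ht).congr_deriv ?_
  have hne := h.mul_one_sub_ne_zero ht
  have h0 := left_ne_zero_of_mul hne
  have h1 := right_ne_zero_of_mul hne
  rw [h.flowDeriv_eq ht hD ⟨ht.1, le_rfl⟩, genAlpha, genBeta]
  field_simp
  ring

theorem hasDerivAt_resSol_right' (h : IsTWData a₀ b₀ c₀ a₁ b₁ c₁ T M f g K Λ) (ht : t ∈ Ioo 0 T)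
    (hD : fredDet K t ≠ 0) : HasDerivAt (resSol K g t)
      ((-genGamma c₀ a₁ c₁ (resPairing K f g) (resPairing K g g) t * resSol K f t t
        - genAlpha a₀ a₁ b₁ c₁ (resPairing K f f) (resPairing K f g) (resPairing K g g) t
          * resSol K g t t)
        / ((t : ℂ) * (1 - t)) - resKernel K t t t * resSol K g t t) t := by
  refine (h.swap.hasDerivAt_resSol_right ht hD).congr_deriv ?_
  simp only [genAlpha, genBeta, genGamma, resPairing_neg_right, resPairing_neg_left, resSol_neg,
    h.nice.resPairing_symm h.cont_g h.cont_f]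
  ring

/-- The moving endpoint contributes +R(t, t)q to q', and the boundary term of the integration by
parts contributes -R(t, t)q. They cancel, and similarly for p; the system closes. -/
theorem isGenTWSolution (h : IsTWData a₀ b₀ c₀ a₁ b₁ c₁ T M f g K Λ) :
    IsGenTWSolution a₀ b₀ c₀ a₁ b₁ c₁ (fun s => resSol K f s s) (fun s => resSol K g s s)
      (resPairing K f f) (resPairing K f g) (resPairing K g g)
      {t | t ∈ Ioo 0 T ∧ fredDet K t ≠ 0} where
  deriv_q t ht := (h.nice.hasDerivAt_resSol_diag h.cont_f ht.1.1 ht.2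
    (h.hasDerivAt_resSol_right ht.1 ht.2)).congr_deriv (by ring)
  deriv_p t ht := (h.nice.hasDerivAt_resSol_diag h.cont_g ht.1.1 ht.2
    (h.hasDerivAt_resSol_right' ht.1 ht.2)).congr_deriv (by ring)
  deriv_u t ht := (h.nice.hasDerivAt_resPairing h.cont_f h.cont_f ht.1.1 ht.2).congr_deriv
    (by ring)
  deriv_v t ht := (h.nice.hasDerivAt_resPairing h.cont_f h.cont_g ht.1.1 ht.2).congr_deriv
    (by ring)
  deriv_w t ht := (h.nice.hasDerivAt_resPairing h.cont_g h.cont_g ht.1.1 ht.2).congr_deriv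
    (by ring)

/-- L'Hôpital in (x - t)R(x, t) = Q(x)p - P(x)q as x → t. The terms of the derivatives of Q and P
containing R(t, t) cancel in this antisymmetric combination. -/
theorem resKernel_diag (h : IsTWData a₀ b₀ c₀ a₁ b₁ c₁ T M f g K Λ) (ht : t ∈ Ioo 0 T)
    (hD : fredDet K t ≠ 0) : t * (1 - t) * resKernel K t t t
      = 2 * genAlpha a₀ a₁ b₁ c₁ (resPairing K f f) (resPairing K f g) (resPairing K g g) t
          * resSol K g t t * resSol K f t t
        + genBeta b₀ a₁ b₁ (resPairing K f f) (resPairing K f g) t * resSol K g t t ^ 2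
        + genGamma c₀ a₁ c₁ (resPairing K f g) (resPairing K g g) t * resSol K f t t ^ 2 := by
  have hd := ((h.hasDerivAt_resSol_right ht hD).mul_const (resSol K g t t)).sub
    ((h.hasDerivAt_resSol_right' ht hD).mul_const (resSol K f t t))
  have hs := hasDerivAt_iff_tendsto_slope.1 hd
  -- Only the left limit is used, since the integrable form of R is available on (0, t] alone.
  have hs' := hs.mono_left (nhdsWithin_mono t (fun x hx => ne_of_lt hx : Iio t ⊆ {t}ᶜ))
  have hR : Tendsto (fun x => resKernel K t x t) (𝓝[<] t) (𝓝 (resKernel K t t t)) :=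
    ((h.nice.continuous_resKernel_comp t continuous_id continuous_const).tendsto t).mono_left
      nhdsWithin_le_nhds
  have he := tendsto_nhds_unique_of_eventuallyEq hs' hR ?_
  · rw [← he]
    have hne := h.mul_one_sub_ne_zero ht
    have h0 := left_ne_zero_of_mul hne
    have h1 := right_ne_zero_of_mul hne
    field_simp
    ring
  · filter_upwards [Ioo_mem_nhdsLT ht.1] with x hx
    have hk := h.sub_mul_resKernel ht hD (x := x) (y := t) ⟨hx.1, hx.2.le⟩ ⟨ht.1, le_rfl⟩
    have hne : ((x : ℂ) - t) ≠ 0 := by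
      have : x - t ≠ 0 := by linarith [hx.2]
      exact_mod_cast this
    rw [slope_def_module]
    simp only [Pi.sub_apply, Complex.real_smul]
    push_cast
    rw [inv_mul_eq_iff_eq_mul₀ hne]
    linear_combination -hk

end IsTWData

/-! ### Dependence on a coupling constant -/

theorem minorBound_mul_pow (M r R : ℝ) (n : ℕ) :
    minorBound M r n * R ^ n = minorBound M (r * R) n := by
  unfold minorBound; rw [mul_pow]; ring

/-- The bounds are summable for every value of r, and a factor R^n only replaces r by rR. Hence the
series in κ converges locally uniformly on the whole plane. -/
theorem differentiable_tsum_pow {c : ℕ → ℂ} {C M r : ℝ} (hM : 0 ≤ M) (hr : 0 ≤ r) (hC : 0 ≤ C)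
    (hc : ∀ n, ‖c n‖ ≤ C * minorBound M r n) : Differentiable ℂ fun κ => ∑' n, c n * κ ^ n := by
  intro κ₀
  have hs : {κ : ℂ | ‖κ‖ < ‖κ₀‖ + 1} ∈ 𝓝 κ₀ :=
    (isOpen_lt (by fun_prop) (by fun_prop)).mem_nhds (by simp)
  refine (Complex.differentiableOn_tsum_of_summable_norm
    (u := fun n => C * minorBound M (r * (‖κ₀‖ + 1)) n)
    ((summable_minorBound hM (by positivity)).mul_left C) (fun n => by fun_prop)
    (isOpen_lt (by fun_prop) (by fun_prop)) fun n κ hκ => ?_).differentiableAt hs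
  rw [norm_mul, norm_pow, ← minorBound_mul_pow, ← mul_assoc]
  have : ‖κ‖ ≤ ‖κ₀‖ + 1 := le_of_lt hκ
  have := minorBound_nonneg hM hr n
  gcongr
  exact hc n

theorem kernelMinor_smul (K : ℝ → ℝ → ℂ) (κ : ℂ) (n : ℕ) (z : Fin n → ℝ) :
    kernelMinor (fun x y => κ * K x y) n z = κ ^ n * kernelMinor K n z := by
  have := Matrix.det_smul (Matrix.of fun i j => K (z i) (z j)) κ
  rw [Fintype.card_fin] at this
  exact this

theorem borderedMinor_smul (K : ℝ → ℝ → ℂ) (κ : ℂ) (n : ℕ) (x y : ℝ) (z : Fin n → ℝ) :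
    borderedMinor (fun x y => κ * K x y) n x y z = κ ^ (n + 1) * borderedMinor K n x y z := by
  have := Matrix.det_smul (Matrix.of fun i j : Fin (n + 1) =>
    K ((Fin.cons x z : Fin (n + 1) → ℝ) i) ((Fin.cons y z : Fin (n + 1) → ℝ) j)) κ
  rw [Fintype.card_fin] at this
  exact this

theorem detIntegral_smul (K : ℝ → ℝ → ℂ) (κ : ℂ) (n : ℕ) (t : ℝ) :
    detIntegral (fun x y => κ * K x y) n t = κ ^ n * detIntegral K n t := by
  simp only [detIntegral, kernelMinor_smul, integral_const_mul]
  ring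

theorem minorIntegral_smul (K : ℝ → ℝ → ℂ) (κ : ℂ) (n : ℕ) (t x y : ℝ) :
    minorIntegral (fun x y => κ * K x y) n t x y = κ ^ (n + 1) * minorIntegral K n t x y := by
  simp only [minorIntegral, borderedMinor_smul, integral_const_mul]
  ring

theorem norm_intervalIntegral_le {F : ℝ → ℂ} {C t : ℝ} (ht : 0 ≤ t)
    (hF : ∀ z ∈ Ioc 0 t, ‖F z‖ ≤ C) : ‖∫ z in (0)..t, F z‖ ≤ C * t := by
  have := intervalIntegral.norm_integral_le_of_norm_le_const (a := 0) (b := t) (f := F) (C := C)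
    (by rwa [uIoc_of_le ht])
  rwa [sub_zero, abs_of_nonneg ht] at this

namespace IsNiceKernel

variable {K : ℝ → ℝ → ℂ} {M : ℝ} {f g : ℝ → ℂ}

theorem const_mul (h : IsNiceKernel K M) (κ : ℂ) :
    IsNiceKernel (fun x y => κ * K x y) (‖κ‖ * M) where
  cont := continuous_const.mul h.cont
  bound x y := by rw [norm_mul]; exact mul_le_mul_of_nonneg_left (h.bound x y) (norm_nonneg _)
  symm x y := by rw [h.symm]

theorem fredDet_smul (h : IsNiceKernel K M) (κ : ℂ) (t : ℝ) :
    fredDet (fun x y => κ * K x y) t = 1 + κ * ∑' n : ℕ,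
      ((-1) ^ (n + 1) / ((n + 1).factorial : ℂ) * detIntegral K (n + 1) t) * κ ^ n := by
  rw [fredDet, ((h.const_mul κ).hasSum_fredDet t).summable.tsum_eq_zero_add, ← tsum_mul_left]
  congr 1
  · simp [detIntegral_zero]
  · refine tsum_congr fun n => ?_
    rw [detIntegral_smul]
    ring

theorem differentiable_fredDet (h : IsNiceKernel K M) (t : ℝ) :
    Differentiable ℂ fun κ : ℂ => fredDet (fun x y => κ * K x y) t := by
  simp only [h.fredDet_smul]
  refine (differentiable_const _).add (differentiable_id.mul ?_)
  exact differentiable_tsum_pow h.nonneg (abs_nonneg t) (abs_nonneg t)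
    fun n => h.norm_detTerm_succ_le n t

/-- For ‖κ‖ ≤ 1 the series gives ‖D - 1‖ ≤ ‖κ‖B with B independent of t in [0, T], so D cannot
vanish once ‖κ‖ < 1/(B + 1). -/
theorem exists_pos_forall_fredDet_ne_zero (h : IsNiceKernel K M) (T : ℝ) :
    ∃ δ > 0, ∀ κ : ℂ, ‖κ‖ < δ → ∀ t ∈ Icc 0 T, fredDet (fun x y => κ * K x y) t ≠ 0 := by
  set B := |T| * ∑' n, minorBound M |T| n with hB
  have hBn : 0 ≤ B := mul_nonneg (abs_nonneg _)
    (tsum_nonneg fun n => minorBound_nonneg h.nonneg (abs_nonneg _) n)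
  refine ⟨min 1 (1 / (B + 1)), by positivity, fun κ hκ t ht h0 => ?_⟩
  have hκ1 : ‖κ‖ ≤ 1 := (hκ.trans_le (min_le_left _ _)).le
  have hκ2 : ‖κ‖ < 1 / (B + 1) := hκ.trans_le (min_le_right _ _)
  have htT : |t| ≤ |T| := by
    rw [abs_of_nonneg ht.1]; exact ht.2.trans (le_abs_self T)
  rw [h.fredDet_smul] at h0
  have hS : ‖∑' n : ℕ, ((-1) ^ (n + 1) / ((n + 1).factorial : ℂ) * detIntegral K (n + 1) t) * κ ^ n‖
      ≤ B := by
    rw [hB, ← tsum_mul_left]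
    refine tsum_of_norm_bounded
      ((summable_minorBound h.nonneg (abs_nonneg T)).mul_left |T|).hasSum fun n => ?_
    rw [norm_mul, norm_pow]
    have h1 := h.norm_detTerm_succ_le n t
    have h2 : ‖κ‖ ^ n ≤ 1 := pow_le_one₀ (norm_nonneg _) hκ1
    calc _ ≤ |t| * minorBound M |t| n * 1 :=
          mul_le_mul h1 h2 (by positivity)
            (mul_nonneg (abs_nonneg _) (minorBound_nonneg h.nonneg (abs_nonneg _) n))
      _ ≤ _ := by
          rw [mul_one]
          exact mul_le_mul htT (minorBound_mono h.nonneg (abs_nonneg _) htT n)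
            (minorBound_nonneg h.nonneg (abs_nonneg _) n) (abs_nonneg _)
  have h3 := congrArg norm (eq_neg_of_add_eq_zero_left h0)
  rw [norm_neg, norm_mul, norm_one] at h3
  rw [lt_div_iff₀ (by positivity)] at hκ2
  nlinarith [norm_nonneg κ]

theorem hasSum_fredMinor_smul (h : IsNiceKernel K M) (κ : ℂ) (t x y : ℝ) :
    HasSum (fun n : ℕ => κ * (((-1) ^ n / (n.factorial : ℂ) * minorIntegral K n t x y) * κ ^ n))
      (fredMinor (fun x y => κ * K x y) t x y) := by
  refine ((h.const_mul κ).hasSum_fredMinor t x y).congr_fun fun n => ?_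
  rw [minorIntegral_smul]
  ring

/-- The integral `∫ N(t, x, z) f(z) dz` of the first minor of `κ K` as a power series in `κ`. -/
theorem hasSum_integral_fredMinor_smul (h : IsNiceKernel K M) (hf : Continuous f) (κ : ℂ) {t : ℝ}
    (ht : 0 ≤ t) (x : ℝ) : HasSum
      (fun n : ℕ => (∫ z in (0)..t, (-1) ^ n / (n.factorial : ℂ) * minorIntegral K n t x z * f z)
        * κ ^ (n + 1)) (∫ z in (0)..t, fredMinor (fun x y => κ * K x y) t x z * f z) := by
  obtain ⟨C, hC⟩ := (isCompact_Icc (a := 0) (b := t)).exists_bound_of_continuousOn hf.continuousOn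
  have hb : ∀ z ∈ Icc 0 t, ‖f z‖ ≤ |C| := fun z hz => (hC z hz).trans (le_abs_self C)
  have := hasSum_intervalIntegral_of_bound (a := 0) (t := t)
    (f := fun n z => (((-1) ^ n / (n.factorial : ℂ) * minorIntegral K n t x z) * f z)
      * κ ^ (n + 1))
    (F := fun z => fredMinor (fun x y => κ * K x y) t x z * f z)
    (b := fun n => |C| * ‖κ‖ * minorBound M (t * ‖κ‖) n) (fun n => ?_) (fun n z hz => ?_)
    ((summable_minorBound h.nonneg (by positivity)).mul_left _) fun z => ?_
  · simpa only [intervalIntegral.integral_mul_const] using this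
  · exact ((continuous_const.mul ((h.continuous_minorIntegral n).comp
      (by fun_prop : Continuous fun z : ℝ => (t, x, z)))).mul hf).mul continuous_const
  · rw [uIoc_of_le ht] at hz
    have h1 := h.norm_minorTerm_le n t x z
    have h2 := hb z ⟨hz.1.le, hz.2⟩
    rw [abs_of_nonneg ht] at h1
    rw [← minorBound_mul_pow, norm_mul, norm_mul, norm_pow, pow_succ]
    have := minorBound_nonneg h.nonneg ht n
    calc _ ≤ minorBound M t n * |C| * (‖κ‖ ^ n * ‖κ‖) := by gcongr
      _ = _ := by ring
  · refine ((h.hasSum_fredMinor_smul κ t x z).mul_right (f z)).congr_fun fun n => ?_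
    ring

theorem norm_integral_minorTerm_le (h : IsNiceKernel K M) {C : ℝ} (hC : 0 ≤ C) {t : ℝ}
    (ht : 0 ≤ t) (hf : ∀ z ∈ Icc 0 t, ‖f z‖ ≤ C) (n : ℕ) (x : ℝ) :
    ‖∫ z in (0)..t, (-1) ^ n / (n.factorial : ℂ) * minorIntegral K n t x z * f z‖
      ≤ (C * t) * minorBound M t n := by
  refine (norm_intervalIntegral_le (C := C * minorBound M t n) ht fun z hz => ?_).trans
    (le_of_eq (by ring))
  have h1 := h.norm_minorTerm_le n t x z
  rw [abs_of_nonneg ht] at h1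
  rw [norm_mul, mul_comm]
  exact mul_le_mul (hf z ⟨hz.1.le, hz.2⟩) h1 (norm_nonneg _) hC

theorem differentiable_integral_fredMinor (h : IsNiceKernel K M) (hf : Continuous f) {t : ℝ}
    (ht : 0 ≤ t) (x : ℝ) : Differentiable ℂ fun κ : ℂ =>
      ∫ z in (0)..t, fredMinor (fun x y => κ * K x y) t x z * f z := by
  obtain ⟨C, hC⟩ := (isCompact_Icc (a := 0) (b := t)).exists_bound_of_continuousOn hf.continuousOn
  have hb : ∀ z ∈ Icc 0 t, ‖f z‖ ≤ |C| := fun z hz => (hC z hz).trans (le_abs_self C)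
  have he : (fun κ : ℂ => ∫ z in (0)..t, fredMinor (fun x y => κ * K x y) t x z * f z)
      = fun κ => κ * ∑' n : ℕ, (∫ z in (0)..t,
        (-1) ^ n / (n.factorial : ℂ) * minorIntegral K n t x z * f z) * κ ^ n := by
    ext κ
    rw [← (h.hasSum_integral_fredMinor_smul hf κ ht x).tsum_eq, ← tsum_mul_left]
    exact tsum_congr fun n => by ring
  rw [he]
  exact differentiable_id.mul (differentiable_tsum_pow h.nonneg ht (by positivity)
    fun n => h.norm_integral_minorTerm_le (abs_nonneg C) ht hb n x)

theorem differentiable_integral_integral_fredMinor (h : IsNiceKernel K M) (hf : Continuous f)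
    (hg : Continuous g) {t : ℝ} (ht : 0 ≤ t) : Differentiable ℂ fun κ : ℂ =>
      ∫ x in (0)..t, f x * ∫ z in (0)..t, fredMinor (fun x y => κ * K x y) t x z * g z := by
  obtain ⟨C, hC⟩ := (isCompact_Icc (a := 0) (b := t)).exists_bound_of_continuousOn hf.continuousOn
  obtain ⟨B, hB⟩ := (isCompact_Icc (a := 0) (b := t)).exists_bound_of_continuousOn hg.continuousOn
  have hb : ∀ z ∈ Icc 0 t, ‖f z‖ ≤ |C| := fun z hz => (hC z hz).trans (le_abs_self C)
  have hb' : ∀ z ∈ Icc 0 t, ‖g z‖ ≤ |B| := fun z hz => (hB z hz).trans (le_abs_self B)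
  set c : ℕ → ℝ → ℂ := fun n x => ∫ z in (0)..t,
    (-1) ^ n / (n.factorial : ℂ) * minorIntegral K n t x z * g z with hc
  have hcc : ∀ n, Continuous (c n) := fun n => by
    refine intervalIntegral.continuous_parametric_intervalIntegral_of_continuous'
      (f := fun x z => (-1) ^ n / (n.factorial : ℂ) * minorIntegral K n t x z * g z) ?_ 0 t
    exact (continuous_const.mul ((h.continuous_minorIntegral n).comp
      (by fun_prop : Continuous fun p : ℝ × ℝ => (t, p.1, p.2)))).mul (hg.comp continuous_snd)
  have hcb : ∀ n x, ‖c n x‖ ≤ |B| * t * minorBound M t n := fun n x =>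
    h.norm_integral_minorTerm_le (abs_nonneg B) ht hb' n x
  have he : (fun κ : ℂ => ∫ x in (0)..t, f x
      * ∫ z in (0)..t, fredMinor (fun x y => κ * K x y) t x z * g z)
      = fun κ => κ * ∑' n : ℕ, (∫ x in (0)..t, f x * c n x) * κ ^ n := by
    ext κ
    have := hasSum_intervalIntegral_of_bound (a := 0) (t := t)
      (f := fun n x => f x * c n x * κ ^ (n + 1))
      (F := fun x => f x * ∫ z in (0)..t, fredMinor (fun x y => κ * K x y) t x z * g z)
      (b := fun n => |C| * (|B| * t) * ‖κ‖ * minorBound M (t * ‖κ‖) n) (fun n => ?_)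
      (fun n x hx => ?_) ((summable_minorBound h.nonneg (by positivity)).mul_left _) fun x => ?_
    · rw [← this.tsum_eq, ← tsum_mul_left]
      simp only [intervalIntegral.integral_mul_const]
      exact tsum_congr fun n => by ring
    · exact (hf.mul (hcc n)).mul continuous_const
    · rw [uIoc_of_le ht] at hx
      rw [← minorBound_mul_pow, norm_mul, norm_mul, norm_pow, pow_succ]
      have := minorBound_nonneg h.nonneg ht n
      have h1 := hb x ⟨hx.1.le, hx.2⟩
      have h2 := hcb n x
      calc _ ≤ |C| * (|B| * t * minorBound M t n) * (‖κ‖ ^ n * ‖κ‖) := by gcongr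
        _ = _ := by ring
    · refine ((h.hasSum_integral_fredMinor_smul hg κ ht x).mul_left (f x)).congr_fun fun n => ?_
      simp only [hc]
      ring
  rw [he]
  refine differentiable_id.mul (differentiable_tsum_pow (C := |C| * (|B| * t) * t) h.nonneg ht
    (by positivity) fun n => ?_)
  refine (norm_intervalIntegral_le (C := |C| * (|B| * t * minorBound M t n)) ht
    fun x hx => ?_).trans (le_of_eq (by ring))
  rw [norm_mul]
  exact mul_le_mul (hb x ⟨hx.1.le, hx.2⟩) (hcb n x) (norm_nonneg _) (abs_nonneg _)

end IsNiceKernel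

end

/-! ### First integrals of the Tracy–Widom system and their values. -/

noncomputable section

/-- `2 α p q + β p² + γ q²`. -/
def genZeta (a₀ b₀ c₀ a₁ b₁ c₁ : ℂ) (q p u v w : ℝ → ℂ) (t : ℝ) : ℂ :=
  2 * genAlpha a₀ a₁ b₁ c₁ u v w t * p t * q t + genBeta b₀ a₁ b₁ u v t * p t ^ 2
    + genGamma c₀ a₁ c₁ v w t * q t ^ 2

/-- The entry `(1, 1)` of the residue at `0` of the dressed linear system. -/
def residueA (a₀ b₁ c₁ : ℂ) (q p u v w : ℝ → ℂ) (t : ℝ) : ℂ :=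
  a₀ + v t + c₁ * u t - b₁ * w t + (1 - t) * (q t * p t)

/-- The entry `(1, 2)` of the residue at `0` of the dressed linear system. -/
def residueB (b₀ a₁ b₁ : ℂ) (q u v : ℝ → ℂ) (t : ℝ) : ℂ :=
  b₀ + (2 * a₁ - 1) * u t + 2 * b₁ * v t - (1 - t) * q t ^ 2

/-- The entry `(2, 1)` of the residue at `0` of the dressed linear system. -/
def residueC (c₀ a₁ c₁ : ℂ) (p v w : ℝ → ℂ) (t : ℝ) : ℂ :=
  -(c₀ - 2 * c₁ * v t - (2 * a₁ + 1) * w t) + (1 - t) * p t ^ 2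

namespace IsGenTWSolution

variable {a₀ b₀ c₀ a₁ b₁ c₁ : ℂ} {q p u v w : ℝ → ℂ} {S : Set ℝ} {t : ℝ}

theorem hasDerivAt_genAlpha (h : IsGenTWSolution a₀ b₀ c₀ a₁ b₁ c₁ q p u v w S) (ht : t ∈ S) :
    HasDerivAt (genAlpha a₀ a₁ b₁ c₁ u v w)
      (a₁ + p t * q t + c₁ * q t ^ 2 - b₁ * p t ^ 2) t :=
  (((((hasDerivAt_ofReal t).const_mul a₁).const_add a₀).add (h.deriv_v t ht)).add
    ((h.deriv_u t ht).const_mul c₁)).sub ((h.deriv_w t ht).const_mul b₁) |>.congr_deriv (by ring)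

theorem hasDerivAt_genBeta (h : IsGenTWSolution a₀ b₀ c₀ a₁ b₁ c₁ q p u v w S) (ht : t ∈ S) :
    HasDerivAt (genBeta b₀ a₁ b₁ u v)
      (b₁ + (2 * a₁ - 1) * q t ^ 2 + 2 * b₁ * (p t * q t)) t :=
  ((((hasDerivAt_ofReal t).const_mul b₁).const_add b₀).add
    ((h.deriv_u t ht).const_mul (2 * a₁ - 1))).add ((h.deriv_v t ht).const_mul (2 * b₁))
    |>.congr_deriv (by ring)

theorem hasDerivAt_genGamma (h : IsGenTWSolution a₀ b₀ c₀ a₁ b₁ c₁ q p u v w S) (ht : t ∈ S) :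
    HasDerivAt (genGamma c₀ a₁ c₁ v w)
      (c₁ - 2 * c₁ * (p t * q t) - (2 * a₁ + 1) * p t ^ 2) t :=
  ((((hasDerivAt_ofReal t).const_mul c₁).const_add c₀).sub
    ((h.deriv_v t ht).const_mul (2 * c₁))).sub ((h.deriv_w t ht).const_mul (2 * a₁ + 1))
    |>.congr_deriv (by ring)

/-- The contributions of q' and p' cancel, since a quadratic form is invariant under the flow of its
own traceless matrix. In those of α', β', γ' the quartic terms cancel as well, leaving the quadratic
form of 𝒜₁, which is the derivative of c₁u + 2a₁v + b₁w. -/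
theorem hasDerivAt_genZeta (h : IsGenTWSolution a₀ b₀ c₀ a₁ b₁ c₁ q p u v w S) (ht : t ∈ S)
    (ht0 : (t : ℂ) ≠ 0) (ht1 : 1 - (t : ℂ) ≠ 0) :
    HasDerivAt (genZeta a₀ b₀ c₀ a₁ b₁ c₁ q p u v w)
      (c₁ * q t ^ 2 + 2 * a₁ * p t * q t + b₁ * p t ^ 2) t := by
  have hq := h.deriv_q t ht
  have hp := h.deriv_p t ht
  refine ((((((h.hasDerivAt_genAlpha ht).const_mul 2).mul hp).mul hq).add
    ((h.hasDerivAt_genBeta ht).mul (hp.pow 2))).add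
    ((h.hasDerivAt_genGamma ht).mul (hq.pow 2))).congr_deriv ?_
  simp only [Pi.mul_apply, Pi.pow_apply]
  field_simp
  ring

theorem hasDerivAt_one_sub (t : ℝ) : HasDerivAt (fun s : ℝ => (1 - (s : ℂ))) (-1) t :=
  (hasDerivAt_ofReal t).const_sub 1

/-- An entry of the Schlesinger equation A₀' = [A_t, A₀]/t, where A_t has rows (-qp, q²) and (-p²,
qp). The next two lemmas are the other entries; together they make det A₀ constant. -/
theorem hasDerivAt_residueA (h : IsGenTWSolution a₀ b₀ c₀ a₁ b₁ c₁ q p u v w S) (ht : t ∈ S)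
    (ht0 : (t : ℂ) ≠ 0) (ht1 : 1 - (t : ℂ) ≠ 0) :
    HasDerivAt (residueA a₀ b₁ c₁ q p u v w)
      ((q t ^ 2 * residueC c₀ a₁ c₁ p v w t + p t ^ 2 * residueB b₀ a₁ b₁ q u v t) / t) t := by
  refine (((((h.deriv_v t ht).const_add a₀).add ((h.deriv_u t ht).const_mul c₁)).sub
    ((h.deriv_w t ht).const_mul b₁)).add
    ((hasDerivAt_one_sub t).mul ((h.deriv_q t ht).mul (h.deriv_p t ht)))).congr_deriv ?_
  simp only [Pi.mul_apply, residueB, residueC, genAlpha, genBeta, genGamma]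
  field_simp
  ring

theorem hasDerivAt_residueB (h : IsGenTWSolution a₀ b₀ c₀ a₁ b₁ c₁ q p u v w S) (ht : t ∈ S)
    (ht0 : (t : ℂ) ≠ 0) (ht1 : 1 - (t : ℂ) ≠ 0) :
    HasDerivAt (residueB b₀ a₁ b₁ q u v)
      ((-2 * (q t * p t) * residueB b₀ a₁ b₁ q u v t
        - 2 * q t ^ 2 * residueA a₀ b₁ c₁ q p u v w t) / t) t := by
  refine (((((h.deriv_u t ht).const_mul (2 * a₁ - 1)).const_add b₀).add
    ((h.deriv_v t ht).const_mul (2 * b₁))).sub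
    ((hasDerivAt_one_sub t).mul ((h.deriv_q t ht).pow 2))).congr_deriv ?_
  simp only [Pi.pow_apply, residueA, residueB, genAlpha, genBeta]
  field_simp
  ring

theorem hasDerivAt_residueC (h : IsGenTWSolution a₀ b₀ c₀ a₁ b₁ c₁ q p u v w S) (ht : t ∈ S)
    (ht0 : (t : ℂ) ≠ 0) (ht1 : 1 - (t : ℂ) ≠ 0) :
    HasDerivAt (residueC c₀ a₁ c₁ p v w)
      ((2 * (q t * p t) * residueC c₀ a₁ c₁ p v w t
        - 2 * p t ^ 2 * residueA a₀ b₁ c₁ q p u v w t) / t) t := by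
  refine ((((((h.deriv_v t ht).const_mul (2 * c₁)).const_sub c₀).sub
    ((h.deriv_w t ht).const_mul (2 * a₁ + 1))).neg).add
    ((hasDerivAt_one_sub t).mul ((h.deriv_p t ht).pow 2))).congr_deriv ?_
  simp only [Pi.pow_apply, residueA, residueC, genAlpha, genGamma]
  field_simp
  ring

end IsGenTWSolution

theorem eq_of_hasDerivAt_zero {F : ℝ → ℂ} {t : ℝ} (ht : 0 ≤ t)
    (hc : ∀ s ∈ Icc 0 t, ContinuousAt F s) (hd : ∀ s ∈ Ioo 0 t, HasDerivAt F 0 s) : F t = F 0 := by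
  have := intervalIntegral.integral_eq_sub_of_hasDerivAt_of_le (f := F) (f' := fun _ => 0) ht
    (fun s hs => (hc s hs).continuousWithinAt) hd intervalIntegrable_const
  simp only [intervalIntegral.integral_zero] at this
  exact (sub_eq_zero.1 this.symm)

theorem Differentiable.eq_zero_of_eventually {G : ℂ → ℂ} (hG : Differentiable ℂ G)
    (h0 : ∀ᶠ z in 𝓝 0, G z = 0) (z : ℂ) : G z = 0 := by
  have := (Complex.analyticOnNhd_univ_iff_differentiable.2 hG).eq_of_eventuallyEq
    (Complex.analyticOnNhd_univ_iff_differentiable.2 (differentiable_const (0 : ℂ))) h0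
  exact congrFun this z

namespace IsNiceKernel

variable {K : ℝ → ℝ → ℂ} {M : ℝ} {f g : ℝ → ℂ} {t : ℝ}

theorem fredDet_mul_resPairing (h : IsNiceKernel K M) (hf : Continuous f) (hg : Continuous g)
    (hD : fredDet K t ≠ 0) : fredDet K t * resPairing K f g t
      = fredDet K t * (∫ x in (0)..t, f x * g x)
        + ∫ x in (0)..t, f x * ∫ z in (0)..t, fredMinor K t x z * g z := by
  have hN : Continuous fun x => ∫ z in (0)..t, fredMinor K t x z * g z :=
    (h.continuous_integral_fredMinor hg).comp (by fun_prop : Continuous fun x : ℝ => (t, x))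
  have hi : ∀ {F : ℝ → ℂ}, Continuous F → IntervalIntegrable F volume 0 t :=
    fun h => h.intervalIntegrable 0 t
  rw [resPairing, ← intervalIntegral.integral_const_mul, ← intervalIntegral.integral_const_mul,
    ← intervalIntegral.integral_add (hi (by fun_prop)) (hi (by fun_prop))]
  refine intervalIntegral.integral_congr fun x _ => ?_
  linear_combination f x * fredDet_mul_resSol (f := g) hD x

theorem continuousAt_resPairing (h : IsNiceKernel K M) (hf : Continuous f) (hg : Continuous g)
    (hD : fredDet K t ≠ 0) : ContinuousAt (resPairing K f g) t := by
  have h1 : ContinuousAt (fun s => ((fredDet K s * ∫ x in (0)..s, f x * g x)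
      + ∫ x in (0)..s, f x * ∫ z in (0)..s, fredMinor K s x z * g z) / fredDet K s) t := by
    have hN := h.continuous_integral_fredMinor hg
    refine ContinuousAt.div ?_ h.continuous_fredDet.continuousAt hD
    refine Continuous.continuousAt (Continuous.add (h.continuous_fredDet.mul ?_) ?_)
    · exact intervalIntegral.continuous_parametric_intervalIntegral_of_continuous
        (f := fun _ x => f x * g x) ((hf.comp continuous_snd).mul (hg.comp continuous_snd))
        continuous_id
    · exact intervalIntegral.continuous_parametric_intervalIntegral_of_continuous
        (f := fun s x => f x * ∫ z in (0)..s, fredMinor K s x z * g z)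
        ((hf.comp continuous_snd).mul hN) continuous_id
  refine h1.congr ?_
  filter_upwards [h.eventually_fredDet_ne_zero hD] with s hs
  rw [← h.fredDet_mul_resPairing hf hg hs]
  field_simp

theorem continuousAt_resSol_diag (h : IsNiceKernel K M) (hf : Continuous f)
    (hD : fredDet K t ≠ 0) : ContinuousAt (fun s => resSol K f s s) t :=
  (h.continuousAt_resSol hf hD t).comp (f := fun s : ℝ => (s, s)) (by fun_prop)

end IsNiceKernel

theorem resSol_zero (K : ℝ → ℝ → ℂ) (f : ℝ → ℂ) (x : ℝ) : resSol K f 0 x = f x := by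
  simp [resSol]

theorem resPairing_zero (K : ℝ → ℝ → ℂ) (f g : ℝ → ℂ) : resPairing K f g 0 = 0 := by
  simp [resPairing]

namespace IsTWData

variable {a₀ b₀ c₀ a₁ b₁ c₁ : ℂ} {T M : ℝ} {f g : ℝ → ℂ} {K Λ : ℝ → ℝ → ℂ} {t : ℝ}

/-- The linear system is homogeneous and the kernel quadratic in the solution: this introduces a
coupling constant l² without changing the coefficients. -/
theorem const_mul (h : IsTWData a₀ b₀ c₀ a₁ b₁ c₁ T M f g K Λ) (l : ℂ) :
    IsTWData a₀ b₀ c₀ a₁ b₁ c₁ T (‖l ^ 2‖ * M) (fun x => l * f x) (fun x => l * g x)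
      (fun x y => l ^ 2 * K x y) (fun x y => l ^ 2 * Λ x y) where
  nice := h.nice.const_mul _
  lt_one := h.lt_one
  cont_f := continuous_const.mul h.cont_f
  cont_g := continuous_const.mul h.cont_g
  cont_Λ := continuous_const.mul h.cont_Λ
  f_zero := by simp [h.f_zero]
  g_zero := by simp [h.g_zero]
  kernel x hx y hy := by linear_combination l ^ 2 * h.kernel x hx y hy
  deriv_f x hx := ((h.deriv_f x hx).const_mul l).congr_deriv (by ring)
  deriv_g x hx := ((h.deriv_g x hx).const_mul l).congr_deriv (by ring)
  deriv_K x hx y hy := ((h.deriv_K x hx y hy).const_mul (l ^ 2)).congr_deriv (by ring)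
  Λ_add x hx y hy := by linear_combination l ^ 2 * h.Λ_add x hx y hy

/-- With no zero of D on [0, t], the conserved quantities can be followed down to 0, where q, p, u,
v, w all vanish. -/
theorem first_integrals_of_forall_ne_zero (h : IsTWData a₀ b₀ c₀ a₁ b₁ c₁ T M f g K Λ)
    (ht : t ∈ Ioo 0 T) (hD : ∀ s ∈ Icc 0 t, fredDet K s ≠ 0) :
    genZeta a₀ b₀ c₀ a₁ b₁ c₁ (fun s => resSol K f s s) (fun s => resSol K g s s)
      (resPairing K f f) (resPairing K f g) (resPairing K g g) t
      = c₁ * resPairing K f f t + 2 * a₁ * resPairing K f g t + b₁ * resPairing K g g t ∧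
    residueA a₀ b₁ c₁ (fun s => resSol K f s s) (fun s => resSol K g s s)
      (resPairing K f f) (resPairing K f g) (resPairing K g g) t ^ 2
      + residueB b₀ a₁ b₁ (fun s => resSol K f s s) (resPairing K f f) (resPairing K f g) t
        * residueC c₀ a₁ c₁ (fun s => resSol K g s s) (resPairing K f g) (resPairing K g g) t
      = a₀ ^ 2 - b₀ * c₀ := by
  have hsol := h.isGenTWSolution
  have hS : ∀ s ∈ Ioo 0 t, s ∈ {t | t ∈ Ioo 0 T ∧ fredDet K t ≠ 0} := fun s hs =>
    ⟨⟨hs.1, hs.2.trans ht.2⟩, hD s ⟨hs.1.le, hs.2.le⟩⟩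
  have hne : ∀ s ∈ Ioo 0 t, (s : ℂ) * (1 - s) ≠ 0 := fun s hs =>
    h.mul_one_sub_ne_zero (hS s hs).1
  have q0 : resSol K f 0 0 = 0 := by rw [resSol_zero, h.f_zero]
  have p0 : resSol K g 0 0 = 0 := by rw [resSol_zero, h.g_zero]
  set q := fun s => resSol K f s s with hq
  set p := fun s => resSol K g s s with hp
  set u := resPairing K f f with hu
  set v := resPairing K f g with hv
  set w := resPairing K g g with hw
  have u0 : u 0 = 0 := resPairing_zero _ _ _
  have v0 : v 0 = 0 := resPairing_zero _ _ _
  have w0 : w 0 = 0 := resPairing_zero _ _ _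
  have cq : ∀ s ∈ Icc 0 t, ContinuousAt q s := fun s hs =>
    h.nice.continuousAt_resSol_diag h.cont_f (hD s hs)
  have cp : ∀ s ∈ Icc 0 t, ContinuousAt p s := fun s hs =>
    h.nice.continuousAt_resSol_diag h.cont_g (hD s hs)
  have cu : ∀ s ∈ Icc 0 t, ContinuousAt u s := fun s hs =>
    h.nice.continuousAt_resPairing h.cont_f h.cont_f (hD s hs)
  have cv : ∀ s ∈ Icc 0 t, ContinuousAt v s := fun s hs =>
    h.nice.continuousAt_resPairing h.cont_f h.cont_g (hD s hs)
  have cw : ∀ s ∈ Icc 0 t, ContinuousAt w s := fun s hs =>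
    h.nice.continuousAt_resPairing h.cont_g h.cont_g (hD s hs)
  constructor
  · have := eq_of_hasDerivAt_zero (F := fun s => genZeta a₀ b₀ c₀ a₁ b₁ c₁ q p u v w s
      - (c₁ * u s + 2 * a₁ * v s + b₁ * w s)) ht.1.le (fun s hs => ?_) fun s hs => ?_
    · simp only [genZeta, q0, p0, u0, v0, w0, hq, hp] at this ⊢
      linear_combination this
    · have := cq s hs
      have := cp s hs
      have := cu s hs
      have := cv s hs
      have := cw s hs
      unfold genZeta genAlpha genBeta genGamma
      fun_prop
    · refine ((hsol.hasDerivAt_genZeta (hS s hs) (left_ne_zero_of_mul (hne s hs))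
        (right_ne_zero_of_mul (hne s hs))).sub ((((hsol.deriv_u s (hS s hs)).const_mul c₁).add
        ((hsol.deriv_v s (hS s hs)).const_mul (2 * a₁))).add
        ((hsol.deriv_w s (hS s hs)).const_mul b₁))).congr_deriv ?_
      ring
  · have := eq_of_hasDerivAt_zero (F := fun s => residueA a₀ b₁ c₁ q p u v w s ^ 2
      + residueB b₀ a₁ b₁ q u v s * residueC c₀ a₁ c₁ p v w s) ht.1.le
      (fun s hs => ?_) fun s hs => ?_
    · rw [this]
      simp only [residueA, residueB, residueC, q0, p0, u0, v0, w0, hq, hp]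
      ring
    · have := cq s hs
      have := cp s hs
      have := cu s hs
      have := cv s hs
      have := cw s hs
      unfold residueA residueB residueC
      fun_prop
    · have e0 := left_ne_zero_of_mul (hne s hs)
      have e1 := right_ne_zero_of_mul (hne s hs)
      refine (((hsol.hasDerivAt_residueA (hS s hs) e0 e1).pow 2).add
        ((hsol.hasDerivAt_residueB (hS s hs) e0 e1).mul
          (hsol.hasDerivAt_residueC (hS s hs) e0 e1))).congr_deriv ?_
      push_cast
      field_simp
      ring

/-- Zeros of D in (0, t) break the argument of following the flow from 0. Instead t is fixed and the
solution is scaled to (lf, lg), with kernel l²K. For small l there are no such zeros; multiplied by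
a power of D, each identity is one between entire functions of l, hence holds at l = 1. -/
theorem first_integrals (h : IsTWData a₀ b₀ c₀ a₁ b₁ c₁ T M f g K Λ)
    (ht : t ∈ Ioo 0 T) (hD : fredDet K t ≠ 0) :
    genZeta a₀ b₀ c₀ a₁ b₁ c₁ (fun s => resSol K f s s) (fun s => resSol K g s s)
      (resPairing K f f) (resPairing K f g) (resPairing K g g) t
      = c₁ * resPairing K f f t + 2 * a₁ * resPairing K f g t + b₁ * resPairing K g g t ∧
    residueA a₀ b₁ c₁ (fun s => resSol K f s s) (fun s => resSol K g s s)
      (resPairing K f f) (resPairing K f g) (resPairing K g g) t ^ 2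
      + residueB b₀ a₁ b₁ (fun s => resSol K f s s) (resPairing K f f) (resPairing K f g) t
        * residueC c₀ a₁ c₁ (fun s => resSol K g s s) (resPairing K f g) (resPairing K g g) t
      = a₀ ^ 2 - b₀ * c₀ := by
  set d : ℂ → ℂ := fun l => fredDet (fun x y => l ^ 2 * K x y) t with hd
  -- `num` is D times q or p, and `pr` is D times u, v or w, for the scaled solution. Unlike the
  -- quotients, these are entire in l.
  set num : (ℝ → ℂ) → ℂ → ℂ := fun f l => l * (d l * f t
    + ∫ z in (0)..t, fredMinor (fun x y => l ^ 2 * K x y) t t z * f z) with hnum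
  set pr : (ℝ → ℂ) → (ℝ → ℂ) → ℂ → ℂ := fun f g l => l ^ 2 * (d l * (∫ x in (0)..t, f x * g x)
    + ∫ x in (0)..t, f x * ∫ z in (0)..t, fredMinor (fun x y => l ^ 2 * K x y) t x z * g z)
    with hpr
  have hsq : Differentiable ℂ fun l : ℂ => l ^ 2 := by fun_prop
  have dd : Differentiable ℂ d := (h.nice.differentiable_fredDet t).comp hsq
  have dnum : ∀ f : ℝ → ℂ, Continuous f → Differentiable ℂ (num f) := fun f hf => by
    have := (h.nice.differentiable_integral_fredMinor hf ht.1.le t).comp hsq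
    exact differentiable_id.mul ((dd.mul_const _).add this)
  have dpr : ∀ f g : ℝ → ℂ, Continuous f → Continuous g → Differentiable ℂ (pr f g) :=
    fun f g hf hg => by
      have := (h.nice.differentiable_integral_integral_fredMinor hf hg ht.1.le).comp hsq
      exact hsq.mul ((dd.mul_const _).add this)
  have enum : ∀ (f : ℝ → ℂ) (l : ℂ), d l ≠ 0 → num f l
      = d l * resSol (fun x y => l ^ 2 * K x y) (fun x => l * f x) t t := fun f l hl => by
    rw [IsNiceKernel.fredDet_mul_resSol hl, hnum]
    simp only [mul_add, ← intervalIntegral.integral_const_mul]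
    congr 1
    · ring
    · exact intervalIntegral.integral_congr fun z _ => by ring
  have epr : ∀ (f g : ℝ → ℂ) (l : ℂ), Continuous f → Continuous g → d l ≠ 0 → pr f g l
      = d l * resPairing (fun x y => l ^ 2 * K x y) (fun x => l * f x) (fun x => l * g x) t :=
    fun f g l hf hg hl => by
    rw [(h.const_mul l).nice.fredDet_mul_resPairing (f := fun x => l * f x)
      (g := fun x => l * g x) (continuous_const.mul hf) (continuous_const.mul hg) hl, hpr]
    simp only [mul_add]
    congr 1
    · rw [mul_left_comm, ← intervalIntegral.integral_const_mul]
      congr 1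
      exact intervalIntegral.integral_congr fun z _ => by ring
    · rw [← intervalIntegral.integral_const_mul]
      refine intervalIntegral.integral_congr fun x _ => ?_
      simp only [mul_left_comm _ l, intervalIntegral.integral_const_mul]
      ring
  set X : ℂ → ℂ := fun l => d l * (d l * a₀ + pr f g l + c₁ * pr f f l - b₁ * pr g g l)
    + (1 - t) * (num f l * num g l) with hX
  set Y : ℂ → ℂ := fun l => d l * (d l * b₀ + (2 * a₁ - 1) * pr f f l + 2 * b₁ * pr f g l)
    - (1 - t) * num f l ^ 2 with hY
  set Z : ℂ → ℂ := fun l => -(d l * (d l * c₀ - 2 * c₁ * pr f g l - (2 * a₁ + 1) * pr g g l))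
    + (1 - t) * num g l ^ 2 with hZ
  -- `G₁` is the defect of the first identity times D³, as αpq is a product of three quotients. `G₂`
  -- is that of the second times D⁴: each entry of the residue needs D², and `X`, `Y`, `Z` are these
  -- multiples.
  set G₁ : ℂ → ℂ := fun l =>
    2 * (d l * (a₀ + a₁ * t) + pr f g l + c₁ * pr f f l - b₁ * pr g g l) * num g l * num f l
    + (d l * (b₀ + b₁ * t) + (2 * a₁ - 1) * pr f f l + 2 * b₁ * pr f g l) * num g l ^ 2
    + (d l * (c₀ + c₁ * t) - 2 * c₁ * pr f g l - (2 * a₁ + 1) * pr g g l) * num f l ^ 2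
    - d l ^ 2 * (c₁ * pr f f l + 2 * a₁ * pr f g l + b₁ * pr g g l) with hG₁
  set G₂ : ℂ → ℂ := fun l => X l ^ 2 + Y l * Z l - d l ^ 4 * (a₀ ^ 2 - b₀ * c₀) with hG₂
  have n1 := dnum f h.cont_f
  have n2 := dnum g h.cont_g
  have r1 := dpr f f h.cont_f h.cont_f
  have r2 := dpr f g h.cont_f h.cont_g
  have r3 := dpr g g h.cont_g h.cont_g
  have dG₁ : Differentiable ℂ G₁ := by fun_prop
  have dG₂ : Differentiable ℂ G₂ := by fun_prop
  have expr₁ : ∀ l, d l ≠ 0 → G₁ l = d l ^ 3 *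
      (genZeta a₀ b₀ c₀ a₁ b₁ c₁ (fun s => resSol (fun x y => l ^ 2 * K x y) (fun x => l * f x) s s)
        (fun s => resSol (fun x y => l ^ 2 * K x y) (fun x => l * g x) s s)
        (resPairing (fun x y => l ^ 2 * K x y) (fun x => l * f x) (fun x => l * f x))
        (resPairing (fun x y => l ^ 2 * K x y) (fun x => l * f x) (fun x => l * g x))
        (resPairing (fun x y => l ^ 2 * K x y) (fun x => l * g x) (fun x => l * g x)) t
      - (c₁ * resPairing (fun x y => l ^ 2 * K x y) (fun x => l * f x) (fun x => l * f x) t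
        + 2 * a₁ * resPairing (fun x y => l ^ 2 * K x y) (fun x => l * f x) (fun x => l * g x) t
        + b₁ * resPairing (fun x y => l ^ 2 * K x y) (fun x => l * g x) (fun x => l * g x) t)) :=
    fun l hl => by
      simp only [hG₁, enum _ l hl, epr f f l h.cont_f h.cont_f hl, epr f g l h.cont_f h.cont_g hl,
        epr g g l h.cont_g h.cont_g hl, genZeta, genAlpha, genBeta, genGamma]
      ring
  have expr₂ : ∀ l, d l ≠ 0 → G₂ l = d l ^ 4 *
      (residueA a₀ b₁ c₁ (fun s => resSol (fun x y => l ^ 2 * K x y) (fun x => l * f x) s s)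
        (fun s => resSol (fun x y => l ^ 2 * K x y) (fun x => l * g x) s s)
        (resPairing (fun x y => l ^ 2 * K x y) (fun x => l * f x) (fun x => l * f x))
        (resPairing (fun x y => l ^ 2 * K x y) (fun x => l * f x) (fun x => l * g x))
        (resPairing (fun x y => l ^ 2 * K x y) (fun x => l * g x) (fun x => l * g x)) t ^ 2
      + residueB b₀ a₁ b₁ (fun s => resSol (fun x y => l ^ 2 * K x y) (fun x => l * f x) s s)
        (resPairing (fun x y => l ^ 2 * K x y) (fun x => l * f x) (fun x => l * f x))
        (resPairing (fun x y => l ^ 2 * K x y) (fun x => l * f x) (fun x => l * g x)) t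
      * residueC c₀ a₁ c₁ (fun s => resSol (fun x y => l ^ 2 * K x y) (fun x => l * g x) s s)
        (resPairing (fun x y => l ^ 2 * K x y) (fun x => l * f x) (fun x => l * g x))
        (resPairing (fun x y => l ^ 2 * K x y) (fun x => l * g x) (fun x => l * g x)) t
      - (a₀ ^ 2 - b₀ * c₀)) := fun l hl => by
      simp only [hG₂, hX, hY, hZ, enum _ l hl, epr f f l h.cont_f h.cont_f hl,
        epr f g l h.cont_f h.cont_g hl, epr g g l h.cont_g h.cont_g hl, residueA, residueB,
        residueC]
      ring
  obtain ⟨δ, hδ, hne⟩ := h.nice.exists_pos_forall_fredDet_ne_zero t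
  have ev : ∀ᶠ l : ℂ in 𝓝 0, ‖l ^ 2‖ < δ := by
    have : Tendsto (fun l : ℂ => ‖l ^ 2‖) (𝓝 0) (𝓝 ‖(0 : ℂ) ^ 2‖) :=
      Continuous.tendsto (by fun_prop) 0
    exact this.eventually_lt_const (by simpa using hδ)
  have z : ∀ᶠ l : ℂ in 𝓝 0, G₁ l = 0 ∧ G₂ l = 0 := by
    filter_upwards [ev] with l hl
    have hdl : d l ≠ 0 := hne _ hl t ⟨ht.1.le, le_rfl⟩
    obtain ⟨e1, e2⟩ := (h.const_mul l).first_integrals_of_forall_ne_zero ht (hne _ hl)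
    rw [expr₁ l hdl, expr₂ l hdl, e1, e2]
    simp
  have hd1 : d 1 ≠ 0 := by simpa [hd] using hD
  have z1 := dG₁.eq_zero_of_eventually (z.mono fun _ h => h.1) 1
  have z2 := dG₂.eq_zero_of_eventually (z.mono fun _ h => h.2) 1
  rw [expr₁ 1 hd1] at z1
  rw [expr₂ 1 hd1] at z2
  have z1 := (mul_eq_zero.1 z1).resolve_left (pow_ne_zero _ hd1)
  have z2 := (mul_eq_zero.1 z2).resolve_left (pow_ne_zero _ hd1)
  simp only [one_pow, one_mul] at z1 z2
  exact ⟨sub_eq_zero.1 z1, sub_eq_zero.1 z2⟩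


end IsTWData

end

/-! ### A continuous extension of the kernel, by integration along the flow of x(1 - x)d/dx. -/

noncomputable section

/-- The nearest point to `x` in `[0, T]`. -/
def clampIcc (T x : ℝ) : ℝ := max 0 (min x T)

theorem clampIcc_of_mem {T x : ℝ} (hx : x ∈ Icc 0 T) : clampIcc T x = x := by
  rw [clampIcc, min_eq_left hx.2, max_eq_right hx.1]

theorem clampIcc_mem {T : ℝ} (hT : 0 ≤ T) (x : ℝ) : clampIcc T x ∈ Icc 0 T :=
  ⟨le_max_left _ _, max_le hT (min_le_right _ _)⟩

@[fun_prop]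
theorem continuous_clampIcc (T : ℝ) : Continuous (clampIcc T) := by
  unfold clampIcc
  fun_prop

/-- The denominator `1 - x + s x`. -/
def scaleDen (T x s : ℝ) : ℝ := 1 - clampIcc T x + clampIcc 1 s * clampIcc T x

/-- The point `y` with `y / (1 - y) = s x / (1 - x)`. -/
def scalePoint (T x s : ℝ) : ℝ := clampIcc 1 s * clampIcc T x / scaleDen T x s

/-- The symmetric bilinear form with matrix `(c, a; a, b)`. -/
def bilinForm (a b c F G H L : ℂ) : ℂ := c * (F * H) + a * (F * L + G * H) + b * (G * L)

/-- The function `f` along the flow `scalePoint`, rescaled. -/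
def scaleFun (T : ℝ) (f : ℝ → ℂ) (x s : ℝ) : ℂ := f (scalePoint T x s) / scaleDen T x s

/-- `x (1 - x)` times the `x`-derivative of the first component of the rescaled solution. -/
def scaleDeriv (T : ℝ) (a₀ b₀ a₁ b₁ : ℂ) (f g : ℝ → ℂ) (x s : ℝ) : ℂ :=
  (a₀ + a₁ * scalePoint T x s) * scaleFun T f x s + (b₀ + b₁ * scalePoint T x s) * scaleFun T g x s
    + (clampIcc T x - scalePoint T x s) * scaleFun T f x s

/-- A continuous extension to the real line of the integrable kernel of `(f, g)` on `(0, T)`. -/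
def extKernel (T : ℝ) (a₁ b₁ c₁ : ℂ) (f g : ℝ → ℂ) (x y : ℝ) : ℂ :=
  ∫ s in (0)..1, bilinForm a₁ b₁ c₁ (scaleFun T f x s) (scaleFun T g x s)
    (scaleFun T f y s) (scaleFun T g y s)

/-- A continuous extension of `x (1 - x)` times the `x`-derivative of the kernel. -/
def extKernelDeriv (T : ℝ) (a₀ b₀ c₀ a₁ b₁ c₁ : ℂ) (f g : ℝ → ℂ) (x y : ℝ) : ℂ :=
  ∫ s in (0)..1, bilinForm a₁ b₁ c₁ (scaleDeriv T a₀ b₀ a₁ b₁ f g x s)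
    (scaleDeriv T (-a₀) (-c₀) (-a₁) (-c₁) g f x s) (scaleFun T f y s) (scaleFun T g y s)

section Scale

variable {T : ℝ} {f g : ℝ → ℂ} {x y s : ℝ}

theorem scaleDen_pos (h0 : 0 ≤ T) (h1 : T < 1) (x s : ℝ) : 0 < scaleDen T x s := by
  have := clampIcc_mem h0 x
  have := clampIcc_mem zero_le_one s
  have : 0 ≤ clampIcc 1 s * clampIcc T x := mul_nonneg this.1 (clampIcc_mem h0 x).1
  rw [scaleDen]
  linarith [(clampIcc_mem h0 x).2]

theorem scaleDen_ne_zero (h0 : 0 ≤ T) (h1 : T < 1) (x s : ℝ) : (scaleDen T x s : ℂ) ≠ 0 := by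
  exact_mod_cast (scaleDen_pos h0 h1 x s).ne'

theorem continuous_scaleDen (T : ℝ) : Continuous fun p : ℝ × ℝ => scaleDen T p.1 p.2 := by
  unfold scaleDen
  fun_prop

theorem continuous_scalePoint (h0 : 0 ≤ T) (h1 : T < 1) :
    Continuous fun p : ℝ × ℝ => scalePoint T p.1 p.2 :=
  Continuous.div (by fun_prop) (continuous_scaleDen T) fun p => (scaleDen_pos h0 h1 p.1 p.2).ne'

theorem continuous_scaleFun (h0 : 0 ≤ T) (h1 : T < 1) (hf : Continuous f) :
    Continuous fun p : ℝ × ℝ => scaleFun T f p.1 p.2 :=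
  (hf.comp (continuous_scalePoint h0 h1)).div
    (Complex.continuous_ofReal.comp (continuous_scaleDen T)) fun p => scaleDen_ne_zero h0 h1 p.1 p.2

theorem continuous_scaleDeriv (h0 : 0 ≤ T) (h1 : T < 1) (hf : Continuous f) (hg : Continuous g)
    (a₀ b₀ a₁ b₁ : ℂ) : Continuous fun p : ℝ × ℝ => scaleDeriv T a₀ b₀ a₁ b₁ f g p.1 p.2 := by
  have := continuous_scaleFun h0 h1 hf
  have := continuous_scaleFun h0 h1 hg
  have := continuous_scalePoint h0 h1
  unfold scaleDeriv
  fun_prop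

theorem continuous_integral_bilinForm {F G H L : ℝ → ℝ → ℂ}
    (hF : Continuous fun p : ℝ × ℝ => F p.1 p.2) (hG : Continuous fun p : ℝ × ℝ => G p.1 p.2)
    (hH : Continuous fun p : ℝ × ℝ => H p.1 p.2) (hL : Continuous fun p : ℝ × ℝ => L p.1 p.2)
    (a b c : ℂ) : Continuous fun p : ℝ × ℝ =>
      ∫ s in (0)..1, bilinForm a b c (F p.1 s) (G p.1 s) (H p.2 s) (L p.2 s) := by
  refine intervalIntegral.continuous_parametric_intervalIntegral_of_continuous'
    (f := fun (p : ℝ × ℝ) s => bilinForm a b c (F p.1 s) (G p.1 s) (H p.2 s) (L p.2 s)) ?_ 0 1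
  have h1 := hF.comp (by fun_prop : Continuous fun r : (ℝ × ℝ) × ℝ => (r.1.1, r.2))
  have h2 := hG.comp (by fun_prop : Continuous fun r : (ℝ × ℝ) × ℝ => (r.1.1, r.2))
  have h3 := hH.comp (by fun_prop : Continuous fun r : (ℝ × ℝ) × ℝ => (r.1.2, r.2))
  have h4 := hL.comp (by fun_prop : Continuous fun r : (ℝ × ℝ) × ℝ => (r.1.2, r.2))
  simp only [Function.comp_def] at h1 h2 h3 h4
  unfold bilinForm
  simp only [Function.uncurry_def]
  fun_prop

theorem scaleFun_clampIcc (h0 : 0 ≤ T) (x s : ℝ) :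
    scaleFun T f (clampIcc T x) s = scaleFun T f x s := by
  simp only [scaleFun, scalePoint, scaleDen, clampIcc_of_mem (clampIcc_mem h0 x)]

/-- The clamps make the kernel depend only on the nearest points of [0, T], so its bound on the
compact square is global. -/
theorem isNiceKernel_extKernel (h0 : 0 ≤ T) (h1 : T < 1) (hf : Continuous f) (hg : Continuous g)
    (a₁ b₁ c₁ : ℂ) : ∃ M, IsNiceKernel (extKernel T a₁ b₁ c₁ f g) M := by
  have hc : Continuous (Function.uncurry (extKernel T a₁ b₁ c₁ f g)) :=
    continuous_integral_bilinForm (continuous_scaleFun h0 h1 hf) (continuous_scaleFun h0 h1 hg)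
      (continuous_scaleFun h0 h1 hf) (continuous_scaleFun h0 h1 hg) a₁ b₁ c₁
  obtain ⟨M, hM⟩ := ((isCompact_Icc (a := (0 : ℝ)) (b := T)).prod
    (isCompact_Icc (a := (0 : ℝ)) (b := T))).exists_bound_of_continuousOn hc.continuousOn
  refine ⟨M, hc, fun x y => ?_, fun x y => ?_⟩
  · have := hM (clampIcc T x, clampIcc T y) ⟨clampIcc_mem h0 x, clampIcc_mem h0 y⟩
    simpa only [Function.uncurry_apply_pair, extKernel, scaleFun_clampIcc h0] using this
  · refine intervalIntegral.integral_congr fun s _ => ?_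
    simp only [bilinForm]
    ring

theorem scaleDen_eq (hx : x ∈ Icc 0 T) (hs : s ∈ Icc 0 1) : scaleDen T x s = 1 - x + s * x := by
  rw [scaleDen, clampIcc_of_mem hx, clampIcc_of_mem hs]

theorem scalePoint_eq (hx : x ∈ Icc 0 T) (hs : s ∈ Icc 0 1) :
    scalePoint T x s = s * x / (1 - x + s * x) := by
  rw [scalePoint, scaleDen_eq hx hs, clampIcc_of_mem hx, clampIcc_of_mem hs]

theorem scaleDen_mul_scalePoint (h0 : 0 ≤ T) (h1 : T < 1) (hx : x ∈ Icc 0 T) (hs : s ∈ Icc 0 1) :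
    (scaleDen T x s : ℂ) * scalePoint T x s = s * x := by
  rw [scalePoint, clampIcc_of_mem hx, clampIcc_of_mem hs]
  push_cast
  field_simp [scaleDen_ne_zero h0 h1 x s]

theorem scalePoint_mem (h1 : T < 1) (hx : x ∈ Ioc 0 T) (hs : s ∈ Ioo 0 1) :
    scalePoint T x s ∈ Ioo 0 T := by
  rw [scalePoint_eq ⟨hx.1.le, hx.2⟩ ⟨hs.1.le, hs.2.le⟩]
  have h3 : 0 < s * x := mul_pos hs.1 hx.1
  have h2 : 0 < 1 - x + s * x := by linarith [hx.2]
  refine ⟨by positivity, ?_⟩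
  rw [div_lt_iff₀ h2]
  have : 0 < x * (1 - x) * (1 - s) :=
    mul_pos (mul_pos hx.1 (by linarith [hx.2])) (by linarith [hs.2])
  nlinarith [mul_le_mul_of_nonneg_right hx.2 h2.le]

theorem hasDerivAt_scaleDen_right (hx : x ∈ Icc 0 T) (hs : s ∈ Ioo 0 1) :
    HasDerivAt (fun s => (scaleDen T x s : ℂ)) x s := by
  have h : HasDerivAt (fun s : ℝ => (1 : ℂ) - x + s * x) x s := by
    simpa using ((hasDerivAt_ofReal s).mul_const (x : ℂ)).const_add (1 - (x : ℂ))
  refine h.congr_of_eventuallyEq ?_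
  filter_upwards [Icc_mem_nhds hs.1 hs.2] with r hr
  rw [scaleDen_eq hx hr]
  push_cast
  rfl

theorem hasDerivAt_scaleDen_left (hx : x ∈ Ioo 0 T) (hs : s ∈ Icc 0 1) :
    HasDerivAt (fun x => (scaleDen T x s : ℂ)) (s - 1) x := by
  have h : HasDerivAt (fun x : ℝ => (1 : ℂ) - x + s * x) (s - 1) x :=
    (((hasDerivAt_ofReal x).const_sub 1).add ((hasDerivAt_ofReal x).const_mul (s : ℂ))).congr_deriv
      (by ring)
  refine h.congr_of_eventuallyEq ?_
  filter_upwards [Icc_mem_nhds hx.1 hx.2] with r hr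
  rw [scaleDen_eq hr hs]
  push_cast
  rfl

theorem hasDerivAt_scalePoint_right (h1 : T < 1) (hx : x ∈ Icc 0 T) (hs : s ∈ Ioo 0 1) :
    HasDerivAt (fun s => scalePoint T x s) (x * (1 - x) / scaleDen T x s ^ 2) s := by
  have hd : 1 - x + s * x ≠ 0 := by
    have := mul_nonneg hs.1.le hx.1
    linarith [hx.2]
  have hs' : s ∈ Icc (0 : ℝ) 1 := ⟨hs.1.le, hs.2.le⟩
  have h : HasDerivAt (fun s : ℝ => s * x / (1 - x + s * x)) (x * (1 - x) / scaleDen T x s ^ 2) s := by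
    refine (((hasDerivAt_id s).mul_const x).div
      (((hasDerivAt_id s).mul_const x).const_add (1 - x)) hd).congr_deriv ?_
    rw [scaleDen_eq hx hs']
    congr 1
    simp only [id]
    ring
  refine h.congr_of_eventuallyEq ?_
  filter_upwards [Icc_mem_nhds hs.1 hs.2] with r hr
  rw [scalePoint_eq hx hr]

theorem hasDerivAt_scalePoint_left (h1 : T < 1) (hx : x ∈ Ioo 0 T) (hs : s ∈ Icc 0 1) :
    HasDerivAt (fun x => scalePoint T x s) (s / scaleDen T x s ^ 2) x := by
  have hd : 1 - x + s * x ≠ 0 := by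
    have := mul_nonneg hs.1 hx.1.le
    linarith [hx.2]
  have hx' : x ∈ Icc 0 T := ⟨hx.1.le, hx.2.le⟩
  have h : HasDerivAt (fun x : ℝ => s * x / (1 - x + s * x)) (s / scaleDen T x s ^ 2) x := by
    refine (((hasDerivAt_id x).const_mul s).div
      (((hasDerivAt_id x).const_sub 1).add ((hasDerivAt_id x).const_mul s)) hd).congr_deriv ?_
    rw [scaleDen_eq hx' hs]
    congr 1
    simp only [id, Pi.add_apply]
    ring
  refine h.congr_of_eventuallyEq ?_
  filter_upwards [Icc_mem_nhds hx.1 hx.2] with r hr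
  rw [scalePoint_eq hr hs]

/-- Chain rule along `scalePoint` for a function with derivative `F x / (x (1 - x))`. -/
theorem hasDerivAt_comp_scalePoint_right {F : ℝ → ℂ} (h0 : 0 ≤ T) (h1 : T < 1)
    (hd : ∀ x ∈ Ioo 0 T, HasDerivAt f (F x / ((x : ℂ) * (1 - x))) x) (hF : F 0 = 0)
    (hx : x ∈ Icc 0 T) (hs : s ∈ Ioo 0 1) :
    HasDerivAt (fun s => f (scalePoint T x s)) (F (scalePoint T x s) / s) s := by
  have hs' : s ∈ Icc (0 : ℝ) 1 := ⟨hs.1.le, hs.2.le⟩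
  -- The origin is a fixed point of the flow, where nothing is known about the derivative of f; the
  -- claim survives because F 0 = 0.
  rcases hx.1.eq_or_lt with rfl | hx0
  · have : ∀ r, scalePoint T 0 r = 0 := fun r => by simp [scalePoint, clampIcc_of_mem hx]
    simp only [this, hF, zero_div]
    exact hasDerivAt_const _ _
  · have hp := scalePoint_mem h1 ⟨hx0, hx.2⟩ hs
    refine ((hd _ hp).scomp s (hasDerivAt_scalePoint_right h1 hx hs)).congr_deriv ?_
    have e := scaleDen_mul_scalePoint h0 h1 hx hs'
    have hne := scaleDen_ne_zero h0 h1 x s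
    have hs0 : (s : ℂ) ≠ 0 := by exact_mod_cast hs.1.ne'
    have hp0 : (scalePoint T x s : ℂ) ≠ 0 := by exact_mod_cast hp.1.ne'
    have hp1 : 1 - (scalePoint T x s : ℂ) ≠ 0 := by
      have : 1 - scalePoint T x s ≠ 0 := by linarith [hp.2]
      exact_mod_cast this
    have e2 : (scaleDen T x s : ℂ) * (1 - scalePoint T x s) = 1 - x := by
      rw [mul_sub, e, scaleDen_eq hx hs']
      push_cast
      ring
    rw [Complex.real_smul]
    push_cast
    field_simp
    linear_combination - F (scalePoint T x s) * (scaleDen T x s * scalePoint T x s) * e2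
      - F (scalePoint T x s) * (1 - x) * e

theorem scalePoint_mem_of_Ioc (h1 : T < 1) (hx : x ∈ Ioo 0 T) (hs : s ∈ Ioc 0 1) :
    scalePoint T x s ∈ Ioo 0 T := by
  rcases hs.2.lt_or_eq with h | rfl
  · exact scalePoint_mem h1 ⟨hx.1, hx.2.le⟩ ⟨hs.1, h⟩
  · rw [scalePoint_eq ⟨hx.1.le, hx.2.le⟩ ⟨hs.1.le, le_rfl⟩]
    simpa using hx

/-- A flow carries its generator to itself: x(1 - x)∂ₓ of the scaled point y is y(1 - y). At s = 0
the scaled point is 0, outside the interval on which f is differentiable, so that value is excluded.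
-/
theorem hasDerivAt_comp_scalePoint_left {F : ℝ → ℂ} (h0 : 0 ≤ T) (h1 : T < 1)
    (hd : ∀ x ∈ Ioo 0 T, HasDerivAt f (F x / ((x : ℂ) * (1 - x))) x)
    (hx : x ∈ Ioo 0 T) (hs : s ∈ Ioc 0 1) :
    HasDerivAt (fun x => f (scalePoint T x s)) (F (scalePoint T x s) / ((x : ℂ) * (1 - x))) x := by
  have hs' : s ∈ Icc (0 : ℝ) 1 := ⟨hs.1.le, hs.2⟩
  have hx' : x ∈ Icc 0 T := ⟨hx.1.le, hx.2.le⟩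
  have hp := scalePoint_mem_of_Ioc h1 hx hs
  refine ((hd _ hp).scomp x (hasDerivAt_scalePoint_left h1 hx hs')).congr_deriv ?_
  have e := scaleDen_mul_scalePoint h0 h1 hx' hs'
  have hne := scaleDen_ne_zero h0 h1 x s
  have hx0 : (x : ℂ) ≠ 0 := by exact_mod_cast hx.1.ne'
  have hx1 : 1 - (x : ℂ) ≠ 0 := by
    have : 1 - x ≠ 0 := by linarith [hx.2]
    exact_mod_cast this
  have hp0 : (scalePoint T x s : ℂ) ≠ 0 := by exact_mod_cast hp.1.ne'
  have hp1 : 1 - (scalePoint T x s : ℂ) ≠ 0 := by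
    have : 1 - scalePoint T x s ≠ 0 := by linarith [hp.2]
    exact_mod_cast this
  have e2 : (scaleDen T x s : ℂ) * (1 - scalePoint T x s) = 1 - x := by
    rw [mul_sub, e, scaleDen_eq hx' hs']
    push_cast
    ring
  rw [Complex.real_smul]
  push_cast
  field_simp
  linear_combination - F (scalePoint T x s) * (scaleDen T x s * scalePoint T x s) * e2
      - F (scalePoint T x s) * (1 - x) * e

end Scale

end

noncomputable section

section Scale

variable {T : ℝ} {f g F : ℝ → ℂ} {x y s : ℝ}

theorem scalePoint_one (hx : x ∈ Icc 0 T) : scalePoint T x 1 = x := by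
  simp [scalePoint_eq hx ⟨zero_le_one, le_rfl⟩]

theorem scalePoint_zero (hx : x ∈ Icc 0 T) : scalePoint T x 0 = 0 := by
  simp [scalePoint_eq hx ⟨le_rfl, zero_le_one⟩]

theorem scaleFun_one (hx : x ∈ Icc 0 T) : scaleFun T f x 1 = f x := by
  simp [scaleFun, scalePoint_one hx, scaleDen_eq hx ⟨zero_le_one, le_rfl⟩]

/-- The extra term comes from the weight: x(1 - x)∂ₓ of 1/(1 - x + sx) is x - y times this weight,
where y is the scaled point. -/
theorem hasDerivAt_scaleFun_left (h0 : 0 ≤ T) (h1 : T < 1)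
    (hd : ∀ x ∈ Ioo 0 T, HasDerivAt f (F x / ((x : ℂ) * (1 - x))) x)
    (hx : x ∈ Ioo 0 T) (hs : s ∈ Ioc 0 1) :
    HasDerivAt (fun x => scaleFun T f x s) ((scaleFun T F x s
      + (clampIcc T x - scalePoint T x s) * scaleFun T f x s) / ((x : ℂ) * (1 - x))) x := by
  have hs' : s ∈ Icc (0 : ℝ) 1 := ⟨hs.1.le, hs.2⟩
  have hx' : x ∈ Icc 0 T := ⟨hx.1.le, hx.2.le⟩
  have hne := scaleDen_ne_zero h0 h1 x s
  have e := scaleDen_mul_scalePoint h0 h1 hx' hs'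
  have hx0 : (x : ℂ) ≠ 0 := by exact_mod_cast hx.1.ne'
  have hx1 : 1 - (x : ℂ) ≠ 0 := by
    have : 1 - x ≠ 0 := by linarith [hx.2]
    exact_mod_cast this
  refine ((hasDerivAt_comp_scalePoint_left h0 h1 hd hx hs).div
    (hasDerivAt_scaleDen_left hx hs') hne).congr_deriv ?_
  have e3 : (scaleDen T x s : ℂ) = 1 - x + s * x := by
    rw [scaleDen_eq hx' hs']
    push_cast
    rfl
  rw [clampIcc_of_mem hx', scaleFun, scaleFun]
  field_simp
  linear_combination (f (scalePoint T x s)) * e - f (scalePoint T x s) * x * e3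

theorem hasDerivAt_scaleFun_right (h0 : 0 ≤ T) (h1 : T < 1)
    (hd : ∀ x ∈ Ioo 0 T, HasDerivAt f (F x / ((x : ℂ) * (1 - x))) x) (hF : F 0 = 0)
    (hx : x ∈ Icc 0 T) (hs : s ∈ Ioo 0 1) :
    HasDerivAt (fun s => scaleFun T f x s) ((scaleFun T F x s
      - scalePoint T x s * scaleFun T f x s) / s) s := by
  have hs' : s ∈ Icc (0 : ℝ) 1 := ⟨hs.1.le, hs.2.le⟩
  have hne := scaleDen_ne_zero h0 h1 x s
  have e := scaleDen_mul_scalePoint h0 h1 hx hs'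
  have hs0 : (s : ℂ) ≠ 0 := by exact_mod_cast hs.1.ne'
  refine ((hasDerivAt_comp_scalePoint_right h0 h1 hd hF hx hs).div
    (hasDerivAt_scaleDen_right hx hs) hne).congr_deriv ?_
  rw [scaleFun, scaleFun]
  field_simp
  linear_combination (f (scalePoint T x s)) * e

theorem scaleFun_linear {F : ℝ → ℂ} {a₀ b₀ a₁ b₁ : ℂ}
    (hF : ∀ x, F x = (a₀ + a₁ * x) * f x + (b₀ + b₁ * x) * g x) :
    scaleFun T F x s = (a₀ + a₁ * scalePoint T x s) * scaleFun T f x s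
      + (b₀ + b₁ * scalePoint T x s) * scaleFun T g x s := by
  simp only [scaleFun, hF]
  ring

end Scale

section ExtKernel

variable {a₀ b₀ c₀ a₁ b₁ c₁ : ℂ} {T : ℝ} {f g : ℝ → ℂ} {x y : ℝ}

/-- Let x_s, y_s be the scaled points and apply s d/ds to f(x_s)g(y_s) - g(x_s)f(y_s). The part of
𝒜₀ drops out because it is traceless, and 𝒜₁ leaves (x_s - y_s) times its symmetric bilinear form.
Since x_s - y_s is s(x - y) over the product of the two denominators, the factor x - y comes out
explicitly. Integrate over [0, 1]; at s = 0 the expression vanishes because f 0 = g 0 = 0. -/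
theorem sub_mul_extKernel (h0 : 0 ≤ T) (h1 : T < 1) (hf : Continuous f) (hg : Continuous g)
    (f0 : f 0 = 0) (g0 : g 0 = 0)
    (hdf : ∀ x ∈ Ioo 0 T, HasDerivAt f
      (((a₀ + a₁ * x) * f x + (b₀ + b₁ * x) * g x) / ((x : ℂ) * (1 - x))) x)
    (hdg : ∀ x ∈ Ioo 0 T, HasDerivAt g
      ((-(c₀ + c₁ * x) * f x - (a₀ + a₁ * x) * g x) / ((x : ℂ) * (1 - x))) x)
    (hx : x ∈ Icc 0 T) (hy : y ∈ Icc 0 T) :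
    ((x : ℂ) - y) * extKernel T a₁ b₁ c₁ f g x y = f x * g y - g x * f y := by
  have cx := continuous_scalePoint h0 h1
  have cf := continuous_scaleFun h0 h1 hf
  have cg := continuous_scaleFun h0 h1 hg
  have cp : ∀ x : ℝ, Continuous fun s => scalePoint T x s := fun x =>
    cx.comp (by fun_prop : Continuous fun s : ℝ => (x, s))
  have cfx : ∀ x : ℝ, Continuous fun s => scaleFun T f x s := fun x =>
    cf.comp (by fun_prop : Continuous fun s : ℝ => (x, s))
  have cgx : ∀ x : ℝ, Continuous fun s => scaleFun T g x s := fun x =>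
    cg.comp (by fun_prop : Continuous fun s : ℝ => (x, s))
  have key := intervalIntegral.integral_eq_sub_of_hasDerivAt_of_le
    (f := fun s => f (scalePoint T x s) * g (scalePoint T y s)
      - g (scalePoint T x s) * f (scalePoint T y s))
    (f' := fun s => ((x : ℂ) - y) * bilinForm a₁ b₁ c₁ (scaleFun T f x s) (scaleFun T g x s)
      (scaleFun T f y s) (scaleFun T g y s)) zero_le_one
    (Continuous.continuousOn (by have := cp x; have := cp y; fun_prop)) (fun s hs => ?_)
    (Continuous.intervalIntegrable (by
      have := cfx x; have := cfx y; have := cgx x; have := cgx y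
      unfold bilinForm
      fun_prop) _ _)
  · rw [intervalIntegral.integral_const_mul] at key
    simpa [extKernel, scalePoint_one hx, scalePoint_one hy, scalePoint_zero hx, scalePoint_zero hy,
      f0, g0] using key
  · have hs' : s ∈ Icc (0 : ℝ) 1 := ⟨hs.1.le, hs.2.le⟩
    have hF0 : (a₀ + a₁ * (0 : ℝ)) * f 0 + (b₀ + b₁ * (0 : ℝ)) * g 0 = 0 := by simp [f0, g0]
    have hG0 : -(c₀ + c₁ * (0 : ℝ)) * f 0 - (a₀ + a₁ * (0 : ℝ)) * g 0 = 0 := by simp [f0, g0]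
    refine (((hasDerivAt_comp_scalePoint_right h0 h1 hdf hF0 hx hs).mul
      (hasDerivAt_comp_scalePoint_right h0 h1 hdg hG0 hy hs)).sub
      ((hasDerivAt_comp_scalePoint_right h0 h1 hdg hG0 hx hs).mul
      (hasDerivAt_comp_scalePoint_right h0 h1 hdf hF0 hy hs))).congr_deriv ?_
    have ex := scaleDen_mul_scalePoint h0 h1 hx hs'
    have ey := scaleDen_mul_scalePoint h0 h1 hy hs'
    have nx := scaleDen_ne_zero h0 h1 x s
    have ny := scaleDen_ne_zero h0 h1 y s
    have hs0 : (s : ℂ) ≠ 0 := by exact_mod_cast hs.1.ne'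
    have dx : (scaleDen T x s : ℂ) = 1 - x + s * x := by
      rw [scaleDen_eq hx hs']
      push_cast
      rfl
    have dy : (scaleDen T y s : ℂ) = 1 - y + s * y := by
      rw [scaleDen_eq hy hs']
      push_cast
      rfl
    have e : (scaleDen T x s : ℂ) * scaleDen T y s * (scalePoint T x s - scalePoint T y s)
        = s * (x - y) := by
      linear_combination scaleDen T y s * ex - scaleDen T x s * ey + s * x * dy - s * y * dx
    simp only [bilinForm, scaleFun]
    field_simp
    linear_combination (c₁ * (f (scalePoint T x s) * f (scalePoint T y s))
      + a₁ * (f (scalePoint T x s) * g (scalePoint T y s)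
        + g (scalePoint T x s) * f (scalePoint T y s))
      + b₁ * (g (scalePoint T x s) * g (scalePoint T y s))) * e

theorem hasDerivAt_extKernel (h0 : 0 ≤ T) (h1 : T < 1) (hf : Continuous f) (hg : Continuous g)
    (hdf : ∀ x ∈ Ioo 0 T, HasDerivAt f
      (((a₀ + a₁ * x) * f x + (b₀ + b₁ * x) * g x) / ((x : ℂ) * (1 - x))) x)
    (hdg : ∀ x ∈ Ioo 0 T, HasDerivAt g
      ((-(c₀ + c₁ * x) * f x - (a₀ + a₁ * x) * g x) / ((x : ℂ) * (1 - x))) x)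
    (hx : x ∈ Ioo 0 T) (y : ℝ) :
    HasDerivAt (fun s => extKernel T a₁ b₁ c₁ f g s y)
      (extKernelDeriv T a₀ b₀ c₀ a₁ b₁ c₁ f g x y / ((x : ℂ) * (1 - x))) x := by
  have cf := continuous_scaleFun h0 h1 hf
  have cg := continuous_scaleFun h0 h1 hg
  have df := continuous_scaleDeriv h0 h1 hf hg a₀ b₀ a₁ b₁
  have dg := continuous_scaleDeriv h0 h1 hg hf (-a₀) (-c₀) (-a₁) (-c₁)
  have cfy : Continuous fun p : ℝ × ℝ => scaleFun T f y p.2 :=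
    cf.comp (by fun_prop : Continuous fun p : ℝ × ℝ => (y, p.2))
  have cgy : Continuous fun p : ℝ × ℝ => scaleFun T g y p.2 :=
    cg.comp (by fun_prop : Continuous fun p : ℝ × ℝ => (y, p.2))
  refine hasDerivAt_integral_of_continuous
    (F := fun x s => bilinForm a₁ b₁ c₁ (scaleFun T f x s) (scaleFun T g x s)
      (scaleFun T f y s) (scaleFun T g y s))
    (G := fun x s => bilinForm a₁ b₁ c₁ (scaleDeriv T a₀ b₀ a₁ b₁ f g x s)
      (scaleDeriv T (-a₀) (-c₀) (-a₁) (-c₁) g f x s) (scaleFun T f y s) (scaleFun T g y s))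
    hx (by unfold bilinForm; fun_prop) (by unfold bilinForm; fun_prop) zero_le_one
    (fun x hx s hs => ?_) h1
  have d1 := hasDerivAt_scaleFun_left h0 h1 hdf hx hs
  have d2 := hasDerivAt_scaleFun_left h0 h1 hdg hx hs
  rw [scaleFun_linear (f := f) (g := g) (a₀ := a₀) (b₀ := b₀) (a₁ := a₁) (b₁ := b₁)
    fun x => rfl] at d1
  rw [scaleFun_linear (f := g) (g := f) (a₀ := -a₀) (b₀ := -c₀) (a₁ := -a₁) (b₁ := -c₁)
    fun x => by ring] at d2
  refine ((((d1.mul_const (scaleFun T f y s)).const_mul c₁).add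
    (((d1.mul_const (scaleFun T g y s)).add (d2.mul_const (scaleFun T f y s))).const_mul a₁)).add
    ((d2.mul_const (scaleFun T g y s)).const_mul b₁)).congr_deriv ?_
  simp only [bilinForm, scaleDeriv]
  ring

/-- The integrand of the left side is the s-derivative of s times the integrand of the kernel. The
factor s kills the lower limit, and at s = 1 the scaled points are x and y. -/
theorem extKernelDeriv_add (h0 : 0 ≤ T) (h1 : T < 1) (hf : Continuous f) (hg : Continuous g)
    (f0 : f 0 = 0) (g0 : g 0 = 0)
    (hdf : ∀ x ∈ Ioo 0 T, HasDerivAt f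
      (((a₀ + a₁ * x) * f x + (b₀ + b₁ * x) * g x) / ((x : ℂ) * (1 - x))) x)
    (hdg : ∀ x ∈ Ioo 0 T, HasDerivAt g
      ((-(c₀ + c₁ * x) * f x - (a₀ + a₁ * x) * g x) / ((x : ℂ) * (1 - x))) x)
    (hx : x ∈ Icc 0 T) (hy : y ∈ Icc 0 T) :
    extKernelDeriv T a₀ b₀ c₀ a₁ b₁ c₁ f g x y + extKernelDeriv T a₀ b₀ c₀ a₁ b₁ c₁ f g y x
      + (1 - x - y) * extKernel T a₁ b₁ c₁ f g x y
    = c₁ * (f x * f y) + a₁ * (f x * g y + g x * f y) + b₁ * (g x * g y) := by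
  have slice : ∀ {F : ℝ → ℝ → ℂ}, (Continuous fun p : ℝ × ℝ => F p.1 p.2) → ∀ x : ℝ,
      Continuous fun s => F x s := fun h x => h.comp (by fun_prop : Continuous fun s : ℝ => (x, s))
  have cf := slice (continuous_scaleFun h0 h1 hf)
  have cg := slice (continuous_scaleFun h0 h1 hg)
  have df := slice (continuous_scaleDeriv h0 h1 hf hg a₀ b₀ a₁ b₁)
  have dg := slice (continuous_scaleDeriv h0 h1 hg hf (-a₀) (-c₀) (-a₁) (-c₁))
  have := cf x
  have := cf y
  have := cg x
  have := cg y
  have := df x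
  have := df y
  have := dg x
  have := dg y
  have hi : ∀ {F : ℝ → ℂ}, Continuous F → IntervalIntegrable F volume 0 1 :=
    fun h => h.intervalIntegrable 0 1
  have key := intervalIntegral.integral_eq_sub_of_hasDerivAt_of_le
    (f := fun s : ℝ => (s : ℂ) * bilinForm a₁ b₁ c₁ (scaleFun T f x s) (scaleFun T g x s)
      (scaleFun T f y s) (scaleFun T g y s))
    (f' := fun s => bilinForm a₁ b₁ c₁ (scaleDeriv T a₀ b₀ a₁ b₁ f g x s)
      (scaleDeriv T (-a₀) (-c₀) (-a₁) (-c₁) g f x s) (scaleFun T f y s) (scaleFun T g y s)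
      + bilinForm a₁ b₁ c₁ (scaleDeriv T a₀ b₀ a₁ b₁ f g y s)
      (scaleDeriv T (-a₀) (-c₀) (-a₁) (-c₁) g f y s) (scaleFun T f x s) (scaleFun T g x s)
      + (1 - x - y) * bilinForm a₁ b₁ c₁ (scaleFun T f x s) (scaleFun T g x s)
      (scaleFun T f y s) (scaleFun T g y s)) zero_le_one
    (Continuous.continuousOn (by unfold bilinForm; fun_prop)) (fun s hs => ?_)
    (hi (by unfold bilinForm; fun_prop))
  · have i1 : IntervalIntegrable (fun s => bilinForm a₁ b₁ c₁ (scaleDeriv T a₀ b₀ a₁ b₁ f g x s)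
      (scaleDeriv T (-a₀) (-c₀) (-a₁) (-c₁) g f x s) (scaleFun T f y s) (scaleFun T g y s))
      volume 0 1 := hi (by unfold bilinForm; fun_prop)
    have i2 : IntervalIntegrable (fun s => bilinForm a₁ b₁ c₁ (scaleDeriv T a₀ b₀ a₁ b₁ f g y s)
      (scaleDeriv T (-a₀) (-c₀) (-a₁) (-c₁) g f y s) (scaleFun T f x s) (scaleFun T g x s))
      volume 0 1 := hi (by unfold bilinForm; fun_prop)
    have i3 : IntervalIntegrable (fun s => (1 - (x : ℂ) - y) * bilinForm a₁ b₁ c₁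
      (scaleFun T f x s) (scaleFun T g x s) (scaleFun T f y s) (scaleFun T g y s))
      volume 0 1 := hi (by unfold bilinForm; fun_prop)
    rw [intervalIntegral.integral_add (i1.add i2) i3, intervalIntegral.integral_add i1 i2,
      intervalIntegral.integral_const_mul] at key
    rw [extKernelDeriv, extKernelDeriv, extKernel, key]
    simp [bilinForm, scaleFun_one hx, scaleFun_one hy]
  · have hF0 : (a₀ + a₁ * (0 : ℝ)) * f 0 + (b₀ + b₁ * (0 : ℝ)) * g 0 = 0 := by simp [f0, g0]
    have hG0 : -(c₀ + c₁ * (0 : ℝ)) * f 0 - (a₀ + a₁ * (0 : ℝ)) * g 0 = 0 := by simp [f0, g0]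
    have d1 := hasDerivAt_scaleFun_right h0 h1 hdf hF0 hx hs
    have d2 := hasDerivAt_scaleFun_right h0 h1 hdg hG0 hx hs
    have d3 := hasDerivAt_scaleFun_right h0 h1 hdf hF0 hy hs
    have d4 := hasDerivAt_scaleFun_right h0 h1 hdg hG0 hy hs
    rw [scaleFun_linear (f := f) (g := g) (a₀ := a₀) (b₀ := b₀) (a₁ := a₁) (b₁ := b₁)
      fun x => rfl] at d1 d3
    rw [scaleFun_linear (f := g) (g := f) (a₀ := -a₀) (b₀ := -c₀) (a₁ := -a₁) (b₁ := -c₁)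
      fun x => by ring] at d2 d4
    have hs0 : (s : ℂ) ≠ 0 := by exact_mod_cast hs.1.ne'
    refine ((hasDerivAt_ofReal s).mul ((((d1.mul d3).const_mul c₁).add
      (((d1.mul d4).add (d2.mul d3)).const_mul a₁)).add ((d2.mul d4).const_mul b₁))).congr_deriv ?_
    simp only [bilinForm, scaleDeriv, Pi.mul_apply, Pi.add_apply, clampIcc_of_mem hx,
      clampIcc_of_mem hy]
    field_simp
    ring

/-- Solutions of the linear system on `(0, T)`, continuous and vanishing at `0`, give the data for
the Tracy–Widom equations. -/
theorem isTWData_extKernel (h0 : 0 ≤ T) (h1 : T < 1) (hf : Continuous f) (hg : Continuous g)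
    (f0 : f 0 = 0) (g0 : g 0 = 0)
    (hdf : ∀ x ∈ Ioo 0 T, HasDerivAt f
      (((a₀ + a₁ * x) * f x + (b₀ + b₁ * x) * g x) / ((x : ℂ) * (1 - x))) x)
    (hdg : ∀ x ∈ Ioo 0 T, HasDerivAt g
      ((-(c₀ + c₁ * x) * f x - (a₀ + a₁ * x) * g x) / ((x : ℂ) * (1 - x))) x) :
    ∃ M, IsTWData a₀ b₀ c₀ a₁ b₁ c₁ T M f g (extKernel T a₁ b₁ c₁ f g)
      (extKernelDeriv T a₀ b₀ c₀ a₁ b₁ c₁ f g) := by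
  obtain ⟨M, hM⟩ := isNiceKernel_extKernel h0 h1 hf hg a₁ b₁ c₁
  exact ⟨M, {
    nice := hM
    lt_one := h1
    cont_f := hf
    cont_g := hg
    cont_Λ := continuous_integral_bilinForm (continuous_scaleDeriv h0 h1 hf hg a₀ b₀ a₁ b₁)
      (continuous_scaleDeriv h0 h1 hg hf (-a₀) (-c₀) (-a₁) (-c₁)) (continuous_scaleFun h0 h1 hf)
      (continuous_scaleFun h0 h1 hg) a₁ b₁ c₁
    f_zero := f0
    g_zero := g0
    kernel := fun x hx y hy => sub_mul_extKernel h0 h1 hf hg f0 g0 hdf hdg hx hy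
    deriv_f := hdf
    deriv_g := hdg
    deriv_K := fun x hx y _ => hasDerivAt_extKernel h0 h1 hf hg hdf hdg hx y
    Λ_add := fun x hx y hy => extKernelDeriv_add h0 h1 hf hg f0 g0 hdf hdg
      ⟨hx.1.le, hx.2.le⟩ ⟨hy.1.le, hy.2.le⟩ }⟩

end ExtKernel

/-- The function equal to `φ` on `(0, T]`, to `0` on the left and constant on the right. -/
def extendFun (T : ℝ) (φ : ℝ → ℂ) (x : ℝ) : ℂ := if x ≤ 0 then 0 else φ (min x T)

theorem extendFun_eq {T x : ℝ} (φ : ℝ → ℂ) (hx : x ∈ Ioc 0 T) : extendFun T φ x = φ x := by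
  rw [extendFun, if_neg (not_le.2 hx.1), min_eq_left hx.2]

theorem extendFun_zero (T : ℝ) (φ : ℝ → ℂ) : extendFun T φ 0 = 0 := if_pos le_rfl

theorem continuous_extendFun {T : ℝ} {φ : ℝ → ℂ} (h0 : 0 < T) (hc : ∀ x ∈ Ioc 0 T, ContinuousAt φ x)
    (hz : Tendsto φ (𝓝[>] 0) (𝓝 0)) : Continuous (extendFun T φ) := by
  refine continuous_iff_continuousAt.2 fun x => ?_
  rcases lt_trichotomy x 0 with h | rfl | h
  · refine (continuousAt_const (y := (0 : ℂ))).congr ?_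
    filter_upwards [Iio_mem_nhds h] with y hy
    exact (if_pos (le_of_lt hy)).symm
  · refine continuousAt_iff_continuous_left'_right'.2 ⟨?_, ?_⟩
    · refine (continuousWithinAt_const (b := (0 : ℂ))).congr (fun y hy => if_pos (le_of_lt hy))
        (extendFun_zero T φ)
    · rw [ContinuousWithinAt, extendFun_zero]
      refine hz.congr' ?_
      filter_upwards [Ioc_mem_nhdsGT h0] with y hy
      exact (extendFun_eq φ hy).symm
  · have : ContinuousAt (fun x => φ (min x T)) x :=
      ContinuousAt.comp (f := fun x => min x T) (hc _ ⟨lt_min h h0, min_le_right _ _⟩) (by fun_prop)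
    refine this.congr ?_
    filter_upwards [Ioi_mem_nhds h] with y hy
    exact (if_neg (not_le.2 hy)).symm

theorem extendFun_eventuallyEq {T x : ℝ} (φ : ℝ → ℂ) (hx : x ∈ Ioo 0 T) :
    extendFun T φ =ᶠ[𝓝 x] φ := by
  filter_upwards [Ioo_mem_nhds hx.1 hx.2] with y hy
  exact extendFun_eq φ ⟨hy.1, hy.2.le⟩

theorem IsTWData.kernel_eq_integrableKernel {a₀ b₀ c₀ a₁ b₁ c₁ : ℂ} {T M : ℝ} {f g φ ψ : ℝ → ℂ}
    {K Λ : ℝ → ℝ → ℂ} (h : IsTWData a₀ b₀ c₀ a₁ b₁ c₁ T M f g K Λ)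
    (hφ : ∀ x ∈ Ioo 0 T, f x = φ x) (hψ : ∀ x ∈ Ioo 0 T, g x = ψ x) {x y : ℝ} (hx : x ∈ Ioo 0 T)
    (hy : y ∈ Ioo 0 T) : K x y = integrableKernel φ ψ x y := by
  have hx' : x ∈ Icc 0 T := ⟨hx.1.le, hx.2.le⟩
  have hy' : y ∈ Icc 0 T := ⟨hy.1.le, hy.2.le⟩
  rw [integrableKernel]
  split_ifs with hxy
  · subst hxy
    have ef : f =ᶠ[𝓝 x] φ := by
      filter_upwards [Ioo_mem_nhds hx.1 hx.2] with z hz using hφ z hz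
    have eg : g =ᶠ[𝓝 x] ψ := by
      filter_upwards [Ioo_mem_nhds hx.1 hx.2] with z hz using hψ z hz
    have d1 := h.deriv_f x hx
    have d2 := h.deriv_g x hx
    -- On the diagonal: differentiate (z - x)K(z, x) = f(z)g(x) - g(z)f(x) at z = x.
    have d3 := (((hasDerivAt_ofReal x).sub_const (x : ℂ)).mul (h.deriv_K x hx x hx'))
    have d4 := (d1.mul_const (g x)).sub (d2.mul_const (f x))
    have d5 := d3.congr_of_eventuallyEq (f₁ := fun z => f z * g x - g z * f x) (by
      filter_upwards [Ioo_mem_nhds hx.1 hx.2] with z hz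
      exact (h.kernel z ⟨hz.1.le, hz.2.le⟩ x hx').symm)
    have := d4.unique d5
    rw [sub_self, zero_mul, add_zero, one_mul] at this
    rw [← this, ← ef.deriv_eq, ← eg.deriv_eq, d1.deriv, d2.deriv, hφ x hx, hψ x hx]
  · have : (x : ℂ) - y ≠ 0 := by
      rw [sub_ne_zero]
      exact_mod_cast hxy
    rw [← hφ x hx, ← hφ y hy, ← hψ x hx, ← hψ y hy, ← h.kernel x hx' y hy']
    field_simp

end

/-! ### Transfer from the extended kernel to one agreeing with it on (0, T)². -/

noncomputable section

section Transfer

variable {K L : ℝ → ℝ → ℂ} {M T t : ℝ} {f g : ℝ → ℂ}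

theorem kernelMinor_eqOn_cube (hL : ∀ x ∈ Ioo 0 T, ∀ y ∈ Ioo 0 T, K x y = L x y) (ht : t ≤ T)
    (n : ℕ) : EqOn (kernelMinor K n) (kernelMinor L n) (cube n t) := fun z hz => by
  have hz' : ∀ i, z i ∈ Ioo 0 T := fun i =>
    ⟨(hz i (Set.mem_univ i)).1, (hz i (Set.mem_univ i)).2.trans_le ht⟩
  simp only [kernelMinor]
  congr 1
  ext i j
  exact hL _ (hz' i) _ (hz' j)

namespace IsNiceKernel

theorem fredholmTerm_eq (hL : ∀ x ∈ Ioo 0 T, ∀ y ∈ Ioo 0 T, K x y = L x y) (ht : t ∈ Ioc 0 T)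
    (n : ℕ) : fredholmTerm L t n = (-1) ^ n / (n.factorial : ℂ) * detIntegral K n t := by
  rw [fredholmTerm, detIntegral_eq K n ht.1,
    setIntegral_congr_fun (measurableSet_cube n t) (kernelMinor_eqOn_cube hL ht.2 n)]

theorem fredholmDet_eq (hL : ∀ x ∈ Ioo 0 T, ∀ y ∈ Ioo 0 T, K x y = L x y) (ht : t ∈ Ioc 0 T) :
    fredholmDet L t = fredDet K t :=
  tsum_congr (fredholmTerm_eq hL ht)

theorem fredholmConverges (h : IsNiceKernel K M)
    (hL : ∀ x ∈ Ioo 0 T, ∀ y ∈ Ioo 0 T, K x y = L x y) (ht : t ∈ Ioc 0 T) :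
    FredholmConverges L t := by
  refine ⟨fun n => (h.integrableOn_kernelMinor n t).congr_fun (kernelMinor_eqOn_cube hL ht.2 n)
    (measurableSet_cube n t), ?_⟩
  refine (h.hasSum_fredDet t).summable.congr fun n => ?_
  exact (fredholmTerm_eq hL ht n).symm

theorem setIntegral_mul_eq (hL : ∀ x ∈ Ioo 0 T, ∀ y ∈ Ioo 0 T, K x y = L x y) (ht : t ∈ Ioo 0 T)
    (f : ℝ → ℂ) {x : ℝ} (hx : x ∈ Ioc 0 t) :
    ∫ y in Ioc 0 t, L x y * f y = ∫ y in (0)..t, K x y * f y := by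
  rw [intervalIntegral.integral_of_le ht.1.le]
  refine setIntegral_congr_fun measurableSet_Ioc fun y hy => ?_
  rw [hL x ⟨hx.1, hx.2.trans_lt ht.2⟩ y ⟨hy.1, hy.2.trans_lt ht.2⟩]

theorem eqOn_of_isResolventSolution (h : IsNiceKernel K M)
    (hL : ∀ x ∈ Ioo 0 T, ∀ y ∈ Ioo 0 T, K x y = L x y) (ht : t ∈ Ioo 0 T) (hD : fredDet K t ≠ 0)
    (hg : MemLp g 2 (volume.restrict (Ioc 0 t))) (hf : IsResolventSolution L t g f) :
    EqOn f (fun x => g x + ∫ z in (0)..t, resKernel K t x z * g z) (Ioc 0 t) := by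
  have hi : ∀ {F : ℝ → ℂ}, MemLp F 2 (volume.restrict (Ioc 0 t)) →
      IntervalIntegrable F volume 0 t := fun hF =>
    (intervalIntegrable_iff_integrableOn_Ioc_of_le ht.1.le).2 (hF.integrable one_le_two)
  refine h.eq_of_solution ht.1.le hD (hi hf.1) (hi hg) fun x hx => ?_
  rw [← hf.2 x hx, setIntegral_mul_eq hL ht f hx]
  ring

theorem isResolventSolution (h : IsNiceKernel K M)
    (hL : ∀ x ∈ Ioo 0 T, ∀ y ∈ Ioo 0 T, K x y = L x y) (ht : t ∈ Ioo 0 T) (hD : fredDet K t ≠ 0)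
    (hg : MemLp g 2 (volume.restrict (Ioc 0 t))) :
    IsResolventSolution L t g fun x => g x + ∫ z in (0)..t, resKernel K t x z * g z := by
  have hint : IntegrableOn g (Ioc 0 t) := hg.integrable one_le_two
  have hi : IntervalIntegrable g volume 0 t :=
    (intervalIntegrable_iff_integrableOn_Ioc_of_le ht.1.le).2 hint
  obtain ⟨C, hC⟩ := h.exists_bound_resKernel t
  have hbd : ∀ x, ∀ᵐ z ∂volume.restrict (Ioc 0 t), ‖resKernel K t x z * g z‖ ≤ C * ‖g z‖ :=
    fun x => Eventually.of_forall fun z => by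
      rw [norm_mul]
      exact mul_le_mul_of_nonneg_right (hC x z) (norm_nonneg _)
  have hcont : Continuous fun x => ∫ z in Ioc 0 t, resKernel K t x z * g z := by
    refine continuous_of_dominated (bound := fun z => C * ‖g z‖) (fun x => ?_) hbd
      (hint.norm.const_mul C) (Eventually.of_forall fun z => ?_)
    · exact (h.continuous_resKernel_comp t continuous_const
        continuous_id).aestronglyMeasurable.mul hint.aestronglyMeasurable
    · exact (h.continuous_resKernel_comp t continuous_id continuous_const).mul continuous_const
  simp only [intervalIntegral.integral_of_le ht.1.le]
  refine ⟨hg.add (MemLp.of_bound hcont.aestronglyMeasurable (∫ z in Ioc 0 t, C * ‖g z‖)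
    (Eventually.of_forall fun x => norm_integral_le_of_norm_le (hint.norm.const_mul C) (hbd x))),
    fun x hx => ?_⟩
  have := h.solution_of_resKernel ht.1.le hD hi x
  rw [setIntegral_mul_eq hL ht _ hx]
  simp only [intervalIntegral.integral_of_le ht.1.le] at this ⊢
  rw [this]
  ring

theorem resolventExists (h : IsNiceKernel K M)
    (hL : ∀ x ∈ Ioo 0 T, ∀ y ∈ Ioo 0 T, K x y = L x y) (ht : t ∈ Ioo 0 T)
    (hD : fredDet K t ≠ 0) : ResolventExists L t := fun _ hg =>
  ⟨_, h.isResolventSolution hL ht hD hg, fun _ hf' => h.eqOn_of_isResolventSolution hL ht hD hg hf'⟩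

theorem resolventApply_eq (h : IsNiceKernel K M)
    (hL : ∀ x ∈ Ioo 0 T, ∀ y ∈ Ioo 0 T, K x y = L x y) (ht : t ∈ Ioo 0 T)
    (hD : fredDet K t ≠ 0) (hf : Continuous f) (hfg : ∀ x ∈ Ioo 0 T, f x = g x) :
    EqOn (resolventApply L t g) (resSol K f t) (Ioc 0 t) := by
  have hIoc : ∀ x ∈ Ioc 0 t, f x = g x := fun x hx => hfg x ⟨hx.1, hx.2.trans_lt ht.2⟩
  obtain ⟨C, hC⟩ := (isCompact_Icc (a := (0 : ℝ)) (b := t)).exists_bound_of_continuousOn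
    hf.continuousOn
  have hfm : MemLp f 2 (volume.restrict (Ioc 0 t)) := MemLp.of_bound hf.aestronglyMeasurable C
    ((ae_restrict_iff' measurableSet_Ioc).2
      (Eventually.of_forall fun x hx => hC x ⟨hx.1.le, hx.2⟩))
  have hgm : MemLp g 2 (volume.restrict (Ioc 0 t)) :=
    hfm.ae_eq ((ae_restrict_iff' measurableSet_Ioc).2 (Eventually.of_forall hIoc))
  -- Existence makes the choice by `Classical.epsilon` an actual solution, and pointwise uniqueness
  -- on (0, t] then identifies its values, including the value at t.
  have hsol : IsResolventSolution L t g (resolventApply L t g) :=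
    Classical.epsilon_spec ⟨_, h.isResolventSolution hL ht hD hgm⟩
  intro x hx
  rw [h.eqOn_of_isResolventSolution hL ht hD hgm hsol hx, resSol, hIoc x hx]
  simp only [intervalIntegral.integral_of_le ht.1.le]
  congr 1
  refine setIntegral_congr_fun measurableSet_Ioc fun z hz => ?_
  simp only [hIoc z hz]

end IsNiceKernel

end Transfer

end

/-! ### Regular solutions: the determinant and the Tracy–Widom quantities on (0, 1). -/

noncomputable section

variable {a₀ b₀ c₀ a₁ b₁ c₁ : ℂ} {φ ψ : ℝ → ℂ}

theorem SolvesLinearSystem.hasDerivAt_fst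
    (h : SolvesLinearSystem (sl2Matrix a₀ b₀ c₀) (sl2Matrix a₁ b₁ c₁) φ ψ) {x : ℝ}
    (hx : x ∈ Ioo 0 1) : HasDerivAt φ
      (((a₀ + a₁ * x) * φ x + (b₀ + b₁ * x) * ψ x) / ((x : ℂ) * (1 - x))) x := by
  refine (h x hx).1.congr_deriv ?_
  simp [sl2Matrix, Matrix.mulVec, dotProduct, Fin.sum_univ_two]
  ring

theorem SolvesLinearSystem.hasDerivAt_snd
    (h : SolvesLinearSystem (sl2Matrix a₀ b₀ c₀) (sl2Matrix a₁ b₁ c₁) φ ψ) {x : ℝ}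
    (hx : x ∈ Ioo 0 1) : HasDerivAt ψ
      ((-(c₀ + c₁ * x) * φ x - (a₀ + a₁ * x) * ψ x) / ((x : ℂ) * (1 - x))) x := by
  refine (h x hx).2.congr_deriv ?_
  simp [sl2Matrix, Matrix.mulVec, dotProduct, Fin.sum_univ_two]
  ring

theorem solvesLinearSystem_iff :
    SolvesLinearSystem (sl2Matrix a₀ b₀ c₀) (sl2Matrix a₁ b₁ c₁) φ ψ ↔ ∀ x ∈ Ioo (0 : ℝ) 1,
      HasDerivAt φ (((a₀ + a₁ * x) * φ x + (b₀ + b₁ * x) * ψ x) / ((x : ℂ) * (1 - x))) x ∧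
      HasDerivAt ψ ((-(c₀ + c₁ * x) * φ x - (a₀ + a₁ * x) * ψ x) / ((x : ℂ) * (1 - x))) x := by
  refine ⟨fun h x hx => ⟨h.hasDerivAt_fst hx, h.hasDerivAt_snd hx⟩, fun h x hx => ⟨?_, ?_⟩⟩
  · refine (h x hx).1.congr_deriv ?_
    simp [sl2Matrix, Matrix.mulVec, dotProduct, Fin.sum_univ_two]
    ring
  · refine (h x hx).2.congr_deriv ?_
    simp [sl2Matrix, Matrix.mulVec, dotProduct, Fin.sum_univ_two]
    ring

/-- A regular solution of the linear system, extended from `(0, T)`. -/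
theorem exists_isTWData (h : SolvesLinearSystem (sl2Matrix a₀ b₀ c₀) (sl2Matrix a₁ b₁ c₁) φ ψ)
    (hr : RegularAtZero φ ψ) {T : ℝ} (hT : T ∈ Ioo 0 1) :
    ∃ M f g K Λ, IsTWData a₀ b₀ c₀ a₁ b₁ c₁ T M f g K Λ ∧
      (∀ x ∈ Ioo 0 T, f x = φ x) ∧ ∀ x ∈ Ioo 0 T, g x = ψ x := by
  have hcφ : Continuous (extendFun T φ) := continuous_extendFun hT.1
    (fun x hx => (h.hasDerivAt_fst ⟨hx.1, hx.2.trans_lt hT.2⟩).continuousAt) hr.1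
  have hcψ : Continuous (extendFun T ψ) := continuous_extendFun hT.1
    (fun x hx => (h.hasDerivAt_snd ⟨hx.1, hx.2.trans_lt hT.2⟩).continuousAt) hr.2
  have e : ∀ (φ : ℝ → ℂ), ∀ x ∈ Ioo 0 T, extendFun T φ x = φ x := fun φ x hx =>
    extendFun_eq φ ⟨hx.1, hx.2.le⟩
  obtain ⟨M, hM⟩ := isTWData_extKernel (a₀ := a₀) (b₀ := b₀) (c₀ := c₀) (a₁ := a₁) (b₁ := b₁)
    (c₁ := c₁) hT.1.le hT.2 hcφ hcψ (extendFun_zero T φ) (extendFun_zero T ψ)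
    (fun x hx => by
      rw [e φ x hx, e ψ x hx]
      exact (h.hasDerivAt_fst ⟨hx.1, hx.2.trans hT.2⟩).congr_of_eventuallyEq
        (extendFun_eventuallyEq φ hx))
    (fun x hx => by
      rw [e φ x hx, e ψ x hx]
      exact (h.hasDerivAt_snd ⟨hx.1, hx.2.trans hT.2⟩).congr_of_eventuallyEq
        (extendFun_eventuallyEq ψ hx))
  exact ⟨M, _, _, _, _, hM, e φ, e ψ⟩

namespace IsTWData

variable {T M t : ℝ} {f g : ℝ → ℂ} {K Λ : ℝ → ℝ → ℂ}

theorem kernel_eq (h : IsTWData a₀ b₀ c₀ a₁ b₁ c₁ T M f g K Λ) (hφ : ∀ x ∈ Ioo 0 T, f x = φ x)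
    (hψ : ∀ x ∈ Ioo 0 T, g x = ψ x) :
    ∀ x ∈ Ioo 0 T, ∀ y ∈ Ioo 0 T, K x y = integrableKernel φ ψ x y :=
  fun _ hx _ hy => h.kernel_eq_integrableKernel hφ hψ hx hy

theorem twQ_eq (h : IsTWData a₀ b₀ c₀ a₁ b₁ c₁ T M f g K Λ) (hφ : ∀ x ∈ Ioo 0 T, f x = φ x)
    (hψ : ∀ x ∈ Ioo 0 T, g x = ψ x) (ht : t ∈ Ioo 0 T) (hD : fredDet K t ≠ 0) :
    twQ φ ψ t = resSol K f t t :=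
  h.nice.resolventApply_eq (h.kernel_eq hφ hψ) ht hD h.cont_f hφ ⟨ht.1, le_rfl⟩

theorem twP_eq (h : IsTWData a₀ b₀ c₀ a₁ b₁ c₁ T M f g K Λ) (hφ : ∀ x ∈ Ioo 0 T, f x = φ x)
    (hψ : ∀ x ∈ Ioo 0 T, g x = ψ x) (ht : t ∈ Ioo 0 T) (hD : fredDet K t ≠ 0) :
    twP φ ψ t = resSol K g t t :=
  h.nice.resolventApply_eq (h.kernel_eq hφ hψ) ht hD h.cont_g hψ ⟨ht.1, le_rfl⟩

theorem setIntegral_mul_resolventApply {F G f₁ g₁ : ℝ → ℂ}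
    (h : IsTWData a₀ b₀ c₀ a₁ b₁ c₁ T M f g K Λ) (hφ : ∀ x ∈ Ioo 0 T, f x = φ x)
    (hψ : ∀ x ∈ Ioo 0 T, g x = ψ x) (hF : ∀ x ∈ Ioo 0 T, f₁ x = F x)
    (hG : ∀ x ∈ Ioo 0 T, g₁ x = G x) (hg : Continuous g₁)
    (ht : t ∈ Ioo 0 T) (hD : fredDet K t ≠ 0) :
    ∫ x in Ioc 0 t, F x * resolventApply (integrableKernel φ ψ) t G x = resPairing K f₁ g₁ t := by
  rw [resPairing, intervalIntegral.integral_of_le ht.1.le]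
  refine setIntegral_congr_fun measurableSet_Ioc fun x hx => ?_
  simp only [h.nice.resolventApply_eq (h.kernel_eq hφ hψ) ht hD hg hG hx,
    hF x ⟨hx.1, hx.2.trans_lt ht.2⟩]

end IsTWData

theorem IsGenTWSolution.of_eventuallyEq {q p u v w q' p' u' v' w' : ℝ → ℂ} {S S' : Set ℝ}
    (h : IsGenTWSolution a₀ b₀ c₀ a₁ b₁ c₁ q p u v w S)
    (hS : ∀ t ∈ S', t ∈ S ∧ q' =ᶠ[𝓝 t] q ∧ p' =ᶠ[𝓝 t] p ∧ u' =ᶠ[𝓝 t] u ∧ v' =ᶠ[𝓝 t] v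
      ∧ w' =ᶠ[𝓝 t] w) : IsGenTWSolution a₀ b₀ c₀ a₁ b₁ c₁ q' p' u' v' w' S' where
  deriv_q t ht := by
    obtain ⟨hm, hq, hp, hu, hv, hw⟩ := hS t ht
    rw [genAlpha, genBeta, hq.eq_of_nhds, hp.eq_of_nhds, hu.eq_of_nhds, hv.eq_of_nhds,
      hw.eq_of_nhds]
    exact (h.deriv_q t hm).congr_of_eventuallyEq hq
  deriv_p t ht := by
    obtain ⟨hm, hq, hp, hu, hv, hw⟩ := hS t ht
    rw [genAlpha, genGamma, hq.eq_of_nhds, hp.eq_of_nhds, hu.eq_of_nhds, hv.eq_of_nhds,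
      hw.eq_of_nhds]
    exact (h.deriv_p t hm).congr_of_eventuallyEq hp
  deriv_u t ht := by
    obtain ⟨hm, hq, hp, hu, hv, hw⟩ := hS t ht
    rw [hq.eq_of_nhds]
    exact (h.deriv_u t hm).congr_of_eventuallyEq hu
  deriv_v t ht := by
    obtain ⟨hm, hq, hp, hu, hv, hw⟩ := hS t ht
    rw [hq.eq_of_nhds, hp.eq_of_nhds]
    exact (h.deriv_v t hm).congr_of_eventuallyEq hv
  deriv_w t ht := by
    obtain ⟨hm, hq, hp, hu, hv, hw⟩ := hS t ht
    rw [hp.eq_of_nhds]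
    exact (h.deriv_w t hm).congr_of_eventuallyEq hw

/-- The extended kernel depends on T < 1, so the system is first obtained near each point; being a
pointwise condition, it glues. -/
theorem IsGenTWSolution.of_forall_exists {q p u v w : ℝ → ℂ} {S : Set ℝ}
    (h : ∀ t ∈ S, ∃ S', t ∈ S' ∧ IsGenTWSolution a₀ b₀ c₀ a₁ b₁ c₁ q p u v w S') :
    IsGenTWSolution a₀ b₀ c₀ a₁ b₁ c₁ q p u v w S where
  deriv_q t ht := let ⟨_, hm, h'⟩ := h t ht; h'.deriv_q t hm
  deriv_p t ht := let ⟨_, hm, h'⟩ := h t ht; h'.deriv_p t hm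
  deriv_u t ht := let ⟨_, hm, h'⟩ := h t ht; h'.deriv_u t hm
  deriv_v t ht := let ⟨_, hm, h'⟩ := h t ht; h'.deriv_v t hm
  deriv_w t ht := let ⟨_, hm, h'⟩ := h t ht; h'.deriv_w t hm

namespace IsTWData

variable {T M t : ℝ} {f g : ℝ → ℂ} {K Λ : ℝ → ℝ → ℂ}

/-- On `(0, T)`, the quantities of the regular solution are those of its extension. -/
theorem tw_eq (h : IsTWData a₀ b₀ c₀ a₁ b₁ c₁ T M f g K Λ) (hφ : ∀ x ∈ Ioo 0 T, f x = φ x)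
    (hψ : ∀ x ∈ Ioo 0 T, g x = ψ x) (ht : t ∈ Ioo 0 T) (hD : fredDet K t ≠ 0) :
    twQ φ ψ t = resSol K f t t ∧ twP φ ψ t = resSol K g t t ∧ twU φ ψ t = resPairing K f f t
      ∧ twV φ ψ t = resPairing K f g t ∧ twW φ ψ t = resPairing K g g t :=
  ⟨h.twQ_eq hφ hψ ht hD, h.twP_eq hφ hψ ht hD,
    h.setIntegral_mul_resolventApply hφ hψ hφ hφ h.cont_f ht hD,
    h.setIntegral_mul_resolventApply hφ hψ hφ hψ h.cont_g ht hD,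
    h.setIntegral_mul_resolventApply hφ hψ hψ hψ h.cont_g ht hD⟩

theorem eventually_tw_eq (h : IsTWData a₀ b₀ c₀ a₁ b₁ c₁ T M f g K Λ)
    (hφ : ∀ x ∈ Ioo 0 T, f x = φ x) (hψ : ∀ x ∈ Ioo 0 T, g x = ψ x) (ht : t ∈ Ioo 0 T)
    (hD : fredDet K t ≠ 0) : ∀ᶠ s in 𝓝 t, twQ φ ψ s = resSol K f s s
      ∧ twP φ ψ s = resSol K g s s ∧ twU φ ψ s = resPairing K f f s
      ∧ twV φ ψ s = resPairing K f g s ∧ twW φ ψ s = resPairing K g g s := by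
  filter_upwards [Ioo_mem_nhds ht.1 ht.2, h.nice.eventually_fredDet_ne_zero hD] with s hs hDs
  exact h.tw_eq hφ hψ hs hDs

theorem isGenTWSolution_tw (h : IsTWData a₀ b₀ c₀ a₁ b₁ c₁ T M f g K Λ)
    (hφ : ∀ x ∈ Ioo 0 T, f x = φ x) (hψ : ∀ x ∈ Ioo 0 T, g x = ψ x) :
    IsGenTWSolution a₀ b₀ c₀ a₁ b₁ c₁ (twQ φ ψ) (twP φ ψ) (twU φ ψ) (twV φ ψ) (twW φ ψ)
      {t | t ∈ Ioo 0 T ∧ fredDet K t ≠ 0} :=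
  h.isGenTWSolution.of_eventuallyEq fun _ ht =>
    have he := h.eventually_tw_eq hφ hψ ht.1 ht.2
    ⟨ht, he.mono fun _ h => h.1, he.mono fun _ h => h.2.1, he.mono fun _ h => h.2.2.1,
      he.mono fun _ h => h.2.2.2.1, he.mono fun _ h => h.2.2.2.2⟩

end IsTWData

section Regular

variable (h : SolvesLinearSystem (sl2Matrix a₀ b₀ c₀) (sl2Matrix a₁ b₁ c₁) φ ψ)
  (hr : RegularAtZero φ ψ) {t : ℝ}
include h hr

/-- Around each point of `(0, 1)`, the determinant is that of an extended kernel. -/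
theorem exists_isTWData_of_mem (ht : t ∈ Ioo 0 1) :
    ∃ T M f g K Λ, T ∈ Ioo t 1 ∧ IsTWData a₀ b₀ c₀ a₁ b₁ c₁ T M f g K Λ ∧
      (∀ x ∈ Ioo 0 T, f x = φ x) ∧ (∀ x ∈ Ioo 0 T, g x = ψ x) ∧
      ∀ s ∈ Ioo 0 T, fredholmDet (integrableKernel φ ψ) s = fredDet K s := by
  -- T lies strictly beyond t, so that derivatives at t are two-sided.
  obtain ⟨T, hT⟩ := nonempty_Ioo.2 ht.2
  obtain ⟨M, f, g, K, Λ, hd, hφ, hψ⟩ := exists_isTWData h hr ⟨ht.1.trans hT.1, hT.2⟩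
  exact ⟨T, M, f, g, K, Λ, hT, hd, hφ, hψ, fun s hs =>
    IsNiceKernel.fredholmDet_eq (hd.kernel_eq hφ hψ) ⟨hs.1, hs.2.le⟩⟩

theorem isGenTWSolution_of_regular : IsGenTWSolution a₀ b₀ c₀ a₁ b₁ c₁
    (twQ φ ψ) (twP φ ψ) (twU φ ψ) (twV φ ψ) (twW φ ψ) (twSet φ ψ) := by
  refine IsGenTWSolution.of_forall_exists fun t ht => ?_
  obtain ⟨T, M, f, g, K, Λ, hT, hd, hφ, hψ, hD⟩ := exists_isTWData_of_mem h hr ht.1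
  have hm : t ∈ Ioo 0 T := ⟨ht.1.1, hT.1⟩
  exact ⟨{t | t ∈ Ioo 0 T ∧ fredDet K t ≠ 0}, ⟨hm, hD t hm ▸ ht.2⟩, hd.isGenTWSolution_tw hφ hψ⟩

theorem genZeta_of_regular (ht : t ∈ twSet φ ψ) :
    genZeta a₀ b₀ c₀ a₁ b₁ c₁ (twQ φ ψ) (twP φ ψ) (twU φ ψ) (twV φ ψ) (twW φ ψ) t
      = c₁ * twU φ ψ t + 2 * a₁ * twV φ ψ t + b₁ * twW φ ψ t := by
  obtain ⟨T, M, f, g, K, Λ, hT, hd, hφ, hψ, hD⟩ := exists_isTWData_of_mem h hr ht.1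
  have hm : t ∈ Ioo 0 T := ⟨ht.1.1, hT.1⟩
  have hDt : fredDet K t ≠ 0 := hD t hm ▸ ht.2
  obtain ⟨e1, e2, e3, e4, e5⟩ := hd.tw_eq hφ hψ hm hDt
  have := (hd.first_integrals hm hDt).1
  simp only [genZeta, genAlpha, genBeta, genGamma, e1, e2, e3, e4, e5] at this ⊢
  exact this

theorem residue_det_of_regular (ht : t ∈ twSet φ ψ) :
    residueA a₀ b₁ c₁ (twQ φ ψ) (twP φ ψ) (twU φ ψ) (twV φ ψ) (twW φ ψ) t ^ 2
      + residueB b₀ a₁ b₁ (twQ φ ψ) (twU φ ψ) (twV φ ψ) t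
        * residueC c₀ a₁ c₁ (twP φ ψ) (twV φ ψ) (twW φ ψ) t = a₀ ^ 2 - b₀ * c₀ := by
  obtain ⟨T, M, f, g, K, Λ, hT, hd, hφ, hψ, hD⟩ := exists_isTWData_of_mem h hr ht.1
  have hm : t ∈ Ioo 0 T := ⟨ht.1.1, hT.1⟩
  have hDt : fredDet K t ≠ 0 := hD t hm ▸ ht.2
  obtain ⟨e1, e2, e3, e4, e5⟩ := hd.tw_eq hφ hψ hm hDt
  have := (hd.first_integrals hm hDt).2
  simp only [residueA, residueB, residueC, e1, e2, e3, e4, e5] at this ⊢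
  exact this

/-- D' = -N(t; t, t) = -D·R(t, t), and t(1 - t)R(t, t) is the quadratic form of `resKernel_diag`;
the sign is absorbed in t - 1. -/
theorem hasDerivAt_fredholmDet_of_regular (ht : t ∈ twSet φ ψ) :
    HasDerivAt (fredholmDet (integrableKernel φ ψ)) (fredholmDet (integrableKernel φ ψ) t *
      (genZeta a₀ b₀ c₀ a₁ b₁ c₁ (twQ φ ψ) (twP φ ψ) (twU φ ψ) (twV φ ψ) (twW φ ψ) t
        / ((t : ℂ) * (t - 1)))) t := by
  obtain ⟨T, M, f, g, K, Λ, hT, hd, hφ, hψ, hD⟩ := exists_isTWData_of_mem h hr ht.1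
  have hm : t ∈ Ioo 0 T := ⟨ht.1.1, hT.1⟩
  have hDt : fredDet K t ≠ 0 := hD t hm ▸ ht.2
  obtain ⟨e1, e2, e3, e4, e5⟩ := hd.tw_eq hφ hψ hm hDt
  have e := hd.resKernel_diag hm hDt
  have hev : fredholmDet (integrableKernel φ ψ) =ᶠ[𝓝 t] fredDet K := by
    filter_upwards [Ioo_mem_nhds hm.1 hm.2] with s hs using hD s hs
  refine ((hd.nice.hasDerivAt_fredDet hm.1).congr_of_eventuallyEq hev).congr_deriv ?_
  simp only [genZeta, genAlpha, genBeta, genGamma, e1, e2, e3, e4, e5, hD t hm] at e ⊢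
  have hne := hd.mul_one_sub_ne_zero hm
  have hne0 := left_ne_zero_of_mul hne
  have hne1 : (t : ℂ) - 1 ≠ 0 := fun h => right_ne_zero_of_mul hne (by linear_combination -h)
  rw [← e, resKernel]
  field_simp
  ring

theorem continuousOn_fredholmDet_of_regular :
    ContinuousOn (fredholmDet (integrableKernel φ ψ)) (Ioo 0 1) := fun t ht => by
  obtain ⟨T, M, f, g, K, Λ, hT, hd, hφ, hψ, hD⟩ := exists_isTWData_of_mem h hr ht
  have hev : fredholmDet (integrableKernel φ ψ) =ᶠ[𝓝 t] fredDet K := by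
    filter_upwards [Ioo_mem_nhds ht.1 hT.1] with s hs using hD s hs
  exact (hd.nice.continuous_fredDet.continuousAt.congr hev.symm).continuousWithinAt

theorem isOpen_twSet_of_regular : IsOpen (twSet φ ψ) :=
  (continuousOn_fredholmDet_of_regular h hr).isOpen_inter_preimage isOpen_Ioo
    isOpen_compl_singleton

theorem fredholmConverges_of_regular (ht : t ∈ Ioo 0 1) :
    FredholmConverges (integrableKernel φ ψ) t := by
  obtain ⟨T, M, f, g, K, Λ, hT, hd, hφ, hψ, hD⟩ := exists_isTWData_of_mem h hr ht
  exact hd.nice.fredholmConverges (hd.kernel_eq hφ hψ) ⟨ht.1, hT.1.le⟩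

theorem resolventExists_of_regular (ht : t ∈ twSet φ ψ) :
    ResolventExists (integrableKernel φ ψ) t := by
  obtain ⟨T, M, f, g, K, Λ, hT, hd, hφ, hψ, hD⟩ := exists_isTWData_of_mem h hr ht.1
  have hm : t ∈ Ioo 0 T := ⟨ht.1.1, hT.1⟩
  exact hd.nice.resolventExists (hd.kernel_eq hφ hψ) hm (hD t hm ▸ ht.2)

theorem tendsto_fredholmDet_of_regular :
    Tendsto (fredholmDet (integrableKernel φ ψ)) (𝓝[>] 0) (𝓝 1) := by
  obtain ⟨T, M, f, g, K, Λ, hT, hd, hφ, hψ, hD⟩ :=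
    exists_isTWData_of_mem (t := 1 / 2) h hr ⟨by norm_num, by norm_num⟩
  have hT0 : 0 < T := lt_trans (by norm_num) hT.1
  have := hd.nice.continuous_fredDet.tendsto 0
  rw [IsNiceKernel.fredDet_zero] at this
  refine (this.mono_left nhdsWithin_le_nhds).congr' ?_
  filter_upwards [Ioo_mem_nhdsGT hT0] with s hs using (hD s hs).symm

theorem twVanishAtZero_of_regular : TWVanishAtZero φ ψ := by
  obtain ⟨T, M, f, g, K, Λ, hT, hd, hφ, hψ, hD⟩ :=
    exists_isTWData_of_mem (t := 1 / 2) h hr ⟨by norm_num, by norm_num⟩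
  have hT0 : 0 < T := lt_trans (by norm_num) hT.1
  have hD0 : fredDet K 0 ≠ 0 := by simp [IsNiceKernel.fredDet_zero]
  have he : ∀ᶠ s in 𝓝[>] (0 : ℝ), twQ φ ψ s = resSol K f s s
      ∧ twP φ ψ s = resSol K g s s ∧ twU φ ψ s = resPairing K f f s
      ∧ twV φ ψ s = resPairing K f g s ∧ twW φ ψ s = resPairing K g g s := by
    filter_upwards [Ioo_mem_nhdsGT hT0,
      (hd.nice.eventually_fredDet_ne_zero hD0).filter_mono nhdsWithin_le_nhds] with s hs hDs
    exact hd.tw_eq hφ hψ hs hDs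
  have key : ∀ {F G : ℝ → ℂ}, ContinuousAt G 0 → G 0 = 0 → (∀ᶠ s in 𝓝[>] (0 : ℝ), F s = G s) →
      Tendsto F (𝓝[>] 0) (𝓝 0) := fun {F G} hG h0 hF =>
    ((h0 ▸ hG.tendsto : Tendsto G (𝓝 0) (𝓝 0)).mono_left nhdsWithin_le_nhds).congr'
      (hF.mono fun _ h => h.symm)
  refine ⟨key (hd.nice.continuousAt_resSol_diag hd.cont_f hD0) ?_ (he.mono fun _ h => h.1),
    key (hd.nice.continuousAt_resSol_diag hd.cont_g hD0) ?_ (he.mono fun _ h => h.2.1),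
    key (hd.nice.continuousAt_resPairing hd.cont_f hd.cont_f hD0) (resPairing_zero _ _ _)
      (he.mono fun _ h => h.2.2.1),
    key (hd.nice.continuousAt_resPairing hd.cont_f hd.cont_g hD0) (resPairing_zero _ _ _)
      (he.mono fun _ h => h.2.2.2.1),
    key (hd.nice.continuousAt_resPairing hd.cont_g hd.cont_g hD0) (resPairing_zero _ _ _)
      (he.mono fun _ h => h.2.2.2.2)⟩
  · simp only [resSol_zero, hd.f_zero]
  · simp only [resSol_zero, hd.g_zero]

end Regular

end

/-! ### Smoothness, the second order equations, and the diagonal and nilpotent systems. -/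

noncomputable section

theorem contDiffOn_succ_of_hasDerivAt {f f' : ℝ → ℂ} {S : Set ℝ} (hS : IsOpen S) {n : ℕ}
    (hf : ∀ t ∈ S, HasDerivAt f (f' t) t) (hf' : ContDiffOn ℝ n f' S) :
    ContDiffOn ℝ (n + 1 : ℕ) f S := by
  have := (contDiffOn_succ_iff_deriv_of_isOpen (𝕜 := ℝ) (n := (n : WithTop ℕ∞)) (f := f) hS).2
    ⟨fun t ht => (hf t ht).differentiableAt.differentiableWithinAt, by simp,
      hf'.congr fun t ht => (hf t ht).deriv⟩
  exact_mod_cast this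

theorem eqOn_const_of_hasDerivAt_zero {F : ℝ → ℂ} {S : Set ℝ} (hS : IsOpen S)
    (hc : IsPreconnected S) (hd : ∀ t ∈ S, HasDerivAt F 0 t) : ∃ C, ∀ t ∈ S, F t = C := by
  rcases S.eq_empty_or_nonempty with rfl | ⟨s, hs⟩
  · exact ⟨0, by simp⟩
  · exact ⟨F s, fun t ht => hS.is_const_of_deriv_eq_zero hc
      (fun r hr => (hd r hr).differentiableAt.differentiableWithinAt)
      (fun r hr => (hd r hr).deriv) ht hs⟩

theorem contDiff_ofReal {n : WithTop ℕ∞} : ContDiff ℝ n fun s : ℝ => (s : ℂ) :=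
  Complex.ofRealCLM.contDiff

namespace IsGenTWSolution

variable {a₀ b₀ c₀ a₁ b₁ c₁ : ℂ} {q p u v w : ℝ → ℂ} {S : Set ℝ} {t : ℝ}

/-- Bootstrapping: the right sides are polynomials in the unknowns and t, divided at most by t(1 -
t), so Cⁿ solutions are Cⁿ⁺¹. -/
theorem contDiffOn (h : IsGenTWSolution a₀ b₀ c₀ a₁ b₁ c₁ q p u v w S) (hS : IsOpen S)
    (hne : ∀ t ∈ S, (t : ℂ) * (1 - t) ≠ 0) (n : ℕ) :
    ContDiffOn ℝ n q S ∧ ContDiffOn ℝ n p S ∧ ContDiffOn ℝ n u S ∧ ContDiffOn ℝ n v S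
      ∧ ContDiffOn ℝ n w S := by
  induction n with
  | zero =>
    simp only [Nat.cast_zero, contDiffOn_zero]
    exact ⟨fun t ht => (h.deriv_q t ht).continuousAt.continuousWithinAt,
      fun t ht => (h.deriv_p t ht).continuousAt.continuousWithinAt,
      fun t ht => (h.deriv_u t ht).continuousAt.continuousWithinAt,
      fun t ht => (h.deriv_v t ht).continuousAt.continuousWithinAt,
      fun t ht => (h.deriv_w t ht).continuousAt.continuousWithinAt⟩
  | succ n ih =>
    obtain ⟨hq, hp, hu, hv, hw⟩ := ih
    have ht : ContDiffOn ℝ n (fun s : ℝ => (s : ℂ)) S := contDiff_ofReal.contDiffOn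
    have hα : ContDiffOn ℝ n (genAlpha a₀ a₁ b₁ c₁ u v w) S := by
      unfold genAlpha
      fun_prop
    have hβ : ContDiffOn ℝ n (genBeta b₀ a₁ b₁ u v) S := by
      unfold genBeta
      fun_prop
    have hγ : ContDiffOn ℝ n (genGamma c₀ a₁ c₁ v w) S := by
      unfold genGamma
      fun_prop
    have hd : ContDiffOn ℝ n (fun s : ℝ => (s : ℂ) * (1 - s)) S := by fun_prop
    have hi : ContDiffOn ℝ n (fun s : ℝ => ((s : ℂ) * (1 - s))⁻¹) S := hd.inv hne
    refine ⟨contDiffOn_succ_of_hasDerivAt hS h.deriv_q ?_,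
      contDiffOn_succ_of_hasDerivAt hS h.deriv_p ?_,
      contDiffOn_succ_of_hasDerivAt hS h.deriv_u ?_,
      contDiffOn_succ_of_hasDerivAt hS h.deriv_v ?_,
      contDiffOn_succ_of_hasDerivAt hS h.deriv_w ?_⟩
    · simp only [div_eq_mul_inv]
      fun_prop
    · simp only [div_eq_mul_inv]
      fun_prop
    · fun_prop
    · fun_prop
    · fun_prop

theorem contDiffOn_genZeta (h : IsGenTWSolution a₀ b₀ c₀ a₁ b₁ c₁ q p u v w S) (hS : IsOpen S)
    (hne : ∀ t ∈ S, (t : ℂ) * (1 - t) ≠ 0) (n : ℕ) :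
    ContDiffOn ℝ n (genZeta a₀ b₀ c₀ a₁ b₁ c₁ q p u v w) S := by
  obtain ⟨hq, hp, hu, hv, hw⟩ := h.contDiffOn hS hne n
  have ht : ContDiffOn ℝ n (fun s : ℝ => (s : ℂ)) S := contDiff_ofReal.contDiffOn
  unfold genZeta genAlpha genBeta genGamma
  fun_prop

theorem twZeta_eq (h : IsGenTWSolution a₀ b₀ c₀ a₁ b₁ c₁ q p u v w S)
    (hne : ∀ t ∈ S, (t : ℂ) * (1 - t) ≠ 0) (ht : t ∈ S) :
    twZeta q p t = genZeta a₀ b₀ c₀ a₁ b₁ c₁ q p u v w t := by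
  have h0 := left_ne_zero_of_mul (hne t ht)
  have h1 := right_ne_zero_of_mul (hne t ht)
  rw [twZeta, (h.deriv_q t ht).deriv, (h.deriv_p t ht).deriv, genZeta]
  field_simp
  ring

theorem hasDerivAt_genZeta_deriv (h : IsGenTWSolution a₀ b₀ c₀ a₁ b₁ c₁ q p u v w S) (ht : t ∈ S) :
    HasDerivAt (fun t => c₁ * q t ^ 2 + 2 * a₁ * p t * q t + b₁ * p t ^ 2)
      ((2 * c₁ * (genAlpha a₀ a₁ b₁ c₁ u v w t * q t ^ 2 + genBeta b₀ a₁ b₁ u v t * (p t * q t))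
        + 2 * a₁ * (genBeta b₀ a₁ b₁ u v t * p t ^ 2 - genGamma c₀ a₁ c₁ v w t * q t ^ 2)
        - 2 * b₁ * (genGamma c₀ a₁ c₁ v w t * (p t * q t)
          + genAlpha a₀ a₁ b₁ c₁ u v w t * p t ^ 2)) / ((t : ℂ) * (1 - t))) t := by
  have hq := h.deriv_q t ht
  have hp := h.deriv_p t ht
  refine ((((hq.pow 2).const_mul c₁).add ((hp.const_mul (2 * a₁)).mul hq)).add
    ((hp.pow 2).const_mul b₁)).congr_deriv ?_
  push_cast
  ring

/-- The function `ζ` and its first two derivatives. -/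
theorem zeta_derivs (h : IsGenTWSolution a₀ b₀ c₀ a₁ b₁ c₁ q p u v w S) (hS : IsOpen S)
    (hne : ∀ t ∈ S, (t : ℂ) * (1 - t) ≠ 0) {ζ : ℝ → ℂ}
    (hζ : ∀ t ∈ S, ζ t = genZeta a₀ b₀ c₀ a₁ b₁ c₁ q p u v w t) :
    ContDiffOn ℝ 2 ζ S ∧ ∀ t ∈ S,
      deriv ζ t = c₁ * q t ^ 2 + 2 * a₁ * p t * q t + b₁ * p t ^ 2 ∧
      (t : ℂ) * (1 - t) * deriv (deriv ζ) t
      = 2 * c₁ * (genAlpha a₀ a₁ b₁ c₁ u v w t * q t ^ 2 + genBeta b₀ a₁ b₁ u v t * (p t * q t))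
        + 2 * a₁ * (genBeta b₀ a₁ b₁ u v t * p t ^ 2 - genGamma c₀ a₁ c₁ v w t * q t ^ 2)
        - 2 * b₁ * (genGamma c₀ a₁ c₁ v w t * (p t * q t)
          + genAlpha a₀ a₁ b₁ c₁ u v w t * p t ^ 2) := by
  have h1 : ∀ t ∈ S, deriv ζ t = c₁ * q t ^ 2 + 2 * a₁ * p t * q t + b₁ * p t ^ 2 := fun t ht => by
    have : ζ =ᶠ[𝓝 t] genZeta a₀ b₀ c₀ a₁ b₁ c₁ q p u v w := by
      filter_upwards [hS.mem_nhds ht] with s hs using hζ s hs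
    rw [this.deriv_eq]
    exact (h.hasDerivAt_genZeta ht (left_ne_zero_of_mul (hne t ht))
      (right_ne_zero_of_mul (hne t ht))).deriv
  refine ⟨(h.contDiffOn_genZeta hS hne 2).congr hζ, fun t ht => ⟨h1 t ht, ?_⟩⟩
  have : deriv ζ =ᶠ[𝓝 t] fun t => c₁ * q t ^ 2 + 2 * a₁ * p t * q t + b₁ * p t ^ 2 := by
    filter_upwards [hS.mem_nhds ht] with s hs using h1 s hs
  rw [this.deriv_eq, (h.hasDerivAt_genZeta_deriv ht).deriv]
  exact mul_div_cancel₀ _ (hne t ht)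

theorem exists_first_integrals (h : IsGenTWSolution a₀ b₀ c₀ a₁ b₁ c₁ q p u v w S)
    (hS : IsOpen S) (hc : IsPreconnected S) (hne : ∀ t ∈ S, (t : ℂ) * (1 - t) ≠ 0) :
    (∃ I, ∀ t ∈ S, genZeta a₀ b₀ c₀ a₁ b₁ c₁ q p u v w t
      - (c₁ * u t + 2 * a₁ * v t + b₁ * w t) = I) ∧
    ∃ J, ∀ t ∈ S, residueA a₀ b₁ c₁ q p u v w t ^ 2
      + residueB b₀ a₁ b₁ q u v t * residueC c₀ a₁ c₁ p v w t = J := by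
  constructor
  · refine eqOn_const_of_hasDerivAt_zero hS hc fun s hs => ?_
    refine ((h.hasDerivAt_genZeta hs (left_ne_zero_of_mul (hne s hs))
      (right_ne_zero_of_mul (hne s hs))).sub ((((h.deriv_u s hs).const_mul c₁).add
      ((h.deriv_v s hs).const_mul (2 * a₁))).add
      ((h.deriv_w s hs).const_mul b₁))).congr_deriv ?_
    ring
  · refine eqOn_const_of_hasDerivAt_zero hS hc fun s hs => ?_
    have e0 := left_ne_zero_of_mul (hne s hs)
    have e1 := right_ne_zero_of_mul (hne s hs)
    refine (((h.hasDerivAt_residueA hs e0 e1).pow 2).add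
      ((h.hasDerivAt_residueB hs e0 e1).mul (h.hasDerivAt_residueC hs e0 e1))).congr_deriv ?_
    push_cast
    field_simp
    ring

end IsGenTWSolution

theorem mul_one_sub_ne_zero {S : Set ℝ} (h0 : (0 : ℝ) ∉ S) (h1 : (1 : ℝ) ∉ S) :
    ∀ t ∈ S, (t : ℂ) * (1 - t) ≠ 0 := fun t ht => by
  refine mul_ne_zero ?_ ?_
  · rintro h
    exact h0 (by rwa [Complex.ofReal_eq_zero.1 h] at ht)
  · intro h
    have : t = 1 := by exact_mod_cast (sub_eq_zero.1 h).symm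
    exact h1 (this ▸ ht)

/-! ### The two second order equations -/

theorem ContDiffOn.hasDerivAt_deriv {ζ : ℝ → ℂ} {S : Set ℝ} (hS : IsOpen S)
    (hζ : ContDiffOn ℝ 2 ζ S) {t : ℝ} (ht : t ∈ S) :
    HasDerivAt ζ (deriv ζ t) t ∧ HasDerivAt (deriv ζ) (deriv (deriv ζ) t) t := by
  have h1 : ContDiffOn ℝ 1 (deriv ζ) S := hζ.deriv_of_isOpen hS (by norm_num)
  exact ⟨((hζ.differentiableOn (by norm_num)).differentiableAt (hS.mem_nhds ht)).hasDerivAt,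
    ((h1.differentiableOn (by norm_num)).differentiableAt (hS.mem_nhds ht)).hasDerivAt⟩

/-- Derivatives of an affine modification. -/
theorem deriv_sub_affine {ζ σ : ℝ → ℂ} {S : Set ℝ} (hS : IsOpen S) (hζ : ContDiffOn ℝ 2 ζ S)
    {m n : ℂ} (hσ : ∀ t ∈ S, σ t = ζ t - m * t + n) : ContDiffOn ℝ 2 σ S ∧ ∀ t ∈ S,
      deriv σ t = deriv ζ t - m ∧ deriv (deriv σ) t = deriv (deriv ζ) t := by
  have h1 : ∀ t ∈ S, deriv σ t = deriv ζ t - m := fun t ht => by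
    have : σ =ᶠ[𝓝 t] fun t => ζ t - m * t + n := by
      filter_upwards [hS.mem_nhds ht] with s hs using hσ s hs
    rw [this.deriv_eq]
    refine (((hζ.hasDerivAt_deriv hS ht).1.sub
      ((hasDerivAt_ofReal t).const_mul m)).add_const n).deriv.trans ?_
    ring
  have hc : ContDiffOn ℝ 2 (fun s : ℝ => (s : ℂ)) S := contDiff_ofReal.contDiffOn
  refine ⟨ContDiffOn.congr (f := fun t => ζ t - m * t + n) (by fun_prop) hσ,
    fun t ht => ⟨h1 t ht, ?_⟩⟩
  have : deriv σ =ᶠ[𝓝 t] fun t => deriv ζ t - m := by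
    filter_upwards [hS.mem_nhds ht] with s hs using h1 s hs
  rw [this.deriv_eq]
  exact ((hζ.hasDerivAt_deriv hS ht).2.sub_const m).deriv

/-- With σ' = ζ' - α₁², the difference of the two sides of the σ-form is identically σ' times that
of the ζ-equation. Where σ' = 0 the σ-form is therefore automatic and says nothing about ζ. -/
theorem sigmaPVIAt_kSigma_iff {α₀ α₁ I₁ I₂ k₁ k₂ : ℂ} {ζ : ℝ → ℂ} {S : Set ℝ} (hS : IsOpen S)
    (hζ : ContDiffOn ℝ 2 ζ S) (hk : KParam α₀ α₁ I₁ I₂ k₁ k₂) {t : ℝ} (ht : t ∈ S) :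
    SigmaPVIAt (kTheta α₁ k₁ k₂) (kSigma α₁ k₁ k₂ ζ) t ↔
      deriv (kSigma α₁ k₁ k₂ ζ) t = 0 ∨ ZetaODEAt α₀ α₁ I₁ I₂ ζ t := by
  obtain ⟨h1, h2⟩ := (deriv_sub_affine (σ := kSigma α₁ k₁ k₂ ζ) hS hζ fun t _ => rfl).2 t ht
  obtain ⟨rfl, rfl⟩ := hk
  have key : (deriv ζ t - α₁ ^ 2) * (((t : ℂ) * (1 - t) * deriv (deriv ζ) t) ^ 2
        + 4 * (deriv ζ t - α₁ ^ 2) * (t * deriv ζ t - ζ t) ^ 2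
        - 4 * deriv ζ t * (t * deriv ζ t - ζ t)
          * (deriv ζ t + 2 * α₀ * α₁ - (-(k₁ * k₂) + α₁ * (2 * α₀ + α₁)))
        - 4 * (-(k₁ * k₂) + α₁ * (2 * α₀ + α₁)
          + ((k₁ + k₂) ^ 2 / 4 - α₁ * (2 * α₀ + α₁))) * deriv ζ t ^ 2) = 0
      ↔ SigmaPVIAt (kTheta α₁ k₁ k₂) (kSigma α₁ k₁ k₂ ζ) t := by
    rw [SigmaPVIAt, h1, h2]
    simp only [kTheta, kSigma]
    constructor
    · intro h
      linear_combination h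
    · intro h
      linear_combination h
  rw [← key, mul_eq_zero, h1, sub_eq_zero (a := _ - _), ZetaODEAt]

theorem SolvesZetaODE.solvesSigmaPVI {α₀ α₁ I₁ I₂ k₁ k₂ : ℂ} {ζ : ℝ → ℂ} {S : Set ℝ}
    (hS : IsOpen S) (h : SolvesZetaODE α₀ α₁ I₁ I₂ S ζ) (hk : KParam α₀ α₁ I₁ I₂ k₁ k₂) :
    SolvesSigmaPVI (kTheta α₁ k₁ k₂) S (kSigma α₁ k₁ k₂ ζ) :=
  ⟨(deriv_sub_affine hS h.1 fun _ _ => rfl).1, fun t ht =>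
    (sigmaPVIAt_kSigma_iff hS h.1 hk ht).2 (Or.inr (h.2 t ht))⟩

/-! ### The diagonal system -/

theorem isDiagTWSolution_iff {α₀ β₀ γ₀ α₁ : ℂ} {q p u v w : ℝ → ℂ} {S : Set ℝ} :
    IsDiagTWSolution α₀ β₀ γ₀ α₁ q p u v w S ↔ IsGenTWSolution α₀ β₀ γ₀ α₁ 0 0 q p u v w S := by
  have e1 : diagAlpha α₀ α₁ v = genAlpha α₀ α₁ 0 0 u v w := by
    ext t; simp only [diagAlpha, genAlpha]; ring
  have e2 : diagBeta β₀ α₁ u = genBeta β₀ α₁ 0 u v := by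
    ext t; simp only [diagBeta, genBeta]; ring
  have e3 : diagGamma γ₀ α₁ w = genGamma γ₀ α₁ 0 v w := by
    ext t; simp only [diagGamma, genGamma]; ring
  rw [IsDiagTWSolution, IsGenTWSolution, e1, e2, e3]

theorem diagI1_eq (α₀ β₀ γ₀ α₁ : ℂ) (q p u v w : ℝ → ℂ) (t : ℝ) :
    diagI1 α₀ β₀ γ₀ α₁ q p u v w t = genZeta α₀ β₀ γ₀ α₁ 0 0 q p u v w t
      - (0 * u t + 2 * α₁ * v t + 0 * w t) := by
  simp only [diagI1, genZeta, diagAlpha, diagBeta, diagGamma, genAlpha, genBeta, genGamma]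
  ring

/-- I₁ + I₂ is minus the determinant of the residue at 0, so the constancy of I₂ reflects
isospectrality. -/
theorem diagI2_eq (α₀ β₀ γ₀ α₁ : ℂ) (q p u v w : ℝ → ℂ) (t : ℝ) :
    diagI2 α₀ β₀ γ₀ α₁ q p u v w t = residueA α₀ 0 0 q p u v w t ^ 2
      + residueB β₀ α₁ 0 q u v t * residueC γ₀ α₁ 0 p v w t
      - diagI1 α₀ β₀ γ₀ α₁ q p u v w t := by
  simp only [diagI2, diagI1, diagAlpha, diagBeta, diagGamma, residueA, residueB, residueC]
  ring

/-- Once I₁ and I₂ are replaced by their expressions in q, p, u, v, w, the equation is a polynomial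
identity in these and t. -/
theorem IsDiagTWSolution.solvesZetaODE {α₀ β₀ γ₀ α₁ I₁ I₂ : ℂ} {q p u v w ζ : ℝ → ℂ} {S : Set ℝ}
    (h : IsDiagTWSolution α₀ β₀ γ₀ α₁ q p u v w S) (hS : IsOpen S)
    (hne : ∀ t ∈ S, (t : ℂ) * (1 - t) ≠ 0)
    (hζ : ∀ t ∈ S, ζ t = genZeta α₀ β₀ γ₀ α₁ 0 0 q p u v w t)
    (h1 : ∀ t ∈ S, diagI1 α₀ β₀ γ₀ α₁ q p u v w t = I₁)
    (h2 : ∀ t ∈ S, diagI2 α₀ β₀ γ₀ α₁ q p u v w t = I₂) : SolvesZetaODE α₀ α₁ I₁ I₂ S ζ := by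
  obtain ⟨hc, hd⟩ := (isDiagTWSolution_iff.1 h).zeta_derivs hS hne hζ
  refine ⟨hc, fun t ht => ?_⟩
  rw [ZetaODEAt, (hd t ht).1, (hd t ht).2, hζ t ht, ← h1 t ht, ← h2 t ht]
  simp only [diagI2, diagI1, genZeta, diagAlpha, diagBeta, diagGamma, genAlpha, genBeta, genGamma]
  ring

theorem diagonal_system {α₀ β₀ γ₀ α₁ : ℂ} {q p u v w : ℝ → ℂ} {S : Set ℝ} (hS : IsOpen S)
    (hc : IsPreconnected S) (h0 : (0 : ℝ) ∉ S) (h1 : (1 : ℝ) ∉ S)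
    (h : IsDiagTWSolution α₀ β₀ γ₀ α₁ q p u v w S) :
    ∃ I₁ I₂ : ℂ,
      (∀ t ∈ S, diagI1 α₀ β₀ γ₀ α₁ q p u v w t = I₁) ∧
      (∀ t ∈ S, diagI2 α₀ β₀ γ₀ α₁ q p u v w t = I₂) ∧
      (∀ t ∈ S, twZeta q p t = 2 * diagAlpha α₀ α₁ v t * p t * q t
        + diagBeta β₀ α₁ u t * p t ^ 2 + diagGamma γ₀ α₁ w t * q t ^ 2) ∧
      (∀ t ∈ S, twZeta q p t = 2 * α₁ * v t + I₁) ∧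
      (∀ t ∈ S, deriv (twZeta q p) t = 2 * α₁ * p t * q t) ∧
      (∀ t ∈ S, (t : ℂ) * (1 - t) * deriv (deriv (twZeta q p)) t
        = 2 * α₁ * (diagBeta β₀ α₁ u t * p t ^ 2 - diagGamma γ₀ α₁ w t * q t ^ 2)) ∧
      SolvesZetaODE α₀ α₁ I₁ I₂ S (twZeta q p) ∧
      ∀ k₁ k₂ : ℂ, KParam α₀ α₁ I₁ I₂ k₁ k₂ →
        SolvesSigmaPVI (kTheta α₁ k₁ k₂) S (kSigma α₁ k₁ k₂ (twZeta q p)) := by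
  have hne := mul_one_sub_ne_zero h0 h1
  have hg := isDiagTWSolution_iff.1 h
  obtain ⟨⟨I, hI⟩, J, hJ⟩ := hg.exists_first_integrals hS hc hne
  have hζ : ∀ t ∈ S, twZeta q p t = genZeta α₀ β₀ γ₀ α₁ 0 0 q p u v w t := fun t ht =>
    hg.twZeta_eq hne ht
  have hI1 : ∀ t ∈ S, diagI1 α₀ β₀ γ₀ α₁ q p u v w t = I := fun t ht => by
    rw [diagI1_eq, hI t ht]
  have hI2 : ∀ t ∈ S, diagI2 α₀ β₀ γ₀ α₁ q p u v w t = J - I := fun t ht => by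
    rw [diagI2_eq, hJ t ht, hI1 t ht]
  obtain ⟨-, hd⟩ := hg.zeta_derivs hS hne hζ
  have hode := h.solvesZetaODE hS hne hζ hI1 hI2
  refine ⟨I, J - I, hI1, hI2, fun t ht => ?_, fun t ht => ?_, fun t ht => ?_, fun t ht => ?_, hode,
    fun k₁ k₂ hk => hode.solvesSigmaPVI hS hk⟩
  · rw [hζ t ht]
    simp only [genZeta, diagAlpha, diagBeta, diagGamma, genAlpha, genBeta, genGamma]
    ring
  · rw [hζ t ht, ← hI t ht]
    ring
  · rw [(hd t ht).1]
    ring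
  · rw [(hd t ht).2]
    simp only [diagBeta, diagGamma, genBeta, genGamma]
    ring

/-! ### The nilpotent system -/

theorem isNilTWSolution_iff {α₀ β₀ γ₀ : ℂ} {q p u v w : ℝ → ℂ} {S : Set ℝ} :
    IsNilTWSolution α₀ β₀ γ₀ q p u v w S ↔ IsGenTWSolution α₀ β₀ γ₀ 0 1 0 q p u v w S := by
  have e1 : nilAlpha α₀ v w = genAlpha α₀ 0 1 0 u v w := by
    ext t; simp only [nilAlpha, genAlpha]; ring
  have e2 : nilBeta β₀ u v = genBeta β₀ 0 1 u v := by
    ext t; simp only [nilBeta, genBeta]; ring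
  have e3 : nilGamma γ₀ w = genGamma γ₀ 0 0 v w := by
    ext t; simp only [nilGamma, genGamma]; ring
  rw [IsNilTWSolution, IsGenTWSolution, e1, e2, e3]

/-- The term γ·1 in I₁ is γ₀ - w: its w supplies the first integral ζ - w, and γ₀ is the value of I₁
when that integral is zero. -/
theorem nilI1_eq (α₀ β₀ γ₀ : ℂ) (q p u v w : ℝ → ℂ) (t : ℝ) :
    nilI1 α₀ β₀ γ₀ q p u v w t = genZeta α₀ β₀ γ₀ 0 1 0 q p u v w t
      - (0 * u t + 2 * 0 * v t + 1 * w t) + γ₀ := by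
  simp only [nilI1, genZeta, nilAlpha, nilBeta, nilGamma, genAlpha, genBeta, genGamma]
  ring

theorem nilI2_eq (α₀ β₀ γ₀ : ℂ) (q p u v w : ℝ → ℂ) (t : ℝ) :
    nilI2 α₀ β₀ γ₀ q p u v w t = residueA α₀ 1 0 q p u v w t ^ 2
      + residueB β₀ 0 1 q u v t * residueC γ₀ 0 0 p v w t - nilI1 α₀ β₀ γ₀ q p u v w t := by
  simp only [nilI2, nilI1, nilAlpha, nilBeta, nilGamma, residueA, residueB, residueC]
  ring

theorem nilpotent_system {α₀ β₀ γ₀ : ℂ} {q p u v w : ℝ → ℂ} {S : Set ℝ} (hS : IsOpen S)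
    (hc : IsPreconnected S) (h0 : (0 : ℝ) ∉ S) (h1 : (1 : ℝ) ∉ S)
    (h : IsNilTWSolution α₀ β₀ γ₀ q p u v w S) :
    ∃ I₁ I₂ : ℂ,
      (∀ t ∈ S, nilI1 α₀ β₀ γ₀ q p u v w t = I₁) ∧
      (∀ t ∈ S, nilI2 α₀ β₀ γ₀ q p u v w t = I₂) ∧
      SolvesZetaODE α₀ 0 I₁ I₂ S (twZeta q p) ∧
      ∀ k₁ k₂ : ℂ, KParam α₀ 0 I₁ I₂ k₁ k₂ →
        SolvesSigmaPVI (kTheta 0 k₁ k₂) S (kSigma 0 k₁ k₂ (twZeta q p)) := by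
  have hne := mul_one_sub_ne_zero h0 h1
  have hg := isNilTWSolution_iff.1 h
  obtain ⟨⟨I, hI⟩, J, hJ⟩ := hg.exists_first_integrals hS hc hne
  have hζ : ∀ t ∈ S, twZeta q p t = genZeta α₀ β₀ γ₀ 0 1 0 q p u v w t := fun t ht =>
    hg.twZeta_eq hne ht
  have hI1 : ∀ t ∈ S, nilI1 α₀ β₀ γ₀ q p u v w t = I + γ₀ := fun t ht => by
    rw [nilI1_eq, hI t ht]
  have hI2 : ∀ t ∈ S, nilI2 α₀ β₀ γ₀ q p u v w t = J - (I + γ₀) := fun t ht => by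
    rw [nilI2_eq, hJ t ht, hI1 t ht]
  obtain ⟨hz, hd⟩ := hg.zeta_derivs hS hne hζ
  have hode : SolvesZetaODE α₀ 0 (I + γ₀) (J - (I + γ₀)) S (twZeta q p) := by
    refine ⟨hz, fun t ht => ?_⟩
    rw [ZetaODEAt, (hd t ht).1, (hd t ht).2, hζ t ht, ← hI2 t ht, ← hI1 t ht]
    simp only [nilI2, nilI1, genZeta, nilAlpha, nilBeta, nilGamma, genAlpha, genBeta, genGamma]
    ring
  exact ⟨I + γ₀, J - (I + γ₀), hI1, hI2, hode, fun k₁ k₂ hk => hode.solvesSigmaPVI hS hk⟩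

end

noncomputable section

/-! ### Matrices -/

theorem hasEigenvaluesPM_iff {A : Matrix (Fin 2) (Fin 2) ℂ} {θ : ℂ} :
    HasEigenvaluesPM A θ ↔ A.trace = 0 ∧ A.det = -(θ ^ 2 / 4) := by
  have e : (Polynomial.X - Polynomial.C (θ / 2)) * (Polynomial.X + Polynomial.C (θ / 2))
      = Polynomial.X ^ 2 - Polynomial.C (θ ^ 2 / 4) := by
    rw [show θ ^ 2 / 4 = (θ / 2) * (θ / 2) by ring, Polynomial.C_mul]
    ring
  rw [HasEigenvaluesPM, Matrix.charpoly_fin_two, e]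
  constructor
  · intro h
    have h0 := congrArg (fun P => Polynomial.coeff P 0) h
    have h1 := congrArg (fun P => Polynomial.coeff P 1) h
    simp only [Polynomial.coeff_add, Polynomial.coeff_sub, Polynomial.coeff_C_mul,
      Polynomial.coeff_X_pow, Polynomial.coeff_X, Polynomial.coeff_C] at h0 h1
    norm_num at h0 h1
    exact ⟨h1, h0⟩
  · rintro ⟨h1, h2⟩
    rw [h1, h2]
    simp
    ring

theorem hasEigenvaluesPM_of_entries {a b c d θ : ℂ} (h1 : a + d = 0)
    (h2 : a ^ 2 + b * c = θ ^ 2 / 4) : HasEigenvaluesPM !![a, b; c, d] θ := by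
  rw [hasEigenvaluesPM_iff, Matrix.trace_fin_two_of, Matrix.det_fin_two_of]
  exact ⟨h1, by linear_combination a * h1 - h2⟩

theorem HasEigenvaluesPM.conj {A P Q : Matrix (Fin 2) (Fin 2) ℂ} {θ : ℂ}
    (h : HasEigenvaluesPM A θ) (hQP : Q * P = 1) : HasEigenvaluesPM (P * A * Q) θ := by
  rw [hasEigenvaluesPM_iff] at h ⊢
  rw [Matrix.trace_mul_comm, ← mul_assoc, hQP, one_mul, Matrix.det_mul_comm, ← mul_assoc, hQP,
    one_mul]
  exact h

/-- A nonzero traceless `2 × 2` matrix is conjugate to its normal form. -/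
theorem exists_conj_residueSum {a b c θ : ℂ} (h : a ^ 2 + b * c = θ ^ 2 / 4)
    (hne : ¬(a = 0 ∧ b = 0 ∧ c = 0)) :
    ∃ P Q : Matrix (Fin 2) (Fin 2) ℂ, Q * P = 1 ∧ P * Q = 1 ∧
      P * !![a, b; c, -a] * Q = residueSum θ := by
  -- For θ ≠ 0 the rows of P are left eigenvectors for -θ/2 and θ/2; for θ = 0 the first row is the
  -- image of the second under the nilpotent matrix. The case distinctions select nonzero such rows.
  suffices ∃ P : Matrix (Fin 2) (Fin 2) ℂ, P.det ≠ 0 ∧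
      P * !![a, b; c, -a] = residueSum θ * P by
    obtain ⟨P, hP, e⟩ := this
    have hu : IsUnit P.det := isUnit_iff_ne_zero.2 hP
    refine ⟨P, P⁻¹, Matrix.nonsing_inv_mul P hu, Matrix.mul_nonsing_inv P hu, ?_⟩
    rw [e, mul_assoc, Matrix.mul_nonsing_inv P hu, mul_one]
  by_cases hθ : θ = 0
  · subst hθ
    simp only [residueSum, if_true]
    by_cases hb : b = 0
    · by_cases hc : c = 0
      · subst hb hc
        exact absurd ⟨by simpa using h, rfl, rfl⟩ hne
      · refine ⟨!![c, -a; 0, 1], by simpa [Matrix.det_fin_two_of] using hc, ?_⟩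
        ext i j
        fin_cases i <;> fin_cases j <;> simp [Matrix.mul_apply, Fin.sum_univ_two]
        · ring
        · linear_combination h
    · refine ⟨!![a, b; 1, 0], by simpa [Matrix.det_fin_two_of] using hb, ?_⟩
      ext i j
      fin_cases i <;> fin_cases j <;> simp [Matrix.mul_apply, Fin.sum_univ_two]
      · linear_combination h
      · ring
  · simp only [residueSum, if_neg hθ]
    by_cases hb : b = 0
    · by_cases hc : c = 0
      · subst hb hc
        have : (a + θ / 2) * (a - θ / 2) = 0 := by linear_combination h
        rcases mul_eq_zero.1 this with h' | h'
        · refine ⟨1, by simp, ?_⟩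
          ext i j
          fin_cases i <;> fin_cases j <;> simp
          · linear_combination h'
          · linear_combination -h'
        · refine ⟨!![0, 1; 1, 0], by simp [Matrix.det_fin_two_of], ?_⟩
          ext i j
          fin_cases i <;> fin_cases j <;> simp [Matrix.mul_apply, Fin.sum_univ_two]
          · linear_combination -h'
          · linear_combination h'
      · refine ⟨!![c, -a - θ / 2; c, θ / 2 - a], ?_, ?_⟩
        · rw [Matrix.det_fin_two_of]
          have : c * θ ≠ 0 := mul_ne_zero hc hθ
          intro h'
          exact this (by linear_combination h')
        · ext i j
          fin_cases i <;> fin_cases j <;> simp [Matrix.mul_apply, Fin.sum_univ_two]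
          · ring
          · linear_combination h
          · ring
          · linear_combination h
    · refine ⟨!![a - θ / 2, b; a + θ / 2, b], ?_, ?_⟩
      · rw [Matrix.det_fin_two_of]
        have : b * θ ≠ 0 := mul_ne_zero hb hθ
        intro h'
        exact this (by linear_combination -h')
      · ext i j
        fin_cases i <;> fin_cases j <;> simp [Matrix.mul_apply, Fin.sum_univ_two]
        · linear_combination h
        · ring
        · linear_combination h
        · ring

theorem hasDerivAt_conj_apply {A : ℝ → Matrix (Fin 2) (Fin 2) ℂ} {A' : Matrix (Fin 2) (Fin 2) ℂ}
    {t : ℝ} (h : ∀ i j, HasDerivAt (fun s => A s i j) (A' i j) t)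
    (P Q : Matrix (Fin 2) (Fin 2) ℂ) (i j : Fin 2) :
    HasDerivAt (fun s => (P * A s * Q) i j) ((P * A' * Q) i j) t := by
  simp only [Matrix.mul_apply, Fin.sum_univ_two]
  exact ((((h 0 0).const_mul _).add ((h 1 0).const_mul _)).mul_const _).add
    ((((h 0 1).const_mul _).add ((h 1 1).const_mul _)).mul_const _)

theorem conj_commutator_apply {A B P Q : Matrix (Fin 2) (Fin 2) ℂ} (hQP : Q * P = 1) (d : ℂ)
    (i j : Fin 2) : ((P * A * Q) * (P * B * Q) - (P * B * Q) * (P * A * Q)) i j / d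
      = (P * (d⁻¹ • (A * B - B * A)) * Q) i j := by
  have e : ∀ X Y : Matrix (Fin 2) (Fin 2) ℂ, (P * X * Q) * (P * Y * Q) = P * (X * Y) * Q :=
    fun X Y => by
      calc (P * X * Q) * (P * Y * Q) = P * X * (Q * P) * Y * Q := by noncomm_ring
        _ = _ := by rw [hQP]; noncomm_ring
  rw [e, e, Matrix.mul_smul, Matrix.smul_mul, Matrix.smul_apply, Matrix.mul_sub, Matrix.sub_mul,
    smul_eq_mul, div_eq_inv_mul]

/-- The Jimbo–Miwa–Ueno conditions are invariant under constant conjugation. -/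
theorem isJMUTau_of_conj {θ : PVIParams} {U : Set ℝ} {τ : ℝ → ℂ}
    {A0 A1 At : ℝ → Matrix (Fin 2) (Fin 2) ℂ} {P Q : Matrix (Fin 2) (Fin 2) ℂ}
    (hQP : Q * P = 1)
    (eig0 : ∀ t ∈ U, HasEigenvaluesPM (A0 t) θ.th0)
    (eig1 : ∀ t ∈ U, HasEigenvaluesPM (A1 t) θ.th1)
    (eigt : ∀ t ∈ U, HasEigenvaluesPM (At t) θ.tht)
    (sum_eq : ∀ t ∈ U, P * (A0 t + A1 t + At t) * Q = residueSum θ.thinf)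
    (deriv0 : ∀ t ∈ U, ∀ i j,
      HasDerivAt (fun s => A0 s i j) (((t : ℂ)⁻¹ • (At t * A0 t - A0 t * At t)) i j) t)
    (deriv1 : ∀ t ∈ U, ∀ i j,
      HasDerivAt (fun s => A1 s i j) ((((t : ℂ) - 1)⁻¹ • (At t * A1 t - A1 t * At t)) i j) t)
    (hτ : ∀ t ∈ U, τ t ≠ 0 ∧ HasDerivAt τ
      (τ t * ((A0 t * At t).trace / (t : ℂ) + (A1 t * At t).trace / ((t : ℂ) - 1))) t) :
    IsJMUTau θ U τ := by
  have e : ∀ X Y : Matrix (Fin 2) (Fin 2) ℂ,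
      ((P * X * Q) * (P * Y * Q)).trace = (X * Y).trace := fun X Y => by
    have : (P * X * Q) * (P * Y * Q) = P * (X * Y) * Q := by
      calc (P * X * Q) * (P * Y * Q) = P * X * (Q * P) * Y * Q := by noncomm_ring
        _ = _ := by rw [hQP]; noncomm_ring
    rw [this, Matrix.trace_mul_comm, ← mul_assoc, hQP, one_mul]
  refine ⟨fun t => P * A0 t * Q, fun t => P * A1 t * Q, fun t => P * At t * Q,
    ⟨fun t ht => (eig0 t ht).conj hQP, fun t ht => (eig1 t ht).conj hQP,
      fun t ht => (eigt t ht).conj hQP, fun t ht => ?_, fun t ht i j => ?_, fun t ht i j => ?_⟩,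
    fun t ht => ?_⟩
  · rw [← sum_eq t ht]
    noncomm_ring
  · rw [conj_commutator_apply hQP]
    exact hasDerivAt_conj_apply (deriv0 t ht) P Q i j
  · rw [conj_commutator_apply hQP]
    exact hasDerivAt_conj_apply (deriv1 t ht) P Q i j
  · simp only [e]
    exact hτ t ht

/-! ### The residues of the dressed linear system -/

/-- The residue at `0`. -/
def residueMatrix₀ (a₀ b₀ c₀ a₁ b₁ c₁ : ℂ) (q p u v w : ℝ → ℂ) (t : ℝ) :
    Matrix (Fin 2) (Fin 2) ℂ :=
  !![residueA a₀ b₁ c₁ q p u v w t, residueB b₀ a₁ b₁ q u v t;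
    residueC c₀ a₁ c₁ p v w t, -residueA a₀ b₁ c₁ q p u v w t]

/-- The residue at `t`. -/
def residueMatrixT (q p : ℝ → ℂ) (t : ℝ) : Matrix (Fin 2) (Fin 2) ℂ :=
  !![-(q t * p t), q t ^ 2; -p t ^ 2, q t * p t]

/-- The residue at `1`. -/
def residueMatrix₁ (a₀ b₀ c₀ a₁ b₁ c₁ : ℂ) (q p u v w : ℝ → ℂ) (t : ℝ) :
    Matrix (Fin 2) (Fin 2) ℂ :=
  !![-a₁ - residueA a₀ b₁ c₁ q p u v w t + q t * p t, -b₁ - residueB b₀ a₁ b₁ q u v t - q t ^ 2;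
    c₁ - residueC c₀ a₁ c₁ p v w t + p t ^ 2, a₁ + residueA a₀ b₁ c₁ q p u v w t - q t * p t]

namespace IsGenTWSolution

variable {a₀ b₀ c₀ a₁ b₁ c₁ : ℂ} {q p u v w : ℝ → ℂ} {S : Set ℝ} {t : ℝ}

theorem hasDerivAt_residueMatrix₀ (h : IsGenTWSolution a₀ b₀ c₀ a₁ b₁ c₁ q p u v w S) (ht : t ∈ S)
    (hne : (t : ℂ) * (1 - t) ≠ 0) (i j : Fin 2) :
    HasDerivAt (fun s => residueMatrix₀ a₀ b₀ c₀ a₁ b₁ c₁ q p u v w s i j)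
      (((t : ℂ)⁻¹ • (residueMatrixT q p t * residueMatrix₀ a₀ b₀ c₀ a₁ b₁ c₁ q p u v w t
        - residueMatrix₀ a₀ b₀ c₀ a₁ b₁ c₁ q p u v w t * residueMatrixT q p t)) i j) t := by
  have h0 := left_ne_zero_of_mul hne
  have h1 := right_ne_zero_of_mul hne
  fin_cases i <;> fin_cases j
  · refine (h.hasDerivAt_residueA ht h0 h1).congr_deriv ?_
    simp [residueMatrix₀, residueMatrixT]
    ring
  · refine (h.hasDerivAt_residueB ht h0 h1).congr_deriv ?_
    simp [residueMatrix₀, residueMatrixT]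
    ring
  · refine (h.hasDerivAt_residueC ht h0 h1).congr_deriv ?_
    simp [residueMatrix₀, residueMatrixT]
    ring
  · refine (h.hasDerivAt_residueA ht h0 h1).neg.congr_deriv ?_
    simp [residueMatrix₀, residueMatrixT]
    ring

/-- This residue is -𝒜₁ - A₀ - A_t, so its derivative is fixed by that of A₀ and by the equations
for q and p. -/
theorem hasDerivAt_residueMatrix₁ (h : IsGenTWSolution a₀ b₀ c₀ a₁ b₁ c₁ q p u v w S) (ht : t ∈ S)
    (hne : (t : ℂ) * (1 - t) ≠ 0) (i j : Fin 2) :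
    HasDerivAt (fun s => residueMatrix₁ a₀ b₀ c₀ a₁ b₁ c₁ q p u v w s i j)
      ((((t : ℂ) - 1)⁻¹ • (residueMatrixT q p t * residueMatrix₁ a₀ b₀ c₀ a₁ b₁ c₁ q p u v w t
        - residueMatrix₁ a₀ b₀ c₀ a₁ b₁ c₁ q p u v w t * residueMatrixT q p t)) i j) t := by
  have h0 := left_ne_zero_of_mul hne
  have h1 := right_ne_zero_of_mul hne
  have h2 : (t : ℂ) - 1 ≠ 0 := fun e => h1 (by linear_combination -e)
  have hq := h.deriv_q t ht
  have hp := h.deriv_p t ht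
  fin_cases i <;> fin_cases j
  · refine (((h.hasDerivAt_residueA ht h0 h1).const_sub (-a₁)).add (hq.mul hp)).congr_deriv ?_
    simp [residueMatrix₁, residueMatrixT]
    simp only [residueA, residueB, residueC, genAlpha, genBeta, genGamma]
    field_simp
    ring
  · refine (((h.hasDerivAt_residueB ht h0 h1).const_sub (-b₁)).sub (hq.pow 2)).congr_deriv ?_
    simp [residueMatrix₁, residueMatrixT]
    simp only [residueA, residueB, genAlpha, genBeta]
    field_simp
    ring
  · refine (((h.hasDerivAt_residueC ht h0 h1).const_sub c₁).add (hp.pow 2)).congr_deriv ?_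
    simp [residueMatrix₁, residueMatrixT]
    simp only [residueA, residueC, genAlpha, genGamma]
    field_simp
    ring
  · refine (((h.hasDerivAt_residueA ht h0 h1).const_add a₁).sub (hq.mul hp)).congr_deriv ?_
    simp [residueMatrix₁, residueMatrixT]
    simp only [residueA, residueB, residueC, genAlpha, genBeta, genGamma]
    field_simp
    ring

/-- The determinant of the residue at `1`. -/
theorem residue₁_det
    (hζ : genZeta a₀ b₀ c₀ a₁ b₁ c₁ q p u v w t = c₁ * u t + 2 * a₁ * v t + b₁ * w t)
    (hdet : residueA a₀ b₁ c₁ q p u v w t ^ 2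
      + residueB b₀ a₁ b₁ q u v t * residueC c₀ a₁ c₁ p v w t = a₀ ^ 2 - b₀ * c₀) :
    (-a₁ - residueA a₀ b₁ c₁ q p u v w t + q t * p t) ^ 2
      + (-b₁ - residueB b₀ a₁ b₁ q u v t - q t ^ 2) * (c₁ - residueC c₀ a₁ c₁ p v w t + p t ^ 2)
      = (a₀ + a₁) ^ 2 - (b₀ + b₁) * (c₀ + c₁) := by
  simp only [residueA, residueB, residueC, genZeta, genAlpha, genBeta, genGamma] at *
  linear_combination hdet - hζ

/-- The link between the two pictures: the logarithmic derivative prescribed for the isomonodromic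
tau function is the one computed from the Fredholm determinant. -/
theorem trace_residueMatrix (h0 : (t : ℂ) ≠ 0) (h1 : (t : ℂ) - 1 ≠ 0) :
    (residueMatrix₀ a₀ b₀ c₀ a₁ b₁ c₁ q p u v w t * residueMatrixT q p t).trace / (t : ℂ)
      + (residueMatrix₁ a₀ b₀ c₀ a₁ b₁ c₁ q p u v w t * residueMatrixT q p t).trace / ((t : ℂ) - 1)
      = genZeta a₀ b₀ c₀ a₁ b₁ c₁ q p u v w t / ((t : ℂ) * (t - 1)) := by
  simp only [Matrix.trace_fin_two, Matrix.mul_apply, Fin.sum_univ_two, residueMatrix₀,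
    residueMatrix₁, residueMatrixT, Matrix.of_apply, Matrix.cons_val_zero, Matrix.cons_val_one,
    Matrix.cons_val', Matrix.cons_val_fin_one]
  simp only [residueA, residueB, residueC, genZeta, genAlpha, genBeta, genGamma]
  field_simp
  ring

/-- Z, Z', T stand for ζ, ζ', t(1 - t)ζ''. Consider 𝒜₁, A_t and M = A₀ + (1 - t)A_t in sl₂ with the
quadratic form -det. The matrix with entries α, β, -γ, -α is M + t𝒜₁, so Z, Z' and the spectral data
determine all pairings of these three vectors, and T is a multiple of their triple product. The
equation is the Gram determinant identity for its square. -/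
theorem sigmaPVI_identity {θ₀ θ₁ θinf : ℂ}
    (hinf : a₁ ^ 2 - b₁ * c₁ = θinf ^ 2 / 4) (h0 : a₀ ^ 2 - b₀ * c₀ = θ₀ ^ 2 / 4)
    (h1 : (a₀ + a₁) ^ 2 - (b₀ + b₁) * (c₀ + c₁) = θ₁ ^ 2 / 4)
    (hζ : genZeta a₀ b₀ c₀ a₁ b₁ c₁ q p u v w t = c₁ * u t + 2 * a₁ * v t + b₁ * w t)
    (hdet : residueA a₀ b₁ c₁ q p u v w t ^ 2
      + residueB b₀ a₁ b₁ q u v t * residueC c₀ a₁ c₁ p v w t = a₀ ^ 2 - b₀ * c₀) {Z Z' T : ℂ}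
    (hZ : Z = genZeta a₀ b₀ c₀ a₁ b₁ c₁ q p u v w t)
    (hZ' : Z' = c₁ * q t ^ 2 + 2 * a₁ * p t * q t + b₁ * p t ^ 2)
    (hT : T = 2 * c₁ * (genAlpha a₀ a₁ b₁ c₁ u v w t * q t ^ 2
        + genBeta b₀ a₁ b₁ u v t * (p t * q t))
        + 2 * a₁ * (genBeta b₀ a₁ b₁ u v t * p t ^ 2 - genGamma c₀ a₁ c₁ v w t * q t ^ 2)
        - 2 * b₁ * (genGamma c₀ a₁ c₁ v w t * (p t * q t)
          + genAlpha a₀ a₁ b₁ c₁ u v w t * p t ^ 2)) :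
    T ^ 2 = θinf ^ 2 * (Z - t * Z') ^ 2
      - (θ₁ ^ 2 - θ₀ ^ 2 - θinf ^ 2 + 4 * Z) * (Z - t * Z') * Z'
      + (θ₀ ^ 2 - 4 * (1 - t) * (Z - t * Z')) * Z' ^ 2 := by
  simp only [residueA, residueB, residueC] at hdet
  simp only [genZeta, genAlpha, genBeta, genGamma] at hZ hT hζ
  have hm : 2 * (a₀ + v t + c₁ * u t - b₁ * w t) * (q t * p t)
      + (b₀ + (2 * a₁ - 1) * u t + 2 * b₁ * v t) * p t ^ 2
      + (c₀ - 2 * c₁ * v t - (2 * a₁ + 1) * w t) * q t ^ 2 = Z - t * Z' := by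
    rw [hZ, hZ']
    ring
  -- The pairing of 𝒜₁ with M. Its value for u = v = w = 0 follows by polarization from the three
  -- determinants; the remainder is c₁u + 2a₁v + b₁w, which is Z by the first integral.
  have hk : 2 * a₁ * (a₀ + v t + c₁ * u t - b₁ * w t)
      - b₁ * (c₀ - 2 * c₁ * v t - (2 * a₁ + 1) * w t)
      - c₁ * (b₀ + (2 * a₁ - 1) * u t + 2 * b₁ * v t)
      = (θ₁ ^ 2 - θ₀ ^ 2 - θinf ^ 2) / 4 + Z := by
    linear_combination -hζ + h1 - h0 - hinf - hZ
  -- Expand -det of A₀ = M - (1 - t)A_t. As A_t is nilpotent, only a term linear in 1 - t is added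
  -- to -det M.
  have he : (a₀ + v t + c₁ * u t - b₁ * w t) ^ 2
      - (b₀ + (2 * a₁ - 1) * u t + 2 * b₁ * v t) * (c₀ - 2 * c₁ * v t - (2 * a₁ + 1) * w t)
      = θ₀ ^ 2 / 4 - (1 - t) * (Z - t * Z') := by
    rw [← hm]
    linear_combination hdet + h0
  -- The Gram determinant of 𝒜₁, M, A_t, shortened because A_t is isotropic. Since the triple
  -- product is alternating, α, β, γ may be replaced by their parts from M.
  have gram : T ^ 2 = 4 * (a₁ ^ 2 - b₁ * c₁)
        * (2 * (a₀ + v t + c₁ * u t - b₁ * w t) * (q t * p t)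
          + (b₀ + (2 * a₁ - 1) * u t + 2 * b₁ * v t) * p t ^ 2
          + (c₀ - 2 * c₁ * v t - (2 * a₁ + 1) * w t) * q t ^ 2) ^ 2
      - 4 * (2 * a₁ * (a₀ + v t + c₁ * u t - b₁ * w t)
          - b₁ * (c₀ - 2 * c₁ * v t - (2 * a₁ + 1) * w t)
          - c₁ * (b₀ + (2 * a₁ - 1) * u t + 2 * b₁ * v t))
        * (2 * (a₀ + v t + c₁ * u t - b₁ * w t) * (q t * p t)
          + (b₀ + (2 * a₁ - 1) * u t + 2 * b₁ * v t) * p t ^ 2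
          + (c₀ - 2 * c₁ * v t - (2 * a₁ + 1) * w t) * q t ^ 2) * Z'
      + 4 * ((a₀ + v t + c₁ * u t - b₁ * w t) ^ 2
          - (b₀ + (2 * a₁ - 1) * u t + 2 * b₁ * v t)
            * (c₀ - 2 * c₁ * v t - (2 * a₁ + 1) * w t)) * Z' ^ 2 := by
    rw [hT, hZ']
    ring
  rw [gram, hm, hk, he, hinf]
  ring

end IsGenTWSolution

/-! ### The determinant of a regular solution -/

section Regular

variable {a₀ b₀ c₀ a₁ b₁ c₁ : ℂ} {φ ψ : ℝ → ℂ}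
  (h : SolvesLinearSystem (sl2Matrix a₀ b₀ c₀) (sl2Matrix a₁ b₁ c₁) φ ψ)
  (hr : RegularAtZero φ ψ) {t : ℝ}

theorem mul_one_sub_ne_zero_of_twSet : ∀ t ∈ twSet φ ψ, (t : ℂ) * (1 - t) ≠ 0 :=
  mul_one_sub_ne_zero (fun h => lt_irrefl _ h.1.1) fun h => lt_irrefl _ h.1.2

include h hr

theorem fredholmWellDefined_of_regular : FredholmWellDefined (integrableKernel φ ψ) where
  converges _ ht := fredholmConverges_of_regular h hr ht
  continuousOn := continuousOn_fredholmDet_of_regular h hr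
  tendsto_one := tendsto_fredholmDet_of_regular h hr
  isOpen := isOpen_twSet_of_regular h hr
  contDiffOn := by
    have hS := isOpen_twSet_of_regular h hr
    have hne := mul_one_sub_ne_zero_of_twSet (φ := φ) (ψ := ψ)
    have hsol := isGenTWSolution_of_regular h hr
    -- The same bootstrapping as for the system, through D' = Dζ/(t(t - 1)).
    suffices ∀ n : ℕ, ContDiffOn ℝ n (fredholmDet (integrableKernel φ ψ)) (twSet φ ψ) from this 3
    intro n
    induction n with
    | zero =>
      simp only [Nat.cast_zero, contDiffOn_zero]
      exact (continuousOn_fredholmDet_of_regular h hr).mono fun t ht => ht.1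
    | succ n ih =>
      refine contDiffOn_succ_of_hasDerivAt hS
        (fun t ht => hasDerivAt_fredholmDet_of_regular h hr ht) ?_
      have hZ := hsol.contDiffOn_genZeta hS hne n
      have ht : ContDiffOn ℝ n (fun s : ℝ => (s : ℂ)) (twSet φ ψ) := contDiff_ofReal.contDiffOn
      have hi : ContDiffOn ℝ n (fun s : ℝ => ((s : ℂ) * (s - 1))⁻¹) (twSet φ ψ) := by
        refine ContDiffOn.inv (by fun_prop) fun s hs e => hne s hs ?_
        linear_combination -e
      simp only [div_eq_mul_inv]
      fun_prop

theorem zetaOf_of_regular (ht : t ∈ twSet φ ψ) : zetaOf (fredholmDet (integrableKernel φ ψ)) t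
    = genZeta a₀ b₀ c₀ a₁ b₁ c₁ (twQ φ ψ) (twP φ ψ) (twU φ ψ) (twV φ ψ) (twW φ ψ) t := by
  have hne := mul_one_sub_ne_zero_of_twSet t ht
  have h0 := left_ne_zero_of_mul hne
  have h1 : (t : ℂ) - 1 ≠ 0 := fun e => right_ne_zero_of_mul hne (by linear_combination -e)
  have hD : fredholmDet (integrableKernel φ ψ) t ≠ 0 := ht.2
  rw [zetaOf, logDeriv_apply, (hasDerivAt_fredholmDet_of_regular h hr ht).deriv]
  field_simp

theorem twWellDefined_of_regular : TWWellDefined φ ψ where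
  det := fredholmWellDefined_of_regular h hr
  resolvent _ ht := resolventExists_of_regular h hr ht
  vanish := twVanishAtZero_of_regular h hr
  logDeriv_eq t ht := by
    have hne := mul_one_sub_ne_zero_of_twSet t ht
    have h0 := left_ne_zero_of_mul hne
    have h1 : (t : ℂ) - 1 ≠ 0 := fun e => right_ne_zero_of_mul hne (by linear_combination -e)
    have e := zetaOf_of_regular h hr ht
    rw [← (isGenTWSolution_of_regular h hr).twZeta_eq mul_one_sub_ne_zero_of_twSet ht, zetaOf,
      twZeta] at e
    exact mul_left_cancel₀ (mul_ne_zero h0 h1) e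

/-- The residues of the dressed system satisfy the Schlesinger equations, and their sum -𝒜₁ is
brought to normal form by a constant conjugation, provided that 𝒜₁ ≠ 0. Their spectra come from the
first integrals, whose values are those at t = 0. -/
theorem isJMUTau_of_regular {θ₀ θ₁ θinf : ℂ}
    (hinf : a₁ ^ 2 - b₁ * c₁ = θinf ^ 2 / 4) (h0 : a₀ ^ 2 - b₀ * c₀ = θ₀ ^ 2 / 4)
    (h1 : (a₀ + a₁) ^ 2 - (b₀ + b₁) * (c₀ + c₁) = θ₁ ^ 2 / 4) :
    IsJMUTau ⟨θ₀, θ₁, 0, θinf⟩ (twSet φ ψ) (fredholmDet (integrableKernel φ ψ)) := by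
  have hne := mul_one_sub_ne_zero_of_twSet (φ := φ) (ψ := ψ)
  have hsol := isGenTWSolution_of_regular h hr
  -- A zero 𝒜₁ is not conjugate to the nonzero nilpotent block prescribed for θ_∞ = 0. But then ζ =
  -- 0 and D' = 0, and a constant solution with A_t = 0 whose sum is that block serves.
  by_cases hA : -a₁ = 0 ∧ -b₁ = 0 ∧ c₁ = 0
  · have ha : a₁ = 0 := neg_eq_zero.1 hA.1
    have hb : b₁ = 0 := neg_eq_zero.1 hA.2.1
    have hc : c₁ = 0 := hA.2.2
    have hθ : θinf = 0 := by
      rw [ha, hb, hc] at hinf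
      simpa using hinf.symm
    refine ⟨fun _ => !![θ₀ / 2, 0; 0, -(θ₀ / 2)], fun _ => !![-(θ₀ / 2), 0; 1, θ₀ / 2], fun _ => 0,
      ⟨fun t _ => hasEigenvaluesPM_of_entries (by ring) (by ring),
        fun t _ => hasEigenvaluesPM_of_entries (by ring) ?_, fun t _ => ?_, fun t _ => ?_,
        fun t _ i j => ?_, fun t _ i j => ?_⟩, fun t ht => ⟨ht.2, ?_⟩⟩
    · rw [ha, hb, hc] at h1
      linear_combination h1 - h0
    · simp [hasEigenvaluesPM_iff]
    · ext i j
      fin_cases i <;> fin_cases j <;> simp [residueSum, hθ]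
    · simpa using hasDerivAt_const t _
    · simpa using hasDerivAt_const t _
    · refine (hasDerivAt_fredholmDet_of_regular h hr ht).congr_deriv ?_
      rw [genZeta_of_regular h hr ht, ha, hb, hc]
      simp
  · obtain ⟨P, Q, hQP, -, hPQ⟩ := exists_conj_residueSum (a := -a₁) (b := -b₁) (c := c₁)
      (θ := θinf) (by linear_combination hinf) hA
    refine isJMUTau_of_conj (A0 := residueMatrix₀ a₀ b₀ c₀ a₁ b₁ c₁ (twQ φ ψ) (twP φ ψ) (twU φ ψ)
        (twV φ ψ) (twW φ ψ)) (A1 := residueMatrix₁ a₀ b₀ c₀ a₁ b₁ c₁ (twQ φ ψ) (twP φ ψ)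
        (twU φ ψ) (twV φ ψ) (twW φ ψ)) (At := residueMatrixT (twQ φ ψ) (twP φ ψ)) hQP
      (fun t ht => hasEigenvaluesPM_of_entries (by ring) ?_)
      (fun t ht => hasEigenvaluesPM_of_entries (by ring) ?_)
      (fun t ht => hasEigenvaluesPM_of_entries (by ring) (by ring))
      (fun t ht => ?_)
      (fun t ht => hsol.hasDerivAt_residueMatrix₀ ht (hne t ht))
      (fun t ht => hsol.hasDerivAt_residueMatrix₁ ht (hne t ht))
      (fun t ht => ⟨ht.2, ?_⟩)
    · rw [residue_det_of_regular h hr ht, h0]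
    · rw [IsGenTWSolution.residue₁_det (genZeta_of_regular h hr ht)
        (residue_det_of_regular h hr ht), h1]
    · rw [← hPQ]
      congr 2
      ext i j
      fin_cases i <;> fin_cases j <;> simp [residueMatrix₀, residueMatrix₁, residueMatrixT]
      · ring
      · ring
      · ring
      · ring
    · have e0 := left_ne_zero_of_mul (hne t ht)
      rw [IsGenTWSolution.trace_residueMatrix e0
        fun e => right_ne_zero_of_mul (hne t ht) (by linear_combination -e)]
      exact hasDerivAt_fredholmDet_of_regular h hr ht

theorem isPVITauDet_of_regular {θ₀ θ₁ θinf : ℂ}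
    (hinf : a₁ ^ 2 - b₁ * c₁ = θinf ^ 2 / 4) (h0 : a₀ ^ 2 - b₀ * c₀ = θ₀ ^ 2 / 4)
    (h1 : (a₀ + a₁) ^ 2 - (b₀ + b₁) * (c₀ + c₁) = θ₁ ^ 2 / 4) :
    IsPVITauDet ⟨θ₀, θ₁, 0, θinf⟩ (integrableKernel φ ψ) := by
  refine ⟨isJMUTau_of_regular h hr hinf h0 h1, ?_⟩
  have hS := isOpen_twSet_of_regular h hr
  obtain ⟨hc, hd⟩ := (isGenTWSolution_of_regular h hr).zeta_derivs hS mul_one_sub_ne_zero_of_twSet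
    fun t ht => zetaOf_of_regular h hr ht
  obtain ⟨hσ, hσd⟩ := deriv_sub_affine
    (σ := sigmaOf ⟨θ₀, θ₁, 0, θinf⟩ (fredholmDet (integrableKernel φ ψ))) hS hc
    (m := θinf ^ 2 / 4) (n := -((θ₀ ^ 2 - θ₁ ^ 2 - θinf ^ 2) / 8)) fun t _ => by
      rw [sigmaOf]
      ring
  refine ⟨hσ, fun t ht => ?_⟩
  have key := IsGenTWSolution.sigmaPVI_identity hinf h0 h1 (genZeta_of_regular h hr ht)
    (residue_det_of_regular h hr ht) (zetaOf_of_regular h hr ht) (hd t ht).1 (hd t ht).2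
  rw [SigmaPVIAt, (hσd t ht).1, (hσd t ht).2]
  simp only [sigmaOf]
  -- The multiplier is σ': as before, the σ-form is σ' times the second order equation for ζ.
  linear_combination (deriv (zetaOf (fredholmDet (integrableKernel φ ψ))) t - θinf ^ 2 / 4) * key

end Regular

theorem determinant_general (A0 A1 : Matrix (Fin 2) (Fin 2) ℂ) (φ ψ : ℝ → ℂ) (θ₀ θ₁ θinf : ℂ)
    (t0 : A0.trace = 0) (t1 : A1.trace = 0) (h : SolvesLinearSystem A0 A1 φ ψ)
    (hr : RegularAtZero φ ψ) (h0 : HasEigenvaluesPM A0 θ₀) (h1 : HasEigenvaluesPM (A0 + A1) θ₁)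
    (hinf : HasEigenvaluesPM A1 θinf) :
    FredholmWellDefined (integrableKernel φ ψ) ∧
      IsPVITauDet ⟨θ₀, θ₁, 0, θinf⟩ (integrableKernel φ ψ) := by
  have key : ∀ A : Matrix (Fin 2) (Fin 2) ℂ, A.trace = 0 →
      A = sl2Matrix (A 0 0) (A 0 1) (-A 1 0) := fun A hA => by
    rw [Matrix.trace_fin_two] at hA
    ext i j
    fin_cases i <;> fin_cases j <;> simp [sl2Matrix]
    linear_combination hA
  have hdet : ∀ a b c : ℂ, (sl2Matrix a b c).det = -(a ^ 2 - b * c) := fun a b c => by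
    rw [sl2Matrix, Matrix.det_fin_two_of]
    ring
  have hadd : ∀ a b c a' b' c' : ℂ, sl2Matrix a b c + sl2Matrix a' b' c'
      = sl2Matrix (a + a') (b + b') (c + c') := fun a b c a' b' c' => by
    ext i j
    fin_cases i <;> fin_cases j <;> simp [sl2Matrix]
    · ring
    · ring
  rw [key A0 t0, key A1 t1] at h h1
  rw [key A0 t0] at h0
  rw [key A1 t1] at hinf
  rw [hadd] at h1
  have e0 := (hasEigenvaluesPM_iff.1 h0).2
  have e1 := (hasEigenvaluesPM_iff.1 h1).2
  have einf := (hasEigenvaluesPM_iff.1 hinf).2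
  rw [hdet, neg_inj] at e0 e1 einf
  exact ⟨fredholmWellDefined_of_regular h hr, isPVITauDet_of_regular h hr einf e0 e1⟩

theorem determinant_diagonal (α₀ β₀ γ₀ α₁ : ℂ) (φ ψ : ℝ → ℂ)
    (h : SolvesLinearSystem (sl2Matrix α₀ β₀ γ₀) (sl2Matrix α₁ 0 0) φ ψ)
    (hr : RegularAtZero φ ψ) :
    TWWellDefined φ ψ ∧
      IsDiagTWSolution α₀ β₀ γ₀ α₁ (twQ φ ψ) (twP φ ψ) (twU φ ψ) (twV φ ψ) (twW φ ψ)
        (twSet φ ψ) ∧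
      (∀ t ∈ twSet φ ψ, diagI1 α₀ β₀ γ₀ α₁
        (twQ φ ψ) (twP φ ψ) (twU φ ψ) (twV φ ψ) (twW φ ψ) t = 0) ∧
      (∀ t ∈ twSet φ ψ, diagI2 α₀ β₀ γ₀ α₁
        (twQ φ ψ) (twP φ ψ) (twU φ ψ) (twV φ ψ) (twW φ ψ) t = α₀ ^ 2 - β₀ * γ₀) ∧
      SolvesZetaODE α₀ α₁ 0 (α₀ ^ 2 - β₀ * γ₀) (twSet φ ψ)
        (zetaOf (fredholmDet (integrableKernel φ ψ))) ∧
      ∀ k₁ k₂ : ℂ, KParam α₀ α₁ 0 (α₀ ^ 2 - β₀ * γ₀) k₁ k₂ →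
        SolvesSigmaPVI (kTheta α₁ k₁ k₂) (twSet φ ψ)
          (kSigma α₁ k₁ k₂ (zetaOf (fredholmDet (integrableKernel φ ψ)))) ∧
        IsPVITauDet (kTheta α₁ k₁ k₂) (integrableKernel φ ψ) := by
  have hS := isOpen_twSet_of_regular h hr
  have hsol := isDiagTWSolution_iff.2 (isGenTWSolution_of_regular h hr)
  have hI1 : ∀ t ∈ twSet φ ψ, diagI1 α₀ β₀ γ₀ α₁
      (twQ φ ψ) (twP φ ψ) (twU φ ψ) (twV φ ψ) (twW φ ψ) t = 0 := fun t ht => by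
    rw [diagI1_eq, genZeta_of_regular h hr ht, sub_self]
  have hI2 : ∀ t ∈ twSet φ ψ, diagI2 α₀ β₀ γ₀ α₁
      (twQ φ ψ) (twP φ ψ) (twU φ ψ) (twV φ ψ) (twW φ ψ) t = α₀ ^ 2 - β₀ * γ₀ := fun t ht => by
    rw [diagI2_eq, hI1 t ht, residue_det_of_regular h hr ht, sub_zero]
  have hode := hsol.solvesZetaODE hS mul_one_sub_ne_zero_of_twSet
    (fun t ht => zetaOf_of_regular h hr ht) hI1 hI2
  refine ⟨twWellDefined_of_regular h hr, hsol, hI1, hI2, hode, fun k₁ k₂ hk =>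
    ⟨hode.solvesSigmaPVI hS hk, isPVITauDet_of_regular h hr ?_ ?_ ?_⟩⟩
  · ring
  -- I₁ = 0 forces k₁k₂ = α₁(2α₀ + α₁), whence I₂ = (k₁ - k₂)²/4.
  · linear_combination hk.2 + hk.1
  · linear_combination hk.2

theorem determinant_nilpotent (α₀ β₀ γ₀ : ℂ) (φ ψ : ℝ → ℂ)
    (h : SolvesLinearSystem (sl2Matrix α₀ β₀ γ₀) !![0, 1; 0, 0] φ ψ)
    (hr : RegularAtZero φ ψ) :
    TWWellDefined φ ψ ∧
      IsNilTWSolution α₀ β₀ γ₀ (twQ φ ψ) (twP φ ψ) (twU φ ψ) (twV φ ψ) (twW φ ψ)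
        (twSet φ ψ) ∧
      (∀ t ∈ twSet φ ψ, nilI1 α₀ β₀ γ₀
        (twQ φ ψ) (twP φ ψ) (twU φ ψ) (twV φ ψ) (twW φ ψ) t = γ₀) ∧
      (∀ t ∈ twSet φ ψ, nilI2 α₀ β₀ γ₀
        (twQ φ ψ) (twP φ ψ) (twU φ ψ) (twV φ ψ) (twW φ ψ) t = α₀ ^ 2 - β₀ * γ₀ - γ₀) := by
  have e : (!![0, 1; 0, 0] : Matrix (Fin 2) (Fin 2) ℂ) = sl2Matrix 0 1 0 := by simp [sl2Matrix]
  rw [e] at h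
  have hI1 : ∀ t ∈ twSet φ ψ, nilI1 α₀ β₀ γ₀
      (twQ φ ψ) (twP φ ψ) (twU φ ψ) (twV φ ψ) (twW φ ψ) t = γ₀ := fun t ht => by
    rw [nilI1_eq, genZeta_of_regular h hr ht, sub_self, zero_add]
  refine ⟨twWellDefined_of_regular h hr, isNilTWSolution_iff.2 (isGenTWSolution_of_regular h hr),
    hI1, fun t ht => ?_⟩
  rw [nilI2_eq, hI1 t ht, residue_det_of_regular h hr ht]

end

noncomputable section

/-! ### Gauss' series and its contiguous relations -/

section Series

variable {a b c : ℂ}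

/-- The coefficients of Gauss' series. -/
def gaussCoeff (a b c : ℂ) (n : ℕ) : ℂ :=
  (n.factorial : ℂ)⁻¹ * (ascPochhammer ℂ n).eval a * (ascPochhammer ℂ n).eval b
    * ((ascPochhammer ℂ n).eval c)⁻¹

theorem ordinaryHypergeometric_eq_tsum_gaussCoeff (a b c s : ℂ) :
    ordinaryHypergeometric a b c s = ∑' n, gaussCoeff a b c n * s ^ n := by
  rw [ordinaryHypergeometric_eq_tsum]
  rfl

theorem gaussCoeff_zero (a b c : ℂ) : gaussCoeff a b c 0 = 1 := by simp [gaussCoeff]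

theorem add_natCast_ne_zero (hc : 0 < c.re) (n : ℕ) : c + n ≠ 0 := fun h => by
  have := congrArg Complex.re h
  simp only [Complex.add_re, Complex.natCast_re, Complex.zero_re] at this
  have : (0 : ℝ) ≤ n := n.cast_nonneg
  linarith

theorem gaussCoeff_succ (hc : 0 < c.re) (a b : ℂ) (n : ℕ) :
    gaussCoeff a b c (n + 1) = (a + n) * (b + n) / ((n + 1) * (c + n)) * gaussCoeff a b c n := by
  have h1 : (n : ℂ) + 1 ≠ 0 := by exact_mod_cast n.succ_ne_zero
  have h2 := add_natCast_ne_zero hc n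
  simp only [gaussCoeff, ascPochhammer_succ_eval, Nat.factorial_succ, Nat.cast_mul, Nat.cast_succ,
    mul_inv]
  field_simp

theorem re_add_one_pos (hc : 0 < c.re) : 0 < (c + 1).re := by
  simp only [Complex.add_re, Complex.one_re]
  linarith

theorem mul_gaussCoeff_succ (hc : 0 < c.re) (a b : ℂ) (n : ℕ) :
    (n + 1) * gaussCoeff a b c (n + 1) = a * b / c * gaussCoeff (a + 1) (b + 1) (c + 1) n := by
  have h0 : c ≠ 0 := by simpa using add_natCast_ne_zero hc 0
  induction n with
  | zero =>
    rw [gaussCoeff_succ hc, gaussCoeff_zero, gaussCoeff_zero]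
    simp
  | succ n ih =>
    have h1 : (n : ℂ) + 1 ≠ 0 := by exact_mod_cast n.succ_ne_zero
    have h2 : (n : ℂ) + 1 + 1 ≠ 0 := by exact_mod_cast (n + 1).succ_ne_zero
    have h3 : c + (n + 1) ≠ 0 := by
      have := add_natCast_ne_zero hc (n + 1)
      push_cast at this
      exact this
    have h4 : c + 1 + n ≠ 0 := by rwa [add_assoc, add_comm 1]
    rw [gaussCoeff_succ hc, gaussCoeff_succ (re_add_one_pos hc)]
    have e : gaussCoeff a b c (n + 1)
        = a * b / c * gaussCoeff (a + 1) (b + 1) (c + 1) n / (n + 1) := by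
      rw [← ih]
      field_simp
    rw [e]
    push_cast
    field_simp
    ring

theorem mul_gaussCoeff_add_one (hc : 0 < c.re) (a b : ℂ) (n : ℕ) :
    (n + c) * gaussCoeff a b (c + 1) n = c * gaussCoeff a b c n := by
  induction n with
  | zero => simp [gaussCoeff_zero]
  | succ n ih =>
    have h1 : (n : ℂ) + 1 ≠ 0 := by exact_mod_cast n.succ_ne_zero
    have h3 : c + n ≠ 0 := add_natCast_ne_zero hc n
    have h4 : c + 1 + n ≠ 0 := add_natCast_ne_zero (re_add_one_pos hc) n
    rw [gaussCoeff_succ hc, gaussCoeff_succ (re_add_one_pos hc)]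
    have e : gaussCoeff a b c n = (n + c) * gaussCoeff a b (c + 1) n / c := by
      rw [ih]
      have h0 : c ≠ 0 := by simpa using add_natCast_ne_zero hc 0
      field_simp
    have h0 : c ≠ 0 := by simpa using add_natCast_ne_zero hc 0
    rw [e]
    push_cast
    field_simp
    ring

/-- All four coefficients are rational multiples of the n-th one for (a + 1, b + 1; c + 1), so this
is an identity of rational functions. -/
theorem gaussCoeff_contiguous (hc : 0 < c.re) (a b : ℂ) (n : ℕ) :
    gaussCoeff (a + 1) (b + 1) (c + 1) (n + 1) - gaussCoeff (a + 1) (b + 1) (c + 1) n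
      = gaussCoeff a b c (n + 1)
        - (c - a) * (c - b) / (c * (c + 1)) * gaussCoeff (a + 1) (b + 1) (c + 2) n := by
  have hc1 := re_add_one_pos hc
  have h0 : c ≠ 0 := by simpa using add_natCast_ne_zero hc 0
  have h5 : c + 1 ≠ 0 := by simpa using add_natCast_ne_zero hc1 0
  have h1 : (n : ℂ) + 1 ≠ 0 := by exact_mod_cast n.succ_ne_zero
  have h4 : c + 1 + n ≠ 0 := add_natCast_ne_zero hc1 n
  have h6 : (n : ℂ) + (c + 1) ≠ 0 := by rwa [add_comm]
  have e1 : gaussCoeff a b c (n + 1)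
      = a * b / c * gaussCoeff (a + 1) (b + 1) (c + 1) n / (n + 1) := by
    rw [← mul_gaussCoeff_succ hc]
    field_simp
  have e2 : gaussCoeff (a + 1) (b + 1) (c + 2) n
      = (c + 1) * gaussCoeff (a + 1) (b + 1) (c + 1) n / (n + (c + 1)) := by
    rw [← mul_gaussCoeff_add_one hc1, show c + 2 = c + 1 + 1 by ring]
    field_simp
  rw [e1, e2, gaussCoeff_succ hc1]
  field_simp
  ring

theorem tendsto_add_div_add (a c : ℂ) :
    Tendsto (fun n : ℕ => (a + n) / (c + n)) atTop (𝓝 1) := by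
  have h1 := tendsto_natCast_div_add_atTop (𝕜 := ℂ) c
  have h2 := h1.mul ((tendsto_inv_atTop_nhds_zero_nat (𝕜 := ℂ)).const_mul a |>.const_add 1)
  rw [mul_zero, add_zero, mul_one] at h2
  refine h2.congr' ?_
  filter_upwards [eventually_ne_atTop 0] with n hn
  have : (n : ℂ) ≠ 0 := Nat.cast_ne_zero.2 hn
  rw [div_mul_eq_mul_div, add_comm c]
  congr 1
  field_simp
  ring

theorem summable_norm_gaussCoeff (hc : 0 < c.re) (a b : ℂ) {r : ℝ} (h0 : 0 ≤ r) (h1 : r < 1) :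
    Summable fun n => ‖gaussCoeff a b c n‖ * r ^ n := by
  obtain ⟨ρ, hρ, hρ1⟩ := exists_between h1
  refine summable_of_ratio_norm_eventually_le hρ1 ?_
  -- Ratio test: the quotient of consecutive terms tends to r, hence is eventually below ρ.
  have ht : Tendsto (fun n : ℕ => ‖(a + n) / (1 + n) * ((b + n) / (c + n))‖ * r) atTop
      (𝓝 (‖(1 : ℂ) * 1‖ * r)) :=
    ((tendsto_add_div_add a 1).mul (tendsto_add_div_add b c)).norm.mul_const r
  rw [mul_one, norm_one, one_mul] at ht
  filter_upwards [ht.eventually_lt_const hρ] with n hn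
  rw [Real.norm_of_nonneg (by positivity), Real.norm_of_nonneg (by positivity),
    gaussCoeff_succ hc, norm_mul, pow_succ]
  rw [div_mul_div_comm, add_comm (1 : ℂ)] at hn
  calc ‖(a + n) * (b + n) / ((n + 1) * (c + n))‖ * ‖gaussCoeff a b c n‖ * (r ^ n * r)
      = ‖(a + n) * (b + n) / ((n + 1) * (c + n))‖ * r * (‖gaussCoeff a b c n‖ * r ^ n) := by ring
    _ ≤ ρ * (‖gaussCoeff a b c n‖ * r ^ n) := mul_le_mul_of_nonneg_right hn.le (by positivity)

theorem hasSum_gauss (hc : 0 < c.re) (a b : ℂ) {s : ℂ} (hs : ‖s‖ < 1) :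
    HasSum (fun n => gaussCoeff a b c n * s ^ n) (ordinaryHypergeometric a b c s) := by
  rw [ordinaryHypergeometric_eq_tsum_gaussCoeff]
  refine Summable.hasSum (Summable.of_norm ?_)
  simpa only [norm_mul, norm_pow] using summable_norm_gaussCoeff hc a b (norm_nonneg s) hs

theorem hasDerivAt_gauss (hc : 0 < c.re) (a b : ℂ) {s : ℂ} (hs : ‖s‖ < 1) :
    HasDerivAt (ordinaryHypergeometric a b c)
      (a * b / c * ordinaryHypergeometric (a + 1) (b + 1) (c + 1) s) s := by
  obtain ⟨r, hr, hr1⟩ := exists_between hs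
  have h0 : 0 ≤ r := (norm_nonneg s).trans hr.le
  have hsum := (summable_norm_gaussCoeff (re_add_one_pos hc) (a + 1) (b + 1) h0 hr1).mul_left
    ‖a * b / c‖
  have hder : ∀ (n : ℕ) (y : ℂ), HasDerivAt (fun y => gaussCoeff a b c (n + 1) * y ^ (n + 1))
      (a * b / c * (gaussCoeff (a + 1) (b + 1) (c + 1) n * y ^ n)) y := fun n y => by
    refine ((hasDerivAt_pow (n + 1) y).const_mul _).congr_deriv ?_
    rw [Nat.add_sub_cancel]
    push_cast
    linear_combination y ^ n * mul_gaussCoeff_succ hc a b n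
  have key := hasDerivAt_tsum_of_isPreconnected (𝕜 := ℂ) hsum (t := Metric.ball 0 r)
    Metric.isOpen_ball (convex_ball _ _).isPreconnected (fun n y _ => hder n y)
    (fun n y hy => ?_) (y₀ := s) (by simpa using hr)
    ((summable_nat_add_iff 1).2 (hasSum_gauss hc a b hs).summable) (y := s) (by simpa using hr)
  · rw [tsum_mul_left, (hasSum_gauss (re_add_one_pos hc) (a + 1) (b + 1) hs).tsum_eq] at key
    refine (key.const_add 1).congr_of_eventuallyEq ?_
    filter_upwards [Metric.isOpen_ball.mem_nhds (by simpa using hs : s ∈ Metric.ball 0 1)] with y hy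
    have hy' : ‖y‖ < 1 := by simpa using hy
    rw [← (hasSum_gauss hc a b hy').tsum_eq, (hasSum_gauss hc a b hy').summable.tsum_eq_zero_add,
      gaussCoeff_zero, pow_zero, mul_one]
  · rw [norm_mul, norm_mul, norm_pow]
    have : ‖y‖ ≤ r := by simpa using (le_of_lt hy : dist y 0 ≤ r)
    gcongr

/-- The derivative of F(a, b; c; s) is a multiple of F(a + 1, b + 1; c + 1; s). This relation
expresses the latter through F(a, b; c; s) and sF(a + 1, b + 1; c + 2; s), so that these two
functions satisfy a closed first order system. -/
theorem gauss_contiguous (hc : 0 < c.re) (a b : ℂ) {s : ℂ} (hs : ‖s‖ < 1) :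
    (1 - s) * ordinaryHypergeometric (a + 1) (b + 1) (c + 1) s = ordinaryHypergeometric a b c s
      - (c - a) * (c - b) / (c * (c + 1)) * (s * ordinaryHypergeometric (a + 1) (b + 1) (c + 2) s) := by
  have hc2 : 0 < (c + 2).re := by
    simp only [Complex.add_re, Complex.re_ofNat]
    linarith
  have h1 := hasSum_gauss (re_add_one_pos hc) (a + 1) (b + 1) hs
  have h2 := hasSum_gauss hc2 (a + 1) (b + 1) hs
  have h3 := hasSum_gauss hc a b hs
  -- The constant terms on both sides are 1; the relation of coefficients handles the terms of index
  -- n + 1.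
  have e1 := (hasSum_nat_add_iff' 1).2 h1
  have e3 := (hasSum_nat_add_iff' 1).2 h3
  simp only [Finset.sum_range_one, gaussCoeff_zero, pow_zero, mul_one] at e1 e3
  have e4 := (e1.sub (h1.mul_left s)).sub (e3.sub
    ((h2.mul_left s).mul_left ((c - a) * (c - b) / (c * (c + 1)))))
  have e5 : ∀ n, (gaussCoeff (a + 1) (b + 1) (c + 1) (n + 1) * s ^ (n + 1)
      - s * (gaussCoeff (a + 1) (b + 1) (c + 1) n * s ^ n))
      - (gaussCoeff a b c (n + 1) * s ^ (n + 1)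
        - (c - a) * (c - b) / (c * (c + 1)) * (s * (gaussCoeff (a + 1) (b + 1) (c + 2) n * s ^ n)))
      = 0 := fun n => by
    rw [pow_succ]
    linear_combination s ^ n * s * gaussCoeff_contiguous hc a b n
  have := e4.unique (by simpa only [e5] using (hasSum_zero (α := ℂ) (β := ℕ)))
  linear_combination this

/-- Coefficientwise this is (n + c)·coefficient for c + 1 = c·coefficient for c. It supplies the
derivative of the second function of the closed system. -/
theorem gauss_deriv_contiguous (hc : 0 < c.re) (a b : ℂ) {s : ℂ} (hs : ‖s‖ < 1) :
    s * deriv (ordinaryHypergeometric a b (c + 1)) s + c * ordinaryHypergeometric a b (c + 1) s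
      = c * ordinaryHypergeometric a b c s := by
  have hc1 := re_add_one_pos hc
  have hd := hasDerivAt_gauss hc1 a b hs
  rw [hd.deriv]
  have h1 := hasSum_gauss (re_add_one_pos hc1) (a + 1) (b + 1) hs
  have h2 := (hasSum_nat_add_iff' 1).2 (hasSum_gauss hc1 a b hs)
  have h3 := (hasSum_nat_add_iff' 1).2 (hasSum_gauss hc a b hs)
  simp only [Finset.sum_range_one, gaussCoeff_zero, pow_zero, mul_one] at h2 h3
  have e := ((h1.mul_left (a * b / (c + 1))).mul_left s).add (h2.mul_left c) |>.sub (h3.mul_left c)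
  have e5 : ∀ n : ℕ, s * (a * b / (c + 1) * (gaussCoeff (a + 1) (b + 1) (c + 1 + 1) n * s ^ n))
      + c * (gaussCoeff a b (c + 1) (n + 1) * s ^ (n + 1))
      - c * (gaussCoeff a b c (n + 1) * s ^ (n + 1)) = 0 := fun n => by
    have e1 := mul_gaussCoeff_succ hc1 a b n
    have e2 := mul_gaussCoeff_add_one hc a b (n + 1)
    push_cast at e2
    rw [pow_succ]
    linear_combination s ^ n * s * (e2 - e1)
  have := e.unique (by simpa only [e5] using (hasSum_zero (α := ℂ) (β := ℕ)))
  linear_combination this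

end Series

end

noncomputable section

/-! ### Traceless linear systems on `(0, b)` -/

/-- `x (1 - x) (f, g)' = (A₀ + A₁ x) (f, g)` on `(0, b)` for traceless `A₀`, `A₁`. -/
def SolvesOn (a₀ b₀ c₀ a₁ b₁ c₁ : ℂ) (b : ℝ) (f g : ℝ → ℂ) : Prop :=
  ∀ x ∈ Ioo (0 : ℝ) b,
    HasDerivAt f (((a₀ + a₁ * x) * f x + (b₀ + b₁ * x) * g x) / ((x : ℂ) * (1 - x))) x ∧
    HasDerivAt g ((-(c₀ + c₁ * x) * f x - (a₀ + a₁ * x) * g x) / ((x : ℂ) * (1 - x))) x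

section LinearSystem

variable {a₀ b₀ c₀ a₁ b₁ c₁ : ℂ} {b : ℝ} {f g f₁ g₁ : ℝ → ℂ}

theorem SolvesOn.const_mul (h : SolvesOn a₀ b₀ c₀ a₁ b₁ c₁ b f g) (κ : ℂ) :
    SolvesOn a₀ b₀ c₀ a₁ b₁ c₁ b (fun x => κ * f x) (fun x => κ * g x) := fun x hx =>
  ⟨((h x hx).1.const_mul κ).congr_deriv (by ring), ((h x hx).2.const_mul κ).congr_deriv (by ring)⟩

theorem SolvesOn.mono (h : SolvesOn a₀ b₀ c₀ a₁ b₁ c₁ b f g) {b' : ℝ} (hb : b' ≤ b) :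
    SolvesOn a₀ b₀ c₀ a₁ b₁ c₁ b' f g := fun x hx => h x ⟨hx.1, hx.2.trans_le hb⟩

/-- The Wronskian of two regular solutions vanishes. -/
theorem SolvesOn.wronskian_eq_zero (h : SolvesOn a₀ b₀ c₀ a₁ b₁ c₁ b f g)
    (h₁ : SolvesOn a₀ b₀ c₀ a₁ b₁ c₁ b f₁ g₁) (hr : RegularAtZero f g)
    (hr₁ : RegularAtZero f₁ g₁) {x : ℝ} (hx : x ∈ Ioo 0 b) : f x * g₁ x - g x * f₁ x = 0 := by
  -- The Wronskian is constant because the system is traceless, and regularity at 0 makes the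
  -- constant zero.
  obtain ⟨C, hC⟩ := eqOn_const_of_hasDerivAt_zero (F := fun x => f x * g₁ x - g x * f₁ x)
    isOpen_Ioo (isPreconnected_Ioo (a := (0 : ℝ)) (b := b)) fun x hx => by
      refine (((h x hx).1.mul (h₁ x hx).2).sub ((h x hx).2.mul (h₁ x hx).1)).congr_deriv ?_
      ring
  have hb : 0 < b := hx.1.trans hx.2
  have ht : Tendsto (fun x => f x * g₁ x - g x * f₁ x) (𝓝[>] 0) (𝓝 (0 * 0 - 0 * 0)) :=
    (hr.1.mul hr₁.2).sub (hr.2.mul hr₁.1)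
  have ht' : Tendsto (fun x => f x * g₁ x - g x * f₁ x) (𝓝[>] 0) (𝓝 C) := by
    refine tendsto_const_nhds.congr' ?_
    filter_upwards [Ioo_mem_nhdsGT hb] with y hy using (hC y hy).symm
  have := tendsto_nhds_unique ht ht'
  rw [hC x hx, ← this]
  ring

theorem SolvesOn.eqOn_of_eq (hb : b ≤ 1) (h : SolvesOn a₀ b₀ c₀ a₁ b₁ c₁ b f g)
    (h₁ : SolvesOn a₀ b₀ c₀ a₁ b₁ c₁ b f₁ g₁) {x₀ : ℝ} (hx₀ : x₀ ∈ Ioo 0 b)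
    (hf : f x₀ = f₁ x₀) (hg : g x₀ = g₁ x₀) {x : ℝ} (hx : x ∈ Ioo 0 b) :
    f x = f₁ x ∧ g x = g₁ x := by
  -- The coefficients are singular at 0 and 1, so the Lipschitz bound is taken on an interval [l, r]
  -- inside (0, b) around both points.
  obtain ⟨l, hl0, hl⟩ := exists_between (lt_min hx₀.1 hx.1)
  obtain ⟨r, hr, hrb⟩ := exists_between (max_lt hx₀.2 hx.2)
  have hsub : Ioo l r ⊆ Ioo 0 b := fun y hy => ⟨hl0.trans hy.1, hy.2.trans hrb⟩
  have hne : ∀ y ∈ Icc l r, (y : ℂ) * (1 - y) ≠ 0 := fun y hy => by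
    have h1 : (y : ℂ) ≠ 0 := by exact_mod_cast (hl0.trans_le hy.1).ne'
    have h2 : 1 - y ≠ 0 := by linarith [hy.2.trans_lt (hrb.trans_le hb)]
    exact mul_ne_zero h1 (by exact_mod_cast h2)
  have bd : ∀ m n : ℂ, ∃ C, ∀ y ∈ Icc l r, ‖(m + n * (y : ℂ)) / ((y : ℂ) * (1 - y))‖ ≤ C :=
    fun m n => isCompact_Icc.exists_bound_of_continuousOn
      (ContinuousOn.div (by fun_prop) (by fun_prop) hne)
  obtain ⟨C₁, hC₁⟩ := bd a₀ a₁
  obtain ⟨C₂, hC₂⟩ := bd b₀ b₁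
  obtain ⟨C₃, hC₃⟩ := bd c₀ c₁
  set v : ℝ → ℂ × ℂ → ℂ × ℂ := fun y z =>
    ((a₀ + a₁ * y) / ((y : ℂ) * (1 - y)) * z.1 + (b₀ + b₁ * y) / ((y : ℂ) * (1 - y)) * z.2,
      -((c₀ + c₁ * y) / ((y : ℂ) * (1 - y))) * z.1
        - (a₀ + a₁ * y) / ((y : ℂ) * (1 - y)) * z.2) with hv
  set C := |C₁| + |C₂| + |C₃| with hCdef
  have hlip : ∀ y ∈ Ioo l r, LipschitzOnWith (Real.toNNReal C) (v y) univ := fun y hy => by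
    refine LipschitzOnWith.of_dist_le_mul fun z _ z' _ => ?_
    rw [Real.coe_toNNReal _ (by positivity), dist_eq_norm, dist_eq_norm]
    have hy' : y ∈ Icc l r := ⟨hy.1.le, hy.2.le⟩
    have e1 := (hC₁ y hy').trans (le_abs_self _)
    have e2 := (hC₂ y hy').trans (le_abs_self _)
    have e3 := (hC₃ y hy').trans (le_abs_self _)
    have n1 : ‖(z - z').1‖ ≤ ‖z - z'‖ := norm_fst_le _
    have n2 : ‖(z - z').2‖ ≤ ‖z - z'‖ := norm_snd_le _
    have hn := norm_nonneg (z - z')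
    refine max_le ?_ ?_
    · have e : (v y z - v y z').1 = (a₀ + a₁ * y) / ((y : ℂ) * (1 - y)) * (z - z').1
          + (b₀ + b₁ * y) / ((y : ℂ) * (1 - y)) * (z - z').2 := by
        simp only [hv, Prod.fst_sub, Prod.snd_sub]
        ring
      rw [e]
      refine (norm_add_le _ _).trans ?_
      rw [norm_mul, norm_mul, hCdef]
      have := mul_le_mul e1 n1 (norm_nonneg _) (abs_nonneg _)
      have := mul_le_mul e2 n2 (norm_nonneg _) (abs_nonneg _)
      nlinarith [mul_nonneg (abs_nonneg C₃) hn]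
    · have e : (v y z - v y z').2 = -((c₀ + c₁ * y) / ((y : ℂ) * (1 - y)) * (z - z').1)
          - (a₀ + a₁ * y) / ((y : ℂ) * (1 - y)) * (z - z').2 := by
        simp only [hv, Prod.fst_sub, Prod.snd_sub]
        ring
      rw [e]
      refine (norm_sub_le _ _).trans ?_
      rw [norm_neg, norm_mul, norm_mul, hCdef]
      have := mul_le_mul e3 n1 (norm_nonneg _) (abs_nonneg _)
      have := mul_le_mul e1 n2 (norm_nonneg _) (abs_nonneg _)
      nlinarith [mul_nonneg (abs_nonneg C₂) hn]
  have hsol : ∀ {f g : ℝ → ℂ}, SolvesOn a₀ b₀ c₀ a₁ b₁ c₁ b f g → ∀ y ∈ Ioo l r,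
      HasDerivAt (fun y => (f y, g y)) (v y (f y, g y)) y ∧ (f y, g y) ∈ (univ : Set (ℂ × ℂ)) :=
    fun {f g} h y hy => by
      refine ⟨HasDerivAt.congr_deriv ((h y (hsub hy)).1.prodMk (h y (hsub hy)).2) ?_, trivial⟩
      simp only [hv]
      congr 1 <;> ring
  have key := ODE_solution_unique_of_mem_Ioo hlip (t₀ := x₀)
    ⟨hl.trans_le (min_le_left _ _), (le_max_left _ _).trans_lt hr⟩ (hsol h) (hsol h₁)
    (by simp only [hf, hg])
  have := key (show x ∈ Ioo l r from
    ⟨hl.trans_le (min_le_right _ _), (le_max_right _ _).trans_lt hr⟩)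
  exact ⟨congrArg Prod.fst this, congrArg Prod.snd this⟩

/-- Regular solutions are proportional. -/
theorem SolvesOn.exists_eq_const_mul (hb : b ≤ 1) (h : SolvesOn a₀ b₀ c₀ a₁ b₁ c₁ b f g)
    (h₁ : SolvesOn a₀ b₀ c₀ a₁ b₁ c₁ b f₁ g₁) (hr : RegularAtZero f g)
    (hr₁ : RegularAtZero f₁ g₁) {x₀ : ℝ} (hx₀ : x₀ ∈ Ioo 0 b) (hne : f₁ x₀ ≠ 0 ∨ g₁ x₀ ≠ 0) :
    ∃ κ : ℂ, ∀ x ∈ Ioo 0 b, f x = κ * f₁ x ∧ g x = κ * g₁ x := by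
  have hw := h.wronskian_eq_zero h₁ hr hr₁ hx₀
  rcases hne with hne | hne
  · refine ⟨f x₀ / f₁ x₀, fun x hx => h.eqOn_of_eq hb (h₁.const_mul _) hx₀ ?_ ?_ hx⟩
    · field_simp
    · field_simp
      linear_combination -hw
  · refine ⟨g x₀ / g₁ x₀, fun x hx => h.eqOn_of_eq hb (h₁.const_mul _) hx₀ ?_ ?_ hx⟩
    · field_simp
      linear_combination hw
    · field_simp

end LinearSystem

/-! ### The system of the functions `f` and `g` -/

section Hyper

variable {a b c : ℂ} {x : ℝ}

theorem hasDerivAt_gauss' (hc : 0 < c.re) (a b : ℂ) {s : ℂ} (hs : ‖s‖ < 1) :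
    HasDerivAt (ordinaryHypergeometric a b c) (a * b / c * ((ordinaryHypergeometric a b c s
      - (c - a) * (c - b) / (c * (c + 1)) * (s * ordinaryHypergeometric (a + 1) (b + 1) (c + 2) s))
      / (1 - s))) s := by
  have h1 : 1 - s ≠ 0 := fun h => by
    rw [← sub_eq_zero.1 h, norm_one] at hs
    exact lt_irrefl _ hs
  refine (hasDerivAt_gauss hc a b hs).congr_deriv ?_
  rw [← gauss_contiguous hc a b hs, mul_div_cancel_left₀ _ h1]

theorem hasDerivAt_mul_gauss (hc : 0 < c.re) (a b : ℂ) {s : ℂ} (hs : ‖s‖ < 1) :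
    HasDerivAt (fun s => s * ordinaryHypergeometric (a + 1) (b + 1) (c + 2) s)
      ((c + 1) * ((ordinaryHypergeometric a b c s - (c - a) * (c - b) / (c * (c + 1))
        * (s * ordinaryHypergeometric (a + 1) (b + 1) (c + 2) s)) / (1 - s))
        - c * ordinaryHypergeometric (a + 1) (b + 1) (c + 2) s) s := by
  have h1 : 1 - s ≠ 0 := fun h => by
    rw [← sub_eq_zero.1 h, norm_one] at hs
    exact lt_irrefl _ hs
  have hc2 : 0 < (c + 2).re := by
    simp only [Complex.add_re, Complex.re_ofNat]
    linarith
  have hd := hasDerivAt_gauss hc2 (a + 1) (b + 1) hs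
  have e := gauss_deriv_contiguous (re_add_one_pos hc) (a + 1) (b + 1) hs
  rw [show c + 1 + 1 = c + 2 by ring, hd.deriv] at e
  refine ((hasDerivAt_id s).mul hd).congr_deriv ?_
  rw [← gauss_contiguous hc a b hs, mul_div_cancel_left₀ _ h1]
  simp only [id]
  linear_combination e

theorem hasDerivAt_ofReal_cpow (k : ℂ) (hx : 0 < x) :
    HasDerivAt (fun x : ℝ => (x : ℂ) ^ k) (k / x * (x : ℂ) ^ k) x := by
  have h0 : (x : ℂ) ≠ 0 := by exact_mod_cast hx.ne'
  refine (((hasDerivAt_id (x : ℂ)).cpow_const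
    (Or.inl (by simpa using hx))).comp_ofReal).congr_deriv ?_
  simp only [id]
  rw [Complex.cpow_sub _ _ h0, Complex.cpow_one]
  ring

theorem hasDerivAt_one_sub_cpow (k : ℂ) (hx : x < 1) :
    HasDerivAt (fun x : ℝ => (1 - (x : ℂ)) ^ k) (-(k / (1 - x)) * (1 - (x : ℂ)) ^ k) x := by
  have h1 : 1 - (x : ℂ) ≠ 0 := by
    have : 1 - x ≠ 0 := by linarith
    exact_mod_cast this
  refine ((((hasDerivAt_id (x : ℂ)).const_sub 1).cpow_const
    (Or.inl (by simpa using hx))).comp_ofReal).congr_deriv ?_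
  simp only [id]
  rw [Complex.cpow_sub _ _ h1, Complex.cpow_one]
  ring

/-- The system solved by the functions `hyperA` and `hyperB`. -/
def SolvesHyperOn (a b c : ℂ) (r : ℝ) (f g : ℝ → ℂ) : Prop :=
  SolvesOn (c / 2) 0 0 ((a + b - c) / 2 - a * b / c)
    (-(a * b * ((c - a) * (c - b)) / (c ^ 2 * (c + 1)))) (-(c + 1)) r f g

/-- `hyperA` by Pfaff's transformation. -/
def pfaffA (a b c : ℂ) (x : ℝ) : ℂ :=
  (x : ℂ) ^ (c / 2) * (1 - (x : ℂ)) ^ ((a - b) / 2) * ordinaryHypergeometric a (c - b) c (x : ℂ)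

/-- `hyperB` by Pfaff's transformation. -/
def pfaffB (a b c : ℂ) (x : ℝ) : ℂ :=
  (x : ℂ) ^ (c / 2) * (1 - (x : ℂ)) ^ ((a - b) / 2)
    * (x * ordinaryHypergeometric (a + 1) (c - b + 1) (c + 2) (x : ℂ))

/-- Here the series is evaluated at x itself and converges on all of (0, 1), whereas Gauss' series
at x/(x - 1) only reaches 1/2. -/
theorem solvesHyperOn_pfaff (hc : 0 < c.re) (a b : ℂ) :
    SolvesHyperOn a b c 1 (pfaffA a b c) (pfaffB a b c) := by
  intro x hx
  have h0 : (x : ℂ) ≠ 0 := by exact_mod_cast hx.1.ne'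
  have h1 : 1 - (x : ℂ) ≠ 0 := by
    have : 1 - x ≠ 0 := by linarith [hx.2]
    exact_mod_cast this
  have hc0 : c ≠ 0 := by simpa using add_natCast_ne_zero hc 0
  have hc1 : c + 1 ≠ 0 := by simpa using add_natCast_ne_zero hc 1
  have hs : ‖(x : ℂ)‖ < 1 := by
    rw [Complex.norm_real, Real.norm_of_nonneg hx.1.le]
    exact hx.2
  have hν := (hasDerivAt_ofReal_cpow (c / 2) hx.1).mul (hasDerivAt_one_sub_cpow ((a - b) / 2) hx.2)
  have d1 := (hasDerivAt_gauss' hc a (c - b) hs).comp x (hasDerivAt_ofReal x)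
  have d2 := (hasDerivAt_mul_gauss hc a (c - b) hs).comp x (hasDerivAt_ofReal x)
  refine ⟨(hν.mul d1).congr_deriv ?_, (hν.mul d2).congr_deriv ?_⟩
  · simp only [pfaffA, pfaffB, Pi.mul_apply, Function.comp_apply]
    generalize (x : ℂ) ^ (c / 2) = X
    generalize (1 - (x : ℂ)) ^ ((a - b) / 2) = Y
    generalize ordinaryHypergeometric a (c - b) c (x : ℂ) = F
    generalize ordinaryHypergeometric (a + 1) (c - b + 1) (c + 2) (x : ℂ) = G
    field_simp
    ring
  · simp only [pfaffA, pfaffB, Pi.mul_apply, Function.comp_apply]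
    generalize (x : ℂ) ^ (c / 2) = X
    generalize (1 - (x : ℂ)) ^ ((a - b) / 2) = Y
    generalize ordinaryHypergeometric a (c - b) c (x : ℂ) = F
    generalize ordinaryHypergeometric (a + 1) (c - b + 1) (c + 2) (x : ℂ) = G
    field_simp
    ring

/-- `hyperA` by Gauss' series. -/
def seriesA (a b c : ℂ) (x : ℝ) : ℂ :=
  (x : ℂ) ^ (c / 2) * (1 - (x : ℂ)) ^ (-(a + b) / 2)
    * ordinaryHypergeometric a b c ((x : ℂ) / (x - 1))

/-- `hyperB` by Gauss' series. -/
def seriesB (a b c : ℂ) (x : ℝ) : ℂ :=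
  -((x : ℂ) ^ (c / 2) * (1 - (x : ℂ)) ^ (-(a + b) / 2)
    * ((x : ℂ) / (x - 1) * ordinaryHypergeometric (a + 1) (b + 1) (c + 2) ((x : ℂ) / (x - 1))))

theorem norm_div_sub_one_lt_one (hx : x ∈ Ioo (0 : ℝ) (1 / 2)) : ‖(x : ℂ) / (x - 1)‖ < 1 := by
  have : (x : ℂ) / (x - 1) = ((x / (x - 1) : ℝ) : ℂ) := by push_cast; rfl
  rw [this, Complex.norm_real, norm_div, Real.norm_of_nonneg hx.1.le, Real.norm_eq_abs,
    abs_of_neg (by linarith [hx.2]), div_lt_one (by linarith [hx.2])]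
  linarith [hx.2]

theorem solvesHyperOn_series (hc : 0 < c.re) (a b : ℂ) :
    SolvesHyperOn a b c (1 / 2) (seriesA a b c) (seriesB a b c) := by
  intro x hx
  have hx1 : x < 1 := hx.2.trans (by norm_num)
  have h0 : (x : ℂ) ≠ 0 := by exact_mod_cast hx.1.ne'
  have h1 : 1 - (x : ℂ) ≠ 0 := by
    have : 1 - x ≠ 0 := by linarith
    exact_mod_cast this
  have h2 : (x : ℂ) - 1 ≠ 0 := fun h => h1 (by linear_combination -h)
  have hc0 : c ≠ 0 := by simpa using add_natCast_ne_zero hc 0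
  have hc1 : c + 1 ≠ 0 := by simpa using add_natCast_ne_zero hc 1
  have hs := norm_div_sub_one_lt_one hx
  have hμ := (hasDerivAt_ofReal_cpow (c / 2) hx.1).mul (hasDerivAt_one_sub_cpow (-(a + b) / 2) hx1)
  have ds : HasDerivAt (fun x : ℝ => (x : ℂ) / (x - 1)) (-1 / ((x : ℂ) - 1) ^ 2) x :=
    ((hasDerivAt_ofReal x).div ((hasDerivAt_ofReal x).sub_const 1) h2).congr_deriv
      (by congr 1; ring)
  have d1 := (hasDerivAt_gauss' hc a b hs).comp x ds
  have d2 := (hasDerivAt_mul_gauss hc a b hs).comp x ds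
  have e1 : 1 - (x : ℂ) / (x - 1) = -1 / ((x : ℂ) - 1) := by
    field_simp
    ring
  rw [e1] at d1 d2
  refine ⟨(hμ.mul d1).congr_deriv ?_, (hμ.mul d2).neg.congr_deriv ?_⟩
  · simp only [seriesA, seriesB, Pi.mul_apply, Function.comp_apply]
    generalize (x : ℂ) ^ (c / 2) = X
    generalize (1 - (x : ℂ)) ^ (-(a + b) / 2) = Y
    generalize ordinaryHypergeometric a b c ((x : ℂ) / (x - 1)) = F
    generalize ordinaryHypergeometric (a + 1) (b + 1) (c + 2) ((x : ℂ) / (x - 1)) = G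
    rw [← neg_sub (x : ℂ) 1]
    field_simp
    ring
  · simp only [seriesA, seriesB, Pi.mul_apply, Function.comp_apply]
    generalize (x : ℂ) ^ (c / 2) = X
    generalize (1 - (x : ℂ)) ^ (-(a + b) / 2) = Y
    generalize ordinaryHypergeometric a b c ((x : ℂ) / (x - 1)) = F
    generalize ordinaryHypergeometric (a + 1) (b + 1) (c + 2) ((x : ℂ) / (x - 1)) = G
    rw [← neg_sub (x : ℂ) 1]
    field_simp
    ring

end Hyper

end

/-! ### Pfaff's transformation, the hypergeometric regular solution and the ₂F₁ kernel. -/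

noncomputable section

section Hyper

variable {a b c : ℂ} {x : ℝ}

theorem tendsto_ofReal_cpow_zero {k : ℂ} (hk : 0 < k.re) :
    Tendsto (fun x : ℝ => (x : ℂ) ^ k) (𝓝[>] 0) (𝓝 0) := by
  rw [tendsto_zero_iff_norm_tendsto_zero]
  have h : Tendsto (fun x : ℝ => x ^ k.re) (𝓝[>] 0) (𝓝 0) := by
    have := (Real.continuousAt_rpow_const 0 k.re (Or.inr hk.le)).tendsto
    rw [Real.zero_rpow hk.ne'] at this
    exact this.mono_left nhdsWithin_le_nhds
  refine h.congr' ?_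
  filter_upwards [self_mem_nhdsWithin] with x hx
  exact (Complex.norm_cpow_eq_rpow_re_of_pos hx k).symm

theorem tendsto_one_sub_cpow (k : ℂ) :
    Tendsto (fun x : ℝ => (1 - (x : ℂ)) ^ k) (𝓝[>] 0) (𝓝 1) := by
  have := (hasDerivAt_one_sub_cpow k (x := 0) one_pos).continuousAt.tendsto
  simp only [Complex.ofReal_zero, sub_zero, Complex.one_cpow] at this
  exact this.mono_left nhdsWithin_le_nhds

theorem tendsto_gauss_comp (hc : 0 < c.re) (a b : ℂ) {s : ℝ → ℂ} {l : Filter ℝ}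
    (hs : Tendsto s l (𝓝 0)) : Tendsto (fun x => ordinaryHypergeometric a b c (s x)) l (𝓝 1) := by
  have := (hasDerivAt_gauss hc a b (s := 0) (by simp)).continuousAt.tendsto
  rw [ordinaryHypergeometric_zero] at this
  exact this.comp hs

theorem tendsto_ofReal_nhdsGT_zero : Tendsto (fun x : ℝ => (x : ℂ)) (𝓝[>] 0) (𝓝 0) :=
  (Complex.continuous_ofReal.tendsto 0).mono_left nhdsWithin_le_nhds

theorem tendsto_div_sub_one_zero :
    Tendsto (fun x : ℝ => (x : ℂ) / (x - 1)) (𝓝[>] 0) (𝓝 0) := by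
  have h := tendsto_ofReal_nhdsGT_zero
  have := h.div (h.sub_const 1) (by simp)
  rwa [zero_div] at this

theorem re_add_two_pos (hc : 0 < c.re) : 0 < (c + 2).re := by
  simp only [Complex.add_re, Complex.re_ofNat]
  linarith

theorem re_div_two_pos (hc : 0 < c.re) : 0 < (c / 2).re := by
  rw [Complex.div_ofNat_re]
  positivity

theorem regularAtZero_of_factor {f g F G : ℝ → ℂ} {l m : ℂ} (hc : 0 < c.re)
    (hf : ∀ x, f x = (x : ℂ) ^ (c / 2) * F x) (hg : ∀ x, g x = (x : ℂ) ^ (c / 2) * G x)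
    (hF : Tendsto F (𝓝[>] 0) (𝓝 l)) (hG : Tendsto G (𝓝[>] 0) (𝓝 m)) : RegularAtZero f g := by
  have h0 := tendsto_ofReal_cpow_zero (re_div_two_pos hc)
  have e1 := h0.mul hF
  have e2 := h0.mul hG
  rw [zero_mul] at e1 e2
  rw [RegularAtZero, funext hf, funext hg]
  exact ⟨e1, e2⟩

theorem tendsto_pfaffA_factor (hc : 0 < c.re) (a b : ℂ) :
    Tendsto (fun x : ℝ => (1 - (x : ℂ)) ^ ((a - b) / 2) * ordinaryHypergeometric a (c - b) c (x : ℂ))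
      (𝓝[>] 0) (𝓝 1) := by
  have := (tendsto_one_sub_cpow ((a - b) / 2)).mul
    (tendsto_gauss_comp hc a (c - b) tendsto_ofReal_nhdsGT_zero)
  rwa [one_mul] at this

theorem regularAtZero_pfaff (hc : 0 < c.re) (a b : ℂ) :
    RegularAtZero (pfaffA a b c) (pfaffB a b c) :=
  regularAtZero_of_factor hc (fun _ => mul_assoc _ _ _) (fun _ => mul_assoc _ _ _)
    (tendsto_pfaffA_factor hc a b)
    ((tendsto_one_sub_cpow _).mul (tendsto_ofReal_nhdsGT_zero.mul
      (tendsto_gauss_comp (re_add_two_pos hc) _ _ tendsto_ofReal_nhdsGT_zero)))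

theorem tendsto_seriesA_factor (hc : 0 < c.re) (a b : ℂ) :
    Tendsto (fun x : ℝ => (1 - (x : ℂ)) ^ (-(a + b) / 2)
      * ordinaryHypergeometric a b c ((x : ℂ) / (x - 1))) (𝓝[>] 0) (𝓝 1) := by
  have := (tendsto_one_sub_cpow (-(a + b) / 2)).mul
    (tendsto_gauss_comp hc a b tendsto_div_sub_one_zero)
  rwa [one_mul] at this

theorem regularAtZero_series (hc : 0 < c.re) (a b : ℂ) :
    RegularAtZero (seriesA a b c) (seriesB a b c) :=
  regularAtZero_of_factor hc (fun _ => mul_assoc _ _ _)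
    (fun x => by rw [seriesB, mul_assoc, ← mul_neg])
    (tendsto_seriesA_factor hc a b)
    ((tendsto_one_sub_cpow _).mul (tendsto_div_sub_one_zero.mul
      (tendsto_gauss_comp (re_add_two_pos hc) _ _ tendsto_div_sub_one_zero))).neg

theorem ofReal_cpow_ne_zero (k : ℂ) (hx : 0 < x) : (x : ℂ) ^ k ≠ 0 := by
  have : (x : ℂ) ≠ 0 := by exact_mod_cast hx.ne'
  simp [Complex.cpow_eq_zero_iff, this]

theorem exists_pfaffA_ne_zero (hc : 0 < c.re) (a b : ℂ) :
    ∃ x ∈ Ioo (0 : ℝ) (1 / 2), pfaffA a b c x ≠ 0 := by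
  have h1 : ∀ᶠ x : ℝ in 𝓝[>] 0, (1 - (x : ℂ)) ^ ((a - b) / 2)
      * ordinaryHypergeometric a (c - b) c (x : ℂ) ≠ 0 :=
    (tendsto_pfaffA_factor hc a b).eventually_ne one_ne_zero
  obtain ⟨x, hx, hx'⟩ := (h1.and (Ioo_mem_nhdsGT (by norm_num : (0 : ℝ) < 1 / 2))).exists
  refine ⟨x, hx', ?_⟩
  rw [pfaffA, mul_assoc]
  exact mul_ne_zero (ofReal_cpow_ne_zero _ hx'.1) hx

/-- Pfaff's transformation. -/
theorem series_eq_pfaff (hc : 0 < c.re) (a b : ℂ) (hx : x ∈ Ioo (0 : ℝ) (1 / 2)) :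
    seriesA a b c x = pfaffA a b c x ∧ seriesB a b c x = pfaffB a b c x := by
  obtain ⟨x₀, hx₀, hne⟩ := exists_pfaffA_ne_zero hc a b
  obtain ⟨κ, hκ⟩ := SolvesOn.exists_eq_const_mul (by norm_num) (solvesHyperOn_series hc a b)
    (SolvesOn.mono (solvesHyperOn_pfaff hc a b) (by norm_num)) (regularAtZero_series hc a b)
    (regularAtZero_pfaff hc a b) hx₀ (Or.inl hne)
  -- Both pairs solve the same system and are regular, so they are proportional. After division by
  -- x^(c/2) both first components tend to 1 at 0, so the factor is 1.
  have h1 := (tendsto_pfaffA_factor hc a b).const_mul κ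
  have h2 := (tendsto_seriesA_factor hc a b).congr' (f₂ := fun x : ℝ =>
      κ * ((1 - (x : ℂ)) ^ ((a - b) / 2) * ordinaryHypergeometric a (c - b) c (x : ℂ))) (by
    filter_upwards [Ioo_mem_nhdsGT (by norm_num : (0 : ℝ) < 1 / 2)] with y hy
    have := (hκ y hy).1
    rw [seriesA, pfaffA] at this
    refine mul_left_cancel₀ (ofReal_cpow_ne_zero (c / 2) hy.1) ?_
    linear_combination this)
  have hκ1 := tendsto_nhds_unique h1 h2
  rw [mul_one] at hκ1
  have := hκ x hx
  rwa [hκ1, one_mul, one_mul] at this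

theorem norm_div_sub_one_lt_one_iff (hx : x ∈ Ioo (0 : ℝ) 1) :
    ‖(x : ℂ) / (x - 1)‖ < 1 ↔ x < 1 / 2 := by
  have : (x : ℂ) / (x - 1) = ((x / (x - 1) : ℝ) : ℂ) := by push_cast; rfl
  rw [this, Complex.norm_real, norm_div, Real.norm_of_nonneg hx.1.le, Real.norm_eq_abs,
    abs_of_neg (by linarith [hx.2]), div_lt_one (by linarith [hx.2])]
  constructor <;> intro h <;> linarith

theorem gauss2F1_of_half_le (a b c : ℂ) (hx : x ∈ Ioo (0 : ℝ) 1) (h : 1 / 2 ≤ x) :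
    gauss2F1 a b c ((x : ℂ) / (x - 1))
      = (1 - (x : ℂ)) ^ a * ordinaryHypergeometric a (c - b) c (x : ℂ) := by
  have h1 : 1 - (x : ℂ) ≠ 0 := by
    have : 1 - x ≠ 0 := by linarith [hx.2]
    exact_mod_cast this
  have h2 : (x : ℂ) - 1 ≠ 0 := fun h => h1 (by linear_combination -h)
  rw [gauss2F1, if_neg (by rw [norm_div_sub_one_lt_one_iff hx]; exact not_lt.2 h)]
  have e1 : (x : ℂ) / (x - 1) / ((x : ℂ) / (x - 1) - 1) = x := by
    have : (x : ℂ) / (x - 1) - 1 = 1 / (x - 1) := by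
      field_simp
      ring
    rw [this]
    field_simp
  have e2 : 1 - (x : ℂ) / (x - 1) = (1 - (x : ℂ))⁻¹ := by
    rw [← neg_sub (1 : ℂ) x]
    field_simp
    ring
  rw [e1, e2, Complex.inv_cpow, Complex.cpow_neg, inv_inv]
  have : (1 : ℂ) - x = ((1 - x : ℝ) : ℂ) := by push_cast; rfl
  rw [this, Complex.arg_ofReal_of_nonneg (by linarith [hx.2])]
  exact Real.pi_pos.ne

theorem ofReal_cpow_one_add (k : ℂ) (hx : 0 < x) : (x : ℂ) ^ (1 + k) = x * (x : ℂ) ^ k := by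
  have : (x : ℂ) ≠ 0 := by exact_mod_cast hx.ne'
  rw [Complex.cpow_add _ _ this, Complex.cpow_one]

/-- `gauss2F1` switches formula where ‖x/(x - 1)‖ = 1, at x = 1/2. Below this point the equality is
Pfaff's transformation, above it the definition; in this form the functions are visibly
differentiable across 1/2. -/
theorem hyper_eq_pfaff (hc : 0 < c.re) (a b : ℂ) (hx : x ∈ Ioo (0 : ℝ) 1) :
    hyperA a b c x = pfaffA a b c x ∧ hyperB a b c x = pfaffB a b c x := by
  have h1 : 1 - (x : ℂ) ≠ 0 := by
    have : 1 - x ≠ 0 := by linarith [hx.2]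
    exact_mod_cast this
  rcases lt_or_ge x (1 / 2) with h | h
  · have hs := (norm_div_sub_one_lt_one_iff hx).2 h
    obtain ⟨e1, e2⟩ := series_eq_pfaff hc a b ⟨hx.1, h⟩
    rw [← e1, ← e2, hyperA, hyperB, gauss2F1, gauss2F1, if_pos hs, if_pos hs, seriesA, seriesB,
      ofReal_cpow_one_add _ hx.1, sub_eq_add_neg (-1 : ℂ), ← neg_div, Complex.cpow_add _ _ h1,
      Complex.cpow_neg_one, add_comm 1 a, add_comm 1 b, add_comm 2 c]
    refine ⟨rfl, ?_⟩
    rw [← neg_sub (1 : ℂ) x]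
    field_simp
  · rw [hyperA, hyperB, gauss2F1_of_half_le _ _ _ hx h, gauss2F1_of_half_le _ _ _ hx h, pfaffA,
      pfaffB, ofReal_cpow_one_add _ hx.1]
    have e1 : (1 - (x : ℂ)) ^ ((a - b) / 2) = (1 - (x : ℂ)) ^ (-(a + b) / 2) * (1 - (x : ℂ)) ^ a := by
      rw [← Complex.cpow_add _ _ h1]
      congr 1
      ring
    have e2 : (1 - (x : ℂ)) ^ ((a - b) / 2)
        = (1 - (x : ℂ)) ^ (-1 - (a + b) / 2) * (1 - (x : ℂ)) ^ (1 + a) := by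
      rw [← Complex.cpow_add _ _ h1]
      congr 1
      ring
    refine ⟨?_, ?_⟩
    · rw [e1]
      ring
    · rw [e2, show 2 + c - (1 + b) = c - b + 1 by ring, add_comm 1 a, add_comm 2 c]
      ring

theorem solvesHyperOn_hyper (hc : 0 < c.re) (a b : ℂ) :
    SolvesHyperOn a b c 1 (hyperA a b c) (hyperB a b c) := fun x hx => by
  have h := solvesHyperOn_pfaff hc a b x hx
  rw [← (hyper_eq_pfaff hc a b hx).1, ← (hyper_eq_pfaff hc a b hx).2] at h
  refine ⟨h.1.congr_of_eventuallyEq ?_, h.2.congr_of_eventuallyEq ?_⟩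
  · filter_upwards [Ioo_mem_nhds hx.1 hx.2] with y hy using (hyper_eq_pfaff hc a b hy).1
  · filter_upwards [Ioo_mem_nhds hx.1 hx.2] with y hy using (hyper_eq_pfaff hc a b hy).2

theorem regularAtZero_hyper (hc : 0 < c.re) (a b : ℂ) :
    RegularAtZero (hyperA a b c) (hyperB a b c) := by
  have h := regularAtZero_pfaff hc a b
  refine ⟨h.1.congr' ?_, h.2.congr' ?_⟩
  · filter_upwards [Ioo_mem_nhdsGT one_pos] with y hy using (hyper_eq_pfaff hc a b hy).1.symm
  · filter_upwards [Ioo_mem_nhdsGT one_pos] with y hy using (hyper_eq_pfaff hc a b hy).2.symm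

theorem exists_hyperA_ne_zero (hc : 0 < c.re) (a b : ℂ) :
    ∃ x ∈ Ioo (0 : ℝ) 1, hyperA a b c x ≠ 0 := by
  obtain ⟨x, hx, h⟩ := exists_pfaffA_ne_zero hc a b
  have hx' : x ∈ Ioo (0 : ℝ) 1 := ⟨hx.1, hx.2.trans (by norm_num)⟩
  exact ⟨x, hx', by rwa [(hyper_eq_pfaff hc a b hx').1]⟩

theorem solvesLinearSystem_iff_solvesOn {a₀ b₀ c₀ a₁ b₁ c₁ : ℂ} {φ ψ : ℝ → ℂ} :
    SolvesLinearSystem (sl2Matrix a₀ b₀ c₀) (sl2Matrix a₁ b₁ c₁) φ ψ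
      ↔ SolvesOn a₀ b₀ c₀ a₁ b₁ c₁ 1 φ ψ :=
  solvesLinearSystem_iff

/-- A constant change of basis from the system of `hyperA` and `hyperB`, which makes the matrix 𝒜₁
diagonal. Uniqueness is the proportionality of regular solutions. -/
theorem regular_solution (hc : 0 < c.re) (hd : c - a - b ≠ 0)
    (A0 A1 : Matrix (Fin 2) (Fin 2) ℂ)
    (h0 : A0 = sl2Matrix (-c / 2 - a * b / (c - a - b)) (-((c - a) * (c - b) / (c - a - b)))
      (-(a * b / (c - a - b))))
    (h1 : A1 = sl2Matrix ((c - a - b) / 2) 0 0) :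
    SolvesLinearSystem A0 A1 (hyperPhi a b c) (hyperPsi a b c) ∧
    RegularAtZero (hyperPhi a b c) (hyperPsi a b c) ∧
    ∀ φ ψ : ℝ → ℂ, SolvesLinearSystem A0 A1 φ ψ → RegularAtZero φ ψ →
      ∃ κ : ℂ, ∀ x ∈ Ioo (0 : ℝ) 1, φ x = κ * hyperPhi a b c x ∧ ψ x = κ * hyperPsi a b c x := by
  have hc0 : c ≠ 0 := by simpa using add_natCast_ne_zero hc 0
  have hc1 : c + 1 ≠ 0 := by simpa using add_natCast_ne_zero hc 1
  have hc1' : 1 + c ≠ 0 := by rwa [add_comm]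
  subst h0 h1
  simp only [solvesLinearSystem_iff_solvesOn]
  have hsol : SolvesOn (-c / 2 - a * b / (c - a - b)) (-((c - a) * (c - b) / (c - a - b)))
      (-(a * b / (c - a - b))) ((c - a - b) / 2) 0 0 1 (hyperPhi a b c) (hyperPsi a b c) := by
    intro x hx
    obtain ⟨d1, d2⟩ := solvesHyperOn_hyper hc a b x hx
    have e0 : (x : ℂ) ≠ 0 := by exact_mod_cast hx.1.ne'
    have e1 : 1 - (x : ℂ) ≠ 0 := by
      have : 1 - x ≠ 0 := by linarith [hx.2]
      exact_mod_cast this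
    refine ⟨(d1.add (d2.const_mul _)).congr_deriv ?_, (d1.neg.sub (d2.const_mul _)).congr_deriv ?_⟩
    · simp only [hyperPhi, hyperPsi]
      rw [add_comm 1 c]
      field_simp
      ring
    · simp only [hyperPhi, hyperPsi]
      rw [add_comm 1 c]
      field_simp
      ring
  have hreg : RegularAtZero (hyperPhi a b c) (hyperPsi a b c) := by
    have h := regularAtZero_hyper hc a b
    have h1 := h.1.add (h.2.const_mul ((c - a) * (c - b) / (c * (1 + c))))
    have h2 := h.1.neg.sub (h.2.const_mul (a * b / (c * (1 + c))))
    simp only [mul_zero, add_zero, neg_zero, sub_zero] at h1 h2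
    exact ⟨h1, h2⟩
  refine ⟨hsol, hreg, fun φ ψ h hr => ?_⟩
  obtain ⟨x₀, hx₀, hne⟩ := exists_hyperA_ne_zero hc a b
  refine SolvesOn.exists_eq_const_mul le_rfl h hsol hr hreg hx₀ ?_
  -- The determinant of the change of basis is proportional to (c - a)(c - b) - ab = c(c - a - b);
  -- being nonzero, it would force `hyperA` to vanish at x₀.
  by_contra! hzero
  obtain ⟨z1, z2⟩ := hzero
  rw [hyperPhi] at z1
  rw [hyperPsi] at z2
  have : (c - a - b) * hyperA a b c x₀ = 0 := by
    field_simp at z1 z2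
    have hz : c * (c - a - b) * hyperA a b c x₀ = 0 := by
      have hm : (1 + c) * c * (c * (c - a - b) * hyperA a b c x₀) = 0 := by
        linear_combination -(a * b) * z1 - (c - a) * (c - b) * z2
      exact (mul_eq_zero.1 hm).resolve_left (mul_ne_zero hc1' hc0)
    rw [mul_assoc] at hz
    exact (mul_eq_zero.1 hz).resolve_left hc0
  exact (mul_ne_zero hd hne) this

theorem kernelA_eq (z z' w w' : ℂ) :
    kernelA z z' w w' = hyperA (z + w') (z' + w') (z + z' + w + w') := by
  ext x
  rw [kernelA, hyperA, show -(z + z' + 2 * w') / 2 = -(z + w' + (z' + w')) / 2 by ring]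

theorem kernelB_eq (z z' w w' : ℂ) :
    kernelB z z' w w' = hyperB (z + w') (z' + w') (z + z' + w + w') := by
  ext x
  rw [kernelB, hyperB, show (z + z' + w + w' + 2) / 2 = 1 + (z + z' + w + w') / 2 by ring,
    show -(z + z' + 2 * w' + 2) / 2 = -1 - (z + w' + (z' + w')) / 2 by ring,
    add_comm 1 (z + w'), add_comm 1 (z' + w'), add_comm 2 (z + z' + w + w')]

theorem exists_sq_eq_complex (l : ℂ) : ∃ κ : ℂ, κ ^ 2 = l :=
  IsAlgClosed.exists_pow_nat_eq l two_pos

/-- The prefactor is distributed over both functions by a square root; its minus sign comes from the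
denominator y - x in place of x - y. -/
theorem hyperKernel_eq_integrableKernel (z z' w w' : ℂ) {κ : ℂ}
    (hκ : κ ^ 2 = -kernelLambda z z' w w') : hyperKernel z z' w w'
      = integrableKernel (fun s => κ * hyperA (z + w') (z' + w') (z + z' + w + w') s)
        (fun s => κ * hyperB (z + w') (z' + w') (z + z' + w + w') s) := by
  ext x y
  rw [hyperKernel, integrableKernel, kernelA_eq, kernelB_eq]
  split_ifs with hxy
  · rw [deriv_const_mul_field, deriv_const_mul_field]
    linear_combination -(deriv (hyperA (z + w') (z' + w') (z + z' + w + w')) x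
      * hyperB (z + w') (z' + w') (z + z' + w + w') x
      - deriv (hyperB (z + w') (z' + w') (z + z' + w + w')) x
      * hyperA (z + w') (z' + w') (z + z' + w + w') x) * hκ
  · have h1 : (x : ℂ) - y ≠ 0 := by
      rw [sub_ne_zero]
      exact_mod_cast hxy
    have h2 : (y : ℂ) - x ≠ 0 := fun h => h1 (by linear_combination -h)
    rw [← neg_sub (x : ℂ) y]
    field_simp
    linear_combination -(hyperA (z + w') (z' + w') (z + z' + w + w') x
      * hyperB (z + w') (z' + w') (z + z' + w + w') y
      - hyperB (z + w') (z' + w') (z + z' + w + w') x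
      * hyperA (z + w') (z' + w') (z + z' + w + w') y) * hκ

/-- A change of basis multiplies the antisymmetric numerator by its determinant, here (w - w')/(1 +
c), which κ² has to compensate; this is where w ≠ w' enters. -/
theorem hyperKernel_eq_of_ne {z z' w w' : ℂ} (hc : 0 < (z + z' + w + w').re) (hw : w ≠ w') :
    ∃ κ : ℂ, ∀ x ∈ Ioo (0 : ℝ) 1, ∀ y ∈ Ioo (0 : ℝ) 1,
      hyperKernel z z' w w' x y = integrableKernel
        (fun s => κ * hyperPhi (z + w') (z' + w') (z + z' + w + w') s)
        (fun s => κ * hyperPsi (z + w') (z' + w') (z + z' + w + w') s) x y := by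
  obtain ⟨μ, hμ⟩ := exists_sq_eq_complex (-kernelLambda z z' w w')
  obtain ⟨κ, hκ⟩ := exists_sq_eq_complex
    (-kernelLambda z z' w w' * (1 + (z + z' + w + w')) / (w - w'))
  rw [hyperKernel_eq_integrableKernel z z' w w' hμ]
  set a := z + w' with ha
  set b := z' + w' with hb
  set c := z + z' + w + w' with hcdef
  have hd : c - a - b = w - w' := by
    rw [ha, hb, hcdef]
    ring
  have hc0 : c ≠ 0 := by simpa using add_natCast_ne_zero hc 0
  have hc1 : 1 + c ≠ 0 := by simpa [add_comm] using add_natCast_ne_zero hc 1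
  have hw' : w - w' ≠ 0 := sub_ne_zero.2 hw
  have hdet : κ ^ 2 * ((c - a) * (c - b) / (c * (1 + c)) - a * b / (c * (1 + c))) = μ ^ 2 := by
    have : (c - a) * (c - b) / (c * (1 + c)) - a * b / (c * (1 + c)) = (w - w') / (1 + c) := by
      rw [← hd]
      field_simp
      ring
    rw [this, hκ, hμ]
    field_simp
  refine ⟨κ, fun x hx y hy => ?_⟩
  rw [integrableKernel, integrableKernel]
  split_ifs with hxy
  · obtain ⟨d1, d2⟩ := solvesHyperOn_hyper hc a b x hx
    have d3 := (d1.differentiableAt.hasDerivAt).add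
      ((d2.differentiableAt.hasDerivAt).const_mul ((c - a) * (c - b) / (c * (1 + c))))
    have d4 := (d1.differentiableAt.hasDerivAt).neg.sub
      ((d2.differentiableAt.hasDerivAt).const_mul (a * b / (c * (1 + c))))
    have e3 : deriv (hyperPhi a b c) x = _ := d3.deriv
    have e4 : deriv (hyperPsi a b c) x = _ := d4.deriv
    simp only [deriv_const_mul_field]
    rw [e3, e4, hyperPhi, hyperPsi]
    linear_combination -(deriv (hyperA a b c) x * hyperB a b c x
      - deriv (hyperB a b c) x * hyperA a b c x) * hdet
  · congr 1
    simp only [hyperPhi, hyperPsi]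
    linear_combination -(hyperA a b c x * hyperB a b c y - hyperB a b c x * hyperA a b c y) * hdet

/-- The general theorem is applied to the pair `hyperA`, `hyperB` rather than to `hyperPhi`,
`hyperPsi`. Its system has no denominator w - w', so w = w' needs no limit. -/
theorem determinant_hyperKernel {z z' w w' : ℂ} (hc : 0 < (z + z' + w + w').re) :
    FredholmWellDefined (hyperKernel z z' w w') ∧
      IsPVITauDet ⟨z + z' + w + w', z - z', 0, w - w'⟩ (hyperKernel z z' w w') := by
  obtain ⟨κ, hκ⟩ := exists_sq_eq_complex (-kernelLambda z z' w w')
  rw [hyperKernel_eq_integrableKernel z z' w w' hκ]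
  have hc0 : z + z' + w + w' ≠ 0 := by simpa using add_natCast_ne_zero hc 0
  have hc1 : z + z' + w + w' + 1 ≠ 0 := by simpa using add_natCast_ne_zero hc 1
  have hsol := solvesLinearSystem_iff_solvesOn.2
    ((solvesHyperOn_hyper hc (z + w') (z' + w')).const_mul κ)
  have hreg : RegularAtZero (fun s => κ * hyperA (z + w') (z' + w') (z + z' + w + w') s)
      (fun s => κ * hyperB (z + w') (z' + w') (z + z' + w + w') s) := by
    have h := regularAtZero_hyper hc (z + w') (z' + w')
    have h1 := h.1.const_mul κ
    have h2 := h.2.const_mul κ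
    rw [mul_zero] at h1 h2
    exact ⟨h1, h2⟩
  refine ⟨fredholmWellDefined_of_regular hsol hreg, isPVITauDet_of_regular hsol hreg ?_ ?_ ?_⟩
  · field_simp
    ring
  · ring
  · field_simp
    ring

end Hyper

end

theorem mainTheorem3 :
    -- Diagonal case: first integrals, and the equation for `ζ`, for all solutions of the system
    (∀ (α₀ β₀ γ₀ α₁ : ℂ) (q p u v w : ℝ → ℂ) (S : Set ℝ),
      IsOpen S → IsPreconnected S → (0 : ℝ) ∉ S → (1 : ℝ) ∉ S →
      IsDiagTWSolution α₀ β₀ γ₀ α₁ q p u v w S →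
      ∃ I₁ I₂ : ℂ,
        (∀ t ∈ S, diagI1 α₀ β₀ γ₀ α₁ q p u v w t = I₁) ∧
        (∀ t ∈ S, diagI2 α₀ β₀ γ₀ α₁ q p u v w t = I₂) ∧
        (∀ t ∈ S, twZeta q p t = 2 * diagAlpha α₀ α₁ v t * p t * q t
          + diagBeta β₀ α₁ u t * p t ^ 2 + diagGamma γ₀ α₁ w t * q t ^ 2) ∧
        (∀ t ∈ S, twZeta q p t = 2 * α₁ * v t + I₁) ∧
        (∀ t ∈ S, deriv (twZeta q p) t = 2 * α₁ * p t * q t) ∧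
        (∀ t ∈ S, (t : ℂ) * (1 - t) * deriv (deriv (twZeta q p)) t
          = 2 * α₁ * (diagBeta β₀ α₁ u t * p t ^ 2 - diagGamma γ₀ α₁ w t * q t ^ 2)) ∧
        SolvesZetaODE α₀ α₁ I₁ I₂ S (twZeta q p) ∧
        ∀ k₁ k₂ : ℂ, KParam α₀ α₁ I₁ I₂ k₁ k₂ →
          SolvesSigmaPVI (kTheta α₁ k₁ k₂) S (kSigma α₁ k₁ k₂ (twZeta q p))) ∧
    -- The equation for `ζ` is the sigma form of Painlevé VI
    (∀ (α₀ α₁ I₁ I₂ k₁ k₂ : ℂ) (ζ : ℝ → ℂ) (S : Set ℝ), IsOpen S → ContDiffOn ℝ 2 ζ S →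
      KParam α₀ α₁ I₁ I₂ k₁ k₂ → ∀ t ∈ S,
        (ZetaODEAt α₀ α₁ I₁ I₂ ζ t → SigmaPVIAt (kTheta α₁ k₁ k₂) (kSigma α₁ k₁ k₂ ζ) t) ∧
        (deriv (kSigma α₁ k₁ k₂ ζ) t ≠ 0 →
          SigmaPVIAt (kTheta α₁ k₁ k₂) (kSigma α₁ k₁ k₂ ζ) t → ZetaODEAt α₀ α₁ I₁ I₂ ζ t)) ∧
    -- Diagonal case: the Fredholm determinant
    (∀ (α₀ β₀ γ₀ α₁ : ℂ) (φ ψ : ℝ → ℂ),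
      SolvesLinearSystem (sl2Matrix α₀ β₀ γ₀) (sl2Matrix α₁ 0 0) φ ψ → RegularAtZero φ ψ →
      TWWellDefined φ ψ ∧
      IsDiagTWSolution α₀ β₀ γ₀ α₁ (twQ φ ψ) (twP φ ψ) (twU φ ψ) (twV φ ψ) (twW φ ψ)
        (twSet φ ψ) ∧
      (∀ t ∈ twSet φ ψ, diagI1 α₀ β₀ γ₀ α₁
        (twQ φ ψ) (twP φ ψ) (twU φ ψ) (twV φ ψ) (twW φ ψ) t = 0) ∧
      (∀ t ∈ twSet φ ψ, diagI2 α₀ β₀ γ₀ α₁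
        (twQ φ ψ) (twP φ ψ) (twU φ ψ) (twV φ ψ) (twW φ ψ) t = α₀ ^ 2 - β₀ * γ₀) ∧
      SolvesZetaODE α₀ α₁ 0 (α₀ ^ 2 - β₀ * γ₀) (twSet φ ψ)
        (zetaOf (fredholmDet (integrableKernel φ ψ))) ∧
      ∀ k₁ k₂ : ℂ, KParam α₀ α₁ 0 (α₀ ^ 2 - β₀ * γ₀) k₁ k₂ →
        SolvesSigmaPVI (kTheta α₁ k₁ k₂) (twSet φ ψ)
          (kSigma α₁ k₁ k₂ (zetaOf (fredholmDet (integrableKernel φ ψ)))) ∧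
        IsPVITauDet (kTheta α₁ k₁ k₂) (integrableKernel φ ψ)) ∧
    -- Nilpotent case: first integrals, and the equation for `ζ`, for all solutions of the system
    (∀ (α₀ β₀ γ₀ : ℂ) (q p u v w : ℝ → ℂ) (S : Set ℝ),
      IsOpen S → IsPreconnected S → (0 : ℝ) ∉ S → (1 : ℝ) ∉ S →
      IsNilTWSolution α₀ β₀ γ₀ q p u v w S →
      ∃ I₁ I₂ : ℂ,
        (∀ t ∈ S, nilI1 α₀ β₀ γ₀ q p u v w t = I₁) ∧
        (∀ t ∈ S, nilI2 α₀ β₀ γ₀ q p u v w t = I₂) ∧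
        SolvesZetaODE α₀ 0 I₁ I₂ S (twZeta q p) ∧
        ∀ k₁ k₂ : ℂ, KParam α₀ 0 I₁ I₂ k₁ k₂ →
          SolvesSigmaPVI (kTheta 0 k₁ k₂) S (kSigma 0 k₁ k₂ (twZeta q p))) ∧
    -- Nilpotent case: the Fredholm determinant
    (∀ (α₀ β₀ γ₀ : ℂ) (φ ψ : ℝ → ℂ),
      SolvesLinearSystem (sl2Matrix α₀ β₀ γ₀) !![0, 1; 0, 0] φ ψ → RegularAtZero φ ψ →
      TWWellDefined φ ψ ∧
      IsNilTWSolution α₀ β₀ γ₀ (twQ φ ψ) (twP φ ψ) (twU φ ψ) (twV φ ψ) (twW φ ψ)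
        (twSet φ ψ) ∧
      (∀ t ∈ twSet φ ψ, nilI1 α₀ β₀ γ₀
        (twQ φ ψ) (twP φ ψ) (twU φ ψ) (twV φ ψ) (twW φ ψ) t = γ₀) ∧
      (∀ t ∈ twSet φ ψ, nilI2 α₀ β₀ γ₀
        (twQ φ ψ) (twP φ ψ) (twU φ ψ) (twV φ ψ) (twW φ ψ) t = α₀ ^ 2 - β₀ * γ₀ - γ₀)) ∧
    -- All linear systems: the Fredholm determinant is a Painlevé VI tau function
    (∀ (A0 A1 : Matrix (Fin 2) (Fin 2) ℂ) (φ ψ : ℝ → ℂ) (θ₀ θ₁ θinf : ℂ),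
      A0.trace = 0 → A1.trace = 0 →
      SolvesLinearSystem A0 A1 φ ψ → RegularAtZero φ ψ →
      HasEigenvaluesPM A0 θ₀ → HasEigenvaluesPM (A0 + A1) θ₁ → HasEigenvaluesPM A1 θinf →
      FredholmWellDefined (integrableKernel φ ψ) ∧
      IsPVITauDet ⟨θ₀, θ₁, 0, θinf⟩ (integrableKernel φ ψ)) ∧
    -- The regular solution in terms of hypergeometric functions
    (∀ a b c : ℂ, 0 < c.re → c - a - b ≠ 0 →
      ∀ A0 A1 : Matrix (Fin 2) (Fin 2) ℂ,
      A0 = sl2Matrix (-c / 2 - a * b / (c - a - b)) (-((c - a) * (c - b) / (c - a - b)))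
        (-(a * b / (c - a - b))) →
      A1 = sl2Matrix ((c - a - b) / 2) 0 0 →
      SolvesLinearSystem A0 A1 (hyperPhi a b c) (hyperPsi a b c) ∧
      RegularAtZero (hyperPhi a b c) (hyperPsi a b c) ∧
      ∀ φ ψ : ℝ → ℂ, SolvesLinearSystem A0 A1 φ ψ → RegularAtZero φ ψ →
        ∃ κ : ℂ, ∀ x ∈ Ioo (0 : ℝ) 1,
          φ x = κ * hyperPhi a b c x ∧ ψ x = κ * hyperPsi a b c x) ∧
    -- The hypergeometric kernel
    (∀ z z' w w' : ℂ, HyperAdmissible z z' w w' →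
      (w ≠ w' → ∃ κ : ℂ, ∀ x ∈ Ioo (0 : ℝ) 1, ∀ y ∈ Ioo (0 : ℝ) 1,
        hyperKernel z z' w w' x y = integrableKernel
          (fun s => κ * hyperPhi (z + w') (z' + w') (z + z' + w + w') s)
          (fun s => κ * hyperPsi (z + w') (z' + w') (z + z' + w + w') s) x y) ∧
      FredholmWellDefined (hyperKernel z z' w w') ∧
      IsPVITauDet ⟨z + z' + w + w', z - z', 0, w - w'⟩ (hyperKernel z z' w w')) := by
  refine ⟨fun α₀ β₀ γ₀ α₁ q p u v w S hS hc h0 h1 h => diagonal_system hS hc h0 h1 h,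
    fun α₀ α₁ I₁ I₂ k₁ k₂ ζ S hS hζ hk t ht =>
      ⟨fun h => (sigmaPVIAt_kSigma_iff hS hζ hk ht).2 (Or.inr h),
        fun hne h => ((sigmaPVIAt_kSigma_iff hS hζ hk ht).1 h).resolve_left hne⟩,
    determinant_diagonal,
    fun α₀ β₀ γ₀ q p u v w S hS hc h0 h1 h => nilpotent_system hS hc h0 h1 h,
    determinant_nilpotent, determinant_general,
    fun a b c hc hd A0 A1 h0 h1 => regular_solution hc hd A0 A1 h0 h1,
    fun z z' w w' h =>
      ⟨fun hw => hyperKernel_eq_of_ne h.re_pos hw, determinant_hyperKernel h.re_pos⟩⟩
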